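/- **Setting.** Let $A$ be a simplicial scheme over a set $I$ (a set of finite nonempty subsets of $I$ containing all nonempty subsets of its members) and let $W_*=(W_\alpha)_{\alpha\in A}$ be a simplicial system of Stein compact sets; more generally, each $W_\alpha$ may be any space with structure sheaf $\mathcal O_{W_\alpha}$ that is locally a subset of a complex space with the topologically restricted structure sheaf, with transition morphisms $W_\beta\to W_\alpha$ for $\alpha\subseteq\beta$. Let $R=R_*$ be a sheaf of graded commutative DG algebras on $W_*$, concentrated in degrees $\le 0$, with $R^0=\mathcal O_{W_*}$ (differentials have degree $+1$). A graded free module is one of the form $\bigoplus_\alpha p_\alpha^*(\mathcal F_\alpha)$ with $\mathcal F_\alpha$ a free graded module on $W_\alpha$, of finite rank in each degree (a generator on $W_\alpha$ is also a generator on $W_\beta$ for all $\beta\supseteq\alpha$). Let $S$ be a DG $R$-algebra with augmentation $\mu:S\to R$ (a morphism of DG $R$-algebras) that is free analytic: as a graded $R$-algebra, $S\cong\tilde{\mathbb S}_R(\mathcal F)$ with $\mathcal F$ graded free with generators $f$ in degrees $\le 0$. That is, $S$ is the graded symmetric algebra, on the generators of negative degree, over $R\{t\}=R\otimes_{R^0}R^0\{t\}$,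 where $t=(t_1,\dots,t_n)$ are the generators of degree $0$ on the simplex in question and $R^0\{t\}$ is the sheaf of convergent power series, i.e. the restriction to the zero section of the structure sheaf of $W\times\mathbb C^n$. Let $d:S\to\Omega^1_{S/R}$ be the universal $R$-linear derivation into the module of analytic differentials, a graded free $S$-module on the $df$, and let $\Omega:=\mathbb S_S(\Omega^1_{S/R}[1])$, a DG $S$-algebra. For a DG $S$-algebra resolution $\nu:B\to R$ over $\mu$ (a quasi-isomorphism of DG $S$-algebras) such that $B=\mathbb S_S(E)$ as a graded algebra with $E$ a graded free $S$-module with generators in degrees $<0$, and for an $R$-linear connection $\nabla:E\to E\otimes_S\Omega^1_{S/R}$, let $\nabla_B:B\to B\otimes_S\Omega^1_{S/R}$ be the derivation extending $\nabla$ and $d$, let $\mathrm{At}_B=[\partial,\nabla_B]:B\to B\otimes_S\Omega^1_{S/R}[1]$ be the Atiyah class and $\widetilde{\mathrm{At}}$ its $\Omega$-linear extension to a derivation of $B\otimes_S\Omega$. If $\widetilde{\mathrm{At}}$ is locally nilpotent and $\mathrm{AC}_B:=\exp(-\widetilde{\mathrm{At}})|_B:B\to B\otimes_S\Omega$ is a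 morphism of DG algebras, let $$\Phi_B:B\otimes_S R\longrightarrow R\otimes_S\Omega$$ be the morphism of DG $R$-algebras induced by $(\nu\otimes\mathrm{id})\circ\mathrm{AC}_B$. **Theorem 2.2.** In this situation the DG $S$-algebra $\Omega$ with its universal derivation exists, and there exist a graded free DG $S$-algebra resolution $\nu:B\to R$ as above, $B=\mathbb S_S(E)$ with $E$ generated in degrees $<0$, and an $R$-linear connection on $E$, such that $\widetilde{\mathrm{At}}$ is locally nilpotent, $\mathrm{AC}_B$ is a morphism of DG algebras, and $$\Phi_B:B\otimes_S R\longrightarrow R\otimes_S\mathbb S_S(\Omega^1_{S/R}[1])$$ is an isomorphism of DG $R$-algebras. -/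

import Mathlib

open CategoryTheory Opposite TopologicalSpace
open scoped TensorProduct

universe u

noncomputable section

/-! ## Differential graded commutative algebras over `ℂ` -/

/-- A graded commutative differential graded `ℂ`-algebra, with differential of degree `+1`. -/
structure CDGA where
  carrier : Type u
  [ring : Ring carrier]
  [algebra : Algebra ℂ carrier]
  deg : ℤ → Submodule ℂ carrier
  one_mem : (1 : carrier) ∈ deg 0
  mul_mem : ∀ {i j : ℤ} {a b : carrier}, a ∈ deg i → b ∈ deg j → a * b ∈ deg (i + j)
  isInternal : DirectSum.IsInternal deg
  comm : ∀ {i j : ℤ} {a b : carrier}, a ∈ deg i → b ∈ deg j →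
    a * b = (i * j).negOnePow • (b * a)
  d : carrier →ₗ[ℂ] carrier
  d_mem : ∀ {i : ℤ} {a : carrier}, a ∈ deg i → d a ∈ deg (i + 1)
  d_d : ∀ a : carrier, d (d a) = 0
  leibniz : ∀ {i : ℤ} {a : carrier}, a ∈ deg i → ∀ b : carrier,
    d (a * b) = d a * b + i.negOnePow • (a * d b)

namespace CDGA

instance : CoeSort CDGA.{u} (Type u) := ⟨CDGA.carrier⟩

attribute [instance] CDGA.ring CDGA.algebra

/-- The subalgebra of elements of degree `0`; it is commutative. -/
def zero (A : CDGA.{u}) : Subalgebra ℂ A where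
  carrier := A.deg 0
  mul_mem' ha hb := by simpa using A.mul_mem ha hb
  one_mem' := A.one_mem
  add_mem' ha hb := (A.deg 0).add_mem ha hb
  zero_mem' := (A.deg 0).zero_mem
  algebraMap_mem' r := by
    rw [Algebra.algebraMap_eq_smul_one]
    exact (A.deg 0).smul_mem r A.one_mem

instance (A : CDGA.{u}) : CommRing A.zero :=
  { (inferInstance : Ring A.zero) with
    mul_comm := fun a b => Subtype.ext (by simpa using A.comm a.2 b.2) }

/-- A homomorphism of graded algebras, not necessarily compatible with the differentials. -/
structure GrHom (A B : CDGA.{u}) extends A →ₐ[ℂ] B where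
  map_deg : ∀ {i : ℤ} {a : A}, a ∈ A.deg i → toAlgHom a ∈ B.deg i

/-- A homomorphism of differential graded algebras. -/
structure Hom (A B : CDGA.{u}) extends GrHom A B where
  map_d : ∀ a : A, toAlgHom (A.d a) = B.d (toAlgHom a)

theorem Hom.ext' {A B : CDGA.{u}} {f g : Hom A B} (h : f.toAlgHom = g.toAlgHom) : f = g := by
  obtain ⟨⟨f, _⟩, _⟩ := f
  obtain ⟨⟨g, _⟩, _⟩ := g
  cases h
  rfl

instance : Category CDGA.{u} where
  Hom A B := Hom A B
  id A := ⟨⟨AlgHom.id ℂ A, fun h => h⟩, fun _ => rfl⟩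
  comp f g := ⟨⟨g.toAlgHom.comp f.toAlgHom, fun h => g.map_deg (f.map_deg h)⟩,
    fun a => by
      change g.toAlgHom (f.toAlgHom _) = _
      rw [f.map_d, g.map_d]
      rfl⟩

/-- The underlying graded homomorphism of a morphism. -/
def gr {A B : CDGA.{u}} (f : A ⟶ B) : GrHom A B := Hom.toGrHom f

/-- The underlying algebra homomorphism of a morphism. -/
def fn {A B : CDGA.{u}} (f : A ⟶ B) : A →ₐ[ℂ] B := (gr f).toAlgHom

/-- The homomorphism induced in degree `0`. -/
def fn0 {A B : CDGA.{u}} (f : A ⟶ B) : A.zero →ₐ[ℂ] B.zero :=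
  ((fn f).comp A.zero.val).codRestrict B.zero fun a => (gr f).map_deg a.2

/-- `∑ₗ rₗ ⊗ bₗ = 0` in `A ⊗ B⁰`, the tensor product being over `A⁰`, which acts on `B⁰`
through `f`. -/
def TensorVanishes {A B : CDGA.{u}} (f : A ⟶ B) {n : ℕ} (r : Fin n → A) (b : Fin n → B.zero) :
    Prop :=
  letI : Module A.zero B.zero := Module.compHom B.zero (fn0 f).toRingHom
  ∑ l, (r l ⊗ₜ[A.zero] b l) = (0 : A ⊗[A.zero] B.zero)

end CDGA

/-! ## Simplicial systems of spaces and sheaves on them -/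

/-- A simplicial scheme `faces` over a set `I` (finite nonempty subsets of `I`, closed under
passing to nonempty subsets), with a topological space `W α` for every simplex `α` and continuous
maps `W β → W α` for `α ⊆ β`, functorially. -/
structure SimplicialSystem where
  I : Type u
  faces : Set (Finset I)
  nonempty : ∀ α ∈ faces, α.Nonempty
  down_closed : ∀ α ∈ faces, ∀ β ⊆ α, β.Nonempty → β ∈ faces
  space : (↥faces)ᵒᵖ ⥤ TopCat.{u}

namespace SimplicialSystem

variable (W : SimplicialSystem.{u})

/-- The space attached to a simplex. -/
abbrev pt (α : W.faces) : TopCat.{u} := W.space.obj (op α)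

variable {W} in
/-- The transition map `W β → W α` for `α ⊆ β`. -/
def trans {α β : W.faces} (h : α ≤ β) (x : W.pt β) : W.pt α := W.space.map (homOfLE h).op x

end SimplicialSystem

/-- A simplex `α` together with an open subset of `W α`. -/
structure Cell (W : SimplicialSystem.{u}) where
  face : W.faces
  U : Opens (W.pt face)

namespace Cell

variable {W : SimplicialSystem.{u}}

/-- `(β, V) ≤ (α, U)` if `α ⊆ β` and the transition map `W β → W α` sends `V` into `U`. -/
instance : Preorder (Cell W) where
  le c' c := ∃ h : c.face ≤ c'.face, ∀ x ∈ c'.U, SimplicialSystem.trans h x ∈ c.U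
  le_refl c := ⟨le_rfl, fun x hx => by
    have : SimplicialSystem.trans (le_refl c.face) x = x := by
      change W.space.map (𝟙 _) x = x
      simp
    rwa [this]⟩
  le_trans a b c := fun ⟨h, H⟩ ⟨h', H'⟩ => ⟨h'.trans h, fun x hx => by
    have : SimplicialSystem.trans (h'.trans h) x =
        SimplicialSystem.trans h' (SimplicialSystem.trans h x) := by
      change W.space.map ((homOfLE h).op ≫ (homOfLE h').op) x = _
      simp [SimplicialSystem.trans]
    rw [this]
    exact H' _ (H x hx)⟩

/-- The cell given by all of `W α`. -/
def whole (α : W.faces) : Cell W := ⟨α, ⊤⟩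

theorem le_whole {c : Cell W} {α : W.faces} (h : α ≤ c.face) : c ≤ whole α :=
  ⟨h, fun _ _ => trivial⟩

/-- The point of `c` below a point of a smaller cell. -/
def point {c' c : Cell W} (h : c' ≤ c) (x : c'.U) : c.U :=
  ⟨SimplicialSystem.trans h.fst x.1, h.snd x.1 x.2⟩

theorem le_of_le {α : W.faces} {V U : Opens (W.pt α)} (h : V ≤ U) :
    (⟨α, V⟩ : Cell W) ≤ ⟨α, U⟩ :=
  ⟨le_rfl, fun x hx => by
    have : SimplicialSystem.trans (le_refl α) x = x := by
      change W.space.map (𝟙 _) x = x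
      simp
    rw [this]
    exact h hx⟩

/-- The property `P` holds on some neighbourhood of every point of `c` (on the same simplex). -/
def Locally (c : Cell W) (P : ∀ c' : Cell W, c' ≤ c → Prop) : Prop :=
  ∀ x ∈ c.U, ∃ (V : Opens (W.pt c.face)) (h : V ≤ c.U), x ∈ V ∧ P ⟨c.face, V⟩ (le_of_le h)

end Cell

/-- A presheaf of differential graded algebras on the simplicial system: algebras `F (α, U)` for
all simplices `α` and all open `U ⊆ W α`, with restriction maps `F (α, U) → F (β, V)` for
`(β, V) ≤ (α, U)`. These comprise the restrictions of a presheaf on each `W α` and the transition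
maps between the presheaves on different simplices. -/
abbrev DGPresheaf (W : SimplicialSystem.{u}) := (Cell W)ᵒᵖ ⥤ CDGA.{u}

namespace DGPresheaf

variable {W : SimplicialSystem.{u}}

/-- Sections over a cell. -/
abbrev sec (F : DGPresheaf W) (c : Cell W) : CDGA.{u} := F.obj (op c)

/-- Restriction of sections. -/
def res (F : DGPresheaf W) {c' c : Cell W} (h : c' ≤ c) : F.sec c →ₐ[ℂ] F.sec c' :=
  CDGA.fn (F.map (homOfLE h).op)

/-- Restriction of sections of degree `0`. -/
def res0 (F : DGPresheaf W) {c' c : Cell W} (h : c' ≤ c) :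
    (F.sec c).zero →ₐ[ℂ] (F.sec c').zero :=
  CDGA.fn0 (F.map (homOfLE h).op)

/-- A morphism of presheaves on sections. -/
def ap {F G : DGPresheaf W} (f : F ⟶ G) (c : Cell W) : F.sec c →ₐ[ℂ] G.sec c :=
  CDGA.fn (f.app (op c))

/-- A morphism of presheaves on sections of degree `0`. -/
def ap0 {F G : DGPresheaf W} (f : F ⟶ G) (c : Cell W) :
    (F.sec c).zero →ₐ[ℂ] (G.sec c).zero :=
  CDGA.fn0 (f.app (op c))

/-- On every `W α` each homogeneous component is a sheaf. -/
def IsSheaf (F : DGPresheaf W) : Prop :=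
  ∀ (α : W.faces) (ι : Type u) (U : ι → Opens (W.pt α)) (n : ℤ)
    (s : ∀ i, F.sec ⟨α, U i⟩), (∀ i, s i ∈ (F.sec ⟨α, U i⟩).deg n) →
    (∀ i k, F.res (Cell.le_of_le (inf_le_left : U i ⊓ U k ≤ U i)) (s i) =
      F.res (Cell.le_of_le (inf_le_right : U i ⊓ U k ≤ U k)) (s k)) →
    ∃! t : F.sec ⟨α, iSup U⟩, t ∈ (F.sec ⟨α, iSup U⟩).deg n ∧
      ∀ i, F.res (Cell.le_of_le (le_iSup U i)) t = s i

/-- `F` is concentrated in degrees `≤ 0`. -/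
def IsNonpos (F : DGPresheaf W) : Prop :=
  ∀ (c : Cell W) (n : ℤ), 0 < n → (F.sec c).deg n = ⊥

/-- `f` induces isomorphisms on the stalks of the cohomology sheaves. -/
def IsQuasiIso {F G : DGPresheaf W} (f : F ⟶ G) : Prop :=
  (∀ (c : Cell W) (b : F.sec c), (F.sec c).d b = 0 → (∃ r : G.sec c, ap f c b = (G.sec c).d r) →
    c.Locally fun c' h => ∃ b' : F.sec c', F.res h b = (F.sec c').d b') ∧
  (∀ (c : Cell W) (r : G.sec c), (G.sec c).d r = 0 →
    c.Locally fun c' h => ∃ (b : F.sec c') (r' : G.sec c'),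
      (F.sec c').d b = 0 ∧ G.res h r = ap f c' b + (G.sec c').d r')

/-- A derivation `D : F → G` of degree `n` along the algebra homomorphism `f : F ⟶ G`,
with the Koszul sign rule; it need not be compatible with the differentials. -/
structure Der {F G : DGPresheaf W} (f : F ⟶ G) (n : ℤ) where
  app : ∀ c : Cell W, F.sec c →ₗ[ℂ] G.sec c
  app_deg : ∀ (c : Cell W) {i : ℤ} {a : F.sec c}, a ∈ (F.sec c).deg i →
    app c a ∈ (G.sec c).deg (i + n)
  leibniz : ∀ (c : Cell W) {i : ℤ} {a : F.sec c}, a ∈ (F.sec c).deg i → ∀ b : F.sec c,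
    app c (a * b) = app c a * ap f c b + (n * i).negOnePow • (ap f c a * app c b)
  natural : ∀ {c' c : Cell W} (h : c' ≤ c) (a : F.sec c), G.res h (app c a) = app c' (F.res h a)

end DGPresheaf

/-! ## Graded free modules and their symmetric algebras -/

/-- Generators of a graded free module `⨁ p_α^*(free module)` on the simplicial system: a generator
`j` lives on the simplex `face j` (and hence on all larger simplices) and has degree `deg j`.
On each simplex there are only finitely many generators of each degree. -/
structure Gens (W : SimplicialSystem.{u}) where
  idx : Type u
  face : idx → W.faces
  deg : idx → ℤ
  finite : ∀ (α : W.faces) (n : ℤ), {j : idx | face j = α ∧ deg j = n}.Finite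

namespace Gens

variable {W : SimplicialSystem.{u}}

/-- The generators present on a cell. -/
def At (G : Gens W) (c : Cell W) : Type u := {j : G.idx // G.face j ≤ c.face}

/-- Only the generators whose degree satisfies `p`. -/
def filter (G : Gens W) (p : ℤ → Prop) : Gens W where
  idx := {j : G.idx // p (G.deg j)}
  face j := G.face j.1
  deg j := G.deg j.1
  finite α n := (G.finite α n).preimage Subtype.val_injective.injOn

/-- The generators of the module shifted by `1`: all degrees drop by `1`. -/
def shift (G : Gens W) : Gens W where
  idx := G.idx
  face := G.face
  deg j := G.deg j - 1
  finite α n := (G.finite α (n + 1)).subset fun _ h => ⟨h.1, by have := h.2; omega⟩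

/-- Sections of `F` on the simplices of the generators. -/
abbrev Sections (G : Gens W) (F : DGPresheaf W) := ∀ j : G.idx, F.sec (Cell.whole (G.face j))

/-- Restriction of such sections to a cell. -/
def resTo (G : Gens W) {F : DGPresheaf W} (e : G.Sections F) (c : Cell W) (j : G.At c) :
    F.sec c :=
  F.res (Cell.le_whole j.2) (e j.1)

instance finite_at_zero (G : Gens W) (c : Cell W) : Finite ((G.filter (· = 0)).At c) := by
  have h1 : {α : W.faces | α ≤ c.face}.Finite :=
    (c.face.1.powerset.finite_toSet.preimage Subtype.val_injective.injOn).subset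
      fun α h => by simpa using h
  have h2 : {j : (G.filter (· = 0)).idx | (G.filter (· = 0)).face j ≤ c.face}.Finite := by
    refine (h1.biUnion fun α _ => (G.filter (· = 0)).finite α 0).subset fun j h => ?_
    simp only [Set.mem_iUnion]
    exact ⟨(G.filter (· = 0)).face j, h, rfl, j.2⟩
  exact h2.to_subtype

/-- `φ : A ⟶ B` realizes `B` as the symmetric algebra `𝕊_A(E)` of the graded free `A`-module `E`
with basis `e`: over every cell, `B` has the universal property of the free graded commutative
`A`-algebra on the elements `e` (differentials are disregarded). As `E` has finite rank in every
degree, no sheafification is involved when `A` is concentrated in degrees `≤ 0` and the generators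
have negative degrees. -/
def IsFree (G : Gens W) {A B : DGPresheaf W} (φ : A ⟶ B) (e : G.Sections B) : Prop :=
  (∀ j, e j ∈ (B.sec (Cell.whole (G.face j))).deg (G.deg j)) ∧
  ∀ (c : Cell W) (Z : CDGA.{u}) (v : CDGA.GrHom (A.sec c) Z) (z : G.At c → Z),
    (∀ j, z j ∈ Z.deg (G.deg j.1)) →
    ∃! w : CDGA.GrHom (B.sec c) Z,
      w.toAlgHom.comp (DGPresheaf.ap φ c) = v.toAlgHom ∧
      ∀ j, w.toAlgHom (G.resTo e c j) = z j

end Gens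

/-! ## Complex analytic structures -/

/-- The holomorphic functional calculus on the degree `0` part of `F`. Sections `s` of `F⁰` have
values `s(x) ∈ ℂ` at points, and sections `a₁, …, aₙ` can be substituted into a function `g` that
is holomorphic on an open neighbourhood of the set of values of `(a₁, …, aₙ)`; outside this range
`hol` is a meaningless total extension. On a complex space this is the composition of `g` with the
holomorphic map `(a₁, …, aₙ)` to `ℂⁿ`. Restriction maps, including the transition maps between
different simplices, are compatible with it, as are comorphisms of complex spaces. -/
structure HolStructure {W : SimplicialSystem.{u}} (F : DGPresheaf W) where
  val : ∀ c : Cell W, c.U → (F.sec c).zero →ₐ[ℂ] ℂ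
  hol : ∀ (c : Cell W) {ι : Type u} [Finite ι], ((ι → ℂ) → ℂ) → (ι → (F.sec c).zero) →
    (F.sec c).zero
  val_res : ∀ {c' c : Cell W} (h : c' ≤ c) (x : c'.U) (s : (F.sec c).zero),
    val c' x (F.res0 h s) = val c (Cell.point h x) s
  hol_congr : ∀ (c : Cell W) {ι : Type u} [Finite ι] (a : ι → (F.sec c).zero)
    (g g' : (ι → ℂ) → ℂ) (D : Set (ι → ℂ)), IsOpen D → (∀ x, (fun i => val c x (a i)) ∈ D) →
    DifferentiableOn ℂ g D → Set.EqOn g g' D → hol c g a = hol c g' a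
  hol_const : ∀ (c : Cell W) {ι : Type u} [Finite ι] (a : ι → (F.sec c).zero) (z : ℂ),
    hol c (fun _ => z) a = algebraMap ℂ _ z
  hol_coord : ∀ (c : Cell W) {ι : Type u} [Finite ι] (a : ι → (F.sec c).zero) (i : ι),
    hol c (fun w => w i) a = a i
  hol_add : ∀ (c : Cell W) {ι : Type u} [Finite ι] (a : ι → (F.sec c).zero)
    (g g' : (ι → ℂ) → ℂ) (D : Set (ι → ℂ)), IsOpen D → (∀ x, (fun i => val c x (a i)) ∈ D) →
    DifferentiableOn ℂ g D → DifferentiableOn ℂ g' D →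
    hol c (fun w => g w + g' w) a = hol c g a + hol c g' a
  hol_mul : ∀ (c : Cell W) {ι : Type u} [Finite ι] (a : ι → (F.sec c).zero)
    (g g' : (ι → ℂ) → ℂ) (D : Set (ι → ℂ)), IsOpen D → (∀ x, (fun i => val c x (a i)) ∈ D) →
    DifferentiableOn ℂ g D → DifferentiableOn ℂ g' D →
    hol c (fun w => g w * g' w) a = hol c g a * hol c g' a
  val_hol : ∀ (c : Cell W) {ι : Type u} [Finite ι] (a : ι → (F.sec c).zero)
    (g : (ι → ℂ) → ℂ) (D : Set (ι → ℂ)), IsOpen D → (∀ x, (fun i => val c x (a i)) ∈ D) →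
    DifferentiableOn ℂ g D → ∀ x, val c x (hol c g a) = g fun i => val c x (a i)
  hol_comp : ∀ (c : Cell W) {ι κ : Type u} [Finite ι] [Finite κ] (a : ι → (F.sec c).zero)
    (h : κ → (ι → ℂ) → ℂ) (g : (κ → ℂ) → ℂ) (D : Set (ι → ℂ)) (D' : Set (κ → ℂ)),
    IsOpen D → (∀ x, (fun i => val c x (a i)) ∈ D) → (∀ k, DifferentiableOn ℂ (h k) D) →
    IsOpen D' → Set.MapsTo (fun w k => h k w) D D' → DifferentiableOn ℂ g D' →
    hol c g (fun k => hol c (h k) a) = hol c (fun w => g fun k => h k w) a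
  hol_res : ∀ {c' c : Cell W} (hc : c' ≤ c) {ι : Type u} [Finite ι] (a : ι → (F.sec c).zero)
    (g : (ι → ℂ) → ℂ) (D : Set (ι → ℂ)), IsOpen D → (∀ x, (fun i => val c x (a i)) ∈ D) →
    DifferentiableOn ℂ g D → F.res0 hc (hol c g a) = hol c' g fun i => F.res0 hc (a i)

namespace HolStructure

variable {W : SimplicialSystem.{u}} {F F' : DGPresheaf W}

/-- The morphism `f` is compatible with values and with the functional calculus. -/
def Preserves (H : HolStructure F) (H' : HolStructure F') (f : F ⟶ F') : Prop :=
  (∀ (c : Cell W) (x : c.U) (s : (F.sec c).zero),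
    H'.val c x (DGPresheaf.ap0 f c s) = H.val c x s) ∧
  ∀ (c : Cell W) {ι : Type u} [Finite ι] (a : ι → (F.sec c).zero) (g : (ι → ℂ) → ℂ)
    (D : Set (ι → ℂ)), IsOpen D → (∀ x, (fun i => H.val c x (a i)) ∈ D) → DifferentiableOn ℂ g D →
    DGPresheaf.ap0 f c (H.hol c g a) = H'.hol c g fun i => DGPresheaf.ap0 f c (a i)

/-- The tuple `a` presents the stalks of `F⁰` at the points `x` of the cell as the local rings
`𝒪_{ℂ^ι, a(x)} / (p₁, …, pₘ)`: every section is locally a holomorphic function of `a`, and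
`g(a)` vanishes near `x` if and only if `g` lies in the ideal `(p₁, …, pₘ)` near `a(x)`. -/
def IsPresentation (H : HolStructure F) (c : Cell W) {ι : Type u} [Finite ι]
    (a : ι → (F.sec c).zero) {m : ℕ} (p : Fin m → (ι → ℂ) → ℂ) : Prop :=
  (∀ (V : Opens (W.pt c.face)) (hV : V ≤ c.U) (s : (F.sec ⟨c.face, V⟩).zero),
    (⟨c.face, V⟩ : Cell W).Locally fun c' h => ∃ (g : (ι → ℂ) → ℂ) (D : Set (ι → ℂ)),
      IsOpen D ∧
      (∀ x, (fun i => H.val c' x (F.res0 (h.trans (Cell.le_of_le hV)) (a i))) ∈ D) ∧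
      DifferentiableOn ℂ g D ∧
      F.res0 h s = H.hol c' g fun i => F.res0 (h.trans (Cell.le_of_le hV)) (a i)) ∧
  (∀ (x : c.U) (g : (ι → ℂ) → ℂ) (D : Set (ι → ℂ)), IsOpen D → (fun i => H.val c x (a i)) ∈ D →
    DifferentiableOn ℂ g D →
    ((∃ (V : Opens (W.pt c.face)) (hV : V ≤ c.U), x.1 ∈ V ∧
        (∀ y : c.U, y.1 ∈ V → (fun i => H.val c y (a i)) ∈ D) ∧
        H.hol ⟨c.face, V⟩ g (fun i => F.res0 (Cell.le_of_le hV) (a i)) = 0) ↔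
      ∃ D' ⊆ D, IsOpen D' ∧ (fun i => H.val c x (a i)) ∈ D' ∧
        ∃ v : Fin m → (ι → ℂ) → ℂ, (∀ l, DifferentiableOn ℂ (v l) D') ∧
          ∀ w ∈ D', g w = ∑ l, v l w * p l w))

/-- A chart: the values of `a` embed the cell topologically into `ℂ^ι`, and `a` presents the
structure sheaf as `𝒪_{ℂ^ι} / (p₁, …, pₘ)` with `p₁, …, pₘ` holomorphic near the image. -/
def IsChart (H : HolStructure F) (c : Cell W) {ι : Type u} [Finite ι]
    (a : ι → (F.sec c).zero) {m : ℕ} (p : Fin m → (ι → ℂ) → ℂ) : Prop :=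
  Topology.IsEmbedding (fun (x : c.U) (i : ι) => H.val c x (a i)) ∧
  (∃ D : Set (ι → ℂ), IsOpen D ∧ (∀ x, (fun i => H.val c x (a i)) ∈ D) ∧
    ∀ l, DifferentiableOn ℂ (p l) D) ∧
  H.IsPresentation c a p

/-- Every `(W α, F⁰ on W α)` is locally isomorphic to `(K, (𝒪_D / (p₁, …, pₘ))|K)` with
`D ⊆ ℂⁿ` open, `p₁, …, pₘ` holomorphic on `D`, and `K` a subset of the zero set of
`p₁, …, pₘ`; that is, it is locally a subset of a complex space with the topological restriction
of the structure sheaf. All (compact, Stein compact) subsets of complex spaces are of this form. -/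
def IsComplexAnalytic (H : HolStructure F) : Prop :=
  ∀ c : Cell W, c.Locally fun c' _ => ∃ (ι : Type u) (_ : Finite ι) (a : ι → (F.sec c').zero)
    (m : ℕ) (p : Fin m → (ι → ℂ) → ℂ), H.IsChart c' a p

end HolStructure

/-! ## Free analytic algebras -/

/-- The data that exhibit `S` as a free analytic algebra `𝕊̃_R(𝓕)` over `R`, where `𝓕` is a
graded free module with generators `f` in degrees `≤ 0`. With `t` the generators of degree `0`,
`Q = R{t} = R ⊗ R⁰{t}` (sheaf tensor product over `R⁰`), where `R⁰{t} = Q⁰` is the topological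
restriction to the zero section of the structure sheaf of the product of `(W, R⁰)` with the number
space having coordinates `t`; and `S` is the graded symmetric `Q`-algebra on the generators of
negative degrees. -/
structure FreeAnalytic {W : SimplicialSystem.{u}} {R S : DGPresheaf W} (HR : HolStructure R)
    (j : R ⟶ S) where
  G : Gens W
  deg_nonpos : ∀ n, G.deg n ≤ 0
  f : G.Sections S
  Q : DGPresheaf W
  isSheaf : Q.IsSheaf
  HQ : HolStructure Q
  i : R ⟶ Q
  k : Q ⟶ S
  i_k : i ≫ k = j
  preserves : HR.Preserves HQ i
  t : ∀ n : (G.filter (· = 0)).idx, (Q.sec (Cell.whole ((G.filter (· = 0)).face n))).zero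
  k_t : ∀ n, DGPresheaf.ap k _ (t n).1 = f n.1
  /-- The points of `W` lie on the zero section. -/
  val_t : ∀ n x, HQ.val _ x (t n) = 0
  /-- If `a` is a chart of `(W, R⁰)` with equations `p`, then `(a, t)` presents `Q⁰` with the same
  equations. -/
  product_chart : ∀ (c : Cell W) {ι : Type u} [Finite ι] (a : ι → (R.sec c).zero) {m : ℕ}
    (p : Fin m → (ι → ℂ) → ℂ), HR.IsChart c a p →
    HQ.IsPresentation c
      (Sum.elim (fun l => DGPresheaf.ap0 i c (a l))
        fun n : (G.filter (· = 0)).At c => Q.res0 (Cell.le_whole n.2) (t n.1))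
      (fun l w => p l fun s => w (Sum.inl s))
  /-- The canonical map from `R ⊗ Q⁰` to `Q` is locally surjective. -/
  tensor_surj : ∀ (c : Cell W) (q : Q.sec c), c.Locally fun c' h =>
    ∃ (n : ℕ) (r : Fin n → R.sec c') (b : Fin n → (Q.sec c').zero),
      Q.res h q = ∑ l, DGPresheaf.ap i c' (r l) * (b l).1
  /-- The canonical map from `R ⊗ Q⁰` to `Q` is locally injective. -/
  tensor_inj : ∀ (c : Cell W) (n : ℕ) (r : Fin n → R.sec c) (b : Fin n → (Q.sec c).zero),
    ∑ l, DGPresheaf.ap i c (r l) * (b l).1 = 0 →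
    c.Locally fun c' h => CDGA.TensorVanishes (i.app (op c')) (fun l => R.res h (r l))
      (fun l => Q.res0 h (b l))
  free : (G.filter (· < 0)).IsFree k fun n => f n.1

/-! ## Differentials, connections, Atiyah classes -/

namespace FreeAnalytic

variable {W : SimplicialSystem.{u}} {R S : DGPresheaf W} {HR : HolStructure R} {j : R ⟶ S}

/-- `Ω` is the symmetric algebra `𝕊_S(Ω¹[1])` with `Ω¹ = Ω¹_{S/R}` the module of analytic
differentials of the free analytic algebra `S`, and `D s = T ds`, where `d : S → Ω¹` is the
universal derivation and `T` is the shift. So `D` is an `R`-linear derivation of degree `-1`;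
the differential of `Ω¹[1]` satisfies `∂ (T ds) = - T d(∂ s)`; the sections `T df`,
`f` a generator of `S`, are a basis of `Ω¹[1]`, which contains all `T ds`, and they are
graded free generators of `Ω`. -/
def IsDifferentialAlgebra (S_free : FreeAnalytic HR j) {Ω : DGPresheaf W} (ω : S ⟶ Ω)
    (D : DGPresheaf.Der ω (-1)) : Prop :=
  (∀ (c : Cell W) (r : R.sec c), D.app c (DGPresheaf.ap j c r) = 0) ∧
  (∀ (c : Cell W) (s : S.sec c),
    (Ω.sec c).d (D.app c s) + D.app c ((S.sec c).d s) = 0) ∧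
  (∀ (c : Cell W) (s : S.sec c), D.app c s ∈ Submodule.span ℂ
    {y : Ω.sec c | ∃ (b : S.sec c) (n : S_free.G.At c),
      y = DGPresheaf.ap ω c b * D.app c (S_free.G.resTo S_free.f c n)}) ∧
  S_free.G.shift.IsFree ω fun n => D.app _ (S_free.f n)

end FreeAnalytic

namespace DGPresheaf

variable {W : SimplicialSystem.{u}}

/-- With `T = B ⊗_S Ω` and `B = 𝕊_S(E)`, `E` graded free on the sections `e`: the derivation
`nabla : B → B ⊗_S Ω¹[1]` (a connection followed by the shift) restricts to `D` on `S` and maps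
`E` to `E ⊗_S Ω¹[1]`. -/
def IsConnection {S B Ω T : DGPresheaf W} {φ : S ⟶ B} {ω : S ⟶ Ω} {iB : B ⟶ T} (iΩ : Ω ⟶ T)
    (D : Der ω (-1)) {E : Gens W} (e : E.Sections B) (nabla : Der iB (-1)) : Prop :=
  (∀ (c : Cell W) (s : S.sec c), nabla.app c (ap φ c s) = ap iΩ c (D.app c s)) ∧
  ∀ n : E.idx, nabla.app _ (e n) ∈ Submodule.span ℂ
    {y : T.sec (Cell.whole (E.face n)) |
      ∃ (b s : S.sec (Cell.whole (E.face n))) (l : E.At (Cell.whole (E.face n))),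
        y = ap iB _ (ap φ _ b * E.resTo e _ l) * ap iΩ _ (D.app _ s)}

/-- `At` is the `Ω`-linear extension to `T = B ⊗_S Ω` of the Atiyah class `[∂, ∇]` of the
connection `∇` with values in `B ⊗_S Ω¹`. In terms of `nabla = T ∘ ∇` (shift), and since
`∂ T = - T ∂`, one has `T ∘ (∂ ∇ - ∇ ∂) = - (∂ nabla + nabla ∂)`. -/
def IsAtiyah {B Ω T : DGPresheaf W} {iB : B ⟶ T} (iΩ : Ω ⟶ T) (nabla : Der iB (-1))
    (At : Der (𝟙 T) 0) : Prop :=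
  (∀ (c : Cell W) (w : Ω.sec c), At.app c (ap iΩ c w) = 0) ∧
  ∀ (c : Cell W) (b : B.sec c),
    At.app c (ap iB c b) = -((T.sec c).d (nabla.app c b) + nabla.app c ((B.sec c).d b))

/-- `At` is locally nilpotent and `AC = exp (-At)` on `B`. -/
def IsExpNeg {B T : DGPresheaf W} (iB : B ⟶ T) (At : Der (𝟙 T) 0) (AC : B ⟶ T) : Prop :=
  (∀ (c : Cell W) (h : T.sec c), ∃ N : ℕ, (At.app c ^ N) h = 0) ∧
  ∀ (c : Cell W) (b : B.sec c) (N : ℕ), (At.app c ^ N) (ap iB c b) = 0 →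
    ap AC c b = ∑ n ∈ Finset.range N, ((-1 : ℂ) ^ n / (n.factorial : ℂ)) •
      (At.app c ^ n) (ap iB c b)

end DGPresheaf

end

/-! The resolution is a Koszul algebra. The exponential of the Atiyah class sends its generators to
the differentials of the generators of S, up to products of at least two differentials, and such a
triangular substitution is invertible.

Resolution. Write S = Q[f] with Q = R{t} and f the generators of negative degree. The coordinates
are translated to τ = t - μ(t), so that the augmentation kills them. Let K = Q[x, e], with one x for
every f of negative degree and one e, of degree one less, for every generator of S including the t.
The differential extends that of Q by ∂x = 0 and ∂e = x or ∂e = τ. The derivation D with Dq = ∑ e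
∂q/∂τ, Dx = e, De = 0 satisfies [∂, D] = Euler field in τ + number of factors x and e. On the
coefficients of monomials with k + 1 factors this is E + (k + 1), which is inverted by q ↦ ∫₀¹ s^k
q(sτ) ds. Composing D with this inverse gives a contraction h with ∂h + h∂ = 1 - (K → R → K); see
`koszul_homotopy` and `nonempty_koszul`.

Structure over S. A morphism φ : S → K over Q is found by recursion on the degree: φ(f) = μ(f) + x +
h(φ(∂f) - μ(∂f)). The last argument is a cycle killed by the augmentation, so the contraction makes
φ compatible with ∂ (`exists_values`, `d_hom`). Since h takes values in polynomials in e and in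
those x of larger degree, the elements φ(f) can replace the x, and K is free over S on the e
(`isFree_e`). This K is the B of the theorem.

Isomorphism. The connection is the one with ∇e = 0. Its Atiyah class kills Ω and adds a factor ds to
everything else. Nonzero factors ds have negative degree in Ω, so the class is locally nilpotent
(`locally_nilpotent`); it is a derivation of degree 0 that commutes with ∂, so its exponential is a
morphism of DG algebras. After base change to R, the image of e is that of ∇(∂e) plus products of at
least two differentials. Here ∂e is τ, or x = φ(f) - μ(f) - h(..); ∇ kills μ(f), and ∇h(..) dies in
R ⊗ Ω because h has values in the ideal of the e, where both ν(e) and ∇e vanish. So e ↦ df +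
products (`map_connection_d_e`). For reasons of degree the products involve only generators of
larger degree, and the substitution is unitriangular.

Analysis. Partial derivatives and averages along rays have to be defined on Q, whose sections of
degree 0 are only locally of the form g(a, τ), with g holomorphic modulo equations p(a). Both
operators act in the variables τ and are linear over functions of a, so they preserve the ideal
generated by the p; this is `hol_lift_eq_zero`, on which well-definedness and gluing rest. They
extend R-linearly to Q by the local description of Q as R ⊗ Q⁰. The same partial derivatives provide
the universal derivation of S, hence Ω.

Algebra. Homomorphisms and derivations of free algebras are handled by the universal property,
derivations being homomorphisms to dual numbers. Arguments with coefficients, such as the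
contraction and the sheaf property of K, use an explicit model of monomials. -/

noncomputable section

/-! ### Graded algebras: Koszul signs as automorphisms, homomorphisms, derivations -/

section

/-- A family of submodules with projections onto its members is a grading. -/
theorem isInternal_of_projections {M : Type*} [AddCommGroup M] [Module ℂ M]
    {𝒜 : ℤ → Submodule ℂ M} (π : ℤ → M →ₗ[ℂ] M) (h1 : ∀ n, ∀ y ∈ 𝒜 n, π n y = y)
    (h2 : ∀ n m, n ≠ m → ∀ y ∈ 𝒜 m, π n y = 0) (h3 : ⨆ n, 𝒜 n = ⊤) :
    DirectSum.IsInternal 𝒜 := by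
  refine ⟨(injective_iff_map_eq_zero (DirectSum.coeAddMonoidHom 𝒜)).2 fun x hx => ?_, ?_⟩
  · have key : ∀ (n : ℤ) (x : DirectSum ℤ fun i => 𝒜 i),
        π n (DirectSum.coeAddMonoidHom 𝒜 x) = (x n : M) := by
      intro n x
      induction x using DirectSum.induction_on with
      | zero => simp
      | of i y =>
        rw [DirectSum.coeAddMonoidHom_of]
        by_cases h : n = i
        · subst h
          rw [h1 _ _ y.2, DirectSum.of_eq_same]
        · rw [h2 n i h _ y.2, DirectSum.of_eq_of_ne _ _ _ h]
          rfl
      | add x y hx hy => simp only [map_add, hx, hy]; rfl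
    refine DFinsupp.ext fun n => Subtype.ext ?_
    rw [← key n x, hx, map_zero]
    rfl
  · intro y
    have hy : y ∈ ⨆ n, 𝒜 n := h3 ▸ Submodule.mem_top
    rw [Submodule.iSup_eq_range_dfinsupp_lsum] at hy
    obtain ⟨f, hf⟩ := hy
    refine ⟨f, ?_⟩
    rw [← hf]
    rfl

namespace CDGA

variable {A B C : CDGA.{u}}

theorem homogeneous_induction {P : A → Prop} (h0 : P 0) (hadd : ∀ a b, P a → P b → P (a + b))
    (hhom : ∀ i, ∀ a ∈ A.deg i, P a) (a : A) : P a := by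
  have ha : a ∈ ⨆ i, A.deg i := A.isInternal.submodule_iSup_eq_top ▸ Submodule.mem_top
  exact Submodule.iSup_induction A.deg (motive := P) ha hhom h0 hadd

variable (A) in
/-- The decomposition into homogeneous components. -/
def decomp : A ≃ₗ[ℂ] DirectSum ℤ fun i => A.deg i :=
  (LinearEquiv.ofBijective (DirectSum.coeLinearMap A.deg) A.isInternal).symm

theorem decomp_of_mem {i : ℤ} {a : A} (h : a ∈ A.deg i) :
    A.decomp a = DirectSum.lof ℂ ℤ (fun i => A.deg i) i ⟨a, h⟩ := by
  rw [decomp, LinearEquiv.symm_apply_eq]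
  exact (DirectSum.coeLinearMap_lof (A := A.deg) i ⟨a, h⟩).symm

variable (A) in
/-- The projection to the component of degree `n`. -/
def proj (n : ℤ) : A →ₗ[ℂ] A :=
  (A.deg n).subtype ∘ₗ DirectSum.component ℂ ℤ (fun i => A.deg i) n ∘ₗ A.decomp.toLinearMap

theorem proj_mem (n : ℤ) (a : A) : A.proj n a ∈ A.deg n := Subtype.property _

theorem proj_of_mem {n : ℤ} {a : A} (h : a ∈ A.deg n) : A.proj n a = a := by
  simp [proj, decomp_of_mem h, DirectSum.component.lof_self]

theorem proj_of_ne {n m : ℤ} (hn : n ≠ m) {a : A} (h : a ∈ A.deg m) : A.proj n a = 0 := by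
  simp [proj, decomp_of_mem h, DirectSum.component.of, Ne.symm hn]

theorem eq_of_proj_eq {a b : A} (h : ∀ n, A.proj n a = A.proj n b) : a = b := by
  apply A.decomp.injective
  refine DFinsupp.ext fun n => Subtype.ext ?_
  exact h n

variable (A) in
/-- The linear map multiplying elements of degree `i` by `(-1)^(n i)`. -/
def sgnLin (n : ℤ) : A →ₗ[ℂ] A :=
  (DirectSum.toModule ℂ ℤ A fun i => (n * i).negOnePow • (A.deg i).subtype) ∘ₗ
    A.decomp.toLinearMap

theorem sgnLin_of_mem (n : ℤ) {i : ℤ} {a : A} (h : a ∈ A.deg i) :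
    A.sgnLin n a = (n * i).negOnePow • a := by
  simp [sgnLin, decomp_of_mem h]

theorem negOnePow_congr {a b : ℤ} (k : ℤ) (h : a - b = 2 * k) : a.negOnePow = b.negOnePow := by
  rw [Int.negOnePow_eq_iff]
  exact ⟨k, by omega⟩

variable (A) in
/-- The automorphism multiplying elements of degree `i` by `(-1)^(n i)`. -/
def sgn (n : ℤ) : A →ₐ[ℂ] A :=
  AlgHom.ofLinearMap (A.sgnLin n) (by simpa using sgnLin_of_mem n A.one_mem) (by
    intro a b
    refine homogeneous_induction (P := fun a => A.sgnLin n (a * b) = A.sgnLin n a * A.sgnLin n b)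
      (by simp) (fun a a' h h' => by rw [add_mul, map_add, map_add, h, h', add_mul]) ?_ a
    intro i a ha
    refine homogeneous_induction (P := fun b => A.sgnLin n (a * b) = A.sgnLin n a * A.sgnLin n b)
      (by simp) (fun a a' h h' => by rw [mul_add, map_add, map_add, h, h', mul_add]) ?_ b
    intro j b hb
    rw [sgnLin_of_mem n ha, sgnLin_of_mem n hb, sgnLin_of_mem n (A.mul_mem ha hb),
      smul_mul_smul_comm, ← Int.negOnePow_add, mul_add])

theorem sgn_of_mem (n : ℤ) {i : ℤ} {a : A} (h : a ∈ A.deg i) :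
    A.sgn n a = (n * i).negOnePow • a := sgnLin_of_mem n h

theorem negOnePow_smul_mem {i : ℤ} {a : A} (h : a ∈ A.deg i) (u : ℤˣ) : u • a ∈ A.deg i := by
  rcases Int.units_eq_one_or u with rfl | rfl
  · simpa using h
  · simpa using h

theorem sgn_mem (n : ℤ) {i : ℤ} {a : A} (h : a ∈ A.deg i) : A.sgn n a ∈ A.deg i := by
  rw [sgn_of_mem n h]
  exact negOnePow_smul_mem h _

theorem map_units_smul {M N F : Type*} [AddCommGroup M] [AddCommGroup N] [FunLike F M N]
    [AddMonoidHomClass F M N] (f : F) (u : ℤˣ) (a : M) : f (u • a) = u • f a := by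
  rcases Int.units_eq_one_or u with rfl | rfl
  · simp
  · simp

theorem sgn_sgn (n m : ℤ) (a : A) : A.sgn n (A.sgn m a) = A.sgn (n + m) a := by
  refine homogeneous_induction (P := fun a => A.sgn n (A.sgn m a) = A.sgn (n + m) a) (by simp)
    (fun a b ha hb => by simp only [map_add, ha, hb]) (fun i a ha => ?_) a
  rw [sgn_of_mem m ha, map_units_smul, sgn_of_mem n ha, sgn_of_mem _ ha, smul_smul,
    ← Int.negOnePow_add]
  congr 2
  ring

@[simp] theorem sgn_zero (a : A) : A.sgn 0 a = a := by
  refine homogeneous_induction (P := fun a => A.sgn 0 a = a) (by simp)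
    (fun a b ha hb => by simp only [map_add, ha, hb]) (fun i a ha => ?_) a
  rw [sgn_of_mem 0 ha]
  simp

/-- Graded commutativity with one homogeneous factor. -/
theorem mul_comm_sgn {i : ℤ} {a : A} (h : a ∈ A.deg i) (b : A) : a * b = A.sgn i b * a := by
  refine homogeneous_induction (P := fun b => a * b = A.sgn i b * a) (by simp)
    (fun b b' hb hb' => by rw [mul_add, map_add, add_mul, hb, hb']) (fun j b hb => ?_) b
  rw [A.comm h hb, sgn_of_mem i hb, smul_mul_assoc]

namespace GrHom

theorem ext_fun {f g : GrHom A B} (h : ∀ a, f.toAlgHom a = g.toAlgHom a) : f = g := by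
  obtain ⟨f, _⟩ := f
  obtain ⟨g, _⟩ := g
  have : f = g := AlgHom.ext h
  cases this
  rfl

theorem map_sgn (f : GrHom A B) (n : ℤ) (a : A) :
    f.toAlgHom (A.sgn n a) = B.sgn n (f.toAlgHom a) := by
  refine homogeneous_induction (P := fun a => f.toAlgHom (A.sgn n a) = B.sgn n (f.toAlgHom a))
    (by simp) (fun a b ha hb => by simp only [map_add, ha, hb]) (fun i a ha => ?_) a
  rw [sgn_of_mem n ha, map_units_smul, sgn_of_mem n (f.map_deg ha)]

/-- The identity. -/
def id (A : CDGA.{u}) : GrHom A A := ⟨AlgHom.id ℂ A, fun h => h⟩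

/-- Composition in diagrammatic order. -/
def comp (f : GrHom A B) (g : GrHom B C) : GrHom A C :=
  ⟨g.toAlgHom.comp f.toAlgHom, fun h => g.map_deg (f.map_deg h)⟩

@[simp] theorem id_apply (a : A) : (GrHom.id A).toAlgHom a = a := rfl

@[simp] theorem comp_apply (f : GrHom A B) (g : GrHom B C) (a : A) :
    (f.comp g).toAlgHom a = g.toAlgHom (f.toAlgHom a) := rfl

end GrHom

/-- A derivation of degree `n` along the graded homomorphism `f`. -/
structure GrDer (f : GrHom A B) (n : ℤ) where
  lin : A →ₗ[ℂ] B
  map_deg : ∀ {i : ℤ} {a : A}, a ∈ A.deg i → lin a ∈ B.deg (i + n)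
  leibniz : ∀ a b : A, lin (a * b) = lin a * f.toAlgHom b + f.toAlgHom (A.sgn n a) * lin b

namespace GrDer

variable {f : GrHom A B} {n m : ℤ}

theorem ext_fun {D D' : GrDer f n} (h : ∀ a, D.lin a = D'.lin a) : D = D' := by
  obtain ⟨D, _, _⟩ := D
  obtain ⟨D', _, _⟩ := D'
  have : D = D' := LinearMap.ext h
  cases this
  rfl

theorem map_one (D : GrDer f n) : D.lin 1 = 0 := by
  have := D.leibniz 1 1
  simpa using this

/-- The derivation shifts degrees by n, and the sign automorphism sees this shift as the factor
(-1)^(kn). -/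
theorem map_sgn (D : GrDer f n) (k : ℤ) (a : A) :
    D.lin (A.sgn k a) = (k * n).negOnePow • B.sgn k (D.lin a) := by
  refine homogeneous_induction
    (P := fun a => D.lin (A.sgn k a) = (k * n).negOnePow • B.sgn k (D.lin a))
    (by simp) (fun a b ha hb => by simp only [map_add, ha, hb, smul_add]) (fun i a ha => ?_) a
  rw [sgn_of_mem k ha, map_units_smul, sgn_of_mem k (D.map_deg ha), smul_smul,
    ← Int.negOnePow_add]
  congr 1
  exact negOnePow_congr (-(k * n)) (by ring)

/-- A linear map satisfying the Leibniz rule on homogeneous elements. -/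
def mk' (lin : A →ₗ[ℂ] B) (map_deg : ∀ {i : ℤ} {a : A}, a ∈ A.deg i → lin a ∈ B.deg (i + n))
    (leibniz : ∀ {i j : ℤ} {a b : A}, a ∈ A.deg i → b ∈ A.deg j → lin (a * b) =
      lin a * f.toAlgHom b + (n * i).negOnePow • (f.toAlgHom a * lin b)) : GrDer f n where
  lin := lin
  map_deg := map_deg
  leibniz a b := by
    refine homogeneous_induction (P := fun a => lin (a * b) =
        lin a * f.toAlgHom b + f.toAlgHom (A.sgn n a) * lin b)
      (by simp) (fun a a' h h' => by simp only [add_mul, map_add, h, h']; abel) ?_ a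
    intro i a ha
    refine homogeneous_induction (P := fun b => lin (a * b) =
        lin a * f.toAlgHom b + f.toAlgHom (A.sgn n a) * lin b)
      (by simp) (fun a a' h h' => by simp only [mul_add, map_add, h, h']; abel) ?_ b
    intro j b hb
    rw [leibniz ha hb, sgn_of_mem n ha, map_units_smul, smul_mul_assoc]

/-- Postcomposition with a homomorphism. -/
def comp (D : GrDer f n) (g : GrHom B C) : GrDer (f.comp g) n where
  lin := g.toAlgHom.toLinearMap ∘ₗ D.lin
  map_deg h := g.map_deg (D.map_deg h)
  leibniz a b := by simp [D.leibniz]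

/-- Precomposition with a homomorphism. -/
def precomp (g : GrHom A B) {f : GrHom B C} (D : GrDer f n) : GrDer (g.comp f) n where
  lin := D.lin ∘ₗ g.toAlgHom.toLinearMap
  map_deg h := D.map_deg (g.map_deg h)
  leibniz a b := by simp [D.leibniz, g.map_sgn]

/-- The graded commutator of a derivation along `f` with derivations of `A` and `B` that are
compatible with `f`. -/
def bracket (D : GrDer f n) (d : GrDer (GrHom.id A) m) (d' : GrDer (GrHom.id B) m)
    (h : ∀ a, d'.lin (f.toAlgHom a) = f.toAlgHom (d.lin a)) : GrDer f (n + m) where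
  lin := d'.lin ∘ₗ D.lin - (n * m).negOnePow • (D.lin ∘ₗ d.lin)
  map_deg {i a} h := by
    have h1 := d'.map_deg (D.map_deg h)
    have h2 := D.map_deg (d.map_deg h)
    rw [show i + n + m = i + (n + m) by ring] at h1
    rw [show i + m + n = i + (n + m) by ring] at h2
    exact Submodule.sub_mem _ h1 (negOnePow_smul_mem h2 _)
  leibniz a b := by
    simp only [LinearMap.sub_apply, LinearMap.comp_apply, LinearMap.smul_apply, D.leibniz,
      d.leibniz, d'.leibniz, GrHom.id_apply, map_add, D.map_sgn, d'.map_sgn, f.map_sgn, h,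
      smul_add, smul_mul_assoc, mul_sub, sub_mul, mul_smul_comm, smul_smul,
      ← Int.negOnePow_add, sgn_sgn, add_comm m n, mul_comm m n]
    -- One of the mixed terms carries (-1)^(nm) twice, from the bracket and from `map_sgn`; with
    -- this square removed the mixed terms cancel in pairs.
    rw [negOnePow_congr (a := n * m + n * m) (b := 0) (n * m) (by ring)]
    simp only [Int.negOnePow_zero, one_smul]
    abel

theorem bracket_lin (D : GrDer f n) (d : GrDer (GrHom.id A) m) (d' : GrDer (GrHom.id B) m)
    (h : ∀ a, d'.lin (f.toAlgHom a) = f.toAlgHom (d.lin a)) (a : A) :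
    (D.bracket d d' h).lin a = d'.lin (D.lin a) - (n * m).negOnePow • D.lin (d.lin a) := rfl

/-- The square of an odd derivation is a derivation. -/
def square (D : GrDer (GrHom.id A) n) (hn : Odd n) : GrDer (GrHom.id A) (n + n) where
  lin := D.lin ∘ₗ D.lin
  map_deg {i a} h := by
    rw [← add_assoc]
    exact D.map_deg (D.map_deg h)
  leibniz a b := by
    -- For odd n the two mixed terms of the iterated Leibniz rule have opposite signs.
    have h1 : (n * n).negOnePow = -1 := Int.negOnePow_odd _ (hn.mul hn)
    simp only [LinearMap.comp_apply, D.leibniz, GrHom.id_apply, map_add, D.map_sgn, h1, sgn_sgn,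
      Units.neg_smul, one_smul, neg_mul]
    abel

/-- The difference of derivations. -/
def sub (D D' : GrDer f n) : GrDer f n where
  lin := D.lin - D'.lin
  map_deg h := Submodule.sub_mem _ (D.map_deg h) (D'.map_deg h)
  leibniz a b := by simp [D.leibniz, D'.leibniz, mul_sub, sub_mul]; abel

end GrDer

/-- The differential as a derivation. -/
def dDer (A : CDGA.{u}) : GrDer (GrHom.id A) 1 :=
  GrDer.mk' A.d A.d_mem fun ha hb => by simp [A.leibniz ha]

end CDGA

end

section

namespace CDGA

variable {A B C : CDGA.{u}}

/-! ## Dual numbers -/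

/-- The graded algebra `B ⊕ B ε` with `ε² = 0`, where `b ε` has degree `|b| - n`. -/
@[ext] structure Dual (B : CDGA.{u}) (n : ℤ) where
  fst : B
  snd : B

namespace Dual

variable {n : ℤ}

/-- The underlying pairs. -/
def equiv (B : CDGA.{u}) (n : ℤ) : Dual B n ≃ B × B :=
  ⟨fun x => (x.1, x.2), fun x => ⟨x.1, x.2⟩, fun _ => rfl, fun _ => rfl⟩

instance : AddCommGroup (Dual B n) := (equiv B n).addCommGroup
instance : Module ℂ (Dual B n) := (equiv B n).module ℂ
instance : One (Dual B n) := ⟨⟨1, 0⟩⟩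
instance : Mul (Dual B n) := ⟨fun x y => ⟨x.1 * y.1, x.2 * y.1 + B.sgn n x.1 * y.2⟩⟩

@[simp] theorem fst_add (x y : Dual B n) : (x + y).fst = x.fst + y.fst := rfl
@[simp] theorem snd_add (x y : Dual B n) : (x + y).snd = x.snd + y.snd := rfl
@[simp] theorem fst_zero : (0 : Dual B n).fst = 0 := rfl
@[simp] theorem snd_zero : (0 : Dual B n).snd = 0 := rfl
@[simp] theorem fst_one : (1 : Dual B n).fst = 1 := rfl
@[simp] theorem snd_one : (1 : Dual B n).snd = 0 := rfl
@[simp] theorem fst_smul (c : ℂ) (x : Dual B n) : (c • x).fst = c • x.fst := rfl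
@[simp] theorem snd_smul (c : ℂ) (x : Dual B n) : (c • x).snd = c • x.snd := rfl
@[simp] theorem fst_mul (x y : Dual B n) : (x * y).fst = x.fst * y.fst := rfl
@[simp] theorem snd_mul (x y : Dual B n) :
    (x * y).snd = x.snd * y.fst + B.sgn n x.fst * y.snd := rfl

instance : Ring (Dual B n) :=
  { (inferInstance : AddCommGroup (Dual B n)) with
    mul := (· * ·)
    one := 1
    left_distrib := fun x y z => by ext <;> simp [mul_add]; abel
    right_distrib := fun x y z => by ext <;> simp [add_mul]; abel
    zero_mul := fun x => by ext <;> simp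
    mul_zero := fun x => by ext <;> simp
    mul_assoc := fun x y z => by ext <;> simp [mul_assoc, add_mul, mul_add]; abel
    one_mul := fun x => by ext <;> simp
    mul_one := fun x => by ext <;> simp }

instance : Algebra ℂ (Dual B n) :=
  Algebra.ofModule (fun r x y => by ext <;> simp) (fun r x y => by ext <;> simp)

variable (B n) in
/-- The first component. -/
def fstLin : Dual B n →ₗ[ℂ] B := ⟨⟨fst, fun _ _ => rfl⟩, fun _ _ => rfl⟩

variable (B n) in
/-- The second component. -/
def sndLin : Dual B n →ₗ[ℂ] B := ⟨⟨snd, fun _ _ => rfl⟩, fun _ _ => rfl⟩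

variable (B n) in
/-- Linear maps into the dual numbers. -/
def pair {M : Type*} [AddCommGroup M] [Module ℂ M] (f g : M →ₗ[ℂ] B) : M →ₗ[ℂ] Dual B n :=
  ⟨⟨fun m => ⟨f m, g m⟩, fun _ _ => by ext <;> simp⟩, fun _ _ => by ext <;> simp⟩

end Dual

/-- The dual numbers with zero differential. -/
def dual (B : CDGA.{u}) (n : ℤ) : CDGA.{u} where
  carrier := Dual B n
  deg i := (B.deg i).comap (Dual.fstLin B n) ⊓ (B.deg (i + n)).comap (Dual.sndLin B n)
  one_mem := ⟨B.one_mem, Submodule.zero_mem _⟩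
  mul_mem {i j a b} ha hb := by
    refine ⟨B.mul_mem ha.1 hb.1, Submodule.add_mem _ ?_ ?_⟩
    · have := B.mul_mem ha.2 hb.1
      rwa [show i + n + j = i + j + n by ring] at this
    · have := B.mul_mem (sgn_mem n ha.1) hb.2
      rwa [← add_assoc] at this
  isInternal := by
    refine isInternal_of_projections
      (fun i => Dual.pair B n (B.proj i ∘ₗ Dual.fstLin B n) (B.proj (i + n) ∘ₗ Dual.sndLin B n))
      (fun i y hy => ?_) (fun i j hij y hy => ?_) ?_
    · exact Dual.ext (proj_of_mem hy.1) (proj_of_mem hy.2)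
    · exact Dual.ext (proj_of_ne hij hy.1) (proj_of_ne (by omega) hy.2)
    · refine eq_top_iff.2 fun y _ => ?_
      have hy : y = Dual.pair B n LinearMap.id 0 y.1 + Dual.pair B n 0 LinearMap.id y.2 := by
        refine Dual.ext ?_ ?_ <;> simp [Dual.pair]
      rw [hy]
      refine Submodule.add_mem _ ?_ ?_
      · refine homogeneous_induction (P := fun b => Dual.pair B n LinearMap.id 0 b ∈ _)
          (by rw [map_zero]; exact Submodule.zero_mem _)
          (fun a b ha hb => by rw [map_add]; exact Submodule.add_mem _ ha hb) ?_ y.1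
        intro i a ha
        exact Submodule.mem_iSup_of_mem i ⟨ha, Submodule.zero_mem _⟩
      · refine homogeneous_induction (P := fun b => Dual.pair B n 0 LinearMap.id b ∈ _)
          (by rw [map_zero]; exact Submodule.zero_mem _)
          (fun a b ha hb => by rw [map_add]; exact Submodule.add_mem _ ha hb) ?_ y.2
        intro i a ha
        refine Submodule.mem_iSup_of_mem (i - n) ⟨Submodule.zero_mem _, ?_⟩
        change a ∈ B.deg (i - n + n)
        rwa [sub_add_cancel]
  comm {i j a b} ha hb := by
    rcases a with ⟨a, a'⟩
    rcases b with ⟨b, b'⟩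
    have ha1 : a ∈ B.deg i := ha.1
    have ha2 : a' ∈ B.deg (i + n) := ha.2
    have hb1 : b ∈ B.deg j := hb.1
    have hb2 : b' ∈ B.deg (j + n) := hb.2
    have hs : ∀ (v : ℤˣ) (x : Dual B n), v • x = ⟨v • x.1, v • x.2⟩ := by
      intro v x
      rcases Int.units_eq_one_or v with rfl | rfl
      · simp
      · simp only [Units.neg_smul, one_smul]; rfl
    rw [hs]
    refine Dual.ext (B.comm ha1 hb1) ?_
    simp only [Dual.snd_mul]
    rw [sgn_of_mem n ha1, sgn_of_mem n hb1, smul_mul_assoc, smul_mul_assoc, B.comm ha1 hb2,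
      B.comm ha2 hb1, smul_add, smul_smul, smul_smul, ← Int.negOnePow_add, ← Int.negOnePow_add,
      negOnePow_congr (a := n * i + i * (j + n)) (b := i * j) (n * i) (by ring),
      add_comm, negOnePow_congr (a := (i + n) * j) (b := i * j + n * j) 0 (by ring)]
  d := 0
  d_mem _ := Submodule.zero_mem _
  d_d _ := rfl
  leibniz _ _ := by simp

/-- The homomorphism to the dual numbers given by a derivation. -/
def GrDer.toDual {f : GrHom A B} {n : ℤ} (D : GrDer f n) : GrHom A (B.dual n) where
  toAlgHom := AlgHom.ofLinearMap (Dual.pair B n f.toAlgHom.toLinearMap D.lin)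
    (Dual.ext (_root_.map_one f.toAlgHom) D.map_one)
    (fun a b => Dual.ext (map_mul f.toAlgHom a b) (by
      change D.lin (a * b) = D.lin a * f.toAlgHom b + B.sgn n (f.toAlgHom a) * D.lin b
      rw [D.leibniz, f.map_sgn]))
  map_deg h := ⟨f.map_deg h, D.map_deg h⟩

variable (B) in
/-- The projection of the dual numbers. -/
def dualFst (n : ℤ) : GrHom (B.dual n) B where
  toAlgHom := AlgHom.ofLinearMap (Dual.fstLin B n) rfl fun _ _ => rfl
  map_deg h := h.1

/-- The derivation given by a homomorphism to the dual numbers. -/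
def derOfDual {f : GrHom A B} {n : ℤ} (w : GrHom A (B.dual n)) (h : w.comp (B.dualFst n) = f) :
    GrDer f n where
  lin := Dual.sndLin B n ∘ₗ w.toAlgHom.toLinearMap
  map_deg h := (w.map_deg h).2
  leibniz a b := by
    subst h
    change (w.toAlgHom (a * b) : Dual B n).snd = _
    rw [map_mul, GrHom.map_sgn]
    rfl

/-! ## Free graded commutative algebras -/

/-- `B` is via `φ` the free graded commutative `A`-algebra on the elements `e`. -/
def IsFreeOn (φ : GrHom A B) {X : Type u} (deg : X → ℤ) (e : X → B) : Prop :=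
  (∀ j, e j ∈ B.deg (deg j)) ∧
  ∀ (Z : CDGA.{u}) (v : GrHom A Z) (z : X → Z), (∀ j, z j ∈ Z.deg (deg j)) →
    ∃! w : GrHom B Z, w.toAlgHom.comp φ.toAlgHom = v.toAlgHom ∧ ∀ j, w.toAlgHom (e j) = z j

namespace IsFreeOn

variable {φ : GrHom A B} {X : Type u} {deg : X → ℤ} {e : X → B}

theorem exists_lift (h : IsFreeOn φ deg e) {Z : CDGA.{u}} (v : GrHom A Z) (z : X → Z)
    (hz : ∀ j, z j ∈ Z.deg (deg j)) :
    ∃ w : GrHom B Z, (∀ a, w.toAlgHom (φ.toAlgHom a) = v.toAlgHom a) ∧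
      ∀ j, w.toAlgHom (e j) = z j := by
  obtain ⟨w, ⟨h1, h2⟩, -⟩ := h.2 Z v z hz
  exact ⟨w, fun a => DFunLike.congr_fun h1 a, h2⟩

/-- The homomorphism with given restriction to `A` and given values on the generators. -/
def lift (h : IsFreeOn φ deg e) {Z : CDGA.{u}} (v : GrHom A Z) (z : X → Z)
    (hz : ∀ j, z j ∈ Z.deg (deg j)) : GrHom B Z := (h.exists_lift v z hz).choose

@[simp] theorem lift_base (h : IsFreeOn φ deg e) {Z : CDGA.{u}} (v : GrHom A Z) (z : X → Z)
    (hz : ∀ j, z j ∈ Z.deg (deg j)) (a : A) :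
    (h.lift v z hz).toAlgHom (φ.toAlgHom a) = v.toAlgHom a :=
  (h.exists_lift v z hz).choose_spec.1 a

@[simp] theorem lift_gen (h : IsFreeOn φ deg e) {Z : CDGA.{u}} (v : GrHom A Z) (z : X → Z)
    (hz : ∀ j, z j ∈ Z.deg (deg j)) (j : X) :
    (h.lift v z hz).toAlgHom (e j) = z j :=
  (h.exists_lift v z hz).choose_spec.2 j

theorem hom_ext (h : IsFreeOn φ deg e) {Z : CDGA.{u}} {w w' : GrHom B Z}
    (h1 : ∀ a, w.toAlgHom (φ.toAlgHom a) = w'.toAlgHom (φ.toAlgHom a))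
    (h2 : ∀ j, w.toAlgHom (e j) = w'.toAlgHom (e j)) : w = w' :=
  (h.2 Z (φ.comp w') (fun j => w'.toAlgHom (e j)) fun j => w'.map_deg (h.1 j)).unique
    ⟨AlgHom.ext h1, h2⟩ ⟨rfl, fun _ => rfl⟩

theorem of_lift (hd : ∀ j, e j ∈ B.deg (deg j))
    (h1 : ∀ (Z : CDGA.{u}) (v : GrHom A Z) (z : X → Z), (∀ j, z j ∈ Z.deg (deg j)) →
      ∃ w : GrHom B Z, (∀ a, w.toAlgHom (φ.toAlgHom a) = v.toAlgHom a) ∧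
        ∀ j, w.toAlgHom (e j) = z j)
    (h2 : ∀ (Z : CDGA.{u}) (w w' : GrHom B Z),
      (∀ a, w.toAlgHom (φ.toAlgHom a) = w'.toAlgHom (φ.toAlgHom a)) →
      (∀ j, w.toAlgHom (e j) = w'.toAlgHom (e j)) → w = w') : IsFreeOn φ deg e := by
  refine ⟨hd, fun Z v z hz => ?_⟩
  obtain ⟨w, hw1, hw2⟩ := h1 Z v z hz
  refine ⟨w, ⟨AlgHom.ext hw1, hw2⟩, fun w' hw' => h2 Z _ _ (fun a => ?_) fun j => ?_⟩
  · rw [hw1]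
    exact DFunLike.congr_fun hw'.1 a
  · rw [hw2, hw'.2]

/-- A derivation along `f` is the second component of a homomorphism to the dual numbers with first
component `f`, and such a homomorphism is determined on the base and on the generators. -/
theorem der_ext (h : IsFreeOn φ deg e) {f : GrHom B C} {n : ℤ} {D D' : GrDer f n}
    (h1 : ∀ a, D.lin (φ.toAlgHom a) = D'.lin (φ.toAlgHom a))
    (h2 : ∀ j, D.lin (e j) = D'.lin (e j)) : D = D' := by
  have : D.toDual = D'.toDual :=
    h.hom_ext (fun a => Dual.ext rfl (h1 a)) fun j => Dual.ext rfl (h2 j)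
  refine GrDer.ext_fun fun a => ?_
  have := congrArg (fun w : GrHom B (C.dual n) => (w.toAlgHom a : Dual C n).snd) this
  exact this

/-- A derivation of a free algebra vanishing on the base and on the generators is zero. -/
theorem der_eq_zero (h : IsFreeOn φ deg e) {f : GrHom B C} {n : ℤ} {D : GrDer f n}
    (h1 : ∀ a, D.lin (φ.toAlgHom a) = 0) (h2 : ∀ j, D.lin (e j) = 0) (b : B) : D.lin b = 0 := by
  have : D = D.sub D := h.der_ext (fun a => by simp [h1, GrDer.sub])
    fun j => by simp [h2, GrDer.sub]
  rw [this]
  simp [GrDer.sub]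

/-- The base derivation and the values `y` define a homomorphism to the dual numbers. Its first
component is `f` by uniqueness, so its second component is a derivation along `f`. -/
theorem exists_der (h : IsFreeOn φ deg e) (f : GrHom B C) {n : ℤ} (DA : GrDer (φ.comp f) n)
    (y : X → C) (hy : ∀ j, y j ∈ C.deg (deg j + n)) :
    ∃ D : GrDer f n, (∀ a, D.lin (φ.toAlgHom a) = DA.lin a) ∧ ∀ j, D.lin (e j) = y j := by
  let z : X → C.dual n := fun j => (⟨f.toAlgHom (e j), y j⟩ : Dual C n)
  have hz : ∀ j, z j ∈ (C.dual n).deg (deg j) := fun j => ⟨f.map_deg (h.1 j), hy j⟩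
  have h1 : (h.lift DA.toDual z hz).comp (C.dualFst n) = f :=
    h.hom_ext (fun a => by rw [GrHom.comp_apply, lift_base]; rfl)
      fun j => by rw [GrHom.comp_apply, lift_gen]; rfl
  refine ⟨derOfDual _ h1, fun a => ?_, fun j => ?_⟩
  · change ((h.lift DA.toDual z hz).toAlgHom (φ.toAlgHom a) : Dual C n).snd = _
    rw [lift_base]
    rfl
  · change ((h.lift DA.toDual z hz).toAlgHom (e j) : Dual C n).snd = _
    rw [lift_gen]

/-- The derivation with given restriction to `A` and given values on the generators. -/
def extendDer (h : IsFreeOn φ deg e) (f : GrHom B C) {n : ℤ} (DA : GrDer (φ.comp f) n)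
    (y : X → C) (hy : ∀ j, y j ∈ C.deg (deg j + n)) : GrDer f n :=
  (h.exists_der f DA y hy).choose

@[simp] theorem extendDer_base (h : IsFreeOn φ deg e) (f : GrHom B C) {n : ℤ}
    (DA : GrDer (φ.comp f) n) (y : X → C) (hy : ∀ j, y j ∈ C.deg (deg j + n)) (a : A) :
    (h.extendDer f DA y hy).lin (φ.toAlgHom a) = DA.lin a :=
  (h.exists_der f DA y hy).choose_spec.1 a

@[simp] theorem extendDer_gen (h : IsFreeOn φ deg e) (f : GrHom B C) {n : ℤ}
    (DA : GrDer (φ.comp f) n) (y : X → C) (hy : ∀ j, y j ∈ C.deg (deg j + n)) (j : X) :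
    (h.extendDer f DA y hy).lin (e j) = y j :=
  (h.exists_der f DA y hy).choose_spec.2 j

/-- A free algebra over a free algebra: if `C` is free over `A` on `f` and `e` together and `B`
is free over `A` on `f`, then `C` is free over `B` on `e`. -/
theorem of_sum {Y : Type u} {degY : Y → ℤ} {ψ : GrHom B C} {g : Y → C}
    (h : IsFreeOn φ deg e)
    (h' : IsFreeOn (φ.comp ψ) (Sum.elim deg degY) (Sum.elim (fun j => ψ.toAlgHom (e j)) g)) :
    IsFreeOn ψ degY g := by
  refine of_lift (fun j => h'.1 (Sum.inr j)) (fun Z v z hz => ?_) fun Z w w' h1 h2 => ?_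
  · have hz' : ∀ j, (Sum.elim (fun j => v.toAlgHom (e j)) z) j ∈
        Z.deg (Sum.elim deg degY j) := by
      rintro (j | j)
      · exact v.map_deg (h.1 j)
      · exact hz j
    refine ⟨h'.lift (φ.comp v) _ hz', ?_, fun j => h'.lift_gen _ _ hz' (Sum.inr j)⟩
    have : ψ.comp (h'.lift (φ.comp v) _ hz') = v :=
      h.hom_ext (fun a => h'.lift_base _ _ hz' a) fun j => h'.lift_gen _ _ hz' (Sum.inl j)
    intro b
    exact congrArg (fun w : GrHom B Z => w.toAlgHom b) this
  · refine h'.hom_ext (fun a => h1 _) ?_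
    rintro (j | j)
    · exact h1 _
    · exact h2 j

/-- Triangular changes of generators. -/
theorem of_triangular (h : IsFreeOn φ deg e) (rk : X → ℕ) {e' : X → B} {a : X → A} {b : X → B}
    (hd : ∀ j, e' j ∈ B.deg (deg j)) (ha : ∀ j, a j ∈ A.deg (deg j))
    (hb : ∀ j, b j ∈ B.deg (deg j)) (he : ∀ j, e' j = e j + φ.toAlgHom (a j) + b j)
    (hb' : ∀ j, b j ∈ Algebra.adjoin ℂ (Set.range φ.toAlgHom ∪ e '' {i | rk i < rk j})) :
    IsFreeOn φ deg e' := by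
  have agree : ∀ {Z : CDGA.{u}} (w w' : GrHom B Z) (m : ℕ),
      (∀ x, w.toAlgHom (φ.toAlgHom x) = w'.toAlgHom (φ.toAlgHom x)) →
      (∀ j, rk j < m → w.toAlgHom (e j) = w'.toAlgHom (e j)) → ∀ x ∈
        Algebra.adjoin ℂ (Set.range φ.toAlgHom ∪ e '' {i | rk i < m}),
        w.toAlgHom x = w'.toAlgHom x := by
    intro Z w w' m h1 h2 x hx
    induction hx using Algebra.adjoin_induction with
    | mem x hx =>
      rcases hx with ⟨x, rfl⟩ | ⟨j, hj, rfl⟩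
      · exact h1 x
      · exact h2 j hj
    | algebraMap r => simp
    | add x y _ _ hx hy => rw [map_add, map_add, hx, hy]
    | mul x y _ _ hx hy => rw [map_mul, map_mul, hx, hy]
  refine of_lift hd (fun Z v z hz => ?_) fun Z w w' h1 h2 => ?_
  -- The condition on e' j reads w(e j) = z j - v(a j) - w(b j), where the right side involves w
  -- only on generators of rank below that of j. Iterating it from any start, the value on a
  -- generator of rank below n no longer changes from the n-th step on.
  · let step : GrHom B Z → GrHom B Z := fun w =>
      h.lift v (fun j => z j - v.toAlgHom (a j) - w.toAlgHom (b j)) fun j =>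
        Submodule.sub_mem _ (Submodule.sub_mem _ (hz j) (v.map_deg (ha j))) (w.map_deg (hb j))
    let w : ℕ → GrHom B Z := fun n => step^[n] (h.lift v z hz)
    have w_succ : ∀ n, w (n + 1) = step (w n) := fun n => Function.iterate_succ_apply' _ _ _
    have w_base : ∀ n x, (w n).toAlgHom (φ.toAlgHom x) = v.toAlgHom x := by
      intro n x
      cases n with
      | zero => exact h.lift_base _ _ _ x
      | succ n => rw [w_succ]; exact h.lift_base _ _ _ x
    have w_gen : ∀ n j, (w (n + 1)).toAlgHom (e j) =
        z j - v.toAlgHom (a j) - (w n).toAlgHom (b j) := by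
      intro n j
      rw [w_succ]
      exact h.lift_gen _ _ _ j
    have stable : ∀ n j, rk j < n → (w (n + 1)).toAlgHom (e j) = (w n).toAlgHom (e j) := by
      intro n
      induction n with
      | zero => intro j hj; omega
      | succ n ih =>
        intro j hj
        rw [w_gen, w_gen, agree (w (n + 1)) (w n) (rk j)
          (fun x => by rw [w_base, w_base]) (fun i hi => ih i (by omega)) _ (hb' j)]
    have stable' : ∀ k n j, rk j < n → (w (n + k)).toAlgHom (e j) = (w n).toAlgHom (e j) := by
      intro k
      induction k with
      | zero => intro n j _; rfl
      | succ k ih =>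
        intro n j hj
        rw [← add_assoc, stable _ _ (by omega), ih n j hj]
    -- The limit of the iteration: each generator receives its stable value.
    let u : GrHom B Z := h.lift v (fun j => (w (rk j + 1)).toAlgHom (e j)) fun j =>
      (w (rk j + 1)).map_deg (h.1 j)
    refine ⟨u, fun x => h.lift_base _ _ _ x, fun j => ?_⟩
    have hu : u.toAlgHom (b j) = (w (rk j)).toAlgHom (b j) := by
      refine agree u (w (rk j)) (rk j) (fun x => ?_) (fun i hi => ?_) _ (hb' j)
      · rw [w_base]; exact h.lift_base _ _ _ x
      · obtain ⟨k, hk⟩ := Nat.exists_eq_add_of_le (Nat.succ_le_of_lt hi)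
        rw [hk, Nat.succ_eq_add_one, stable' k _ _ (Nat.lt_succ_self _)]
        exact h.lift_gen _ _ _ i
    have h1 : u.toAlgHom (e j) = (w (rk j + 1)).toAlgHom (e j) := h.lift_gen _ _ _ j
    have h2 : u.toAlgHom (φ.toAlgHom (a j)) = v.toAlgHom (a j) := h.lift_base _ _ _ _
    rw [he, map_add, map_add, h1, h2, hu, w_gen]
    abel
  · have key : ∀ n j, rk j < n → w.toAlgHom (e j) = w'.toAlgHom (e j) := by
      intro n
      induction n with
      | zero => intro j hj; omega
      | succ n ih =>
        intro j hj
        have e1 := h2 j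
        have e2 := agree w w' (rk j) h1 (fun i hi => ih i (by omega)) _ (hb' j)
        rw [he, map_add, map_add, map_add, map_add, h1, e2] at e1
        exact add_right_cancel (add_right_cancel e1)
    exact h.hom_ext h1 fun j => key _ j (Nat.lt_succ_self _)

end IsFreeOn

end CDGA

end

section

namespace CDGA

/-! ## The monomial model of free graded commutative algebras -/

namespace Mono

variable {X : Type u} (deg : X → ℤ)

/-- The degree of a monomial. -/
def mdeg (s : Multiset X) : ℤ := (s.map deg).sum

@[simp] theorem mdeg_zero : mdeg deg 0 = 0 := by simp [mdeg]
@[simp] theorem mdeg_add (s t : Multiset X) : mdeg deg (s + t) = mdeg deg s + mdeg deg t := by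
  simp [mdeg]
@[simp] theorem mdeg_cons (j : X) (s : Multiset X) : mdeg deg (j ::ₘ s) = deg j + mdeg deg s := by
  simp [mdeg]
@[simp] theorem mdeg_singleton (j : X) : mdeg deg {j} = deg j := by simp [mdeg]

variable [LinearOrder X]

/-- Generators of odd degree occur at most once. -/
def Reduced (s : Multiset X) : Prop := ∀ x, Odd (deg x) → s.count x ≤ 1

/-- The sign of the transposition of two generators. -/
def swap (i j : X) : ℤˣ := if j < i then (deg i * deg j).negOnePow else 1

/-- The sign of the multiplication of two monomials. -/
def cocycle (s t : Multiset X) : ℤˣ := (s.map fun i => (t.map fun j => swap deg i j).prod).prod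

theorem reduced_zero : Reduced deg (0 : Multiset X) := fun x _ => by simp

variable {deg} in
theorem Reduced.mono {s t : Multiset X} (h : Reduced deg t) (hst : s ≤ t) : Reduced deg s :=
  fun x hx => (Multiset.count_le_of_le x hst).trans (h x hx)

@[simp] theorem cocycle_zero_left (t : Multiset X) : cocycle deg 0 t = 1 := by simp [cocycle]
@[simp] theorem cocycle_zero_right (t : Multiset X) : cocycle deg t 0 = 1 := by simp [cocycle]

theorem cocycle_add_left (s s' t : Multiset X) :
    cocycle deg (s + s') t = cocycle deg s t * cocycle deg s' t := by simp [cocycle]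

theorem cocycle_add_right (s t t' : Multiset X) :
    cocycle deg s (t + t') = cocycle deg s t * cocycle deg s t' := by
  simp [cocycle, Multiset.prod_map_mul]

theorem cocycle_cons_left (j : X) (s t : Multiset X) :
    cocycle deg (j ::ₘ s) t = cocycle deg {j} t * cocycle deg s t := by
  rw [← Multiset.singleton_add, cocycle_add_left]

theorem cocycle_cons_right (j : X) (s t : Multiset X) :
    cocycle deg s (j ::ₘ t) = cocycle deg s {j} * cocycle deg s t := by
  rw [← Multiset.singleton_add, cocycle_add_right]

theorem cocycle_singleton (i j : X) : cocycle deg {i} {j} = swap deg i j := by simp [cocycle]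

theorem units_mul_self (u : ℤˣ) : u * u = 1 := by
  rcases Int.units_eq_one_or u with rfl | rfl <;> simp

theorem swap_comm {i j : X} (h : i = j → ¬ Odd (deg i)) :
    swap deg i j = (deg i * deg j).negOnePow * swap deg j i := by
  unfold swap
  rcases lt_trichotomy i j with hij | rfl | hij
  · rw [if_neg hij.not_gt, if_pos hij, mul_comm (deg j), units_mul_self]
  · rw [if_neg (lt_irrefl i), mul_one]
    exact (Int.negOnePow_even _ ((Int.not_odd_iff_even.1 (h rfl)).mul_left _)).symm
  · rw [if_pos hij, if_neg hij.not_gt, mul_one]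

theorem cocycle_singleton_comm (i : X) (t : Multiset X) (h : Reduced deg (i ::ₘ t)) :
    cocycle deg {i} t = (deg i * mdeg deg t).negOnePow * cocycle deg t {i} := by
  induction t using Multiset.induction with
  | empty => simp
  | cons j t ih =>
    have hij : i = j → ¬ Odd (deg i) := by
      rintro rfl ho
      have := h i ho
      simp at this
    rw [cocycle_cons_right, cocycle_cons_left, cocycle_singleton, cocycle_singleton,
      swap_comm deg hij, ih (h.mono (Multiset.cons_le_cons _ (Multiset.le_cons_self _ _))),
      mdeg_cons, mul_add, Int.negOnePow_add]
    simp only [mul_assoc, mul_comm, mul_left_comm]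

/-- The generators of both monomials are transposed pairwise. Reducedness excludes an odd generator
meeting itself: there `swap` is 1 although the sign rule asks for -1. -/
theorem cocycle_comm (s t : Multiset X) (h : Reduced deg (s + t)) :
    cocycle deg s t = (mdeg deg s * mdeg deg t).negOnePow * cocycle deg t s := by
  induction s using Multiset.induction with
  | empty => simp
  | cons i s ih =>
    rw [Multiset.cons_add] at h
    rw [cocycle_cons_left, cocycle_cons_right deg i t s, mdeg_cons, add_mul, Int.negOnePow_add,
      ih (h.mono (Multiset.le_cons_self _ _)), cocycle_singleton_comm deg i t
        (h.mono (Multiset.cons_le_cons _ (Multiset.le_add_left _ _)))]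
    simp only [mul_assoc, mul_comm, mul_left_comm]

end Mono

open Mono

variable (A : CDGA.{u}) {X : Type u} [LinearOrder X] (deg : X → ℤ)

/-- Polynomials with coefficients in `A`. -/
def Poly : Type u := {s : Multiset X // Reduced deg s} →₀ A

namespace Poly

instance : AddCommGroup (Poly A deg) := inferInstanceAs (AddCommGroup (_ →₀ A))
instance : Module ℂ (Poly A deg) := inferInstanceAs (Module ℂ (_ →₀ A))

/-- The monomial `a xˢ` for reduced `s`. -/
def lsingle (s : {s : Multiset X // Reduced deg s}) : A →ₗ[ℂ] Poly A deg := Finsupp.lsingle s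

open Classical in
/-- The monomial `a xˢ`; it is zero if `s` is not reduced. -/
def mono (s : Multiset X) : A →ₗ[ℂ] Poly A deg :=
  if h : Reduced deg s then lsingle A deg ⟨s, h⟩ else 0

variable {A deg}

theorem mono_of_not {s : Multiset X} (h : ¬ Reduced deg s) (a : A) : mono A deg s a = 0 := by
  rw [mono, dif_neg h]
  rfl

theorem single_eq (s : {s : Multiset X // Reduced deg s}) (a : A) :
    (Finsupp.single s a : Poly A deg) = mono A deg s.1 a := by
  rw [mono, dif_pos s.2]
  rfl

/-- The coefficient of a monomial. -/
def coeff (s : {s : Multiset X // Reduced deg s}) : Poly A deg →ₗ[ℂ] A := Finsupp.lapply s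

open Classical in
theorem coeff_mono (s : {s : Multiset X // Reduced deg s}) (t : Multiset X) (a : A) :
    coeff s (mono A deg t a) = if t = s.1 then a else 0 := by
  by_cases h : Reduced deg t
  · rw [mono, dif_pos h]
    change (Finsupp.single (⟨t, h⟩ : {s : Multiset X // Reduced deg s}) a) s = _
    rw [Finsupp.single_apply]
    simp only [Subtype.ext_iff]
  · rw [mono_of_not h, map_zero, if_neg]
    rintro rfl
    exact h s.2

@[ext] theorem ext_coeff {x y : Poly A deg} (h : ∀ s, coeff s x = coeff s y) : x = y :=
  Finsupp.ext h

theorem induction_mono {P : Poly A deg → Prop} (h0 : P 0) (hadd : ∀ x y, P x → P y → P (x + y))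
    (hm : ∀ s, Reduced deg s → ∀ a, P (mono A deg s a)) (x : Poly A deg) : P x := by
  refine Finsupp.induction_linear (motive := P) x h0 hadd fun s a => ?_
  rw [single_eq]
  exact hm s.1 s.2 a

theorem lin_ext {M : Type*} [AddCommGroup M] [Module ℂ M] {f g : Poly A deg →ₗ[ℂ] M}
    (h : ∀ s a, f (mono A deg s a) = g (mono A deg s a)) : f = g :=
  LinearMap.ext fun x => induction_mono (P := fun x => f x = g x) (by simp)
    (fun x y hx hy => by rw [map_add, map_add, hx, hy]) (fun s _ a => h s a) x

/-- The linear map with given values on monomials. -/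
def lsum {M : Type*} [AddCommGroup M] [Module ℂ M] (f : Multiset X → A →ₗ[ℂ] M) :
    Poly A deg →ₗ[ℂ] M :=
  Finsupp.lsum ℂ (fun s : {s : Multiset X // Reduced deg s} => f s.1)

theorem lsum_mono {M : Type*} [AddCommGroup M] [Module ℂ M] (f : Multiset X → A →ₗ[ℂ] M)
    {s : Multiset X} (h : Reduced deg s) (a : A) : lsum f (mono A deg s a) = f s a := by
  rw [mono, dif_pos h]
  change Finsupp.lsum ℂ _ (Finsupp.single _ _) = _
  rw [Finsupp.lsum_single]

theorem lsum_mono' {M : Type*} [AddCommGroup M] [Module ℂ M] (f : Multiset X → A →ₗ[ℂ] M)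
    (hf : ∀ s, ¬ Reduced deg s → f s = 0) (s : Multiset X) (a : A) :
    lsum f (mono A deg s a) = f s a := by
  by_cases h : Reduced deg s
  · exact lsum_mono f h a
  · rw [mono_of_not h, map_zero, hf s h]
    rfl

variable (A deg) in
/-- The product of monomials. -/
def mulMono (s t : Multiset X) : A →ₗ[ℂ] A →ₗ[ℂ] Poly A deg :=
  ((LinearMap.mul ℂ A).compl₂ (A.sgn (mdeg deg s)).toLinearMap).compr₂
    (cocycle deg s t • mono A deg (s + t))

theorem mulMono_apply (s t : Multiset X) (a b : A) : mulMono A deg s t a b =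
    cocycle deg s t • mono A deg (s + t) (a * A.sgn (mdeg deg s) b) := rfl

variable (A deg) in
/-- The multiplication as a bilinear map. -/
def mulLin : Poly A deg →ₗ[ℂ] Poly A deg →ₗ[ℂ] Poly A deg :=
  lsum fun s => LinearMap.flip (lsum fun t => (mulMono A deg s t).flip)

instance : Mul (Poly A deg) := ⟨fun x y => mulLin A deg x y⟩
instance : One (Poly A deg) := ⟨mono A deg 0 1⟩

theorem mul_def (x y : Poly A deg) : x * y = mulLin A deg x y := rfl
theorem one_def : (1 : Poly A deg) = mono A deg 0 1 := rfl

/-- Since `mono` vanishes on multisets that are not reduced, and a sum with such a multiset is not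
reduced either, the formula needs no case distinction; this is what makes associativity a
computation with signs alone. -/
theorem mono_mul_mono (s t : Multiset X) (a b : A) : mono A deg s a * mono A deg t b =
    cocycle deg s t • mono A deg (s + t) (a * A.sgn (mdeg deg s) b) := by
  rw [mul_def, mulLin]
  by_cases h : Reduced deg s
  · by_cases h' : Reduced deg t
    · rw [lsum_mono _ h, LinearMap.flip_apply, lsum_mono _ h', LinearMap.flip_apply,
        mulMono_apply]
    · have h2 : ¬ Reduced deg (s + t) := fun h => h' (h.mono (Multiset.le_add_left _ _))
      rw [mono_of_not h', map_zero, mono_of_not h2, smul_zero]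
  · have h2 : ¬ Reduced deg (s + t) := fun h' => h (h'.mono (Multiset.le_add_right _ _))
    rw [mono_of_not h, map_zero, mono_of_not h2, smul_zero]
    rfl

protected theorem mul_add (x y z : Poly A deg) : x * (y + z) = x * y + x * z := by
  simp only [mul_def, map_add]

protected theorem add_mul (x y z : Poly A deg) : (x + y) * z = x * z + y * z := by
  simp only [mul_def, map_add, LinearMap.add_apply]

protected theorem mul_units_smul (u : ℤˣ) (x y : Poly A deg) : x * (u • y) = u • (x * y) := by
  simp only [mul_def, CDGA.map_units_smul]

protected theorem units_smul_mul (u : ℤˣ) (x y : Poly A deg) : (u • x) * y = u • (x * y) := by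
  simp only [mul_def, CDGA.map_units_smul]
  rcases Int.units_eq_one_or u with rfl | rfl <;> simp

protected theorem zero_mul (x : Poly A deg) : 0 * x = 0 := by
  simp only [mul_def, map_zero, LinearMap.zero_apply]

protected theorem mul_zero (x : Poly A deg) : x * 0 = 0 := by
  simp only [mul_def, map_zero]

protected theorem mul_assoc (x y z : Poly A deg) : x * y * z = x * (y * z) := by
  refine induction_mono (P := fun x => x * y * z = x * (y * z))
    (by simp only [Poly.zero_mul]) (fun x x' h h' => by simp only [Poly.add_mul, h, h']) ?_ x
  intro s _ a
  refine induction_mono (P := fun y => mono A deg s a * y * z = mono A deg s a * (y * z))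
    (by simp only [Poly.zero_mul, Poly.mul_zero])
    (fun x x' h h' => by simp only [Poly.add_mul, Poly.mul_add, h, h']) ?_ y
  intro t _ b
  refine induction_mono (P := fun z => mono A deg s a * mono A deg t b * z =
      mono A deg s a * (mono A deg t b * z))
    (by simp only [Poly.mul_zero])
    (fun x x' h h' => by simp only [Poly.mul_add, h, h']) ?_ z
  intro r _ c
  rw [mono_mul_mono, mono_mul_mono, Poly.units_smul_mul, Poly.mul_units_smul, mono_mul_mono,
    mono_mul_mono, smul_smul, smul_smul, map_mul (A.sgn _), sgn_sgn, mdeg_add, cocycle_add_left,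
    cocycle_add_right, add_assoc, mul_assoc]
  congr 1
  simp only [mul_assoc, mul_comm]

instance : Ring (Poly A deg) :=
  { (inferInstance : AddCommGroup (Poly A deg)) with
    mul := (· * ·)
    one := 1
    left_distrib := Poly.mul_add
    right_distrib := Poly.add_mul
    zero_mul := Poly.zero_mul
    mul_zero := Poly.mul_zero
    mul_assoc := Poly.mul_assoc
    one_mul := fun x => by
      refine induction_mono (P := fun x => 1 * x = x) (Poly.mul_zero 1)
        (fun x y hx hy => by rw [Poly.mul_add, hx, hy]) (fun s _ a => ?_) x
      rw [one_def, mono_mul_mono]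
      simp
    mul_one := fun x => by
      refine induction_mono (P := fun x => x * 1 = x) (Poly.zero_mul 1)
        (fun x y hx hy => by rw [Poly.add_mul, hx, hy]) (fun s _ a => ?_) x
      rw [one_def, mono_mul_mono]
      simp }

instance : Algebra ℂ (Poly A deg) :=
  Algebra.ofModule (fun r x y => by simp only [mul_def, map_smul, LinearMap.smul_apply])
    (fun r x y => by simp only [mul_def, map_smul])

variable (A deg) in
/-- The component of degree `n`. -/
def degree (n : ℤ) : Submodule ℂ (Poly A deg) where
  carrier := {x | ∀ s, coeff s x ∈ A.deg (n - mdeg deg s.1)}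
  add_mem' hx hy s := by rw [map_add]; exact Submodule.add_mem _ (hx s) (hy s)
  zero_mem' s := by rw [map_zero]; exact Submodule.zero_mem _
  smul_mem' c x hx s := by rw [map_smul]; exact Submodule.smul_mem _ _ (hx s)

theorem mono_mem_degree {n i : ℤ} {s : Multiset X} {a : A} (ha : a ∈ A.deg i)
    (h : i + mdeg deg s = n) : mono A deg s a ∈ degree A deg n := by
  classical
  intro t
  rw [coeff_mono]
  split_ifs with hst
  · rw [← h, hst, add_sub_cancel_right]
    exact ha
  · exact Submodule.zero_mem _

theorem eq_sum (x : Poly A deg) :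
    x = ∑ s ∈ Finsupp.support x, mono A deg s.1 (coeff s x) := by
  conv_lhs => rw [← Finsupp.sum_single x]
  exact Finset.sum_congr rfl fun s _ => single_eq s _

theorem degree_induction {n : ℤ} {P : Poly A deg → Prop} (h0 : P 0)
    (hadd : ∀ x y, P x → P y → P (x + y))
    (hm : ∀ s i, Reduced deg s → i + mdeg deg s = n → ∀ a ∈ A.deg i, P (mono A deg s a))
    {x : Poly A deg} (hx : x ∈ degree A deg n) : P x := by
  rw [eq_sum x]
  exact Finset.sum_induction _ P hadd h0 fun s _ => hm s.1 _ s.2 (by ring) _ (hx s)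

theorem isInternal_degree : DirectSum.IsInternal (degree A deg) := by
  have hm : ∀ n s, ¬ Reduced deg s → mono A deg s ∘ₗ A.proj (n - mdeg deg s) = 0 := by
    intro n s h
    refine LinearMap.ext fun a => ?_
    exact mono_of_not h _
  refine isInternal_of_projections
    (fun n => lsum fun s => mono A deg s ∘ₗ A.proj (n - mdeg deg s))
    (fun n y hy => ?_) (fun n m hnm y hy => ?_) ?_
  · refine degree_induction (P := fun y => lsum _ y = y) (by simp)
      (fun x y hx hy => by rw [map_add, hx, hy]) (fun s i _ hi a ha => ?_) hy
    rw [lsum_mono' _ (hm n), LinearMap.comp_apply, proj_of_mem]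
    rwa [← hi, add_sub_cancel_right]
  · refine degree_induction (P := fun y => lsum _ y = 0) (by simp)
      (fun x y hx hy => by rw [map_add, hx, hy, add_zero]) (fun s i _ hi a ha => ?_) hy
    rw [lsum_mono' _ (hm n), LinearMap.comp_apply, proj_of_ne _ ha, map_zero]
    omega
  · refine eq_top_iff.2 fun x _ => ?_
    refine induction_mono (P := fun x => x ∈ ⨆ n, degree A deg n) (Submodule.zero_mem _)
      (fun x y hx hy => Submodule.add_mem _ hx hy) (fun s _ a => ?_) x
    refine homogeneous_induction (P := fun a => mono A deg s a ∈ ⨆ n, degree A deg n)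
      (by rw [map_zero]; exact Submodule.zero_mem _)
      (fun a b ha hb => by rw [map_add]; exact Submodule.add_mem _ ha hb) (fun i a ha => ?_) a
    exact Submodule.mem_iSup_of_mem (i + mdeg deg s) (mono_mem_degree ha rfl)

theorem units_smul_mem_degree {n : ℤ} {x : Poly A deg} (hx : x ∈ degree A deg n) (u : ℤˣ) :
    u • x ∈ degree A deg n := by
  rcases Int.units_eq_one_or u with rfl | rfl
  · simpa using hx
  · simpa using hx

theorem mul_mem_degree {i j : ℤ} {x y : Poly A deg} (hx : x ∈ degree A deg i)
    (hy : y ∈ degree A deg j) : x * y ∈ degree A deg (i + j) := by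
  refine degree_induction (P := fun x => x * y ∈ degree A deg (i + j))
    (by rw [zero_mul]; exact Submodule.zero_mem _)
    (fun x x' h h' => by rw [add_mul]; exact Submodule.add_mem _ h h')
    (fun s k _ hk a ha => ?_) hx
  refine degree_induction (P := fun y => mono A deg s a * y ∈ degree A deg (i + j))
    (by rw [mul_zero]; exact Submodule.zero_mem _)
    (fun x x' h h' => by rw [mul_add]; exact Submodule.add_mem _ h h')
    (fun t l _ hl b hb => ?_) hy
  rw [mono_mul_mono]
  refine units_smul_mem_degree (mono_mem_degree (A.mul_mem ha (sgn_mem _ hb)) ?_) _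
  rw [mdeg_add]
  omega

theorem mul_comm_degree {i j : ℤ} {x y : Poly A deg} (hx : x ∈ degree A deg i)
    (hy : y ∈ degree A deg j) : x * y = (i * j).negOnePow • (y * x) := by
  refine degree_induction (P := fun x => x * y = (i * j).negOnePow • (y * x))
    (by rw [zero_mul, mul_zero, smul_zero])
    (fun x x' h h' => by rw [add_mul, mul_add, smul_add, h, h'])
    (fun s k _ hk a ha => ?_) hx
  refine degree_induction
    (P := fun y => mono A deg s a * y = (i * j).negOnePow • (y * mono A deg s a))
    (by rw [zero_mul, mul_zero, smul_zero])
    (fun x x' h h' => by rw [add_mul, mul_add, smul_add, h, h'])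
    (fun t l _ hl b hb => ?_) hy
  rw [mono_mul_mono, mono_mul_mono, add_comm t s]
  by_cases h : Reduced deg (s + t)
  · rw [cocycle_comm deg s t h, sgn_of_mem _ hb, sgn_of_mem _ ha, mul_smul_comm, mul_smul_comm,
      A.comm ha hb]
    simp only [CDGA.map_units_smul, smul_smul]
    congr 1
    rw [mul_left_comm _ (cocycle deg t s), mul_comm _ (cocycle deg t s), mul_assoc]
    congr 1
    simp only [← Int.negOnePow_add]
    refine negOnePow_congr (-(mdeg deg t * k)) ?_
    rw [← hk, ← hl]
    ring
  · simp [mono_of_not h]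

end Poly

open CDGA.Poly in
/-- The free graded commutative algebra on generators in given degrees, with the differential
that kills the generators. -/
abbrev free : CDGA.{u} where
  carrier := Poly A deg
  deg := degree A deg
  one_mem := mono_mem_degree A.one_mem (by simp)
  mul_mem := mul_mem_degree
  isInternal := isInternal_degree
  comm := mul_comm_degree
  d := 0
  d_mem _ := Submodule.zero_mem _
  d_d _ := rfl
  leibniz _ _ := by simp

end CDGA

end

/-! ### The universal property of the monomial model -/

section

namespace CDGA

open CDGA.Mono CDGA.Poly

variable {A Z : CDGA.{u}} {X : Type u} [LinearOrder X] {deg : X → ℤ}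

/-- The ordered product of the values of the generators in a monomial. -/
def monoProd (z : X → Z) (s : Multiset X) : Z := ((s.sort (· ≤ ·)).map z).prod

@[simp] theorem monoProd_zero (z : X → Z) : monoProd z 0 = 1 := by simp [monoProd]

/-- The sign rule gives a * a = -(a * a), and 2 is invertible over ℂ. -/
theorem mul_self_eq_zero_of_odd {i : ℤ} (hi : Odd i) {a : Z} (ha : a ∈ Z.deg i) : a * a = 0 := by
  have h := Z.comm ha ha
  rw [Int.negOnePow_odd _ (hi.mul hi), Units.neg_smul, one_smul] at h
  have h2 : (2 : ℂ) • (a * a) = 0 := by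
    rw [two_smul]
    exact eq_neg_iff_add_eq_zero.1 h
  exact (smul_eq_zero.1 h2).resolve_left two_ne_zero

section

variable {z : X → Z} (hz : ∀ j, z j ∈ Z.deg (deg j))

include hz

/-- Insertion into a sorted list moves the new factor past exactly the smaller generators, and these
are the transpositions that `cocycle` counts. -/
theorem mul_prod_sorted (j : X) (l : List X) (hl : l.Pairwise (· ≤ ·)) :
    z j * (l.map z).prod =
      cocycle deg {j} (l : Multiset X) • ((l.orderedInsert (· ≤ ·) j).map z).prod := by
  induction l with
  | nil => simp
  | cons i l ih =>
    rw [List.pairwise_cons] at hl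
    by_cases hij : j ≤ i
    · have h1 : cocycle deg {j} ((i :: l : List X) : Multiset X) = 1 := by
        simp only [cocycle, Multiset.map_singleton, Multiset.prod_singleton, Multiset.map_coe,
          Multiset.prod_coe]
        refine List.prod_eq_one fun x hx => ?_
        obtain ⟨y, hy, rfl⟩ := List.mem_map.1 hx
        refine if_neg (not_lt.2 ?_)
        rcases List.mem_cons.1 hy with rfl | hy
        · exact hij
        · exact hij.trans (hl.1 y hy)
      rw [h1, one_smul, List.orderedInsert_cons_of_le _ _ hij, List.map_cons, List.map_cons,
        List.map_cons, List.prod_cons, List.prod_cons, List.prod_cons]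
    · rw [List.orderedInsert_of_not_le _ _ hij, List.map_cons, List.prod_cons, List.map_cons,
        List.prod_cons, ← mul_assoc, Z.comm (hz j) (hz i), smul_mul_assoc, mul_assoc, ih hl.2,
        mul_smul_comm, smul_smul, ← Multiset.cons_coe, cocycle_cons_right, cocycle_singleton, swap,
        if_pos (not_le.1 hij)]

theorem gen_mul_monoProd (j : X) (s : Multiset X) :
    z j * monoProd z s = cocycle deg {j} s • monoProd z (j ::ₘ s) := by
  have h1 : (j ::ₘ s).sort (· ≤ ·) = (s.sort (· ≤ ·)).orderedInsert (· ≤ ·) j := by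
    refine List.Perm.eq_of_pairwise' (r := (· ≤ ·)) (Multiset.pairwise_sort _ _)
      ((Multiset.pairwise_sort _ _).orderedInsert _ _) ?_
    rw [← Multiset.coe_eq_coe, Multiset.sort_eq]
    have := Multiset.coe_eq_coe.2 (List.perm_orderedInsert (· ≤ ·) j (s.sort (· ≤ ·)))
    rw [this, ← Multiset.cons_coe, Multiset.sort_eq]
  rw [monoProd, mul_prod_sorted hz j _ (Multiset.pairwise_sort _ _), monoProd, h1,
    Multiset.sort_eq]

theorem monoProd_cons (j : X) (s : Multiset X) :
    monoProd z (j ::ₘ s) = cocycle deg {j} s • (z j * monoProd z s) := by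
  rw [gen_mul_monoProd hz, smul_smul, units_mul_self, one_smul]

theorem monoProd_mem (s : Multiset X) : monoProd z s ∈ Z.deg (mdeg deg s) := by
  induction s using Multiset.induction with
  | empty => simpa using Z.one_mem
  | cons j s ih =>
    rw [monoProd_cons hz, mdeg_cons]
    exact negOnePow_smul_mem (Z.mul_mem (hz j) ih) _

/-- The ordered product contains the square of an odd element. -/
theorem monoProd_of_not {s : Multiset X} (h : ¬ Reduced deg s) : monoProd z s = 0 := by
  simp only [Reduced, not_forall, not_le] at h
  obtain ⟨x, hx, hs⟩ := h
  obtain ⟨t, rfl⟩ := Multiset.exists_cons_of_mem (Multiset.one_le_count_iff_mem.1 hs.le)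
  rw [Multiset.count_cons_self] at hs
  obtain ⟨t, rfl⟩ := Multiset.exists_cons_of_mem
    (Multiset.one_le_count_iff_mem.1 (Nat.lt_succ_iff.1 hs))
  rw [monoProd_cons hz, monoProd_cons hz, mul_smul_comm, ← mul_assoc,
    mul_self_eq_zero_of_odd hx (hz x), zero_mul, smul_zero, smul_zero]

theorem monoProd_mul (s t : Multiset X) :
    monoProd z s * monoProd z t = cocycle deg s t • monoProd z (s + t) := by
  induction s using Multiset.induction with
  | empty => simp
  | cons j s ih =>
    rw [monoProd_cons hz, smul_mul_assoc, mul_assoc, ih, mul_smul_comm, gen_mul_monoProd hz,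
      cocycle_cons_left, cocycle_add_right, Multiset.cons_add]
    simp only [smul_smul]
    congr 1
    rw [mul_comm (cocycle deg s t), mul_assoc, ← mul_assoc (cocycle deg {j} s), ← mul_assoc,
      units_mul_self, one_mul]

end

/-- The homomorphism of algebras with given values on coefficients and generators. -/
def polyLift (v : GrHom A Z) (z : X → Z) (hz : ∀ j, z j ∈ Z.deg (deg j)) :
    Poly A deg →ₐ[ℂ] Z :=
  let f : Multiset X → A →ₗ[ℂ] Z := fun s =>
    LinearMap.mulRight ℂ (monoProd z s) ∘ₗ v.toAlgHom.toLinearMap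
  have hf : ∀ s, ¬ Reduced deg s → f s = 0 := fun s hs => by
    refine LinearMap.ext fun a => ?_
    simp [f, monoProd_of_not hz hs]
  have hl : ∀ s a, lsum f (mono A deg s a) = v.toAlgHom a * monoProd z s := fun s a =>
    lsum_mono' f hf s a
  AlgHom.ofLinearMap (lsum f) (by rw [one_def, hl]; simp) (by
    intro x y
    refine induction_mono (P := fun x => lsum f (x * y) = lsum f x * lsum f y)
      (by simp) (fun x x' h h' => by simp only [add_mul, map_add, h, h']) (fun s _ a => ?_) x
    refine induction_mono (P := fun y => lsum f (mono A deg s a * y) =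
      lsum f (mono A deg s a) * lsum f y)
      (by simp) (fun x x' h h' => by simp only [mul_add, map_add, h, h']) (fun t _ b => ?_) y
    rw [mono_mul_mono, CDGA.map_units_smul, hl, hl, hl, mul_assoc, ← mul_assoc (monoProd z s),
      mul_comm_sgn (monoProd_mem hz s), mul_assoc, monoProd_mul hz, map_mul, v.map_sgn,
      mul_smul_comm, mul_smul_comm, mul_assoc])

theorem polyLift_mono (v : GrHom A Z) (z : X → Z) (hz : ∀ j, z j ∈ Z.deg (deg j))
    (s : Multiset X) (a : A) :
    polyLift v z hz (mono A deg s a) = v.toAlgHom a * monoProd z s :=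
  lsum_mono' (fun s => LinearMap.mulRight ℂ (monoProd z s) ∘ₗ v.toAlgHom.toLinearMap)
    (fun s hs => by
      refine LinearMap.ext fun a => ?_
      simp [monoProd_of_not hz hs]) s a

/-- The homomorphism on the free algebra with given values on coefficients and generators. -/
def freeLift (v : GrHom A Z) (z : X → Z) (hz : ∀ j, z j ∈ Z.deg (deg j)) :
    GrHom (free A deg) Z where
  toAlgHom := polyLift v z hz
  map_deg := fun {i x} hx => by
    refine degree_induction (P := fun x => polyLift v z hz x ∈ Z.deg i)
      (by rw [map_zero]; exact Submodule.zero_mem _)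
      (fun x y h h' => by rw [map_add]; exact Submodule.add_mem _ h h') ?_ hx
    intro s k _ hk a ha
    rw [polyLift_mono, ← hk]
    exact Z.mul_mem (v.map_deg ha) (monoProd_mem hz s)

theorem freeLift_mono (v : GrHom A Z) (z : X → Z) (hz : ∀ j, z j ∈ Z.deg (deg j))
    (s : Multiset X) (a : A) :
    (freeLift v z hz).toAlgHom (mono A deg s a) = v.toAlgHom a * monoProd z s :=
  polyLift_mono v z hz s a

variable (A deg) in
/-- The inclusion of the coefficients. -/
def freeIncl : GrHom A (free A deg) where
  toAlgHom := (AlgHom.ofLinearMap (mono A deg 0) rfl (fun a b => by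
    rw [mono_mul_mono]
    simp) : A →ₐ[ℂ] Poly A deg)
  map_deg h := mono_mem_degree h (by simp)

variable (A) in
/-- The generators. -/
def freeGen (deg : X → ℤ) (j : X) : free A deg := mono A deg {j} 1

theorem freeIncl_apply (a : A) : (freeIncl A deg).toAlgHom a = mono A deg 0 a := rfl

theorem freeGen_mem (j : X) : freeGen A deg j ∈ (free A deg).deg (deg j) :=
  mono_mem_degree A.one_mem (by simp)

theorem monoProd_gen (s : Multiset X) : monoProd (freeGen A deg) s = mono A deg s 1 := by
  induction s using Multiset.induction with
  | empty => simp; rfl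
  | cons j s ih =>
    rw [monoProd_cons freeGen_mem, ih]
    have : freeGen A deg j * (mono A deg s 1 : free A deg) =
      cocycle deg {j} s • (mono A deg (j ::ₘ s) 1 : free A deg) := by
      refine (mono_mul_mono {j} s 1 1).trans ?_
      simp [Multiset.singleton_add]
    rw [this, smul_smul, units_mul_self, one_smul]

theorem mono_eq (s : Multiset X) (a : A) : (mono A deg s a : free A deg) =
    (freeIncl A deg).toAlgHom a * monoProd (freeGen A deg) s := by
  rw [monoProd_gen]
  refine Eq.trans ?_ (mono_mul_mono (A := A) (deg := deg) 0 s a 1).symm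
  simp

theorem map_monoProd {B : CDGA.{u}} (w : GrHom B Z) (z : X → B) (s : Multiset X) :
    w.toAlgHom (monoProd z s) = monoProd (fun j => w.toAlgHom (z j)) s := by
  simp [monoProd, map_list_prod, Function.comp_def]

-- The lift sends a monomial to the image of its coefficient times the ordered product of the values
-- of its generators; that product obeys the same cocycle as the monomials (`monoProd_mul`), which
-- gives multiplicativity. Uniqueness holds because every monomial is such a product.
variable (A deg) in
theorem isFreeOn_free : IsFreeOn (freeIncl A deg) deg (freeGen A deg) := by
  refine IsFreeOn.of_lift freeGen_mem (fun Z v z hz => ⟨freeLift v z hz, fun a => ?_, fun j => ?_⟩)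
    fun Z w w' h1 h2 => GrHom.ext_fun fun x => ?_
  · rw [freeIncl_apply, freeLift_mono, monoProd_zero, mul_one]
  · rw [freeGen, freeLift_mono, map_one, one_mul, ← mul_one (z j), ← monoProd_zero z,
      gen_mul_monoProd hz]
    simp
  · refine induction_mono (P := fun x => w.toAlgHom x = w'.toAlgHom x)
      ((map_zero w.toAlgHom).trans (map_zero w'.toAlgHom).symm)
      (fun x y hx hy => ?_) (fun s _ a => ?_) x
    · exact (map_add w.toAlgHom x y).trans
        ((congrArg₂ (· + ·) hx hy).trans (map_add w'.toAlgHom x y).symm)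
    · rw [mono_eq, map_mul, map_mul, h1, map_monoProd, map_monoProd, funext h2]

/-- Homomorphisms of free algebras given by a map of coefficients and an embedding of the
generators act on monomials. -/
theorem freeLift_gen_mono {Y : Type u} [LinearOrder Y] {deg' : Y → ℤ} {A' : CDGA.{u}}
    (v : GrHom A A') (ι : X → Y) (hι : StrictMono ι)
    (w : GrHom (free A deg) (free A' deg'))
    (h1 : ∀ a, w.toAlgHom ((freeIncl A deg).toAlgHom a) =
      (freeIncl A' deg').toAlgHom (v.toAlgHom a))
    (h2 : ∀ j, w.toAlgHom (freeGen A deg j) = freeGen A' deg' (ι j)) (s : Multiset X) (a : A) :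
    w.toAlgHom (mono A deg s a) = mono A' deg' (s.map ι) (v.toAlgHom a) := by
  have h3 : monoProd (fun j => freeGen A' deg' (ι j)) s = monoProd (freeGen A' deg') (s.map ι) := by
    unfold monoProd
    rw [← Multiset.map_sort (r := (· ≤ ·)) (r' := (· ≤ ·)) (f := ι) (s := s)
      (fun a _ b _ => hι.le_iff_le.symm), List.map_map]
    rfl
  refine (congrArg w.toAlgHom (mono_eq s a)).trans ?_
  rw [map_mul, h1, map_monoProd, funext h2, h3]
  exact (mono_eq _ _).symm

/-- Every homogeneous element of a free algebra is a sum of monomials of the same degree. -/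
theorem IsFreeOn.degree_induction {B : CDGA.{u}} {φ : GrHom A B} {e : X → B}
    (h : IsFreeOn φ deg e) {n : ℤ} {P : B → Prop} (h0 : P 0)
    (hadd : ∀ x y, P x → P y → P (x + y))
    (hm : ∀ s i, Reduced deg s → i + mdeg deg s = n → ∀ a ∈ A.deg i,
      P (φ.toAlgHom a * monoProd e s)) {b : B} (hb : b ∈ B.deg n) : P b := by
  let w := h.lift (freeIncl A deg) (freeGen A deg) freeGen_mem
  let w' := (isFreeOn_free A deg).lift φ e h.1
  -- By uniqueness the passage to the monomial model and back is the identity of `B`, so that the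
  -- claim can be checked on images of monomials.
  have hw : w.comp w' = GrHom.id B := h.hom_ext
    (fun a => by rw [GrHom.comp_apply, h.lift_base, lift_base]; rfl)
    (fun j => by rw [GrHom.comp_apply, h.lift_gen, lift_gen]; rfl)
  have hb' : b = w'.toAlgHom (w.toAlgHom b) :=
    (congrArg (fun f : GrHom B B => f.toAlgHom b) hw).symm
  rw [hb']
  refine Poly.degree_induction (A := A) (deg := deg) (P := fun x => P (w'.toAlgHom x))
    ((congrArg P (map_zero w'.toAlgHom)).mpr h0) (fun x y hx hy => ?_) (fun s i hs hi a ha => ?_)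
    (w.map_deg hb)
  · exact (congrArg P (map_add w'.toAlgHom x y)).mpr (hadd _ _ hx hy)
  · have := congrArg w'.toAlgHom (mono_eq (A := A) (deg := deg) s a)
    have h5 : (fun j => w'.toAlgHom (freeGen A deg j)) = e := funext (lift_gen _ _ _ h.1)
    rw [map_mul, lift_base, map_monoProd, h5] at this
    exact (congrArg P this).mpr (hm s i hs hi a ha)

theorem monoProd_mem_adjoin {B : CDGA.{u}} {e : X → B} {s : Multiset X} {T : Set B}
    (h : ∀ j ∈ s, e j ∈ T) : monoProd e s ∈ Algebra.adjoin ℂ T := by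
  refine Subalgebra.list_prod_mem _ fun x hx => ?_
  obtain ⟨j, hj, rfl⟩ := List.mem_map.1 hx
  exact Algebra.subset_adjoin (h j ((Multiset.mem_sort _).1 hj))

end CDGA

end

/-! ### Presheaves of DG algebras: morphisms and derivations given on sections -/

section

variable {W : SimplicialSystem.{u}}

namespace DGPresheaf

open CDGA

variable {F G H : DGPresheaf W}

/-- Restriction as a graded homomorphism. -/
def resG (F : DGPresheaf W) {c' c : Cell W} (h : c' ≤ c) : GrHom (F.sec c) (F.sec c') :=
  gr (F.map (homOfLE h).op)

/-- A morphism on sections as a graded homomorphism. -/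
def apG (f : F ⟶ G) (c : Cell W) : GrHom (F.sec c) (G.sec c) := gr (f.app (op c))

@[simp] theorem apG_toAlgHom (f : F ⟶ G) (c : Cell W) : (apG f c).toAlgHom = ap f c := rfl

theorem res_mem {c' c : Cell W} (h : c' ≤ c) {n : ℤ} {a : F.sec c} (ha : a ∈ (F.sec c).deg n) :
    F.res h a ∈ (F.sec c').deg n := (F.resG h).map_deg ha

theorem ap_mem (f : F ⟶ G) (c : Cell W) {n : ℤ} {a : F.sec c} (ha : a ∈ (F.sec c).deg n) :
    ap f c a ∈ (G.sec c).deg n := (apG f c).map_deg ha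

theorem res_self (c : Cell W) (h : c ≤ c) (a : F.sec c) : F.res h a = a := by
  have : F.map (homOfLE h).op = 𝟙 _ := F.map_id (op c)
  change fn (F.map (homOfLE h).op) a = a
  rw [this]
  rfl

theorem res_res {c'' c' c : Cell W} (h' : c'' ≤ c') (h : c' ≤ c) (a : F.sec c) :
    F.res h' (F.res h a) = F.res (h'.trans h) a := by
  have : F.map (homOfLE (h'.trans h)).op = F.map (homOfLE h).op ≫ F.map (homOfLE h').op := by
    rw [← F.map_comp]
    rfl
  change _ = fn (F.map (homOfLE (h'.trans h)).op) a
  rw [this]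
  rfl

theorem res_d {c' c : Cell W} (h : c' ≤ c) (a : F.sec c) :
    F.res h ((F.sec c).d a) = (F.sec c').d (F.res h a) :=
  CDGA.Hom.map_d (F.map (homOfLE h).op) a

theorem ap_d (f : F ⟶ G) (c : Cell W) (a : F.sec c) :
    ap f c ((F.sec c).d a) = (G.sec c).d (ap f c a) :=
  CDGA.Hom.map_d (f.app (op c)) a

theorem res_ap (f : F ⟶ G) {c' c : Cell W} (h : c' ≤ c) (a : F.sec c) :
    G.res h (ap f c a) = ap f c' (F.res h a) :=
  (congrArg (fun g : F.sec c ⟶ G.sec c' => fn g a) (f.naturality (homOfLE h).op)).symm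

@[simp] theorem ap_comp (f : F ⟶ G) (g : G ⟶ H) (c : Cell W) (a : F.sec c) :
    ap (f ≫ g) c a = ap g c (ap f c a) := rfl

@[simp] theorem ap_id (c : Cell W) (a : F.sec c) : ap (𝟙 F) c a = a := rfl

theorem hom_ext_ap {f g : F ⟶ G} (h : ∀ c a, ap f c a = ap g c a) : f = g := by
  refine NatTrans.ext (funext fun c => ?_)
  refine CDGA.Hom.ext' (AlgHom.ext fun a => ?_)
  exact h c.unop a

/-- A morphism given by compatible homomorphisms on sections. -/
def homMk (w : ∀ c, GrHom (F.sec c) (G.sec c))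
    (hn : ∀ {c' c : Cell W} (h : c' ≤ c) (a : F.sec c),
      G.res h ((w c).toAlgHom a) = (w c').toAlgHom (F.res h a))
    (hd : ∀ c a, (w c).toAlgHom ((F.sec c).d a) = (G.sec c).d ((w c).toAlgHom a)) : F ⟶ G where
  app c := (⟨w c.unop, hd c.unop⟩ : CDGA.Hom _ _)
  naturality c c' f := by
    refine CDGA.Hom.ext' (AlgHom.ext fun a => ?_)
    exact (hn (leOfHom f.unop) a).symm

@[simp] theorem ap_homMk (w : ∀ c, GrHom (F.sec c) (G.sec c))
    (hn : ∀ {c' c : Cell W} (h : c' ≤ c) (a : F.sec c),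
      G.res h ((w c).toAlgHom a) = (w c').toAlgHom (F.res h a))
    (hd : ∀ c a, (w c).toAlgHom ((F.sec c).d a) = (G.sec c).d ((w c).toAlgHom a)) (c : Cell W)
    (a : F.sec c) : ap (homMk w hn hd) c a = (w c).toAlgHom a := rfl

/-- A morphism that is bijective on sections is an isomorphism. -/
theorem isIso_of_inverse (f : F ⟶ G) (w : ∀ c, GrHom (G.sec c) (F.sec c))
    (h1 : ∀ c a, (w c).toAlgHom (ap f c a) = a) (h2 : ∀ c a, ap f c ((w c).toAlgHom a) = a) :
    IsIso f := by
  have inj : ∀ c, Function.Injective (ap f c) := fun c =>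
    Function.LeftInverse.injective (h1 c)
  refine ⟨homMk w (fun {c' c} h a => ?_) (fun c a => ?_), hom_ext_ap fun c a => ?_,
    hom_ext_ap fun c a => ?_⟩
  · apply inj
    rw [h2, ← res_ap, h2]
  · apply inj
    rw [h2, ap_d, h2]
  · rw [ap_comp, ap_homMk, h1, ap_id]
  · rw [ap_comp, ap_homMk, h2, ap_id]

/-- A derivation on the sections over a cell. -/
def Der.grDer {f : F ⟶ G} {n : ℤ} (D : Der f n) (c : Cell W) : GrDer (apG f c) n :=
  GrDer.mk' (D.app c) (D.app_deg c) fun ha _ => D.leibniz c ha _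

@[simp] theorem Der.grDer_lin {f : F ⟶ G} {n : ℤ} (D : Der f n) (c : Cell W) (a : F.sec c) :
    (D.grDer c).lin a = D.app c a := rfl

/-- Derivations given on sections. -/
def Der.ofGrDer {f : F ⟶ G} {n : ℤ} (D : ∀ c, GrDer (apG f c) n)
    (hn : ∀ {c' c : Cell W} (h : c' ≤ c) (a : F.sec c),
      G.res h ((D c).lin a) = (D c').lin (F.res h a)) : Der f n where
  app c := (D c).lin
  app_deg c := (D c).map_deg
  leibniz c {i a} ha b := by
    rw [(D c).leibniz, sgn_of_mem n ha, map_units_smul, smul_mul_assoc]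
    rfl
  natural := hn

end DGPresheaf

namespace Gens

open CDGA DGPresheaf

variable (G : Gens W)

instance (c : Cell W) : LinearOrder (G.At c) :=
  letI : LinearOrder G.idx := IsWellOrder.linearOrder WellOrderingRel
  inferInstanceAs (LinearOrder {j : G.idx // G.face j ≤ c.face})

/-- The degrees of the generators over a cell. -/
def degAt (c : Cell W) (j : G.At c) : ℤ := G.deg j.1

/-- The generators over a cell are generators over smaller cells. -/
def incl {c' c : Cell W} (h : c' ≤ c) (j : G.At c) : G.At c' := ⟨j.1, j.2.trans h.fst⟩

theorem incl_strictMono {c' c : Cell W} (h : c' ≤ c) : StrictMono (G.incl h) :=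
  fun _ _ hij => hij

/-- A generator over its own simplex. -/
def self (j : G.idx) : G.At (Cell.whole (G.face j)) := ⟨j, le_refl (G.face j)⟩

variable {G} {A B C : DGPresheaf W} {φ : A ⟶ B} {e : G.Sections B}

theorem resTo_self (e : G.Sections B) (j : G.idx) : G.resTo e _ (G.self j) = e j :=
  res_self _ _ _

theorem res_resTo (e : G.Sections B) {c' c : Cell W} (h : c' ≤ c) (j : G.At c) :
    B.res h (G.resTo e c j) = G.resTo e c' (G.incl h j) := res_res _ _ _

theorem resTo_eq (e : G.Sections B) {c : Cell W} (j : G.At c) :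
    G.resTo e c j = B.res (Cell.le_whole j.2) (e j.1) := rfl

theorem ap_resTo (f : B ⟶ C) (e : G.Sections B) {c : Cell W} (j : G.At c) :
    ap f c (G.resTo e c j) = G.resTo (fun j => ap f _ (e j)) c j := (res_ap f _ _).symm

theorem resTo_mem {e : G.Sections B} (he : ∀ j, e j ∈ (B.sec _).deg (G.deg j)) (c : Cell W)
    (j : G.At c) : G.resTo e c j ∈ (B.sec c).deg (G.degAt c j) := res_mem _ (he j.1)

theorem isFree_iff : G.IsFree φ e ↔ (∀ j, e j ∈ (B.sec _).deg (G.deg j)) ∧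
    ∀ c, IsFreeOn (apG φ c) (G.degAt c) (G.resTo e c) :=
  ⟨fun h => ⟨h.1, fun c => ⟨resTo_mem h.1 c, h.2 c⟩⟩, fun h => ⟨h.1, fun c => (h.2 c).2⟩⟩

theorem IsFree.on (h : G.IsFree φ e) (c : Cell W) :
    IsFreeOn (apG φ c) (G.degAt c) (G.resTo e c) := (isFree_iff.1 h).2 c

/-- Homogeneous elements of degree `n` as values of the generators. -/
theorem resTo_mem' {e : G.Sections B} {n : ℤ} (he : ∀ j, e j ∈ (B.sec _).deg (G.deg j + n))
    (c : Cell W) (j : G.At c) : G.resTo e c j ∈ (B.sec c).deg (G.degAt c j + n) :=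
  res_mem _ (he j.1)

/-- The graded homomorphism out of a free algebra given by its values on the generators. -/
def IsFree.gr (h : G.IsFree φ e) (v : A ⟶ C) (z : G.Sections C)
    (hz : ∀ j, z j ∈ (C.sec _).deg (G.deg j)) (c : Cell W) : GrHom (B.sec c) (C.sec c) :=
  (h.on c).lift (apG v c) (G.resTo z c) (resTo_mem hz c)

theorem IsFree.gr_base (h : G.IsFree φ e) (v : A ⟶ C) (z : G.Sections C)
    (hz : ∀ j, z j ∈ (C.sec _).deg (G.deg j)) (c : Cell W) (a : A.sec c) :
    (h.gr v z hz c).toAlgHom (ap φ c a) = ap v c a := (h.on c).lift_base _ _ _ a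

theorem IsFree.gr_gen (h : G.IsFree φ e) (v : A ⟶ C) (z : G.Sections C)
    (hz : ∀ j, z j ∈ (C.sec _).deg (G.deg j)) (c : Cell W) (j : G.At c) :
    (h.gr v z hz c).toAlgHom (G.resTo e c j) = G.resTo z c j := (h.on c).lift_gen _ _ _ j

theorem IsFree.res_gr (h : G.IsFree φ e) (v : A ⟶ C) (z : G.Sections C)
    (hz : ∀ j, z j ∈ (C.sec _).deg (G.deg j)) {c' c : Cell W} (hc : c' ≤ c) (a : B.sec c) :
    C.res hc ((h.gr v z hz c).toAlgHom a) = (h.gr v z hz c').toAlgHom (B.res hc a) := by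
  have : (h.gr v z hz c).comp (C.resG hc) = (B.resG hc).comp (h.gr v z hz c') :=
    (h.on c).hom_ext (fun a => by
        change C.res hc ((h.gr v z hz c).toAlgHom (ap φ c a)) =
          (h.gr v z hz c').toAlgHom (B.res hc (ap φ c a))
        rw [gr_base, res_ap, res_ap, gr_base])
      (fun j => by
        change C.res hc ((h.gr v z hz c).toAlgHom (G.resTo e c j)) =
          (h.gr v z hz c').toAlgHom (B.res hc (G.resTo e c j))
        rw [gr_gen, res_resTo, res_resTo, gr_gen])
  exact congrArg (fun f : GrHom _ _ => f.toAlgHom a) this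

/-- A morphism out of a free algebra given by its values on the generators. -/
theorem IsFree.exists_hom (h : G.IsFree φ e) (v : A ⟶ C) (z : G.Sections C)
    (hz : ∀ j, z j ∈ (C.sec _).deg (G.deg j))
    (hd : ∀ j, (h.gr v z hz _).toAlgHom ((B.sec _).d (e j)) = (C.sec _).d (z j)) :
    ∃ w : B ⟶ C, φ ≫ w = v ∧ ∀ j, ap w _ (e j) = z j := by
  let w : ∀ c, GrHom (B.sec c) (C.sec c) := h.gr v z hz
  have wb : ∀ c a, (w c).toAlgHom (ap φ c a) = ap v c a := h.gr_base v z hz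
  have wg : ∀ c j, (w c).toAlgHom (G.resTo e c j) = G.resTo z c j := h.gr_gen v z hz
  have hn : ∀ {c' c : Cell W} (hc : c' ≤ c) (a : B.sec c),
      C.res hc ((w c).toAlgHom a) = (w c').toAlgHom (B.res hc a) := h.res_gr v z hz
  have hd' : ∀ c a, (w c).toAlgHom ((B.sec c).d a) = (C.sec c).d ((w c).toAlgHom a) := by
    intro c a
    let D1 : GrDer (w c) 1 := (B.sec c).dDer.comp (w c)
    let D2 : GrDer (w c) 1 := (C.sec c).dDer.precomp (w c)
    have : D1 = D2 := (h.on c).der_ext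
      (fun a => by
        change (w c).toAlgHom ((B.sec c).d (ap φ c a)) =
          (C.sec c).d ((w c).toAlgHom (ap φ c a))
        rw [← ap_d, wb, wb, ap_d])
      (fun j => by
        change (w c).toAlgHom ((B.sec c).d (G.resTo e c j)) =
          (C.sec c).d ((w c).toAlgHom (G.resTo e c j))
        rw [wg, resTo_eq, ← res_d, ← hn, resTo_eq, ← res_d]
        congr 1
        exact hd j.1)
    exact congrArg (fun f : GrDer _ _ => f.lin a) this
  refine ⟨homMk w hn hd', hom_ext_ap wb, fun j => ?_⟩
  rw [ap_homMk, ← resTo_self e j, wg, resTo_self]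

theorem IsFree.hom_ext (h : G.IsFree φ e) {w w' : B ⟶ C} (h1 : φ ≫ w = φ ≫ w')
    (h2 : ∀ j, ap w _ (e j) = ap w' _ (e j)) : w = w' := by
  refine hom_ext_ap fun c a => ?_
  have : apG w c = apG w' c := (h.on c).hom_ext
    (fun a => congrArg (fun f : A ⟶ C => ap f c a) h1)
    (fun j => by
      change ap w c (G.resTo e c j) = ap w' c (G.resTo e c j)
      rw [ap_resTo, ap_resTo, resTo_eq, resTo_eq, h2])
  exact congrArg (fun f : GrHom _ _ => f.toAlgHom a) this

/-- A derivation of a free algebra given by its restriction to the coefficients and its values on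
the generators. -/
theorem IsFree.exists_der (h : G.IsFree φ e) (f : B ⟶ C) {n : ℤ} (DA : Der (φ ≫ f) n)
    (y : G.Sections C) (hy : ∀ j, y j ∈ (C.sec _).deg (G.deg j + n)) :
    ∃ D : Der f n, (∀ c a, D.app c (ap φ c a) = DA.app c a) ∧ ∀ j, D.app _ (e j) = y j := by
  let D : ∀ c, GrDer (apG f c) n := fun c =>
    (h.on c).extendDer (apG f c) (DA.grDer c) (G.resTo y c) (resTo_mem' hy c)
  have Db : ∀ c a, (D c).lin (ap φ c a) = DA.app c a := fun c a =>
    (h.on c).extendDer_base _ _ _ _ a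
  have Dg : ∀ c j, (D c).lin (G.resTo e c j) = G.resTo y c j :=
    fun c j => (h.on c).extendDer_gen _ _ _ _ j
  have hn : ∀ {c' c : Cell W} (hc : c' ≤ c) (a : B.sec c),
      C.res hc ((D c).lin a) = (D c').lin (B.res hc a) := by
    intro c' c hc a
    let D1 : GrDer ((apG f c).comp (C.resG hc)) n := (D c).comp (C.resG hc)
    let D2 : GrDer ((B.resG hc).comp (apG f c')) n := (D c').precomp (B.resG hc)
    have hf : (B.resG hc).comp (apG f c') = (apG f c).comp (C.resG hc) :=
      GrHom.ext_fun fun a => (res_ap f hc a).symm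
    -- The two derivations live along homomorphisms that are equal but not by definition.
    -- Generalizing over the homomorphism allows the equality to be substituted before uniqueness is
    -- applied.
    have key : ∀ (g : GrHom (B.sec c) (C.sec c')) (D2 : GrDer g n),
        g = (apG f c).comp (C.resG hc) →
        (∀ a, D1.lin (ap φ c a) = D2.lin (ap φ c a)) →
        (∀ j, D1.lin (G.resTo e c j) = D2.lin (G.resTo e c j)) → D1.lin a = D2.lin a := by
      rintro g D2 rfl h1 h2
      exact congrArg (fun D : GrDer _ _ => D.lin a) ((h.on c).der_ext (D := D1) h1 h2)
    refine key _ D2 hf (fun a => ?_) fun j => ?_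
    · change C.res hc ((D c).lin (ap φ c a)) = (D c').lin (B.res hc (ap φ c a))
      rw [Db, res_ap, Db, DA.natural]
    · change C.res hc ((D c).lin (G.resTo e c j)) = (D c').lin (B.res hc (G.resTo e c j))
      rw [Dg, res_resTo, res_resTo, Dg]
  refine ⟨Der.ofGrDer D hn, Db, fun j => ?_⟩
  change (D _).lin (e j) = _
  have := Dg _ (G.self j)
  rwa [resTo_self, resTo_self] at this

end Gens

end

/-! ### Free algebras with prescribed differential, and base change -/

section

namespace CDGA

variable {A B : CDGA.{u}}

/-- The same graded algebra with another differential. -/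
abbrev twist (A : CDGA.{u}) (D : GrDer (GrHom.id A) 1) (h : ∀ a, D.lin (D.lin a) = 0) :
    CDGA.{u} where
  carrier := A
  deg := A.deg
  one_mem := A.one_mem
  mul_mem := A.mul_mem
  isInternal := A.isInternal
  comm := A.comm
  d := D.lin
  d_mem := D.map_deg
  d_d := h
  leibniz ha b := by
    rw [D.leibniz, sgn_of_mem 1 ha, one_mul, map_units_smul, smul_mul_assoc]
    rfl

/-- The identity as a map to the algebra with another differential. -/
def toTwist (D : GrDer (GrHom.id A) 1) (h : ∀ a, D.lin (D.lin a) = 0) :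
    GrHom A (A.twist D h) := ⟨AlgHom.id ℂ A, fun h => h⟩

/-- The identity as a map from the algebra with another differential. -/
def ofTwist (D : GrDer (GrHom.id A) 1) (h : ∀ a, D.lin (D.lin a) = 0) :
    GrHom (A.twist D h) A := ⟨AlgHom.id ℂ A, fun h => h⟩

/-- The universal property concerns graded homomorphisms and does not see the differential of `B`.
-/
theorem IsFreeOn.twist {φ : GrHom A B} {X : Type u} {deg : X → ℤ} {e : X → B}
    (hf : IsFreeOn φ deg e) (D : GrDer (GrHom.id B) 1) (h : ∀ a, D.lin (D.lin a) = 0) :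
    IsFreeOn (φ.comp (toTwist D h)) deg e :=
  of_lift hf.1
    (fun _ v z hz => ⟨(ofTwist D h).comp (hf.lift v z hz), hf.lift_base v z hz,
      hf.lift_gen v z hz⟩)
    fun _ w w' h1 h2 => by
      have := hf.hom_ext (w := (toTwist D h).comp w) (w' := (toTwist D h).comp w') h1 h2
      exact GrHom.ext_fun fun a => congrArg (fun f : GrHom B _ => f.toAlgHom a) this

end CDGA

variable {W : SimplicialSystem.{u}}

namespace Gens

open CDGA DGPresheaf

variable (A : DGPresheaf W) (G : Gens W)

/-- The free graded commutative algebra on the generators over a cell. -/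
abbrev freeSec (c : Cell W) : CDGA.{u} := free (A.sec c) (G.degAt c)

/-- Restriction of elements of the free algebra. -/
def freeRes {c' c : Cell W} (h : c' ≤ c) : GrHom (freeSec A G c) (freeSec A G c') :=
  (isFreeOn_free _ _).lift ((A.resG h).comp (freeIncl _ _)) (fun j => freeGen _ _ (G.incl h j))
    fun j => freeGen_mem (G.incl h j)

variable {A G}

theorem freeRes_incl {c' c : Cell W} (h : c' ≤ c) (a : A.sec c) :
    (freeRes A G h).toAlgHom ((freeIncl _ _).toAlgHom a) = (freeIncl _ _).toAlgHom (A.res h a) :=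
  (isFreeOn_free _ _).lift_base _ _ _ a

theorem freeRes_gen {c' c : Cell W} (h : c' ≤ c) (j : G.At c) :
    (freeRes A G h).toAlgHom (freeGen (A.sec c) (G.degAt c) j) = freeGen _ _ (G.incl h j) :=
  (isFreeOn_free _ _).lift_gen _ _ (fun j => freeGen_mem (G.incl h j)) j

theorem freeRes_mono {c' c : Cell W} (h : c' ≤ c) (s : Multiset (G.At c)) (a : A.sec c) :
    (freeRes A G h).toAlgHom (Poly.mono _ _ s a) =
      Poly.mono _ _ (s.map (G.incl h)) (A.res h a) :=
  freeLift_gen_mono (A.resG h) (G.incl h) (G.incl_strictMono h) _ (freeRes_incl h)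
    (freeRes_gen h) s a

theorem freeRes_self (c : Cell W) (h : c ≤ c) : freeRes A G h = GrHom.id _ :=
  (isFreeOn_free _ _).hom_ext (fun a => by rw [freeRes_incl, res_self]; rfl)
    fun j => by rw [freeRes_gen]; rfl

theorem freeRes_comp {c'' c' c : Cell W} (h' : c'' ≤ c') (h : c' ≤ c) :
    (freeRes A G h).comp (freeRes A G h') = freeRes A G (h'.trans h) :=
  (isFreeOn_free _ _).hom_ext
    (fun a => by rw [GrHom.comp_apply, freeRes_incl, freeRes_incl, freeRes_incl, res_res])
    fun j => by rw [GrHom.comp_apply, freeRes_gen, freeRes_gen, freeRes_gen]; rfl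

variable (A G) in
/-- Values of a differential on the generators of the free algebra. -/
structure Boundary where
  val : ∀ j : G.idx, freeSec A G (Cell.whole (G.face j))
  mem : ∀ j, val j ∈ (freeSec A G (Cell.whole (G.face j))).deg (G.deg j + 1)

namespace Boundary

variable (y : Boundary A G)

/-- The derivation extending the differential of the coefficients, with the given values on the
generators. -/
def der (c : Cell W) : GrDer (GrHom.id (freeSec A G c)) 1 :=
  (isFreeOn_free _ _).extendDer (GrHom.id (freeSec A G c))
    ((A.sec c).dDer.comp (freeIncl (A.sec c) (G.degAt c)) : GrDer (freeIncl _ _) 1)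
    (fun j => (freeRes A G (Cell.le_whole j.2)).toAlgHom (y.val j.1))
    fun j => (freeRes A G (Cell.le_whole j.2)).map_deg (y.mem j.1)

theorem der_incl (c : Cell W) (a : A.sec c) :
    (y.der c).lin ((freeIncl _ _).toAlgHom a) = (freeIncl _ _).toAlgHom ((A.sec c).d a) :=
  (isFreeOn_free _ _).extendDer_base _ _ _ _ a

theorem der_gen (c : Cell W) (j : G.At c) : (y.der c).lin (freeGen _ _ j) =
    (freeRes A G (Cell.le_whole j.2)).toAlgHom (y.val j.1) :=
  (isFreeOn_free _ _).extendDer_gen (GrHom.id (freeSec A G c))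
    ((A.sec c).dDer.comp (freeIncl (A.sec c) (G.degAt c)) : GrDer (freeIncl _ _) 1)
    (fun j => (freeRes A G (Cell.le_whole j.2)).toAlgHom (y.val j.1))
    (fun j => (freeRes A G (Cell.le_whole j.2)).map_deg (y.mem j.1)) j

theorem res_der {c' c : Cell W} (h : c' ≤ c) (x : freeSec A G c) :
    (freeRes A G h).toAlgHom ((y.der c).lin x) = (y.der c').lin ((freeRes A G h).toAlgHom x) := by
  let D1 : GrDer (freeRes A G h) 1 := (y.der c).comp (freeRes A G h)
  let D2 : GrDer (freeRes A G h) 1 := (y.der c').precomp (freeRes A G h)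
  have : D1 = D2 := (isFreeOn_free _ _).der_ext
    (fun a => by
      change (freeRes A G h).toAlgHom ((y.der c).lin _) =
        (y.der c').lin ((freeRes A G h).toAlgHom _)
      rw [der_incl, freeRes_incl, freeRes_incl, der_incl, res_d])
    fun j => by
      change (freeRes A G h).toAlgHom ((y.der c).lin _) =
        (y.der c').lin ((freeRes A G h).toAlgHom _)
      rw [der_gen, freeRes_gen, der_gen, ← GrHom.comp_apply, freeRes_comp]
      rfl
  exact congrArg (fun f : GrDer _ _ => f.lin x) this

/-- The values are cycles. -/
def IsClosed : Prop := ∀ j, (y.der _).lin (y.val j) = 0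

variable {y}

/-- The square of an odd derivation is a derivation, so it suffices that it vanishes on the
coefficients and on the generators. -/
theorem IsClosed.der_der (h : y.IsClosed) (c : Cell W) (x : freeSec A G c) :
    (y.der c).lin ((y.der c).lin x) = 0 := by
  refine (isFreeOn_free _ _).der_eq_zero (D := (y.der c).square odd_one) (fun a => ?_)
    (fun j => ?_) x
  · change (y.der c).lin ((y.der c).lin _) = 0
    rw [der_incl, der_incl, (A.sec c).d_d]
    exact map_zero _
  · change (y.der c).lin ((y.der c).lin _) = 0
    rw [der_gen, ← res_der, h]
    exact map_zero _

/-- The free algebra with the given differential. -/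
def presheaf (h : y.IsClosed) : DGPresheaf W where
  obj c := (freeSec A G c.unop).twist (y.der c.unop) (h.der_der c.unop)
  map {c c'} f := (⟨⟨(freeRes A G (leOfHom f.unop)).toAlgHom,
    (freeRes A G (leOfHom f.unop)).map_deg⟩, y.res_der (leOfHom f.unop)⟩ :
      CDGA.Hom ((freeSec A G c.unop).twist (y.der c.unop) (h.der_der c.unop))
        ((freeSec A G c'.unop).twist (y.der c'.unop) (h.der_der c'.unop)))
  map_id c := CDGA.Hom.ext' (AlgHom.ext fun a =>
    congrArg (fun f : GrHom (freeSec A G c.unop) (freeSec A G c.unop) => f.toAlgHom a)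
      (freeRes_self c.unop le_rfl))
  map_comp {c _ c''} f g := CDGA.Hom.ext' (AlgHom.ext fun a =>
    (congrArg (fun f : GrHom (freeSec A G c.unop) (freeSec A G c''.unop) => f.toAlgHom a)
      (freeRes_comp (leOfHom g.unop) (leOfHom f.unop))).symm)

variable (h : y.IsClosed)

/-- The inclusion of the coefficients. -/
def inclusion : A ⟶ presheaf h :=
  homMk (G := presheaf h)
    (fun c => (freeIncl (A.sec c) (G.degAt c)).comp (toTwist (y.der c) (h.der_der c)))
    (fun hc a => freeRes_incl hc a) fun c a => (y.der_incl c a).symm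

/-- The generators. -/
def gens : G.Sections (presheaf h) := fun j => freeGen (A.sec _) (G.degAt _) (G.self j)

theorem resTo_gens (c : Cell W) (j : G.At c) : G.resTo (gens h) c j = freeGen _ _ j :=
  freeRes_gen (A := A) (G := G) (Cell.le_whole j.2) (G.self j.1)

theorem isFree : G.IsFree (inclusion h) (gens h) := by
  refine isFree_iff.2 ⟨fun j => freeGen_mem (G.self j), fun c => ?_⟩
  rw [funext (resTo_gens h c)]
  exact (isFreeOn_free (A.sec c) (G.degAt c)).twist (y.der c) (h.der_der c)

theorem d_gens (j : G.idx) : ((presheaf h).sec _).d (gens h j) = y.val j := by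
  refine (y.der_gen _ (G.self j)).trans ?_
  exact congrArg (fun f : GrHom _ _ => f.toAlgHom (y.val j)) (freeRes_self _ _)

end Boundary

/-- Base change of free algebras. -/
theorem IsFree.exists_pushout {A A' B : DGPresheaf W} {φ : A ⟶ B} {e : G.Sections B}
    (h : G.IsFree φ e) (f : A ⟶ A') :
    ∃ (C : DGPresheaf W) (ι : A' ⟶ C) (p : B ⟶ C), IsPushout f φ ι p ∧
      G.IsFree ι fun j => ap p _ (e j) := by
  let pf : ∀ c, GrHom (B.sec c) (freeSec A' G c) := fun c =>
    (h.on c).lift ((apG f c).comp (freeIncl _ _)) (freeGen _ _) freeGen_mem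
  have pb : ∀ c a, (pf c).toAlgHom (ap φ c a) = (freeIncl _ _).toAlgHom (ap f c a) :=
    fun c a => (h.on c).lift_base _ _ _ a
  have pg : ∀ c j, (pf c).toAlgHom (G.resTo e c j) = freeGen _ _ j :=
    fun c j => (h.on c).lift_gen _ _ freeGen_mem j
  have pn : ∀ {c' c : Cell W} (hc : c' ≤ c) (b : B.sec c),
      (freeRes A' G hc).toAlgHom ((pf c).toAlgHom b) = (pf c').toAlgHom (B.res hc b) := by
    intro c' c hc b
    have : (pf c).comp (freeRes A' G hc) = (B.resG hc).comp (pf c') :=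
      (h.on c).hom_ext (fun a => by
          change (freeRes A' G hc).toAlgHom ((pf c).toAlgHom (ap φ c a)) =
            (pf c').toAlgHom (B.res hc (ap φ c a))
          rw [pb, freeRes_incl, res_ap, res_ap, pb])
        (fun j => by
          change (freeRes A' G hc).toAlgHom ((pf c).toAlgHom (G.resTo e c j)) =
            (pf c').toAlgHom (B.res hc (G.resTo e c j))
          rw [pg, freeRes_gen, res_resTo, pg])
    exact congrArg (fun f : GrHom _ _ => f.toAlgHom b) this
  -- The differential of a generator of the base change is the image of the differential of the old
  -- generator; this choice makes `pf` compatible with the differentials.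
  let y : Boundary A' G :=
    ⟨fun j => (pf _).toAlgHom ((B.sec _).d (e j)), fun j => (pf _).map_deg ((B.sec _).d_mem (h.1 j))⟩
  have pd : ∀ c b, (pf c).toAlgHom ((B.sec c).d b) = (y.der c).lin ((pf c).toAlgHom b) := by
    intro c b
    let D1 : GrDer (pf c) 1 := (B.sec c).dDer.comp (pf c)
    let D2 : GrDer (pf c) 1 := (y.der c).precomp (pf c)
    have : D1 = D2 := (h.on c).der_ext
      (fun a => by
        change (pf c).toAlgHom ((B.sec c).d (ap φ c a)) = (y.der c).lin ((pf c).toAlgHom (ap φ c a))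
        rw [← ap_d, pb, pb, y.der_incl, ap_d])
      (fun j => by
        change (pf c).toAlgHom ((B.sec c).d (G.resTo e c j)) =
          (y.der c).lin ((pf c).toAlgHom (G.resTo e c j))
        rw [pg, y.der_gen, resTo_eq, ← res_d, pn])
    exact congrArg (fun f : GrDer _ _ => f.lin b) this
  have hy : y.IsClosed := fun j => by
    change (y.der _).lin ((pf _).toAlgHom _) = 0
    rw [← pd, (B.sec _).d_d, map_zero]
  let p : B ⟶ Boundary.presheaf hy :=
    homMk (G := Boundary.presheaf hy) (fun c => (pf c).comp (toTwist (y.der c) (hy.der_der c)))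
      (fun hc b => pn hc b) fun c b => pd c b
  have hpe : (fun j => ap p _ (e j)) = Boundary.gens hy := by
    funext j
    have := pg _ (G.self j)
    rw [resTo_self] at this
    exact this
  have hfree : G.IsFree (Boundary.inclusion hy) fun j => ap p _ (e j) := by
    rw [hpe]
    exact Boundary.isFree hy
  have w : f ≫ Boundary.inclusion hy = φ ≫ p := hom_ext_ap fun c a => (pb c a).symm
  refine ⟨Boundary.presheaf hy, Boundary.inclusion hy, p, ⟨⟨w⟩, ⟨?_⟩⟩, hfree⟩
  have exd : ∀ s : Limits.PushoutCocone f φ, ∃ l : Boundary.presheaf hy ⟶ s.pt,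
      Boundary.inclusion hy ≫ l = s.inl ∧ ∀ j, ap l _ (ap p _ (e j)) = ap s.inr _ (e j) := by
    intro s
    refine hfree.exists_hom s.inl (fun j => ap s.inr _ (e j)) (fun j => ap_mem _ _ (h.1 j)) ?_
    intro j
    set c := Cell.whole (G.face j)
    rw [← ap_d, ← ap_d]
    -- Compatibility with differentials on a generator concerns the value of the lift on the image
    -- of d(e j). After composition with `p` the lift agrees with `s.inr` on all of `B`, in
    -- particular on d(e j).
    have key : (apG p c).comp ((hfree.on c).lift (apG s.inl c)
        (G.resTo (fun j => ap s.inr _ (e j)) c) (resTo_mem (fun j => ap_mem _ _ (h.1 j)) _)) =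
        apG s.inr c := by
      refine (h.on c).hom_ext (fun a => ?_) fun j => ?_
      · have h1 : ap p c (ap φ c a) = ap (Boundary.inclusion hy) c (ap f c a) := pb c a
        have h2 : ap s.inl c (ap f c a) = ap s.inr c (ap φ c a) :=
          congrArg (fun g : A ⟶ s.pt => ap g c a) s.condition
        change _ = ap s.inr c (ap φ c a)
        rw [← h2, GrHom.comp_apply]
        change _ = (apG s.inl c).toAlgHom _
        rw [← (hfree.on c).lift_base (apG s.inl c)
          (G.resTo (fun j => ap s.inr _ (e j)) c) (resTo_mem (fun j => ap_mem _ _ (h.1 j)) _)]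
        exact congrArg _ h1
      · rw [GrHom.comp_apply, apG_toAlgHom, ap_resTo, (hfree.on c).lift_gen, apG_toAlgHom,
          ap_resTo]
    exact congrArg (fun g : GrHom _ _ => g.toAlgHom ((B.sec c).d (e j))) key
  choose l hl1 hl2 using exd
  refine Limits.PushoutCocone.IsColimit.mk w l hl1 (fun s => ?_) fun s m hm1 hm2 => ?_
  · refine h.hom_ext ?_ (hl2 s)
    rw [← Category.assoc, ← w, Category.assoc, hl1, s.condition]
  · refine hfree.hom_ext (hm1.trans (hl1 s).symm) fun j => ?_
    rw [hl2, ← hm2]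
    rfl

end Gens

end

section

/-! ## Holomorphic functions of several variables -/

section Analysis

open MeasureTheory Metric

variable {F : Type*} [NormedAddCommGroup F] [NormedSpace ℂ F]

/-- The Cauchy estimate for the derivative of a holomorphic function. -/
theorem norm_fderiv_le_of_ball {g : F → ℂ} {p : F} {ε M : ℝ} (hε : 0 < ε)
    (hd : DifferentiableOn ℂ g (ball p ε)) (hM : ∀ x ∈ ball p ε, ‖g x‖ ≤ M) :
    ‖fderiv ℂ g p‖ ≤ 2 * M / ε := by
  have hM0 : 0 ≤ M := (norm_nonneg _).trans (hM p (mem_ball_self hε))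
  refine ContinuousLinearMap.opNorm_le_bound _ (by positivity) fun v => ?_
  by_cases hv : v = 0
  · simp [hv]
  have hv' : 0 < ‖v‖ := norm_pos_iff.2 hv
  -- On the complex line through p in the direction v, a disc of this radius stays within distance
  -- ε/2 of p; there the one-variable Cauchy estimate applies.
  have hR : 0 < ε / (2 * ‖v‖) := by positivity
  have hmem : ∀ ζ ∈ closedBall (0 : ℂ) (ε / (2 * ‖v‖)), p + ζ • v ∈ ball p ε := by
    intro ζ hζ
    rw [mem_closedBall_zero_iff] at hζ
    rw [mem_ball_iff_norm, add_sub_cancel_left, norm_smul]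
    calc ‖ζ‖ * ‖v‖ ≤ ε / (2 * ‖v‖) * ‖v‖ := by gcongr
      _ = ε / 2 := by field_simp
      _ < ε := by linarith
  have hl : ∀ ζ : ℂ, HasFDerivAt (fun ζ : ℂ => p + ζ • v)
      ((ContinuousLinearMap.id ℂ ℂ).smulRight v) ζ := fun ζ =>
    ((ContinuousLinearMap.id ℂ ℂ).smulRight v).hasFDerivAt.const_add p
  have hline : DifferentiableOn ℂ (fun ζ : ℂ => g (p + ζ • v))
      (closedBall (0 : ℂ) (ε / (2 * ‖v‖))) :=
    hd.comp (fun ζ _ => (hl ζ).differentiableAt.differentiableWithinAt) hmem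
  have h1 := Complex.norm_deriv_le_of_forall_mem_sphere_norm_le hR
    (hline.diffContOnCl_ball (subset_refl _))
    (fun ζ hζ => hM _ (hmem ζ (sphere_subset_closedBall hζ)))
  have h2 : deriv (fun ζ : ℂ => g (p + ζ • v)) 0 = fderiv ℂ g p v := by
    have hg : DifferentiableAt ℂ g (p + (0 : ℂ) • v) := by
      simpa using hd.differentiableAt (ball_mem_nhds p hε)
    have := (hg.hasFDerivAt.comp (0 : ℂ) (hl 0)).hasDerivAt.deriv
    simpa [Function.comp_def] using this
  rw [h2] at h1
  calc ‖fderiv ℂ g p v‖ ≤ M / (ε / (2 * ‖v‖)) := h1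
    _ = 2 * M / ε * ‖v‖ := by field_simp

variable [FiniteDimensional ℂ F]

/-- Differentiation under the integral sign for `∫ k(s) g(A_s w + b_s) ds` with `g` holomorphic. -/
theorem hasFDerivAt_integral_affine {U : Set F} (hU : IsOpen U) {g : F → ℂ}
    (hg : DifferentiableOn ℂ g U) {a b : ℝ} {k : ℝ → ℂ} (hk : Continuous k) {A : ℝ → F →L[ℂ] F}
    (hA : Continuous A) {β : ℝ → F} (hβ : Continuous β) {w : F}
    (hw : ∀ s ∈ Set.uIcc a b, A s w + β s ∈ U) :
    HasFDerivAt (fun w => ∫ s in a..b, k s * g (A s w + β s))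
      (∫ s in a..b, k s • (fderiv ℂ g (A s w + β s)).comp (A s)) w := by
  have : ProperSpace F := FiniteDimensional.proper ℂ F
  have : CompleteSpace F := FiniteDimensional.complete ℂ F
  let : MeasurableSpace F := borel F
  have : BorelSpace F := ⟨rfl⟩
  have hL : Continuous fun p : ℝ × F => A p.1 p.2 + β p.1 :=
    ((hA.comp continuous_fst).clm_apply continuous_snd).add (hβ.comp continuous_fst)
  have hLw : ∀ w, Continuous fun s => A s w + β s := fun w =>
    hL.comp (continuous_id.prodMk continuous_const)
  have hK : IsCompact ((fun s => A s w + β s) '' Set.uIcc a b) :=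
    isCompact_uIcc.image (hLw w)
  have hKU : (fun s => A s w + β s) '' Set.uIcc a b ⊆ U := by
    rintro _ ⟨s, hs, rfl⟩
    exact hw s hs
  obtain ⟨ε, hε, hεU⟩ := hK.exists_cthickening_subset_open hU hKU
  have hKc : IsCompact (cthickening ε ((fun s => A s w + β s) '' Set.uIcc a b)) :=
    hK.cthickening
  obtain ⟨M, hM⟩ := hKc.exists_bound_of_continuousOn (hg.continuousOn.mono hεU)
  have hball : ∀ s ∈ Set.uIcc a b, ∀ x, dist x (A s w + β s) < ε →
      x ∈ cthickening ε ((fun s => A s w + β s) '' Set.uIcc a b) := fun s hs x hx =>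
    mem_cthickening_of_dist_le x _ _ _ (Set.mem_image_of_mem _ hs) hx.le
  obtain ⟨a0, ha0⟩ := isCompact_uIcc.exists_bound_of_continuousOn (s := Set.uIcc a b)
    hA.continuousOn
  obtain ⟨k0, hk0⟩ := isCompact_uIcc.exists_bound_of_continuousOn (s := Set.uIcc a b)
    hk.continuousOn
  have ha0' : 0 ≤ a0 := (norm_nonneg _).trans (ha0 a Set.left_mem_uIcc)
  have hk0' : 0 ≤ k0 := (norm_nonneg _).trans (hk0 a Set.left_mem_uIcc)
  have hM' : 0 ≤ M := (norm_nonneg _).trans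
    (hM (A a w + β a) (hball a Set.left_mem_uIcc _ (by simpa using hε)))
  -- As `a0` bounds the norms of the A s, moving w by less than δ moves A s w + β s by less than
  -- ε/2. The other ε/2 is left for the Cauchy estimate around the displaced point.
  set δ := ε / (2 * (a0 + 1)) with hδ
  have hδ0 : 0 < δ := by positivity
  have hnear : ∀ s ∈ Set.uIcc a b, ∀ x ∈ ball w δ, dist (A s x + β s) (A s w + β s) < ε / 2 := by
    intro s hs x hx
    rw [dist_add_right, dist_eq_norm, ← map_sub]
    calc ‖A s (x - w)‖ ≤ ‖A s‖ * ‖x - w‖ := (A s).le_opNorm _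
      _ ≤ (a0 + 1) * ‖x - w‖ := by
        have := ha0 s hs
        gcongr
        linarith
      _ < (a0 + 1) * δ := by
        have := mem_ball_iff_norm.1 hx
        gcongr
      _ = ε / 2 := by rw [hδ]; field_simp
  have hinU : ∀ s ∈ Set.uIcc a b, ∀ x ∈ ball w δ, A s x + β s ∈ U := fun s hs x hx =>
    hεU (hball s hs _ ((hnear s hs x hx).trans (by linarith)))
  have hdiff : ∀ s ∈ Set.uIcc a b, ∀ x ∈ ball w δ, HasFDerivAt (fun x => k s * g (A s x + β s))
      (k s • (fderiv ℂ g (A s x + β s)).comp (A s)) x := by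
    intro s hs x hx
    have h1 : HasFDerivAt g (fderiv ℂ g (A s x + β s)) (A s x + β s) :=
      (hg.differentiableAt (hU.mem_nhds (hinU s hs x hx))).hasFDerivAt
    have h2 : HasFDerivAt (fun x => A s x + β s) (A s) x := (A s).hasFDerivAt.add_const _
    have h3 := (h1.comp x h2).const_smul (k s)
    exact h3
  have hcont : ∀ x ∈ ball w δ, ContinuousOn (fun s => k s * g (A s x + β s)) (Set.uIcc a b) :=
    fun x hx => hk.continuousOn.mul
      (hg.continuousOn.comp (hLw x).continuousOn fun s hs => hinU s hs x hx)
  refine (intervalIntegral.hasFDerivAt_integral_of_dominated_loc_of_lip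
    (bound := fun _ => k0 * (2 * M / (ε / 2) * a0)) (ball_mem_nhds w hδ0) ?_ ?_ ?_ ?_ ?_ ?_).2
  · filter_upwards [ball_mem_nhds w hδ0] with x hx
    exact ((hcont x hx).mono Set.uIoc_subset_uIcc).aestronglyMeasurable measurableSet_uIoc
  · exact (hcont w (mem_ball_self hδ0)).intervalIntegrable
  -- Continuity of the derivative of g is not known at this stage, being itself a consequence of
  -- this lemma. Derivatives are measurable without any assumption, and this suffices here.
  · have h1 : Measurable fun s => fderiv ℂ g (A s w + β s) :=
      (measurable_fderiv ℂ g).comp (hLw w).measurable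
    have h2 : StronglyMeasurable fun s => fderiv ℂ g (A s w + β s) := h1.stronglyMeasurable
    have h3 : Continuous fun p : (F →L[ℂ] ℂ) × (F →L[ℂ] F) => p.1.comp p.2 :=
      continuous_fst.clm_comp continuous_snd
    exact ((hk.stronglyMeasurable).smul
      (h3.comp_stronglyMeasurable (h2.prodMk hA.stronglyMeasurable))).aestronglyMeasurable
  · refine Filter.Eventually.of_forall fun s hs => ?_
    have hs' := Set.uIoc_subset_uIcc hs
    refine Convex.lipschitzOnWith_of_nnnorm_hasFDerivWithin_le (𝕜 := ℂ)
      (f' := fun x => k s • (fderiv ℂ g (A s x + β s)).comp (A s))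
      (fun x hx => (hdiff s hs' x hx).hasFDerivWithinAt) (fun x hx => ?_) (convex_ball w δ)
    rw [← NNReal.coe_le_coe, coe_nnnorm, Real.coe_nnabs, abs_of_nonneg (by positivity), norm_smul]
    refine mul_le_mul (hk0 s hs') ?_ (norm_nonneg _) hk0'
    refine (ContinuousLinearMap.opNorm_comp_le _ _).trans
      (mul_le_mul ?_ (ha0 s hs') (norm_nonneg _) (by positivity))
    have hsub : ∀ y ∈ ball (A s x + β s) (ε / 2),
        y ∈ cthickening ε ((fun s => A s w + β s) '' Set.uIcc a b) := fun y hy =>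
      hball s hs' y (((dist_triangle y (A s x + β s) _).trans_lt
        (add_lt_add hy (hnear s hs' x hx))).trans_eq (by ring))
    exact norm_fderiv_le_of_ball (by positivity) (hg.mono fun y hy => hεU (hsub y hy))
      fun y hy => hM y (hsub y hy)
  · exact intervalIntegrable_const
  · exact Filter.Eventually.of_forall fun s hs =>
      hdiff s (Set.uIoc_subset_uIcc hs) w (mem_ball_self hδ0)

/-- The derivatives of a holomorphic function are holomorphic. -/
theorem differentiableOn_deriv_line {U : Set F} (hU : IsOpen U) {g : F → ℂ}
    (hg : DifferentiableOn ℂ g U) (v : F) :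
    DifferentiableOn ℂ (fun w => deriv (fun ζ : ℂ => g (w + ζ • v)) 0) U := by
  intro w hw
  refine DifferentiableAt.differentiableWithinAt ?_
  obtain ⟨ε, hε, hεU⟩ := Metric.isOpen_iff.1 hU w hw
  set R := ε / (2 * (‖v‖ + 1)) with hR
  have hR0 : 0 < R := by positivity
  have hmem : ∀ x ∈ ball w (ε / 2), ∀ ζ ∈ closedBall (0 : ℂ) R, x + ζ • v ∈ U := by
    intro x hx ζ hζ
    refine hεU ?_
    rw [mem_closedBall_zero_iff] at hζ
    rw [mem_ball_iff_norm] at hx ⊢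
    calc ‖x + ζ • v - w‖ = ‖(x - w) + ζ • v‖ := by congr 1; abel
      _ ≤ ‖x - w‖ + ‖ζ‖ * ‖v‖ := (norm_add_le _ _).trans (by rw [norm_smul])
      _ ≤ ‖x - w‖ + R * (‖v‖ + 1) := by gcongr; linarith
      _ = ‖x - w‖ + ε / 2 := by rw [hR]; field_simp
      _ < ε := by linarith
  -- Cauchy's formula for the derivative on the circle of radius R. Its integrand is a kernel in θ
  -- times g evaluated at a translate of x, so it can be differentiated under the integral sign in
  -- x.
  have heq : ∀ x ∈ ball w (ε / 2), deriv (fun ζ : ℂ => g (x + ζ • v)) 0 =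
      (2 * Real.pi * Complex.I : ℂ)⁻¹ * ∫ θ in (0 : ℝ)..(2 * Real.pi),
        (deriv (circleMap 0 R) θ * ((circleMap 0 R θ) ^ 2)⁻¹) *
          g (ContinuousLinearMap.id ℂ F x + circleMap 0 R θ • v) := by
    intro x hx
    have hline : DifferentiableOn ℂ (fun ζ : ℂ => g (x + ζ • v)) (closedBall (0 : ℂ) R) := by
      refine hg.comp (fun ζ _ => ?_) (hmem x hx)
      exact DifferentiableAt.differentiableWithinAt (by fun_prop)
    rw [eq_inv_mul_iff_mul_eq₀ Complex.two_pi_I_ne_zero, ← smul_eq_mul,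
      ← hline.deriv_eq_smul_circleIntegral hR0]
    simp only [circleIntegral, smul_eq_mul, sub_zero, ContinuousLinearMap.id_apply, one_div,
      mul_assoc]
  have hdiff := hasFDerivAt_integral_affine hU hg (a := 0) (b := 2 * Real.pi)
    (k := fun θ => deriv (circleMap 0 R) θ * ((circleMap 0 R θ) ^ 2)⁻¹)
    (A := fun _ => ContinuousLinearMap.id ℂ F) (β := fun θ => circleMap 0 R θ • v) (w := w)
    (by
      simp only [deriv_circleMap]
      refine ((continuous_circleMap 0 R).mul continuous_const).mul
        (((continuous_circleMap 0 R).pow 2).inv₀ fun θ => ?_)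
      exact pow_ne_zero _ (circleMap_ne_center hR0.ne'))
    continuous_const ((continuous_circleMap 0 R).smul continuous_const)
    (fun θ _ => hmem w (mem_ball_self (by positivity)) _
      (sphere_subset_closedBall (circleMap_mem_sphere _ hR0.le θ)))
  refine ((hdiff.differentiableAt.const_mul (2 * Real.pi * Complex.I : ℂ)⁻¹).congr_of_eventuallyEq ?_)
  filter_upwards [ball_mem_nhds w (show 0 < ε / 2 by positivity)] with x hx
  exact heq x hx

end Analysis

end

/-! ### Operators on polydiscs: partial derivatives, averages along rays, Euler field -/

section

namespace Slice

open MeasureTheory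

variable {ι κ : Type u}

/-- The polydisc of radius `r` around `0`. -/
def polydisc (κ : Type u) (r : ℝ) : Set (κ → ℂ) := {τ | ∀ n, ‖τ n‖ < r}

/-- The product of `A` with a polydisc. -/
def dom (κ : Type u) (A : Set (ι → ℂ)) (r : ℝ) : Set (ι ⊕ κ → ℂ) :=
  {w | (fun i => w (Sum.inl i)) ∈ A ∧ (fun n => w (Sum.inr n)) ∈ polydisc κ r}

/-- The restriction of a function of two groups of variables to a slice. -/
def slice (g : (ι ⊕ κ → ℂ) → ℂ) (z : ι → ℂ) (τ : κ → ℂ) : ℂ := g (Sum.elim z τ)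

theorem isOpen_polydisc [Finite κ] (r : ℝ) : IsOpen (polydisc κ r) := by
  simp only [polydisc, Set.ofPred_forall]
  exact isOpen_iInter_of_finite fun n => isOpen_lt (continuous_apply n).norm continuous_const

theorem isOpen_dom [Finite κ] {A : Set (ι → ℂ)} (hA : IsOpen A) (r : ℝ) : IsOpen (dom κ A r) :=
  (hA.preimage (by fun_prop)).inter ((isOpen_polydisc r).preimage (by fun_prop))

theorem smul_mem_polydisc {r : ℝ} {τ : κ → ℂ} (h : τ ∈ polydisc κ r) {s : ℂ} (hs : ‖s‖ ≤ 1) :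
    s • τ ∈ polydisc κ r := fun n => by
  rw [Pi.smul_apply, norm_smul]
  exact (mul_le_of_le_one_left (norm_nonneg _) hs).trans_lt (h n)

theorem elim_mem_dom {A : Set (ι → ℂ)} {r : ℝ} {z : ι → ℂ} {τ : κ → ℂ} :
    Sum.elim z τ ∈ dom κ A r ↔ z ∈ A ∧ τ ∈ polydisc κ r := Iff.rfl

theorem elim_comp (w : ι ⊕ κ → ℂ) :
    Sum.elim (fun i => w (Sum.inl i)) (fun n => w (Sum.inr n)) = w :=
  funext fun i => by cases i <;> rfl

section

variable [Finite ι] [Finite κ]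

theorem differentiable_elim (z : ι → ℂ) :
    Differentiable ℂ fun τ : κ → ℂ => (Sum.elim z τ : ι ⊕ κ → ℂ) := by
  have := Fintype.ofFinite ι
  have := Fintype.ofFinite κ
  rw [differentiable_pi]
  rintro (i | n)
  · exact differentiable_const _
  · exact differentiable_apply n

theorem differentiableOn_slice {A : Set (ι → ℂ)} {r : ℝ} {g : (ι ⊕ κ → ℂ) → ℂ}
    (hg : DifferentiableOn ℂ g (dom κ A r)) {z : ι → ℂ} (hz : z ∈ A) :
    DifferentiableOn ℂ (slice g z) (polydisc κ r) := by
  have := Fintype.ofFinite ι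
  have := Fintype.ofFinite κ
  exact DifferentiableOn.comp (t := dom κ A r) (g := g)
    (f := fun τ : κ → ℂ => (Sum.elim z τ : ι ⊕ κ → ℂ)) hg
    (differentiable_elim z).differentiableOn fun _ hτ => elim_mem_dom.2 ⟨hz, hτ⟩

end

/-- A linear operator on the functions on polydiscs that depends holomorphically on parameters. -/
structure Op (κ : Type u) [Finite κ] where
  op : ((κ → ℂ) → ℂ) → (κ → ℂ) → ℂ
  congr : ∀ {r : ℝ} {g g' : (κ → ℂ) → ℂ}, Set.EqOn g g' (polydisc κ r) →
    Set.EqOn (op g) (op g') (polydisc κ r)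
  sum : ∀ {r : ℝ} {m : ℕ} (c : Fin m → ℂ) (g : Fin m → (κ → ℂ) → ℂ),
    (∀ l, DifferentiableOn ℂ (g l) (polydisc κ r)) →
    Set.EqOn (op fun τ => ∑ l, g l τ * c l) (fun τ => ∑ l, op (g l) τ * c l) (polydisc κ r)
  holo : ∀ {ι : Type u} [Finite ι] {A : Set (ι → ℂ)} {r : ℝ} {g : (ι ⊕ κ → ℂ) → ℂ}, IsOpen A →
    DifferentiableOn ℂ g (dom κ A r) → DifferentiableOn ℂ
      (fun w => op (slice g fun i => w (Sum.inl i)) fun n => w (Sum.inr n)) (dom κ A r)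

/-- The action on functions with parameters. -/
def Op.lift [Finite κ] (Θ : Op κ) (g : (ι ⊕ κ → ℂ) → ℂ) (w : ι ⊕ κ → ℂ) : ℂ :=
  Θ.op (slice g fun i => w (Sum.inl i)) fun n => w (Sum.inr n)

theorem Op.differentiableOn_lift [Finite κ] [Finite ι] (Θ : Op κ) {A : Set (ι → ℂ)} {r : ℝ}
    {g : (ι ⊕ κ → ℂ) → ℂ} (hA : IsOpen A) (hg : DifferentiableOn ℂ g (dom κ A r)) :
    DifferentiableOn ℂ (Θ.lift g) (dom κ A r) := Θ.holo hA hg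

open Classical in
/-- The partial derivative on slices. -/
def pd (n : κ) (g : (κ → ℂ) → ℂ) (τ : κ → ℂ) : ℂ :=
  deriv (fun ζ : ℂ => g (τ + ζ • Pi.single n 1)) 0

/-- The weighted average along rays. -/
def ray (k : ℕ) (g : (κ → ℂ) → ℂ) (τ : κ → ℂ) : ℂ :=
  ∫ s in (0 : ℝ)..1, (s : ℂ) ^ k * g ((s : ℂ) • τ)

open Classical in
theorem pd_coord (n m : κ) (τ : κ → ℂ) :
    pd n (fun τ => τ m) τ = if n = m then 1 else 0 := by
  have h : (fun ζ : ℂ => (τ + ζ • (Pi.single n 1 : κ → ℂ)) m) =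
      fun ζ => τ m + ζ * (if n = m then 1 else 0) := by
    funext ζ
    simp [Pi.single_apply, eq_comm]
  unfold pd
  rw [h]
  split_ifs <;> simp

theorem ofReal_smul_mem {r : ℝ} {τ : κ → ℂ} (hτ : τ ∈ polydisc κ r) {s : ℝ} (hs : s ∈ Set.uIcc (0 : ℝ) 1) :
    (s : ℂ) • τ ∈ polydisc κ r := by
  rw [Set.uIcc_of_le zero_le_one] at hs
  refine smul_mem_polydisc hτ ?_
  rw [Complex.norm_real, Real.norm_eq_abs, abs_of_nonneg hs.1]
  exact hs.2

theorem continuousOn_ray {r : ℝ} {g : (κ → ℂ) → ℂ} {τ : κ → ℂ} (hg : ContinuousOn g (polydisc κ r)) (hτ : τ ∈ polydisc κ r) (k : ℕ) :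
    ContinuousOn (fun s : ℝ => (s : ℂ) ^ k * g ((s : ℂ) • τ)) (Set.uIcc (0 : ℝ) 1) := by
  refine ContinuousOn.mul (by fun_prop) (hg.comp (by fun_prop) fun s hs => ofReal_smul_mem hτ hs)

theorem ray_congr {r : ℝ} {g g' : (κ → ℂ) → ℂ} (k : ℕ) (h : Set.EqOn g g' (polydisc κ r)) :
    Set.EqOn (ray k g) (ray k g') (polydisc κ r) := fun τ hτ =>
  intervalIntegral.integral_congr fun s hs => by
    exact congrArg (fun z => (s : ℂ) ^ k * z) (h (ofReal_smul_mem hτ hs))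

theorem ray_sum {r : ℝ} (k : ℕ) {ν : Type*} [Fintype ν] (c : ν → ℂ) (g : ν → (κ → ℂ) → ℂ)
    (hg : ∀ l, DifferentiableOn ℂ (g l) (polydisc κ r)) :
    Set.EqOn (ray k fun τ => ∑ l, g l τ * c l) (fun τ => ∑ l, ray k (g l) τ * c l)
      (polydisc κ r) := by
  intro τ hτ
  simp only [ray, Finset.mul_sum, ← mul_assoc]
  rw [intervalIntegral.integral_finsetSum]
  · simp only [intervalIntegral.integral_mul_const]
  · intro l _
    exact ((continuousOn_ray (hg l).continuousOn hτ k).mul continuousOn_const).intervalIntegrable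

section

variable [Fintype κ] {r : ℝ} {g g' : (κ → ℂ) → ℂ} {τ : κ → ℂ}

theorem hasDerivAt_line {E : Type*} [NormedAddCommGroup E] [NormedSpace ℂ E] {g : E → ℂ} {p : E}
    (hg : DifferentiableAt ℂ g p) (v : E) :
    HasDerivAt (fun ζ : ℂ => g (p + ζ • v)) (fderiv ℂ g p v) 0 := by
  have h1 : HasFDerivAt (fun ζ : ℂ => p + ζ • v)
      ((ContinuousLinearMap.id ℂ ℂ).smulRight v) 0 :=
    ((ContinuousLinearMap.id ℂ ℂ).smulRight v).hasFDerivAt.const_add p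
  have h2 : HasFDerivAt g (fderiv ℂ g p) (p + (0 : ℂ) • v) := by simpa using hg.hasFDerivAt
  simpa [Function.comp_def] using (h2.comp (0 : ℂ) h1).hasDerivAt

open Classical in
theorem pd_eq_fderiv (n : κ) (hg : DifferentiableAt ℂ g τ) :
    pd n g τ = fderiv ℂ g τ (Pi.single n 1) := by
  rw [← (hasDerivAt_line hg (Pi.single n 1)).deriv]
  unfold pd
  congr!

theorem differentiableAt_of_mem (hg : DifferentiableOn ℂ g (polydisc κ r))
    (hτ : τ ∈ polydisc κ r) : DifferentiableAt ℂ g τ :=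
  hg.differentiableAt ((isOpen_polydisc r).mem_nhds hτ)

theorem differentiableOn_pd (n : κ) (hg : DifferentiableOn ℂ g (polydisc κ r)) :
    DifferentiableOn ℂ (pd n g) (polydisc κ r) :=
  differentiableOn_deriv_line (isOpen_polydisc r) hg _

theorem pd_congr (n : κ) (h : Set.EqOn g g' (polydisc κ r)) :
    Set.EqOn (pd n g) (pd n g') (polydisc κ r) := by
  classical
  intro τ hτ
  refine Filter.EventuallyEq.deriv_eq ?_
  have hc : Continuous fun ζ : ℂ => τ + ζ • (Pi.single n 1 : κ → ℂ) := by fun_prop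
  have h0 : τ + (0 : ℂ) • (Pi.single n 1 : κ → ℂ) ∈ polydisc κ r := by simpa using hτ
  filter_upwards [hc.continuousAt.preimage_mem_nhds ((isOpen_polydisc r).mem_nhds h0)] with ζ hζ
  exact h hζ

theorem pd_sum (n : κ) {m : ℕ} (c : Fin m → ℂ) (g : Fin m → (κ → ℂ) → ℂ)
    (hg : ∀ l, DifferentiableOn ℂ (g l) (polydisc κ r)) :
    Set.EqOn (pd n fun τ => ∑ l, g l τ * c l) (fun τ => ∑ l, pd n (g l) τ * c l)
      (polydisc κ r) := by
  classical
  intro τ hτ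
  have h1 : ∀ l, HasDerivAt (fun ζ : ℂ => g l (τ + ζ • Pi.single n 1) * c l)
      (fderiv ℂ (g l) τ (Pi.single n 1) * c l) 0 := fun l =>
    (hasDerivAt_line (differentiableAt_of_mem (hg l) hτ) (Pi.single n 1)).mul_const (c l)
  have h2 := (HasDerivAt.fun_sum fun l (_ : l ∈ Finset.univ) => h1 l).deriv
  have h3 : ∀ l, pd n (g l) τ = fderiv ℂ (g l) τ (Pi.single n 1) := fun l =>
    pd_eq_fderiv n (differentiableAt_of_mem (hg l) hτ)
  simp only [h3]
  convert h2 using 1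
  unfold pd
  congr!

theorem pd_mul (n : κ) (hg : DifferentiableOn ℂ g (polydisc κ r))
    (hg' : DifferentiableOn ℂ g' (polydisc κ r)) (hτ : τ ∈ polydisc κ r) :
    pd n (fun τ => g τ * g' τ) τ = pd n g τ * g' τ + g τ * pd n g' τ := by
  classical
  have h1 := hasDerivAt_line (differentiableAt_of_mem hg hτ) (Pi.single n 1)
  have h2 := hasDerivAt_line (differentiableAt_of_mem hg' hτ) (Pi.single n 1)
  rw [pd_eq_fderiv n (differentiableAt_of_mem hg hτ),
    pd_eq_fderiv n (differentiableAt_of_mem hg' hτ)]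
  have h3 := (h1.mul h2).deriv
  simp only [zero_smul, add_zero] at h3
  rw [← h3]
  unfold pd
  congr!

theorem sum_mul_pd (hg : DifferentiableAt ℂ g τ) (v : κ → ℂ) :
    ∑ n, v n * pd n g τ = fderiv ℂ g τ v := by
  classical
  conv_rhs => rw [pi_eq_sum_univ' v]
  rw [map_sum]
  refine Finset.sum_congr rfl fun n _ => ?_
  rw [pd_eq_fderiv n hg, map_smul, smul_eq_mul]

theorem differentiableOn_fderiv (hg : DifferentiableOn ℂ g (polydisc κ r)) :
    DifferentiableOn ℂ (fderiv ℂ g) (polydisc κ r) := by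
  have hsum : ∀ x ∈ polydisc κ r, fderiv ℂ g x =
      ∑ n, pd n g x • ContinuousLinearMap.proj (R := ℂ) (φ := fun _ : κ => ℂ) n := by
    intro x hx
    refine ContinuousLinearMap.ext fun v => ?_
    rw [← sum_mul_pd (differentiableAt_of_mem hg hx) v]
    simp [mul_comm]
  refine DifferentiableOn.congr ?_ hsum
  exact DifferentiableOn.fun_sum fun n _ => (differentiableOn_pd n hg).smul_const _

theorem hasFDerivAt_ray (k : ℕ) (hg : DifferentiableOn ℂ g (polydisc κ r))
    (hτ : τ ∈ polydisc κ r) :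
    HasFDerivAt (ray k g) (∫ s in (0 : ℝ)..1, ((s : ℂ) ^ k) • (fderiv ℂ g ((s : ℂ) • τ)).comp
      ((s : ℂ) • ContinuousLinearMap.id ℂ (κ → ℂ))) τ := by
  have := hasFDerivAt_integral_affine (isOpen_polydisc r) hg (a := 0) (b := 1)
    (k := fun s => (s : ℂ) ^ k) (by fun_prop)
    (A := fun s => (s : ℂ) • ContinuousLinearMap.id ℂ (κ → ℂ)) (by fun_prop)
    (β := fun _ => 0) continuous_const (w := τ)
    (fun s hs => by simpa using ofReal_smul_mem hτ hs)
  simpa using! this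

/-- The Euler vector field. -/
def euler (g : (κ → ℂ) → ℂ) (τ : κ → ℂ) : ℂ := ∑ n, τ n * pd n g τ

theorem differentiableOn_euler (hg : DifferentiableOn ℂ g (polydisc κ r)) :
    DifferentiableOn ℂ (euler g) (polydisc κ r) := by
  unfold euler
  exact DifferentiableOn.fun_sum fun n _ =>
    (differentiable_apply n).differentiableOn.mul (differentiableOn_pd n hg)

theorem hasDerivAt_ray_line (hg : DifferentiableOn ℂ g (polydisc κ r)) (hτ : τ ∈ polydisc κ r)
    {s : ℝ} (hs : s ∈ Set.uIcc (0 : ℝ) 1) :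
    HasDerivAt (fun s : ℝ => g ((s : ℂ) • τ)) (fderiv ℂ g ((s : ℂ) • τ) τ) s := by
  have h1 : HasFDerivAt (fun ζ : ℂ => ζ • τ)
      ((ContinuousLinearMap.id ℂ ℂ).smulRight τ) (s : ℂ) :=
    ((ContinuousLinearMap.id ℂ ℂ).smulRight τ).hasFDerivAt
  have h2 := (differentiableAt_of_mem hg (ofReal_smul_mem hτ hs)).hasFDerivAt
  simpa [Function.comp_def] using (h2.comp (s : ℂ) h1).hasDerivAt.comp_ofReal

/-- The derivative of s^(k+1) g(sτ) in s is s^k times the value of (E + k + 1) g at sτ. The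
fundamental theorem of calculus leaves g(τ), since the boundary term at s = 0 vanishes thanks to the
positive exponent. -/
theorem ray_euler (k : ℕ) (hg : DifferentiableOn ℂ g (polydisc κ r)) (hτ : τ ∈ polydisc κ r) :
    ray k (fun τ => euler g τ + (k + 1) * g τ) τ = g τ := by
  have hd : ∀ s ∈ Set.uIcc (0 : ℝ) 1, HasDerivAt (fun s : ℝ => (s : ℂ) ^ (k + 1) * g ((s : ℂ) • τ))
      ((s : ℂ) ^ k * (euler g ((s : ℂ) • τ) + (k + 1) * g ((s : ℂ) • τ))) s := by
    intro s hs
    have h1 : HasDerivAt (fun s : ℝ => (s : ℂ) ^ (k + 1)) ((k + 1 : ℕ) * (s : ℂ) ^ k) s := by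
      simpa using (hasDerivAt_pow (k + 1) (s : ℂ)).comp_ofReal
    have h2 : euler g ((s : ℂ) • τ) = s * fderiv ℂ g ((s : ℂ) • τ) τ := by
      rw [← sum_mul_pd (differentiableAt_of_mem hg (ofReal_smul_mem hτ hs)), euler,
        Finset.mul_sum]
      exact Finset.sum_congr rfl fun n _ => by rw [Pi.smul_apply, smul_eq_mul, mul_assoc]
    have h3 := h1.mul (hasDerivAt_ray_line hg hτ hs)
    rw [h2]
    convert! h3 using 1
    push_cast
    ring
  have hc : DifferentiableOn ℂ (fun τ => euler g τ + (k + 1) * g τ) (polydisc κ r) :=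
    (differentiableOn_euler hg).add (hg.const_mul _)
  have := intervalIntegral.integral_eq_sub_of_hasDerivAt hd
    (continuousOn_ray hc.continuousOn hτ k).intervalIntegrable
  rw [ray, this]
  simp

/-- The Euler field commutes with the average along rays, by differentiation under the integral
sign; this reduces the claim to `ray_euler`. -/
theorem euler_ray (k : ℕ) (hg : DifferentiableOn ℂ g (polydisc κ r)) (hτ : τ ∈ polydisc κ r) :
    euler (ray k g) τ + (k + 1) * ray k g τ = g τ := by
  have h1 := hasFDerivAt_ray k hg hτ
  have h2 : euler (ray k g) τ = ray k (euler g) τ := by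
    have hcont : ContinuousOn (fun s : ℝ => ((s : ℂ) ^ k) • (fderiv ℂ g ((s : ℂ) • τ)).comp
        ((s : ℂ) • ContinuousLinearMap.id ℂ (κ → ℂ))) (Set.uIcc 0 1) := by
      have : ContinuousOn (fderiv ℂ g) (polydisc κ r) := (differentiableOn_fderiv hg).continuousOn
      have hτ' : Continuous fun s : ℝ => (s : ℂ) • τ := by fun_prop
      have hid : Continuous fun s : ℝ => (s : ℂ) • ContinuousLinearMap.id ℂ (κ → ℂ) := by fun_prop
      have hpow : Continuous fun s : ℝ => (s : ℂ) ^ k := by fun_prop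
      exact hpow.continuousOn.smul ((this.comp hτ'.continuousOn fun s hs =>
        ofReal_smul_mem hτ hs).clm_comp hid.continuousOn)
    have h3 : euler (ray k g) τ = fderiv ℂ (ray k g) τ τ := sum_mul_pd h1.differentiableAt τ
    rw [h3, h1.fderiv, ContinuousLinearMap.intervalIntegral_apply hcont.intervalIntegrable]
    refine intervalIntegral.integral_congr fun s hs => ?_
    have h4 : euler g ((s : ℂ) • τ) = fderiv ℂ g ((s : ℂ) • τ) ((s : ℂ) • τ) :=
      sum_mul_pd (differentiableAt_of_mem hg (ofReal_smul_mem hτ hs)) _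
    simp only [h4]
    rfl
  rw [h2]
  conv_rhs => rw [← ray_euler k hg hτ]
  simp only [ray, mul_add]
  rw [intervalIntegral.integral_add
    (continuousOn_ray (differentiableOn_euler hg).continuousOn hτ k).intervalIntegrable]
  · congr 1
    rw [← intervalIntegral.integral_const_mul]
    exact intervalIntegral.integral_congr fun s _ => by ring
  · exact (continuousOn_ray (hg.const_mul ((k : ℂ) + 1)).continuousOn hτ k).intervalIntegrable

/-- Hadamard's lemma. -/
theorem eq_add_sum_ray (hg : DifferentiableOn ℂ g (polydisc κ r)) (hτ : τ ∈ polydisc κ r) :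
    g τ = g 0 + ∑ n, τ n * ray 0 (pd n g) τ := by
  have hd := fun s hs => hasDerivAt_ray_line hg hτ (s := s) hs
  have h1 : ∀ s ∈ Set.uIcc (0 : ℝ) 1, fderiv ℂ g ((s : ℂ) • τ) τ =
      ∑ n, ((s : ℂ) ^ 0 * pd n g ((s : ℂ) • τ)) * τ n := fun s hs => by
    rw [← sum_mul_pd (differentiableAt_of_mem hg (ofReal_smul_mem hτ hs))]
    exact Finset.sum_congr rfl fun n _ => by ring
  have hc : ∀ n, ContinuousOn (fun s : ℝ => ((s : ℂ) ^ 0 * pd n g ((s : ℂ) • τ)) * τ n)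
      (Set.uIcc 0 1) := fun n =>
    (continuousOn_ray (differentiableOn_pd n hg).continuousOn hτ 0).mul continuousOn_const
  have h2 := intervalIntegral.integral_eq_sub_of_hasDerivAt hd
    (((continuousOn_finsetSum _ fun n _ => hc n).congr h1).intervalIntegrable)
  rw [intervalIntegral.integral_congr (g := fun s : ℝ =>
      ∑ n, ((s : ℂ) ^ 0 * pd n g ((s : ℂ) • τ)) * τ n) fun s hs => h1 s hs,
    intervalIntegral.integral_finsetSum fun n _ => (hc n).intervalIntegrable] at h2
  simp only [intervalIntegral.integral_mul_const, Complex.ofReal_one, one_smul,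
    Complex.ofReal_zero, zero_smul] at h2
  simp only [ray]
  rw [eq_comm, ← eq_sub_iff_add_eq', ← h2]
  exact Finset.sum_congr rfl fun n _ => mul_comm _ _

theorem pd_comm (n m : κ) (hg : DifferentiableOn ℂ g (polydisc κ r)) (hτ : τ ∈ polydisc κ r) :
    pd n (pd m g) τ = pd m (pd n g) τ := by
  classical
  have h1 : DifferentiableAt ℂ (fderiv ℂ g) τ :=
    (differentiableOn_fderiv hg).differentiableAt ((isOpen_polydisc r).mem_nhds hτ)
  have h2 : ∀ n m, pd n (pd m g) τ =
      fderiv ℂ (fderiv ℂ g) τ (Pi.single n 1) (Pi.single m 1) := fun n m => by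
    have h3 : Set.EqOn (pd m g) (fun τ => fderiv ℂ g τ (Pi.single m 1)) (polydisc κ r) :=
      fun x hx => pd_eq_fderiv m (differentiableAt_of_mem hg hx)
    rw [pd_congr n h3 hτ]
    have h4 : HasFDerivAt (fun τ => fderiv ℂ g τ (Pi.single m 1))
        ((ContinuousLinearMap.apply ℂ ℂ (Pi.single m 1 : κ → ℂ)).comp
          (fderiv ℂ (fderiv ℂ g) τ)) τ :=
      (ContinuousLinearMap.apply ℂ ℂ (Pi.single m 1 : κ → ℂ)).hasFDerivAt.comp τ h1.hasFDerivAt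
    rw [pd_eq_fderiv n h4.differentiableAt, h4.fderiv]
    simp
  rw [h2, h2]
  refine second_derivative_symmetric_of_eventually (f := g) (f' := fderiv ℂ g) ?_ h1.hasFDerivAt _ _
  filter_upwards [(isOpen_polydisc r).mem_nhds hτ] with y hy
  exact (differentiableAt_of_mem hg hy).hasFDerivAt

/-- The coordinate τ n in the Euler field contributes the extra term by the product rule; the
remaining terms agree because partial derivatives commute. -/
theorem pd_euler (n : κ) (hg : DifferentiableOn ℂ g (polydisc κ r)) (hτ : τ ∈ polydisc κ r) :
    pd n (euler g) τ = euler (pd n g) τ + pd n g τ := by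
  classical
  have h1 : ∀ m, DifferentiableOn ℂ (fun τ : κ → ℂ => τ m) (polydisc κ r) := fun m =>
    (differentiable_apply m).differentiableOn
  have h2 : pd n (euler g) τ = ∑ m, pd n (fun τ => τ m * pd m g τ) τ := by
    have h3 : ∀ m, DifferentiableAt ℂ (fun τ : κ → ℂ => τ m * pd m g τ) τ := fun m =>
      differentiableAt_of_mem ((h1 m).mul (differentiableOn_pd m hg)) hτ
    rw [pd_eq_fderiv n (differentiableAt_of_mem (differentiableOn_euler hg) hτ)]
    unfold euler
    rw [fderiv_fun_sum fun m _ => h3 m, _root_.sum_apply]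
    exact Finset.sum_congr rfl fun m _ => (pd_eq_fderiv n (h3 m)).symm
  rw [h2]
  simp only [pd_mul n (h1 _) (differentiableOn_pd _ hg) hτ, pd_coord, euler, Finset.sum_add_distrib,
    ite_mul, one_mul, zero_mul, Finset.sum_ite_eq, Finset.mem_univ, if_true]
  rw [add_comm]
  congr 1
  exact Finset.sum_congr rfl fun m _ => by rw [pd_comm n m hg hτ]

end

/-- The partial derivative. -/
def pdOp [Finite κ] (n : κ) : Op κ where
  op := pd n
  congr h := by
    have := Fintype.ofFinite κ
    exact pd_congr n h
  sum c g hg := by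
    have := Fintype.ofFinite κ
    exact pd_sum n c g hg
  holo {ι _ A r g} hA hg := by
    classical
    have := Fintype.ofFinite κ
    have := Fintype.ofFinite ι
    have := differentiableOn_deriv_line (isOpen_dom (κ := κ) hA r) hg (Pi.single (Sum.inr n) 1)
    refine this.congr fun w _ => ?_
    unfold pd slice
    congr 1
    funext ζ
    congr 1
    funext i
    rcases i with i | i
    · simp
    · simp only [Sum.elim_inr, Pi.add_apply, Pi.smul_apply, Pi.single_apply, Sum.inr.injEq]

/-- The weighted average along rays. -/
def rayOp (κ : Type u) [Finite κ] (k : ℕ) : Op κ where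
  op := ray k
  congr h := by
    have := Fintype.ofFinite κ
    exact ray_congr k h
  sum c g hg := by
    have := Fintype.ofFinite κ
    exact ray_sum k c g hg
  holo {ι _ A r g} hA hg := by
    have := Fintype.ofFinite κ
    have := Fintype.ofFinite ι
    intro w hw
    refine DifferentiableAt.differentiableWithinAt ?_
    -- The map P1 + s P2 scales only the second group of variables, so that the average along rays
    -- becomes an integral over affine maps of all variables jointly.
    let P1 : (ι ⊕ κ → ℂ) →L[ℂ] (ι ⊕ κ → ℂ) := ContinuousLinearMap.pi
      (Sum.elim (fun i => ContinuousLinearMap.proj (Sum.inl i)) fun _ => 0)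
    let P2 : (ι ⊕ κ → ℂ) →L[ℂ] (ι ⊕ κ → ℂ) := ContinuousLinearMap.pi
      (Sum.elim (fun _ => 0) fun n => ContinuousLinearMap.proj (Sum.inr n))
    have hP : ∀ (s : ℂ) (w : ι ⊕ κ → ℂ), (P1 + s • P2) w + 0 =
        Sum.elim (fun i => w (Sum.inl i)) (s • fun n => w (Sum.inr n)) := by
      intro s w
      funext i
      rcases i with i | i <;> simp [P1, P2]
    have := (hasFDerivAt_integral_affine (isOpen_dom (κ := κ) hA r) hg (a := 0) (b := 1)
      (k := fun s => (s : ℂ) ^ k) (by fun_prop) (A := fun s => P1 + (s : ℂ) • P2) (by fun_prop)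
      (β := fun _ => 0) continuous_const (w := w) (fun s hs => by
        rw [hP]
        exact ⟨hw.1, ofReal_smul_mem hw.2 hs⟩)).differentiableAt
    simp only [hP] at this
    exact this

end Slice

end

/-! ### Local properties of cells, separatedness and gluing -/

section

variable {W : SimplicialSystem.{u}}

namespace Cell

theorem trans_continuous {α β : W.faces} (h : α ≤ β) :
    Continuous (SimplicialSystem.trans h : W.pt β → W.pt α) :=
  (W.space.map (homOfLE h).op).hom.continuous

/-- Properties of cells that pass to smaller open subsets of the same simplex. -/
def Stable (c : Cell W) (P : ∀ c' : Cell W, c' ≤ c → Prop) : Prop :=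
  ∀ (V V' : Opens (W.pt c.face)) (hV : V ≤ c.U) (h : V' ≤ V),
    P ⟨c.face, V⟩ (le_of_le hV) → P ⟨c.face, V'⟩ (le_of_le (h.trans hV))

variable {c : Cell W} {P P' : ∀ c' : Cell W, c' ≤ c → Prop}

theorem Locally.mono (h : c.Locally P)
    (h' : ∀ (V : Opens (W.pt c.face)) (hV : V ≤ c.U), P ⟨c.face, V⟩ (le_of_le hV) →
      P' ⟨c.face, V⟩ (le_of_le hV)) : c.Locally P' := fun x hx =>
  let ⟨V, hV, hxV, hP⟩ := h x hx
  ⟨V, hV, hxV, h' V hV hP⟩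

theorem Locally.forall_finite {X : Type*} [Finite X] {P : X → ∀ c' : Cell W, c' ≤ c → Prop}
    (h : ∀ i, c.Locally (P i)) (hP : ∀ i, c.Stable (P i)) :
    c.Locally fun c' l => ∀ i, P i c' l := fun x hx => by
  choose V hV hxV hp using fun i => h i x hx
  let V' : Opens (W.pt c.face) := ⟨⋂ i, V i, isOpen_iInter_of_finite fun i => (V i).2⟩
  exact ⟨V' ⊓ c.U, inf_le_right, ⟨Set.mem_iInter.2 hxV, hx⟩, fun i =>
    hP i (V i) _ (hV i) (fun y (hy : y ∈ V' ∧ y ∈ c.U) => Set.mem_iInter.1 hy.1 i) (hp i)⟩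

end Cell

namespace CDGA

theorem GrHom.map_proj {A B : CDGA.{u}} (f : GrHom A B) (n : ℤ) (a : A) :
    f.toAlgHom (A.proj n a) = B.proj n (f.toAlgHom a) := by
  induction a using homogeneous_induction with
  | h0 => simp
  | hadd a b ha hb => simp [ha, hb]
  | hhom m a ha =>
    by_cases h : n = m
    · subst h
      rw [proj_of_mem ha, proj_of_mem (f.map_deg ha)]
    · rw [proj_of_ne h ha, proj_of_ne h (f.map_deg ha), map_zero]

end CDGA

namespace DGPresheaf

open CDGA

variable {F G : DGPresheaf W}

theorem res_proj {c' c : Cell W} (h : c' ≤ c) (n : ℤ) (a : F.sec c) :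
    F.res h ((F.sec c).proj n a) = (F.sec c').proj n (F.res h a) := (F.resG h).map_proj n a

/-- The sheaf condition is available only for homogeneous components; projections to components
commute with restrictions, so equality can be checked degree by degree. -/
theorem IsSheaf.ext (hF : F.IsSheaf) {c : Cell W} {s s' : F.sec c}
    (h : c.Locally fun _ l => F.res l s = F.res l s') : s = s' := by
  refine eq_of_proj_eq fun n => ?_
  choose V hV hxV hp using fun x : c.U => h x.1 x.2
  have hle : c ≤ ⟨c.face, iSup V⟩ :=
    Cell.le_of_le fun x hx => Opens.mem_iSup.2 ⟨⟨x, hx⟩, hxV ⟨x, hx⟩⟩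
  have hge : (⟨c.face, iSup V⟩ : Cell W) ≤ c := Cell.le_of_le (iSup_le hV)
  have key := fun s : F.sec c => hF c.face c.U V n (fun x => F.res (Cell.le_of_le (hV x)) (proj _ n s))
    (fun x => F.res_mem _ (proj_mem _ _)) fun x y => by rw [res_res, res_res]
  have hpr : ∀ x, F.res (Cell.le_of_le (hV x)) (proj _ n s) =
      F.res (Cell.le_of_le (hV x)) (proj _ n s') := fun x => by
    rw [res_proj, res_proj, hp]
  obtain ⟨t, -, ht⟩ := key s
  have h1 := ht (F.res hge (proj _ n s)) ⟨F.res_mem _ (proj_mem _ _), fun x => by rw [res_res]⟩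
  have h2 := ht (F.res hge (proj _ n s')) ⟨F.res_mem _ (proj_mem _ _), fun x => by
    rw [res_res, hpr]⟩
  have h3 := congrArg (F.res hle) (h1.trans h2.symm)
  rwa [res_res, res_res, res_self, res_self] at h3

/-- Sections that are characterized locally can be glued. -/
theorem IsSheaf.glue (hF : F.IsSheaf) {c : Cell W} (n : ℤ)
    (P : ∀ V : Opens (W.pt c.face), V ≤ c.U → F.sec ⟨c.face, V⟩ → Prop)
    (mono : ∀ V V' (hV : V ≤ c.U) (h : V' ≤ V) s, P V hV s →
      P V' (h.trans hV) (F.res (Cell.le_of_le h) s))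
    (uniq : ∀ V (hV : V ≤ c.U) s s', P V hV s → P V hV s' → s = s')
    (ex : ∀ x ∈ c.U, ∃ (V : Opens (W.pt c.face)) (hV : V ≤ c.U), x ∈ V ∧
      ∃ s ∈ (F.sec ⟨c.face, V⟩).deg n, P V hV s) :
    ∃ t ∈ (F.sec c).deg n, ∀ x ∈ c.U, ∃ (V : Opens (W.pt c.face)) (hV : V ≤ c.U), x ∈ V ∧
      P V hV (F.res (Cell.le_of_le hV) t) := by
  choose V hV hxV s hs hp using fun x : c.U => ex x.1 x.2
  have hle : c ≤ ⟨c.face, iSup V⟩ :=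
    Cell.le_of_le fun x hx => Opens.mem_iSup.2 ⟨⟨x, hx⟩, hxV ⟨x, hx⟩⟩
  obtain ⟨t, ⟨ht, ht'⟩, -⟩ := hF c.face c.U V n s hs fun x y =>
    uniq _ (inf_le_left.trans (hV x)) _ _ (mono _ _ (hV x) inf_le_left _ (hp x))
      (mono _ _ (hV y) inf_le_right _ (hp y))
  refine ⟨F.res hle t, F.res_mem _ ht, fun x hx => ⟨V ⟨x, hx⟩, hV _, hxV ⟨x, hx⟩, ?_⟩⟩
  have h2 := hp ⟨x, hx⟩
  rw [← ht' ⟨x, hx⟩] at h2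
  rwa [res_res]

end DGPresheaf

end

/-! ### The functional calculus under changes of coordinates -/

section

variable {W : SimplicialSystem.{u}}

namespace DGPresheaf

variable {F G H : DGPresheaf W}

@[simp] theorem coe_res0 {c' c : Cell W} (h : c' ≤ c) (s : (F.sec c).zero) :
    (F.res0 h s : F.sec c') = F.res h s := rfl

@[simp] theorem coe_ap0 (f : F ⟶ G) (c : Cell W) (s : (F.sec c).zero) :
    (ap0 f c s : G.sec c) = ap f c s := rfl

theorem res0_res0 {c'' c' c : Cell W} (h' : c'' ≤ c') (h : c' ≤ c) (s : (F.sec c).zero) :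
    F.res0 h' (F.res0 h s) = F.res0 (h'.trans h) s := Subtype.ext (F.res_res h' h s)

theorem res0_ap0 (f : F ⟶ G) {c' c : Cell W} (h : c' ≤ c) (s : (F.sec c).zero) :
    G.res0 h (ap0 f c s) = ap0 f c' (F.res0 h s) := Subtype.ext (res_ap f h s)

theorem IsSheaf.ext0 (hF : F.IsSheaf) {c : Cell W} {s s' : (F.sec c).zero}
    (h : c.Locally fun _ l => F.res0 l s = F.res0 l s') : s = s' :=
  Subtype.ext (hF.ext (h.mono fun _ _ h => congrArg Subtype.val h))

end DGPresheaf

namespace HolStructure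

open DGPresheaf

variable {F : DGPresheaf W} (H : HolStructure F) {c : Cell W} {ι κ : Type u} [Finite ι] [Finite κ]

/-- Coordinate functions evaluate to the given sections, so that a reindexing of variables is a
composition of holomorphic functions. -/
theorem hol_reindex (b : κ → (F.sec c).zero) (f : ι → κ) {g : (ι → ℂ) → ℂ} {D : Set (ι → ℂ)}
    (hD : IsOpen D) (hb : ∀ x, (fun l => H.val c x (b (f l))) ∈ D) (hg : DifferentiableOn ℂ g D) :
    H.hol c g (fun l => b (f l)) = H.hol c (fun w => g fun l => w (f l)) b := by
  have := Fintype.ofFinite ι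
  have := Fintype.ofFinite κ
  have := H.hol_comp c b (fun l w => w (f l)) g ((fun w l => w (f l)) ⁻¹' D) D
    (hD.preimage (by fun_prop)) hb (fun l => (differentiable_apply (f l)).differentiableOn) hD
    (fun w hw => hw) hg
  simpa only [H.hol_coord] using this

omit [Finite ι] in
theorem val_res' {c' : Cell W} (h : c' ≤ c) (a : ι → (F.sec c).zero) {D : Set (ι → ℂ)}
    (ha : ∀ x, (fun l => H.val c x (a l)) ∈ D) (x : c'.U) :
    (fun l => H.val c' x (F.res0 h (a l))) ∈ D := by
  simpa only [H.val_res] using ha (Cell.point h x)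

variable {H} in
/-- Finitely many sections are locally holomorphic functions, with a common domain, of a tuple
that presents the structure sheaf. -/
theorem IsPresentation.exists_hol {a : ι → (F.sec c).zero} {m : ℕ} {p : Fin m → (ι → ℂ) → ℂ}
    (h : H.IsPresentation c a p) {X : Type*} [Finite X] (s : X → (F.sec c).zero) :
    c.Locally fun d l => ∃ (g : X → (ι → ℂ) → ℂ) (D : Set (ι → ℂ)), IsOpen D ∧
      (∀ x, (fun i => H.val d x (F.res0 l (a i))) ∈ D) ∧ (∀ i, DifferentiableOn ℂ (g i) D) ∧
      ∀ i, F.res0 l (s i) = H.hol d (g i) fun i => F.res0 l (a i) := by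
  have h1 : ∀ i, c.Locally fun d l => ∃ (g : (ι → ℂ) → ℂ) (D : Set (ι → ℂ)), IsOpen D ∧
      (∀ x, (fun i => H.val d x (F.res0 l (a i))) ∈ D) ∧ DifferentiableOn ℂ g D ∧
      F.res0 l (s i) = H.hol d g fun i => F.res0 l (a i) := fun i =>
    h.1 c.U le_rfl (s i)
  refine (Cell.Locally.forall_finite h1 ?_).mono ?_
  · rintro i V V' hV hVV' ⟨g, D, hD, ha, hg, hs⟩
    have hr : (⟨c.face, V'⟩ : Cell W) ≤ ⟨c.face, V⟩ := Cell.le_of_le hVV'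
    refine ⟨g, D, hD, fun x => ?_, hg, ?_⟩
    · simpa only [res0_res0] using H.val_res' hr _ ha x
    · have := congrArg (F.res0 hr) hs
      rw [H.hol_res hr _ g D hD ha hg] at this
      simpa only [res0_res0] using this
  · intro V hV hp
    choose g D hD ha hg hs using hp
    exact ⟨g, ⋂ i, D i, isOpen_iInter_of_finite hD, fun x => Set.mem_iInter.2 fun i => ha i x,
      fun i => (hg i).mono (Set.iInter_subset _ i), hs⟩

end HolStructure

namespace Slice

variable {ι ι' κ : Type u} [Finite ι] [Finite ι'] [Finite κ]

/-- A change of coordinates. -/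
def change (u : ι' → (ι → ℂ) → ℂ) (m : κ → (ι → ℂ) → ℂ) (w : ι ⊕ κ → ℂ) : ι' ⊕ κ → ℂ :=
  Sum.elim (fun l => u l fun i => w (Sum.inl i)) fun n => w (Sum.inr n) + m n fun i => w (Sum.inl i)

variable {u : ι' → (ι → ℂ) → ℂ} {m : κ → (ι → ℂ) → ℂ} {A : Set (ι → ℂ)}

theorem differentiable_left :
    Differentiable ℂ fun (w : ι ⊕ κ → ℂ) (i : ι) => w (Sum.inl i) := by
  have := Fintype.ofFinite ι
  have := Fintype.ofFinite κ
  fun_prop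

omit [Finite ι'] in
theorem differentiableOn_change_apply (hu : ∀ l, DifferentiableOn ℂ (u l) A)
    (hm : ∀ n, DifferentiableOn ℂ (m n) A) (k : ι' ⊕ κ) :
    DifferentiableOn ℂ (fun w => change u m w k) {w | (fun i => w (Sum.inl i)) ∈ A} := by
  have := Fintype.ofFinite ι
  have := Fintype.ofFinite κ
  rcases k with l | n
  · exact (hu l).comp differentiable_left.differentiableOn fun _ h => h
  · exact (differentiable_apply (Sum.inr n)).differentiableOn.add
      ((hm n).comp differentiable_left.differentiableOn fun _ h => h)

theorem differentiableOn_change (hu : ∀ l, DifferentiableOn ℂ (u l) A)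
    (hm : ∀ n, DifferentiableOn ℂ (m n) A) :
    DifferentiableOn ℂ (change u m) {w | (fun i => w (Sum.inl i)) ∈ A} := by
  have := Fintype.ofFinite ι
  have := Fintype.ofFinite ι'
  have := Fintype.ofFinite κ
  exact differentiableOn_pi.2 (differentiableOn_change_apply hu hm)

/-- The preimage of a set under a change of coordinates. -/
def changeDom (u : ι' → (ι → ℂ) → ℂ) (m : κ → (ι → ℂ) → ℂ) (A : Set (ι → ℂ))
    (D : Set (ι' ⊕ κ → ℂ)) : Set (ι ⊕ κ → ℂ) :=
  {w | (fun i => w (Sum.inl i)) ∈ A} ∩ change u m ⁻¹' D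

theorem isOpen_changeDom (hA : IsOpen A) (hu : ∀ l, DifferentiableOn ℂ (u l) A)
    (hm : ∀ n, DifferentiableOn ℂ (m n) A) {D : Set (ι' ⊕ κ → ℂ)} (hD : IsOpen D) :
    IsOpen (changeDom u m A D) := by
  have := Fintype.ofFinite ι
  have := Fintype.ofFinite ι'
  have := Fintype.ofFinite κ
  exact (differentiableOn_change hu hm).continuousOn.isOpen_inter_preimage
    (hA.preimage differentiable_left.continuous) hD

theorem differentiableOn_comp_change (hu : ∀ l, DifferentiableOn ℂ (u l) A)
    (hm : ∀ n, DifferentiableOn ℂ (m n) A) {D : Set (ι' ⊕ κ → ℂ)} {g : (ι' ⊕ κ → ℂ) → ℂ}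
    (hg : DifferentiableOn ℂ g D) :
    DifferentiableOn ℂ (fun w => g (change u m w)) (changeDom u m A D) := by
  have := Fintype.ofFinite ι
  have := Fintype.ofFinite ι'
  have := Fintype.ofFinite κ
  exact hg.comp ((differentiableOn_change hu hm).mono Set.inter_subset_left) fun _ h => h.2

/-- All points have vanishing τ, so products of open sets with polydiscs around 0 are the only
domains needed; on these the slices are polydiscs, as the operators require. -/
theorem exists_dom_subset {O : Set (ι ⊕ κ → ℂ)} (hO : IsOpen O) {z : ι → ℂ}
    (hz : Sum.elim z 0 ∈ O) : ∃ (A : Set (ι → ℂ)) (r : ℝ), IsOpen A ∧ z ∈ A ∧ 0 < r ∧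
      dom κ A r ⊆ O := by
  have := Fintype.ofFinite ι
  have := Fintype.ofFinite κ
  obtain ⟨r, hr, h⟩ := Metric.isOpen_iff.1 hO _ hz
  refine ⟨Metric.ball z r, r, Metric.isOpen_ball, Metric.mem_ball_self hr, hr, fun w hw => h ?_⟩
  rw [Metric.mem_ball, dist_pi_lt_iff hr]
  rintro (i | n)
  · exact (dist_pi_lt_iff hr).1 (Metric.mem_ball.1 hw.1) i
  · simpa using hw.2 n

theorem differentiableOn_comp_left {g : (ι → ℂ) → ℂ} (hg : DifferentiableOn ℂ g A) :
    DifferentiableOn ℂ (fun w : ι ⊕ κ → ℂ => g fun i => w (Sum.inl i))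
      {w | (fun i => w (Sum.inl i)) ∈ A} := by
  have := Fintype.ofFinite ι
  have := Fintype.ofFinite κ
  exact hg.comp differentiable_left.differentiableOn fun _ h => h

end Slice

namespace HolStructure

open DGPresheaf Slice

variable {R Q : DGPresheaf W} {HR : HolStructure R} {HQ : HolStructure Q} {i : R ⟶ Q}

theorem Preserves.hol_left (hi : HR.Preserves HQ i) {c : Cell W} {ι κ : Type u} [Finite ι]
    [Finite κ] (a : ι → (R.sec c).zero) (σ : κ → (Q.sec c).zero) {A : Set (ι → ℂ)} (hA : IsOpen A)
    (ha : ∀ x, (fun l => HR.val c x (a l)) ∈ A) {g : (ι → ℂ) → ℂ} (hg : DifferentiableOn ℂ g A) :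
    HQ.hol c (fun w => g fun l => w (Sum.inl l)) (Sum.elim (fun l => ap0 i c (a l)) σ) =
      ap0 i c (HR.hol c g a) := by
  rw [hi.2 c a g A hA ha hg]
  exact (HQ.hol_reindex (Sum.elim (fun l => ap0 i c (a l)) σ) Sum.inl hA
    (by simpa [hi.1] using ha) hg).symm

/-- The functional calculus after a change of coordinates. -/
theorem Preserves.hol_change (hi : HR.Preserves HQ i) {c : Cell W} {ι ι' κ : Type u} [Finite ι]
    [Finite ι'] [Finite κ] (a : ι → (R.sec c).zero) (σ : κ → (Q.sec c).zero) {A : Set (ι → ℂ)}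
    (hA : IsOpen A) (ha : ∀ x, (fun l => HR.val c x (a l)) ∈ A) {u : ι' → (ι → ℂ) → ℂ}
    {m : κ → (ι → ℂ) → ℂ} (hu : ∀ l, DifferentiableOn ℂ (u l) A)
    (hm : ∀ n, DifferentiableOn ℂ (m n) A) {D : Set (ι' ⊕ κ → ℂ)} (hD : IsOpen D)
    (hval : ∀ x, change u m (Sum.elim (fun l => HR.val c x (a l)) fun n => HQ.val c x (σ n)) ∈ D)
    {g : (ι' ⊕ κ → ℂ) → ℂ} (hg : DifferentiableOn ℂ g D) :
    HQ.hol c g (Sum.elim (fun l => ap0 i c (HR.hol c (u l) a))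
        fun n => σ n + ap0 i c (HR.hol c (m n) a)) =
      HQ.hol c (fun w => g (change u m w)) (Sum.elim (fun l => ap0 i c (a l)) σ) := by
  have hv : ∀ x, (fun l => HQ.val c x (Sum.elim (fun l => ap0 i c (a l)) σ l)) =
      Sum.elim (fun l => HR.val c x (a l)) fun n => HQ.val c x (σ n) := fun x => by
    funext l
    rcases l with l | n
    · exact hi.1 c x (a l)
    · rfl
  have hin : ∀ x, (fun l => HQ.val c x (Sum.elim (fun l => ap0 i c (a l)) σ l)) ∈
      changeDom u m A D := fun x => by
    rw [hv]
    exact ⟨ha x, hval x⟩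
  have hopen := isOpen_changeDom hA hu hm hD
  rw [← HQ.hol_comp c (Sum.elim (fun l => ap0 i c (a l)) σ) (fun k w => change u m w k) g
    (changeDom u m A D) D hopen hin
    (fun k => (differentiableOn_change_apply hu hm k).mono Set.inter_subset_left) hD
    (fun w hw => hw.2) hg]
  congr 1
  funext k
  rcases k with l | n
  · exact (hi.hol_left a σ hA ha (hu l)).symm
  · have h1 := HQ.hol_add c (Sum.elim (fun l => ap0 i c (a l)) σ) (fun w => w (Sum.inr n))
      (fun w => m n fun l => w (Sum.inl l)) (changeDom u m A D) hopen hin (by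
        have := Fintype.ofFinite ι
        have := Fintype.ofFinite κ
        exact (differentiable_apply _).differentiableOn)
      ((differentiableOn_comp_left (hm n)).mono Set.inter_subset_left)
    rw [HQ.hol_coord, hi.hol_left a σ hA ha (hm n)] at h1
    exact h1.symm

end HolStructure

end

/-! ### Coordinates translated so that the augmentation kills them -/

section

variable {W : SimplicialSystem.{u}}

namespace FreeAnalytic

open DGPresheaf Slice

variable {R S : DGPresheaf W} {HR : HolStructure R} {j : R ⟶ S} (fa : FreeAnalytic HR j)

/-- The generators of degree `0`. -/
abbrev gens0 : Gens W := fa.G.filter (· = 0)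

/-- The generators of degree `0` on a simplex. -/
abbrev Idx (α : W.faces) : Type u := {n : fa.gens0.idx // fa.gens0.face n ≤ α}

instance (α : W.faces) : Finite (fa.Idx α) :=
  inferInstanceAs (Finite (fa.gens0.At (Cell.whole α)))

variable (μ : S ⟶ R)

/-- The value of a coordinate under the augmentation. -/
def shiftVal (n : fa.gens0.idx) : (R.sec (Cell.whole (fa.gens0.face n))).zero :=
  ap0 μ _ (ap0 fa.k _ (fa.t n))

/-- The coordinates of degree `0`, translated so that the augmentation vanishes on them. -/
def tau (n : fa.gens0.idx) : (fa.Q.sec (Cell.whole (fa.gens0.face n))).zero :=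
  fa.t n - ap0 fa.i _ (fa.shiftVal μ n)

/-- The translated coordinates on a cell. -/
def coord (c : Cell W) (n : fa.Idx c.face) : (fa.Q.sec c).zero :=
  fa.Q.res0 (Cell.le_whole n.2) (fa.tau μ n.1)

/-- The values of the coordinates on a cell. -/
def shiftAt (c : Cell W) (n : fa.Idx c.face) : (R.sec c).zero :=
  R.res0 (Cell.le_whole n.2) (fa.shiftVal μ n.1)

/-- Points lie on the zero section, so t has value 0 everywhere. If μ(t) had a value z ≠ 0 at some
point, the functional calculus would make t - z invertible; but its augmentation has value z - z = 0
at that point, which is not invertible. Hence the translated coordinates still vanish at all points.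
-/
theorem val_shiftVal (n : fa.gens0.idx) (x) : HR.val _ x (fa.shiftVal μ n) = 0 := by
  let c : Cell W := Cell.whole (fa.gens0.face n)
  by_contra hz
  let z := HR.val c x (fa.shiftVal μ n)
  let a : PUnit.{u + 1} → (fa.Q.sec c).zero := fun _ => fa.t n
  let D : Set (PUnit.{u + 1} → ℂ) := {w | w ⟨⟩ ≠ z}
  have hD : IsOpen D := isOpen_ne_fun (continuous_apply _) continuous_const
  have ha : ∀ y, (fun l => fa.HQ.val c y (a l)) ∈ D := fun y => by
    change fa.HQ.val c y (fa.t n) ≠ z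
    rw [fa.val_t]
    exact Ne.symm hz
  have h1 : DifferentiableOn ℂ (fun w : PUnit.{u + 1} → ℂ => w ⟨⟩) D :=
    (differentiable_apply _).differentiableOn
  have h2 : DifferentiableOn ℂ (fun w : PUnit.{u + 1} → ℂ => w ⟨⟩ + -z) D := h1.add_const _
  have h3 : DifferentiableOn ℂ (fun w : PUnit.{u + 1} → ℂ => (w ⟨⟩ + -z)⁻¹) D :=
    h2.inv fun w hw => by
      rw [← sub_eq_add_neg, sub_ne_zero]
      exact hw
  have e1 := fa.HQ.hol_mul c a _ _ D hD ha h2 h3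
  have e2 := fa.HQ.hol_congr c a _ (fun _ => 1) D hD ha (h2.mul h3) fun w hw => by
    refine mul_inv_cancel₀ ?_
    change w ⟨⟩ + -z ≠ 0
    rw [← sub_eq_add_neg, sub_ne_zero]
    exact hw
  have e3 := fa.HQ.hol_add c a _ (fun _ => -z) D hD ha h1 (differentiableOn_const _)
  rw [fa.HQ.hol_coord, fa.HQ.hol_const] at e3
  simp only [Pi.mul_def] at e2
  rw [e1, e3, fa.HQ.hol_const] at e2
  have e4 := congrArg (fun q => HR.val c x (ap0 μ c (ap0 fa.k c q))) e2
  simp only [map_mul, map_add, map_one, AlgHom.commutes, Algebra.algebraMap_self, RingHom.id_apply]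
    at e4
  change (z + -z) * _ = 1 at e4
  rw [add_neg_cancel, zero_mul] at e4
  exact zero_ne_one e4

theorem val_tau (n : fa.gens0.idx) (x) : fa.HQ.val _ x (fa.tau μ n) = 0 := by
  rw [tau, map_sub, fa.val_t, fa.preserves.1, val_shiftVal, sub_zero]

theorem val_coord (c : Cell W) (n : fa.Idx c.face) (x : c.U) :
    fa.HQ.val c x (fa.coord μ c n) = 0 := by
  rw [coord, fa.HQ.val_res]
  exact fa.val_tau μ n.1 _

theorem val_shiftAt (c : Cell W) (n : fa.Idx c.face) (x : c.U) :
    HR.val c x (fa.shiftAt μ c n) = 0 := by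
  rw [shiftAt, HR.val_res]
  exact fa.val_shiftVal μ n.1 _

theorem res0_coord {c' c : Cell W} (h : c' ≤ c) (n : fa.Idx c.face) :
    fa.Q.res0 h (fa.coord μ c n) = fa.coord μ c' ⟨n.1, n.2.trans h.fst⟩ := res0_res0 _ _ _

theorem res0_shiftAt {c' c : Cell W} (h : c' ≤ c) (n : fa.Idx c.face) :
    R.res0 h (fa.shiftAt μ c n) = fa.shiftAt μ c' ⟨n.1, n.2.trans h.fst⟩ := res0_res0 _ _ _

theorem coord_eq (c : Cell W) (n : fa.Idx c.face) :
    fa.coord μ c n = fa.Q.res0 (Cell.le_whole n.2) (fa.t n.1) - ap0 fa.i c (fa.shiftAt μ c n) := by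
  rw [coord, tau, map_sub, res0_ap0]
  rfl

/-- Sections of `R⁰` together with the translated coordinates. -/
def tuple (c : Cell W) {ι : Type u} (a : ι → (R.sec c).zero) : ι ⊕ fa.Idx c.face → (fa.Q.sec c).zero :=
  Sum.elim (fun l => ap0 fa.i c (a l)) (fa.coord μ c)

theorem val_tuple {c : Cell W} {ι : Type u} (a : ι → (R.sec c).zero) (x : c.U) :
    (fun l => fa.HQ.val c x (fa.tuple μ c a l)) = Sum.elim (fun l => HR.val c x (a l)) 0 := by
  funext l
  rcases l with l | n
  · exact fa.preserves.1 c x (a l)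
  · exact fa.val_coord μ c n x

theorem res_tuple {c : Cell W} {V : Opens (W.pt c.face)} (h : V ≤ c.U) {ι : Type u}
    (a : ι → (R.sec c).zero) : (fun l => fa.Q.res0 (Cell.le_of_le h) (fa.tuple μ c a l)) =
      fa.tuple μ ⟨c.face, V⟩ fun l => R.res0 (Cell.le_of_le h) (a l) := by
  funext l
  rcases l with l | n
  · exact res0_ap0 fa.i _ _
  · exact fa.res0_coord μ _ n

/-- The values of `a` lie in the open set `A`, and `r` is positive. -/
structure _root_.HolStructure.Near (HR : HolStructure R) {c : Cell W} {ι : Type u}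
    (a : ι → (R.sec c).zero) (A : Set (ι → ℂ)) (r : ℝ) : Prop where
  isOpen : IsOpen A
  pos : 0 < r
  mem : ∀ x, (fun l => HR.val c x (a l)) ∈ A

theorem _root_.HolStructure.Near.res {c : Cell W} {ι : Type u} {a : ι → (R.sec c).zero}
    {A : Set (ι → ℂ)} {r : ℝ} (h : HR.Near a A r) {c' : Cell W} (l : c' ≤ c) :
    HR.Near (fun k => R.res0 l (a k)) A r :=
  ⟨h.isOpen, h.pos, HR.val_res' l a h.mem⟩

section

variable {μ} {c : Cell W} {ι : Type u} [Finite ι] {a : ι → (R.sec c).zero} {A : Set (ι → ℂ)} {r : ℝ}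

omit [Finite ι] in
theorem val_tuple_mem (h : HR.Near a A r) (x : c.U) :
    (fun l => fa.HQ.val c x (fa.tuple μ c a l)) ∈ dom (fa.Idx c.face) A r := by
  rw [val_tuple]
  exact ⟨h.mem x, fun n => by simpa using h.pos⟩

theorem res_hol_tuple (h : HR.Near a A r) {V : Opens (W.pt c.face)} (hV : V ≤ c.U)
    {g : (ι ⊕ fa.Idx c.face → ℂ) → ℂ} (hg : DifferentiableOn ℂ g (dom _ A r)) :
    fa.Q.res0 (Cell.le_of_le hV) (fa.HQ.hol c g (fa.tuple μ c a)) =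
      fa.HQ.hol ⟨c.face, V⟩ g (fa.tuple μ _ fun l => R.res0 (Cell.le_of_le hV) (a l)) := by
  rw [fa.HQ.hol_res (Cell.le_of_le hV) _ g _ (isOpen_dom h.isOpen r) (fa.val_tuple_mem h) hg,
    res_tuple _ _ hV]

end

/-- A chart around a point. -/
theorem _root_.HolStructure.IsComplexAnalytic.exists_nhds (hR : HR.IsComplexAnalytic) {c : Cell W} {x}
    (hx : x ∈ c.U) : ∃ (V : Opens (W.pt c.face)) (_ : V ≤ c.U) (_ : x ∈ V) (ι : Type u) (_ : Finite ι)
      (a : ι → (R.sec ⟨c.face, V⟩).zero) (m : ℕ) (p : Fin m → (ι → ℂ) → ℂ), HR.IsChart _ a p :=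
  let ⟨V, hV, hxV, ι, hι, a, m, p, h⟩ := hR c x hx
  ⟨V, hV, hxV, ι, hι, a, m, p, h⟩

theorem _root_.HolStructure.IsChart.exists_nhds {c : Cell W} {ι : Type u} [Finite ι]
    {a : ι → (R.sec c).zero} {m : ℕ} {p : Fin m → (ι → ℂ) → ℂ} (h : HR.IsChart c a p)
    {A : Set (ι → ℂ)} (hA : IsOpen A) {x : c.U} (hx : (fun l => HR.val c x (a l)) ∈ A) :
    ∃ (V : Opens (W.pt c.face)) (hV : V ≤ c.U), x.1 ∈ V ∧
      ∀ y : V, (fun l => HR.val c ⟨y.1, hV y.2⟩ (a l)) ∈ A := by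
  have ho := hA.preimage h.1.continuous
  refine ⟨⟨_, c.U.isOpen.isOpenMap_subtype_val _ ho⟩, ?_, ⟨x, hx, rfl⟩, ?_⟩
  · rintro _ ⟨y, -, rfl⟩
    exact y.2
  · rintro ⟨_, y, hy, rfl⟩
    exact hy

end FreeAnalytic

end

/-! ### Operators in the coordinates preserve the ideal of relations -/

section

variable {W : SimplicialSystem.{u}}

theorem Cell.point_le_of_le {α : W.faces} {V U : Opens (W.pt α)} (h : V ≤ U) (x : V) :
    Cell.point (Cell.le_of_le h) x = ⟨x.1, h x.2⟩ := Subtype.ext <| by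
  change W.space.map (𝟙 _) x.1 = x.1
  simp

namespace FreeAnalytic

open DGPresheaf Slice

variable {R S : DGPresheaf W} {HR : HolStructure R} {j : R ⟶ S} (fa : FreeAnalytic HR j) {μ : S ⟶ R}

/-- Sections of `R⁰` together with the coordinates. -/
def rawTuple (c : Cell W) {ι : Type u} (a : ι → (R.sec c).zero) :
    ι ⊕ fa.Idx c.face → (fa.Q.sec c).zero :=
  Sum.elim (fun l => ap0 fa.i c (a l)) fun n => fa.Q.res0 (Cell.le_whole n.2) (fa.t n.1)

theorem val_rawTuple {c : Cell W} {ι : Type u} (a : ι → (R.sec c).zero) (x : c.U) :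
    (fun l => fa.HQ.val c x (fa.rawTuple c a l)) = Sum.elim (fun l => HR.val c x (a l)) 0 := by
  funext l
  rcases l with l | n
  · exact fa.preserves.1 c x (a l)
  · exact (fa.HQ.val_res _ x _).trans (fa.val_t _ _)

theorem res_rawTuple {c : Cell W} {V : Opens (W.pt c.face)} (h : V ≤ c.U) {ι : Type u}
    (a : ι → (R.sec c).zero) : (fun l => fa.Q.res0 (Cell.le_of_le h) (fa.rawTuple c a l)) =
      fa.rawTuple ⟨c.face, V⟩ fun l => R.res0 (Cell.le_of_le h) (a l) := by
  funext l
  rcases l with l | n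
  · exact res0_ap0 fa.i _ _
  · exact res0_res0 _ _ _

/-- Passage from the coordinates to the translated ones. -/
theorem hol_rawTuple {c : Cell W} {ι : Type u} [Finite ι] (a : ι → (R.sec c).zero)
    {A : Set (ι → ℂ)} (hA : IsOpen A) (ha : ∀ x, (fun l => HR.val c x (a l)) ∈ A)
    {m : fa.Idx c.face → (ι → ℂ) → ℂ} (hm : ∀ n, DifferentiableOn ℂ (m n) A)
    (hs : ∀ n, fa.shiftAt μ c n = HR.hol c (m n) a) {D : Set (ι ⊕ fa.Idx c.face → ℂ)} (hD : IsOpen D)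
    (hval : ∀ x, Sum.elim (fun l => HR.val c x (a l)) 0 ∈ D)
    {g : (ι ⊕ fa.Idx c.face → ℂ) → ℂ} (hg : DifferentiableOn ℂ g D) :
    fa.HQ.hol c g (fa.rawTuple c a) =
      fa.HQ.hol c (fun w => g (change (fun l z => z l) m w)) (fa.tuple μ c a) := by
  have h := fa.preserves.hol_change a (fa.coord μ c) hA ha (u := fun l z => z l) (m := m)
    (fun l => (differentiable_apply l).differentiableOn) hm hD (fun x => by
      convert hval x using 1
      funext l
      rcases l with l | n
      · rfl
      · change fa.HQ.val c x _ + m n (fun l => HR.val c x (a l)) = 0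
        rw [val_coord, ← HR.val_hol c a (m n) A hA ha (hm n), ← hs, val_shiftAt, add_zero]) hg
  refine Eq.trans ?_ h
  congr 1
  funext l
  rcases l with l | n
  · exact congrArg (ap0 fa.i c) (HR.hol_coord c a l).symm
  · change _ = fa.coord μ c n + _
    rw [← hs, coord_eq, sub_add_cancel]
    rfl

/-- Passage from the translated coordinates to the coordinates. -/
theorem hol_tuple {c : Cell W} {ι ι' : Type u} [Finite ι] [Finite ι'] (a : ι → (R.sec c).zero)
    {A : Set (ι → ℂ)} (hA : IsOpen A) (ha : ∀ x, (fun l => HR.val c x (a l)) ∈ A)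
    {u : ι' → (ι → ℂ) → ℂ} {m : fa.Idx c.face → (ι → ℂ) → ℂ} (hu : ∀ l, DifferentiableOn ℂ (u l) A)
    (hm : ∀ n, DifferentiableOn ℂ (m n) A) (hs : ∀ n, fa.shiftAt μ c n = HR.hol c (m n) a)
    {A' : Set (ι' → ℂ)} {r : ℝ} (hn : HR.Near (fun l => HR.hol c (u l) a) A' r)
    {g : (ι' ⊕ fa.Idx c.face → ℂ) → ℂ} (hg : DifferentiableOn ℂ g (dom _ A' r)) :
    fa.HQ.hol c g (fa.tuple μ c fun l => HR.hol c (u l) a) =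
      fa.HQ.hol c (fun w => g (change u (fun n z => -m n z) w)) (fa.rawTuple c a) := by
  have := Fintype.ofFinite ι
  have hneg : ∀ n, HR.hol c (fun z => -m n z) a = -HR.hol c (m n) a := fun n => by
    have h1 := HR.hol_mul c a (fun _ => -1) (m n) A hA ha (differentiableOn_const _) (hm n)
    rw [HR.hol_const] at h1
    simpa using h1
  have hv : ∀ x n, m n (fun l => HR.val c x (a l)) = 0 := fun x n => by
    rw [← HR.val_hol c a (m n) A hA ha (hm n), ← hs, val_shiftAt]
  refine Eq.trans ?_ (fa.preserves.hol_change a _ hA ha hu (fun n => (hm n).fun_neg)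
    (isOpen_dom hn.isOpen r) (fun x => ⟨?_, fun n => ?_⟩) hg)
  · congr 1
    funext l
    rcases l with l | n
    · rfl
    · change fa.coord μ c n = _ + ap0 fa.i c _
      rw [hneg, ← hs, coord_eq, map_neg, ← sub_eq_add_neg]
  · have := hn.mem x
    simp only [HR.val_hol c a _ A hA ha (hu _)] at this
    exact this
  · change ‖fa.HQ.val c x _ + -m n _‖ < r
    have h0 : fa.HQ.val c x (fa.Q.res0 (Cell.le_whole n.2) (fa.t n.1)) = 0 :=
      (fa.HQ.val_res _ x _).trans (fa.val_t _ _)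
    rw [h0]
    change ‖0 + -m n (fun l => HR.val c x (a l))‖ < r
    rw [hv]
    simpa using hn.pos

/-- Vanishing of a section is preserved by operators on the coordinates. -/
theorem hol_lift_eq_zero (hR : HR.IsComplexAnalytic) {c : Cell W} {ι : Type u} [Finite ι]
    {a : ι → (R.sec c).zero} {A : Set (ι → ℂ)} {r : ℝ} (hn : HR.Near a A r)
    {g : (ι ⊕ fa.Idx c.face → ℂ) → ℂ} (hg : DifferentiableOn ℂ g (dom _ A r))
    (Θ : Op (fa.Idx c.face)) (h : fa.HQ.hol c g (fa.tuple μ c a) = 0) :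
    fa.HQ.hol c (Θ.lift g) (fa.tuple μ c a) = 0 := by
  refine fa.isSheaf.ext0 fun x hx => ?_
  -- The tuple `a` need not be a chart. Near x a chart `b` is chosen, and both the sections `a` and
  -- the translations μ(t) are written as holomorphic functions u and m of `b`; this relates `g` to
  -- the presentation of Q⁰ by `b` and the original coordinates.
  obtain ⟨V₀, hV₀, hx₀, ι', _, b, M, p, hb⟩ := hR.exists_nhds hx
  obtain ⟨V₁, hV₁, hx₁, f, A₁, hA₁, hval₁, hf, hs⟩ : ∃ (V₁ : Opens (W.pt c.face)) (hV₁ : V₁ ≤ V₀)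
      (_ : x ∈ V₁) (f : ι ⊕ fa.Idx c.face → (ι' → ℂ) → ℂ) (A₁ : Set (ι' → ℂ)), IsOpen A₁ ∧
      (∀ y : V₁, (fun i => HR.val ⟨c.face, V₁⟩ y (R.res0 (Cell.le_of_le hV₁) (b i))) ∈ A₁) ∧
      (∀ i, DifferentiableOn ℂ (f i) A₁) ∧ ∀ i, R.res0 (Cell.le_of_le hV₁)
        (Sum.elim (fun l => R.res0 (Cell.le_of_le hV₀) (a l)) (fa.shiftAt μ ⟨c.face, V₀⟩) i) =
        HR.hol ⟨c.face, V₁⟩ (f i) fun i => R.res0 (Cell.le_of_le hV₁) (b i) := by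
    obtain ⟨V₁, hV₁, hx₁, h⟩ := hb.2.2.exists_hol
      (Sum.elim (fun l => R.res0 (Cell.le_of_le hV₀) (a l)) (fa.shiftAt μ ⟨c.face, V₀⟩)) x hx₀
    exact ⟨V₁, hV₁, hx₁, h⟩
  set u := fun l => f (Sum.inl l) with hu
  set m := fun n => f (Sum.inr n) with hm
  have hvres : ∀ (V : Opens (W.pt c.face)) (hV : V ≤ V₀) (y : W.pt c.face) (hy : y ∈ V)
      (s : (R.sec ⟨c.face, V₀⟩).zero), HR.val ⟨c.face, V⟩ ⟨y, hy⟩ (R.res0 (Cell.le_of_le hV) s) =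
        HR.val ⟨c.face, V₀⟩ ⟨y, hV hy⟩ s := fun V hV y hy s => by
    rw [HR.val_res, Cell.point_le_of_le]
  let b' : ∀ V : Opens (W.pt c.face), V ≤ V₁ → ι' → (R.sec ⟨c.face, V⟩).zero :=
    fun V hV l => R.res0 (Cell.le_of_le (hV.trans hV₁)) (b l)
  have hb' : ∀ (V : Opens (W.pt c.face)) (hV : V ≤ V₁) (y : V),
      (fun l => HR.val ⟨c.face, V⟩ y (b' V hV l)) ∈ A₁ := fun V hV y => by
    have h1 : (fun l => HR.val ⟨c.face, V⟩ y (b' V hV l)) = fun l =>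
        HR.val ⟨c.face, V₁⟩ ⟨y.1, hV y.2⟩ (R.res0 (Cell.le_of_le hV₁) (b l)) := funext fun l =>
      (hvres V (hV.trans hV₁) y.1 y.2 (b l)).trans (hvres V₁ hV₁ y.1 (hV y.2) (b l)).symm
    rw [h1]
    exact hval₁ ⟨y.1, hV y.2⟩
  have hsV : ∀ (V : Opens (W.pt c.face)) (hV : V ≤ V₁) k,
      R.res0 (Cell.le_of_le (hV.trans hV₁)) (Sum.elim (fun l => R.res0 (Cell.le_of_le hV₀) (a l))
        (fa.shiftAt μ ⟨c.face, V₀⟩) k) = HR.hol ⟨c.face, V⟩ (f k) (b' V hV) := fun V hV k => by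
    have h1 := congrArg (R.res0 (Cell.le_of_le hV)) (hs k)
    rw [HR.hol_res (Cell.le_of_le hV) _ (f k) A₁ hA₁ hval₁ (hf k)] at h1
    simp only [res0_res0] at h1
    exact h1
  have hua : ∀ (V : Opens (W.pt c.face)) (hV : V ≤ V₁),
      (fun l => R.res0 (Cell.le_of_le (hV.trans (hV₁.trans hV₀))) (a l)) =
        fun l => HR.hol ⟨c.face, V⟩ (u l) (b' V hV) := fun V hV => by
    funext l
    rw [← hsV V hV (Sum.inl l)]
    exact (res0_res0 _ _ _).symm
  have hma : ∀ (V : Opens (W.pt c.face)) (hV : V ≤ V₁) n,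
      fa.shiftAt μ ⟨c.face, V⟩ n = HR.hol ⟨c.face, V⟩ (m n) (b' V hV) := fun V hV n => by
    rw [← hsV V hV (Sum.inr n)]
    exact (fa.res0_shiftAt (c := ⟨c.face, V₀⟩) μ (Cell.le_of_le (hV.trans hV₁)) n).symm
  have hnear : ∀ (V : Opens (W.pt c.face)) (hV : V ≤ V₁),
      HR.Near (fun l => HR.hol ⟨c.face, V⟩ (u l) (b' V hV)) A r := fun V hV => by
    rw [← hua V hV]
    exact hn.res _
  have hG : ∀ (V : Opens (W.pt c.face)) (hV : V ≤ V₁) (G : (ι ⊕ fa.Idx c.face → ℂ) → ℂ),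
      DifferentiableOn ℂ G (dom _ A r) →
      fa.Q.res0 (Cell.le_of_le (hV.trans (hV₁.trans hV₀))) (fa.HQ.hol c G (fa.tuple μ c a)) =
        fa.HQ.hol ⟨c.face, V⟩ (fun w => G (change u (fun n z => -m n z) w))
          (fa.rawTuple ⟨c.face, V⟩ (b' V hV)) := fun V hV G hG => by
    rw [fa.res_hol_tuple hn (hV.trans (hV₁.trans hV₀)) hG, hua V hV]
    exact fa.hol_tuple (b' V hV) hA₁ (hb' V hV) (fun l => hf _) (fun n => hf _) (hma V hV)
      (hnear V hV) hG
  have := Fintype.ofFinite ι'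
  have hpt : ∀ (y : V₁) (z : ι' → ℂ), z = (fun l => HR.val ⟨c.face, V₀⟩ ⟨y.1, hV₁ y.2⟩ (b l)) →
      z ∈ A₁ ∧ (fun l => u l z) ∈ A ∧ ∀ n, m n z = 0 := by
    rintro y z rfl
    have hz : (fun l => HR.val ⟨c.face, V₁⟩ y (b' V₁ le_rfl l)) =
        fun l => HR.val ⟨c.face, V₀⟩ ⟨y.1, hV₁ y.2⟩ (b l) := funext fun l => hvres V₁ hV₁ y.1 y.2 (b l)
    have hval : ∀ k, HR.val ⟨c.face, V₁⟩ y (HR.hol ⟨c.face, V₁⟩ (f k) (b' V₁ le_rfl)) =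
        f k fun l => HR.val ⟨c.face, V₁⟩ y (b' V₁ le_rfl l) := fun k =>
      HR.val_hol _ (b' V₁ le_rfl) (f k) A₁ hA₁ (hb' V₁ le_rfl) (hf k) y
    rw [← hz]
    refine ⟨hb' V₁ le_rfl y, ?_, fun n => ?_⟩
    · have h1 := (hnear V₁ le_rfl).mem y
      simp only [u, hval] at h1
      exact h1
    · rw [hm]
      exact (hval (Sum.inr n)).symm.trans
        ((congrArg _ (hma V₁ le_rfl n).symm).trans (fa.val_shiftAt μ ⟨c.face, V₁⟩ n y))
  have hu' : ∀ l, DifferentiableOn ℂ (u l) A₁ := fun l => hf _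
  have hm' : ∀ n, DifferentiableOn ℂ (m n) A₁ := fun l => hf _
  have hm'' : ∀ n, DifferentiableOn ℂ (fun z => -m n z) A₁ := fun l => (hf _).fun_neg
  have hid : ∀ l : ι', DifferentiableOn ℂ (fun z : ι' → ℂ => z l) A₁ := fun l =>
    (differentiable_apply l).differentiableOn
  have hptD : ∀ y : V₁, (fun l => fa.HQ.val ⟨c.face, V₀⟩ ⟨y.1, hV₁ y.2⟩
      (fa.rawTuple ⟨c.face, V₀⟩ b l)) ∈ changeDom u (fun n z => -m n z) A₁ (dom _ A r) := fun y => by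
    obtain ⟨h1, h2, h3⟩ := hpt y _ rfl
    rw [show (fun l => fa.HQ.val ⟨c.face, V₀⟩ ⟨y.1, hV₁ y.2⟩ (fa.rawTuple ⟨c.face, V₀⟩ b l)) =
      Sum.elim (fun l => HR.val ⟨c.face, V₀⟩ ⟨y.1, hV₁ y.2⟩ (b l)) 0 from val_rawTuple fa b _]
    refine ⟨h1, h2, fun n => ?_⟩
    change ‖0 + -m n (fun l => HR.val ⟨c.face, V₀⟩ ⟨y.1, hV₁ y.2⟩ (b l))‖ < r
    rw [h3 n]
    simpa using hn.pos
  -- The vanishing section forces the function, in the original coordinates, into the ideal of the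
  -- equations p near the point, with holomorphic coefficients v.
  obtain ⟨D', hD', hD'o, hxD', v, hv, hgv⟩ : ∃ D' ⊆ changeDom u (fun n z => -m n z) A₁ (dom _ A r),
      IsOpen D' ∧ (fun l => fa.HQ.val ⟨c.face, V₀⟩ ⟨x, hx₀⟩ (fa.rawTuple ⟨c.face, V₀⟩ b l)) ∈ D' ∧
      ∃ v : Fin M → (ι' ⊕ fa.Idx c.face → ℂ) → ℂ, (∀ l, DifferentiableOn ℂ (v l) D') ∧
        ∀ w ∈ D', g (change u (fun n z => -m n z) w) = ∑ l, v l w * p l fun s => w (Sum.inl s) := ((fa.product_chart _ b p hb).2 ⟨x, hx₀⟩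
    (fun w => g (change u (fun n z => -m n z) w))
    (changeDom u (fun n z => -m n z) A₁ (dom _ A r))
    (isOpen_changeDom hA₁ hu' hm'' (isOpen_dom hn.isOpen r)) (hptD ⟨x, hx₁⟩)
    (differentiableOn_comp_change hu' hm'' hg)).1 ⟨V₁, hV₁, hx₁, fun y hy => hptD ⟨y.1, hy⟩, by
      have h1 := hG V₁ le_rfl g hg
      rw [h, map_zero] at h1
      rw [h1]
      congr 1
      exact fa.res_rawTuple (c := ⟨c.face, V₀⟩) hV₁ b⟩
  have hvx : (fun l => fa.HQ.val ⟨c.face, V₀⟩ ⟨x, hx₀⟩ (fa.rawTuple ⟨c.face, V₀⟩ b l)) =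
    Sum.elim (fun l => HR.val ⟨c.face, V₀⟩ ⟨x, hx₀⟩ (b l)) 0 := val_rawTuple fa b ⟨x, hx₀⟩
  rw [hvx] at hxD'
  set z₀ : ι' → ℂ := fun l => HR.val ⟨c.face, V₀⟩ ⟨x, hx₀⟩ (b l) with hz₀
  obtain ⟨hz₁, huz, hmz⟩ := hpt ⟨x, hx₁⟩ z₀ rfl
  -- Back in the translated coordinates, the ideal relation holds on a product with a polydisc. The
  -- point is (z₀, 0) in both coordinate systems because m vanishes at z₀.
  obtain ⟨A', r', hA', hzA', hr', hsub⟩ := exists_dom_subset (z := z₀)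
    (isOpen_changeDom (u := fun l z => z l) hA₁ hid hm' hD'o) ⟨hz₁, by
      have h1 : change (fun l z => z l) m (Sum.elim z₀ 0) = Sum.elim z₀ 0 := by
        funext k
        rcases k with l | n
        · rfl
        · change 0 + m n z₀ = 0
          rw [hmz, add_zero]
      change change _ m _ ∈ D'
      rwa [h1]⟩
  have hA'₁ : ∀ z ∈ A', z ∈ A₁ := fun z hz => (hsub (elim_mem_dom.2 ⟨hz, fun n => by
    simpa using hr'⟩ : Sum.elim z 0 ∈ _)).1
  let v' : Fin M → (ι' ⊕ fa.Idx c.face → ℂ) → ℂ := fun l w => v l (change (fun l z => z l) m w)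
  have hv' : ∀ l, DifferentiableOn ℂ (v' l) (dom _ A' r') := fun l =>
    (differentiableOn_comp_change hid hm' (hv l)).mono hsub
  have hcc : ∀ w, change u (fun n z => -m n z) (change (fun l z => z l) m w) =
      Sum.elim (fun l => u l fun i => w (Sum.inl i)) fun n => w (Sum.inr n) := fun w => by
    funext k
    rcases k with l | n
    · rfl
    · exact add_neg_cancel_right _ _
  have hslice : ∀ z ∈ A', Set.EqOn (slice g fun l => u l z)
      (fun τ => ∑ l, slice (v' l) z τ * p l z) (polydisc _ r') := fun z hz τ hτ => by
    have h1 := hgv (change (fun l z => z l) m (Sum.elim z τ)) (hsub (elim_mem_dom.2 ⟨hz, hτ⟩)).2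
    rw [hcc] at h1
    exact h1
  -- On a slice the equations p are constants, so the operator acts on the coefficients only, and
  -- the transformed function stays in the ideal.
  have hΘ : ∀ z ∈ A', ∀ τ ∈ polydisc _ r', Θ.op (slice g fun l => u l z) τ =
      ∑ l, Θ.lift (v' l) (Sum.elim z τ) * p l z := fun z hz τ hτ => by
    rw [Θ.congr (hslice z hz) hτ]
    exact Θ.sum (fun l => p l z) (fun l => slice (v' l) z)
      (fun l => differentiableOn_slice (hv' l) hz) hτ
  have hΘg := Θ.holo hn.isOpen hg
  have hpos : ∀ n, ‖0 + -m n z₀‖ < r' := fun n => by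
    rw [hmz]
    simpa using hr'
  have hcc' : ∀ w : ι' ⊕ fa.Idx c.face → ℂ, change (fun l z => z l) m
      (change (fun l z => z l) (fun n z => -m n z) w) = w := fun w => by
    funext k
    rcases k with l | n
    · rfl
    · exact neg_add_cancel_right _ _
  -- The presentation in the other direction: membership in the ideal near the point makes the
  -- transformed section vanish near x.
  obtain ⟨V₂, hV₂, hx₂, hval₂, h₂⟩ := ((fa.product_chart _ b p hb).2 ⟨x, hx₀⟩
    (fun w => Θ.lift g (change u (fun n z => -m n z) w))
    (changeDom (fun l z => z l) (fun n z => -m n z) A₁ (dom _ A' r'))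
    (isOpen_changeDom hA₁ hid hm'' (isOpen_dom hA' r')) (by
      change (fun l => fa.HQ.val ⟨c.face, V₀⟩ ⟨x, hx₀⟩ (fa.rawTuple ⟨c.face, V₀⟩ b l)) ∈ _
      rw [hvx]
      exact ⟨hz₁, hzA', hpos⟩)
    ((differentiableOn_comp_change hu' hm'' hΘg).mono fun w hw => by
      exact Set.mem_of_eq_of_mem (hcc' w).symm (hD' (hsub hw.2).2))).2 ⟨_, subset_rfl, isOpen_changeDom hA₁ hid hm'' (isOpen_dom hA' r'), (by
      change (fun l => fa.HQ.val ⟨c.face, V₀⟩ ⟨x, hx₀⟩ (fa.rawTuple ⟨c.face, V₀⟩ b l)) ∈ _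
      rw [hvx]
      exact ⟨hz₁, hzA', hpos⟩),
      fun l w => Θ.lift (v' l) (change (fun l z => z l) (fun n z => -m n z) w), fun l =>
        differentiableOn_comp_change hid hm'' (Θ.holo hA' (hv' l)), fun w hw =>
        hΘ _ hw.2.1 _ hw.2.2⟩
  have hle₁ : V₁ ⊓ V₂ ≤ V₁ := inf_le_left
  have hle₂ : V₁ ⊓ V₂ ≤ V₂ := inf_le_right
  refine ⟨V₁ ⊓ V₂, hle₁.trans (hV₁.trans hV₀), ⟨hx₁, hx₂⟩, ?_⟩
  refine (hG (V₁ ⊓ V₂) hle₁ _ hΘg).trans (Eq.trans ?_ (map_zero _).symm)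
  have h3 := fa.HQ.hol_res (Cell.le_of_le hle₂)
    (fun k => fa.Q.res0 (Cell.le_of_le hV₂) (fa.rawTuple ⟨c.face, V₀⟩ b k))
    (fun w => Θ.lift g (change u (fun n z => -m n z) w))
    (changeDom (fun l z => z l) (fun n z => -m n z) A₁ (dom _ A' r'))
    (isOpen_changeDom hA₁ hid hm'' (isOpen_dom hA' r')) (fun y => by
      have h4 := hval₂ ⟨y.1, hV₂ y.2⟩ y.2
      simp only [fa.HQ.val_res]
      exact Set.mem_of_eq_of_mem (congrArg (fun z : V₀ => fun k =>
        fa.HQ.val ⟨c.face, V₀⟩ z (fa.rawTuple ⟨c.face, V₀⟩ b k)) (Cell.point_le_of_le hV₂ y)) h4)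
    ((differentiableOn_comp_change hu' hm'' hΘg).mono fun w hw => by
      exact Set.mem_of_eq_of_mem (hcc' w).symm (hD' (hsub hw.2).2))
  refine Eq.trans ?_ (h3.symm.trans ((congrArg _ h₂).trans (map_zero _)))
  congr 1
  simp only [res0_res0]
  exact (fa.res_rawTuple (c := ⟨c.face, V₀⟩) (hle₂.trans hV₂) b).symm

end FreeAnalytic

end

/-! ### Sections as holomorphic functions of a common tuple -/

section

variable {W : SimplicialSystem.{u}}

namespace HolStructure

variable {F : DGPresheaf W} (H : HolStructure F) {c : Cell W} {ι : Type u} [Finite ι]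

theorem hol_sum {a : ι → (F.sec c).zero} {D : Set (ι → ℂ)} (hD : IsOpen D)
    (ha : ∀ x, (fun i => H.val c x (a i)) ∈ D) {X : Type*} (s : Finset X) (g : X → (ι → ℂ) → ℂ)
    (hg : ∀ k, DifferentiableOn ℂ (g k) D) :
    H.hol c (fun w => ∑ k ∈ s, g k w) a = ∑ k ∈ s, H.hol c (g k) a := by
  classical
  have := Fintype.ofFinite ι
  induction s using Finset.induction_on with
  | empty => simpa using H.hol_const c a 0
  | insert k s hk ih =>
    simp only [Finset.sum_insert hk]
    rw [← ih, ← H.hol_add c a (g k) (fun w => ∑ k ∈ s, g k w) D hD ha (hg k)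
      (DifferentiableOn.fun_sum fun k _ => hg k)]

end HolStructure

namespace Slice

variable {ι ι' κ : Type u} [Finite κ]

theorem Op.lift_reindex (Θ : Op κ) (f : ι → ι') (g : (ι ⊕ κ → ℂ) → ℂ) :
    (Θ.lift fun w : ι' ⊕ κ → ℂ => g fun l => w (Sum.map f id l)) =
      fun w => Θ.lift g fun l => w (Sum.map f id l) := by
  funext w
  have h : slice (fun w : ι' ⊕ κ → ℂ => g fun l => w (Sum.map f id l))
      (fun i => w (Sum.inl i)) = slice g fun i => w (Sum.inl (f i)) := by
    funext τ
    exact congrArg g (funext fun l => by cases l <;> rfl)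
  unfold Op.lift
  rw [h]
  rfl

theorem Op.lift_sum [Finite ι] (Θ : Op κ) {A : Set (ι → ℂ)} {r : ℝ} {m : ℕ}
    (u : Fin m → (ι → ℂ) → ℂ) (g : Fin m → (ι ⊕ κ → ℂ) → ℂ)
    (hg : ∀ k, DifferentiableOn ℂ (g k) (dom κ A r)) :
    Set.EqOn (Θ.lift fun w => ∑ k, g k w * u k fun i => w (Sum.inl i))
      (fun w => ∑ k, Θ.lift (g k) w * u k fun i => w (Sum.inl i)) (dom κ A r) := fun w hw =>
  Θ.sum (fun k => u k fun i => w (Sum.inl i)) (fun k => slice (g k) _)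
    (fun k => differentiableOn_slice (hg k) hw.1) hw.2

end Slice

namespace FreeAnalytic

open DGPresheaf Slice

variable {R S : DGPresheaf W} {HR : HolStructure R} {j : R ⟶ S} (fa : FreeAnalytic HR j) {μ : S ⟶ R}

/-- Finitely many sections are locally holomorphic functions of a common tuple. -/
theorem exists_rep (hR : HR.IsComplexAnalytic) {c : Cell W} {X Y : Type*} [Finite X] [Finite Y]
    (q : X → (fa.Q.sec c).zero) (s : Y → (R.sec c).zero) (x : W.pt c.face) (hx : x ∈ c.U) :
    ∃ (V : Opens (W.pt c.face)) (hV : V ≤ c.U), x ∈ V ∧ ∃ (ι : Type u) (_ : Finite ι)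
      (a : ι → (R.sec ⟨c.face, V⟩).zero) (A : Set (ι → ℂ)) (r : ℝ), HR.Near a A r ∧
      ∃ (g : X → (ι ⊕ fa.Idx c.face → ℂ) → ℂ) (u : Y → (ι → ℂ) → ℂ),
        (∀ k, DifferentiableOn ℂ (g k) (dom _ A r)) ∧
        (∀ k, fa.Q.res0 (Cell.le_of_le hV) (q k) =
          fa.HQ.hol ⟨c.face, V⟩ (g k) (fa.tuple μ ⟨c.face, V⟩ a)) ∧
        (∀ k, DifferentiableOn ℂ (u k) A) ∧
        ∀ k, R.res0 (Cell.le_of_le hV) (s k) = HR.hol ⟨c.face, V⟩ (u k) a := by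
  obtain ⟨V₀, hV₀, hx₀, ι, _, b, M, p, hb⟩ := hR.exists_nhds hx
  have := Fintype.ofFinite ι
  obtain ⟨V₁, hV₁, hx₁, g, D, hD, hvD, hg, hq⟩ : ∃ (V₁ : Opens (W.pt c.face)) (hV₁ : V₁ ≤ V₀)
      (_ : x ∈ V₁) (g : X → (ι ⊕ fa.Idx c.face → ℂ) → ℂ) (D : Set (ι ⊕ fa.Idx c.face → ℂ)),
      IsOpen D ∧ (∀ y : V₁, (fun i => fa.HQ.val ⟨c.face, V₁⟩ y
        (fa.Q.res0 (Cell.le_of_le hV₁) (fa.rawTuple ⟨c.face, V₀⟩ b i))) ∈ D) ∧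
      (∀ i, DifferentiableOn ℂ (g i) D) ∧ ∀ k, fa.Q.res0 (Cell.le_of_le hV₁)
        (fa.Q.res0 (Cell.le_of_le hV₀) (q k)) =
        fa.HQ.hol ⟨c.face, V₁⟩ (g k) fun i =>
          fa.Q.res0 (Cell.le_of_le hV₁) (fa.rawTuple ⟨c.face, V₀⟩ b i) := by
    obtain ⟨V₁, hV₁, hx₁, h⟩ := (fa.product_chart _ b p hb).exists_hol
      (fun k => fa.Q.res0 (Cell.le_of_le hV₀) (q k)) x hx₀
    exact ⟨V₁, hV₁, hx₁, h⟩
  obtain ⟨V₂, hV₂, hx₂, f, A, hA, hvA, hf, hs⟩ : ∃ (V₂ : Opens (W.pt c.face)) (hV₂ : V₂ ≤ V₀)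
      (_ : x ∈ V₂) (f : Y ⊕ fa.Idx c.face → (ι → ℂ) → ℂ) (A : Set (ι → ℂ)), IsOpen A ∧
      (∀ y : V₂, (fun i => HR.val ⟨c.face, V₂⟩ y (R.res0 (Cell.le_of_le hV₂) (b i))) ∈ A) ∧
      (∀ i, DifferentiableOn ℂ (f i) A) ∧ ∀ i, R.res0 (Cell.le_of_le hV₂)
        (Sum.elim (fun l => R.res0 (Cell.le_of_le hV₀) (s l)) (fa.shiftAt μ ⟨c.face, V₀⟩) i) =
        HR.hol ⟨c.face, V₂⟩ (f i) fun i => R.res0 (Cell.le_of_le hV₂) (b i) := by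
    obtain ⟨V₂, hV₂, hx₂, h⟩ := hb.2.2.exists_hol
      (Sum.elim (fun l => R.res0 (Cell.le_of_le hV₀) (s l)) (fa.shiftAt μ ⟨c.face, V₀⟩)) x hx₀
    exact ⟨V₂, hV₂, hx₂, h⟩
  have hid : ∀ l : ι, DifferentiableOn ℂ (fun z : ι → ℂ => z l) A := fun l =>
    (differentiable_apply l).differentiableOn
  have hm : ∀ n, DifferentiableOn ℂ (fun z => f (Sum.inr n) z) A := fun n => hf (Sum.inr n)
  let z₀ : ι → ℂ := fun l => HR.val ⟨c.face, V₀⟩ ⟨x, hx₀⟩ (b l)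
  have hz₀ : z₀ = fun l => HR.val ⟨c.face, V₂⟩ ⟨x, hx₂⟩ (R.res0 (Cell.le_of_le hV₂) (b l)) := by
    funext l
    rw [HR.val_res, Cell.point_le_of_le hV₂]
  have hmz : ∀ n, f (Sum.inr n) z₀ = 0 := fun n => by
    rw [hz₀, ← HR.val_hol _ _ (f (Sum.inr n)) A hA hvA (hf _), ← hs]
    exact (congrArg _ (fa.res0_shiftAt (c := ⟨c.face, V₀⟩) μ (Cell.le_of_le hV₂) n)).trans
      (fa.val_shiftAt μ ⟨c.face, V₂⟩ n ⟨x, hx₂⟩)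
  have hzA : z₀ ∈ A := hz₀ ▸ hvA ⟨x, hx₂⟩
  have hO := isOpen_changeDom (u := fun l z => z l) hA hid hm hD
  -- In the translated coordinates the point is again (z₀, 0), as m vanishes at z₀; a product
  -- neighbourhood therefore exists on which all representing functions are defined.
  obtain ⟨A', r', hA', hzA', hr', hsub⟩ := exists_dom_subset (z := z₀) hO ⟨hzA, by
    have h1 : change (fun l z => z l) (fun n z => f (Sum.inr n) z) (Sum.elim z₀ 0) =
        Sum.elim z₀ 0 := by
      funext k
      rcases k with l | n
      · rfl
      · change 0 + f (Sum.inr n) z₀ = 0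
        rw [hmz, add_zero]
    change change _ _ _ ∈ D
    rw [h1]
    refine Set.mem_of_eq_of_mem ?_ (hvD ⟨x, hx₁⟩)
    rw [← val_rawTuple fa b ⟨x, hx₀⟩]
    funext k
    rw [fa.HQ.val_res, Cell.point_le_of_le hV₁]⟩
  have hA'A : A' ⊆ A := fun z hz => (hsub (elim_mem_dom.2 ⟨hz, fun n => by
    simpa using hr'⟩ : Sum.elim z 0 ∈ _)).1
  obtain ⟨V₃, hV₃, hx₃, hv₃⟩ : ∃ (V₃ : Opens (W.pt c.face)) (hV₃ : V₃ ≤ V₀), x ∈ V₃ ∧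
      ∀ y : V₃, (fun l => HR.val ⟨c.face, V₀⟩ ⟨y.1, hV₃ y.2⟩ (b l)) ∈ A' :=
    hb.exists_nhds hA' (x := ⟨x, hx₀⟩) hzA'
  have l₁ : V₁ ⊓ V₂ ⊓ V₃ ≤ V₁ := inf_le_left.trans inf_le_left
  have l₂ : V₁ ⊓ V₂ ⊓ V₃ ≤ V₂ := inf_le_left.trans inf_le_right
  have l₃ : V₁ ⊓ V₂ ⊓ V₃ ≤ V₃ := inf_le_right
  have l₀ : V₁ ⊓ V₂ ⊓ V₃ ≤ V₀ := l₁.trans hV₁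
  set V := V₁ ⊓ V₂ ⊓ V₃ with hVdef
  have hvA' : ∀ y : V, (fun l => HR.val ⟨c.face, V⟩ y (R.res0 (Cell.le_of_le l₀) (b l))) ∈ A' :=
    fun y => by
      simp only [HR.val_res]
      exact Set.mem_of_eq_of_mem (congrArg (fun z : V₀ => fun k =>
        HR.val ⟨c.face, V₀⟩ z (b k)) (Cell.point_le_of_le l₀ y)) (hv₃ ⟨y.1, l₃ y.2⟩)
  have hsV : ∀ k, R.res0 (Cell.le_of_le l₀) (Sum.elim (fun l => R.res0 (Cell.le_of_le hV₀) (s l))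
      (fa.shiftAt μ ⟨c.face, V₀⟩) k) =
      HR.hol ⟨c.face, V⟩ (f k) fun l => R.res0 (Cell.le_of_le l₀) (b l) := fun k => by
    have h1 := congrArg (R.res0 (Cell.le_of_le l₂)) (hs k)
    rw [HR.hol_res (Cell.le_of_le l₂) _ (f k) A hA hvA (hf k)] at h1
    simp only [res0_res0] at h1
    exact h1
  refine ⟨V, l₀.trans hV₀, ⟨⟨hx₁, hx₂⟩, hx₃⟩, ι, inferInstance,
    fun l => R.res0 (Cell.le_of_le l₀) (b l), A', r', ⟨hA', hr', hvA'⟩,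
    fun k w => g k (change (fun l z => z l) (fun n z => f (Sum.inr n) z) w), fun k => f (Sum.inl k),
    fun k => (differentiableOn_comp_change hid hm (hg k)).mono hsub, fun k => ?_,
    fun k => (hf _).mono hA'A, fun k => ?_⟩
  · have h1 := congrArg (fa.Q.res0 (Cell.le_of_le l₁)) (hq k)
    rw [fa.HQ.hol_res (Cell.le_of_le l₁) _ (g k) D hD hvD (hg k)] at h1
    simp only [res0_res0] at h1
    rw [h1]
    refine Eq.trans ?_ (fa.hol_rawTuple (c := ⟨c.face, V⟩) _ hA (fun y => hA'A (hvA' y)) hm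
      (fun n => ?_) hD (fun y => ?_) (hg k))
    · congr 1
      exact fa.res_rawTuple (c := ⟨c.face, V₀⟩) l₀ b
    · rw [← hsV (Sum.inr n)]
      exact (fa.res0_shiftAt (c := ⟨c.face, V₀⟩) μ (Cell.le_of_le l₀) n).symm
    · have h2 := hvD ⟨y.1, l₁ y.2⟩
      refine Set.mem_of_eq_of_mem ?_ h2
      rw [← val_rawTuple fa (c := ⟨c.face, V⟩)]
      funext k
      have h3 := congrFun (fa.res_rawTuple (c := ⟨c.face, V₀⟩) l₀ b) k
      have h4 : fa.HQ.val ⟨c.face, V⟩ y (fa.Q.res0 (Cell.le_of_le l₁)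
        (fa.Q.res0 (Cell.le_of_le hV₁) (fa.rawTuple ⟨c.face, V₀⟩ b k))) =
        fa.HQ.val ⟨c.face, V₁⟩ ⟨y.1, l₁ y.2⟩
          (fa.Q.res0 (Cell.le_of_le hV₁) (fa.rawTuple ⟨c.face, V₀⟩ b k)) := by
        rw [fa.HQ.val_res, Cell.point_le_of_le]
      rw [← h4, res0_res0]
      exact congrArg _ h3.symm
  · rw [← hsV (Sum.inl k)]
    exact (res0_res0 _ _ _).symm

end FreeAnalytic

end

/-! ### The action of operators on sections of degree zero -/

section

variable {W : SimplicialSystem.{u}}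

namespace FreeAnalytic

open DGPresheaf Slice

variable {R S : DGPresheaf W} {HR : HolStructure R} {j : R ⟶ S} (fa : FreeAnalytic HR j) {μ : S ⟶ R}

section

variable {c : Cell W} {ι : Type u} [Finite ι] {a : ι → (R.sec c).zero} {A : Set (ι → ℂ)} {r : ℝ}
  (hn : HR.Near a A r)

include hn

theorem hol_tuple_left {u : (ι → ℂ) → ℂ} (hu : DifferentiableOn ℂ u A) :
    fa.HQ.hol c (fun w => u fun i => w (Sum.inl i)) (fa.tuple μ c a) = ap0 fa.i c (HR.hol c u a) :=
  fa.preserves.hol_left a _ hn.isOpen hn.mem hu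

theorem hol_tuple_congr {g g' : (ι ⊕ fa.Idx c.face → ℂ) → ℂ} (hg : DifferentiableOn ℂ g (dom _ A r))
    (h : Set.EqOn g g' (dom _ A r)) :
    fa.HQ.hol c g (fa.tuple μ c a) = fa.HQ.hol c g' (fa.tuple μ c a) :=
  fa.HQ.hol_congr c _ g g' _ (isOpen_dom hn.isOpen r) (fa.val_tuple_mem hn) hg h

theorem hol_tuple_mul {g g' : (ι ⊕ fa.Idx c.face → ℂ) → ℂ} (hg : DifferentiableOn ℂ g (dom _ A r))
    (hg' : DifferentiableOn ℂ g' (dom _ A r)) :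
    fa.HQ.hol c (fun w => g w * g' w) (fa.tuple μ c a) =
      fa.HQ.hol c g (fa.tuple μ c a) * fa.HQ.hol c g' (fa.tuple μ c a) :=
  fa.HQ.hol_mul c _ g g' _ (isOpen_dom hn.isOpen r) (fa.val_tuple_mem hn) hg hg'

theorem hol_tuple_add {g g' : (ι ⊕ fa.Idx c.face → ℂ) → ℂ} (hg : DifferentiableOn ℂ g (dom _ A r))
    (hg' : DifferentiableOn ℂ g' (dom _ A r)) :
    fa.HQ.hol c (fun w => g w + g' w) (fa.tuple μ c a) =
      fa.HQ.hol c g (fa.tuple μ c a) + fa.HQ.hol c g' (fa.tuple μ c a) :=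
  fa.HQ.hol_add c _ g g' _ (isOpen_dom hn.isOpen r) (fa.val_tuple_mem hn) hg hg'

theorem hol_tuple_sum {X : Type*} (s : Finset X) {g : X → (ι ⊕ fa.Idx c.face → ℂ) → ℂ}
    (hg : ∀ k, DifferentiableOn ℂ (g k) (dom _ A r)) :
    fa.HQ.hol c (fun w => ∑ k ∈ s, g k w) (fa.tuple μ c a) =
      ∑ k ∈ s, fa.HQ.hol c (g k) (fa.tuple μ c a) :=
  fa.HQ.hol_sum (isOpen_dom hn.isOpen r) (fa.val_tuple_mem hn) s g hg

omit hn in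
theorem differentiableOn_left {u : (ι → ℂ) → ℂ} (hu : DifferentiableOn ℂ u A) :
    DifferentiableOn ℂ (fun w : ι ⊕ fa.Idx c.face → ℂ => u fun i => w (Sum.inl i)) (dom _ A r) :=
  (differentiableOn_comp_left hu).mono fun _ h => h.1

omit hn in
theorem differentiableOn_coord (n : fa.Idx c.face) :
    DifferentiableOn ℂ (fun w : ι ⊕ fa.Idx c.face → ℂ => w (Sum.inr n)) (dom _ A r) := by
  have := Fintype.ofFinite ι
  have := Fintype.ofFinite (fa.Idx c.face)
  exact (differentiable_apply _).differentiableOn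

theorem hol_tuple_linear {m : ℕ} {u : Fin m → (ι → ℂ) → ℂ} (hu : ∀ k, DifferentiableOn ℂ (u k) A)
    {g : Fin m → (ι ⊕ fa.Idx c.face → ℂ) → ℂ} (hg : ∀ k, DifferentiableOn ℂ (g k) (dom _ A r)) :
    fa.HQ.hol c (fun w => ∑ k, g k w * u k fun i => w (Sum.inl i)) (fa.tuple μ c a) =
      ∑ k, fa.HQ.hol c (g k) (fa.tuple μ c a) * ap0 fa.i c (HR.hol c (u k) a) := by
  have := Fintype.ofFinite ι
  have := Fintype.ofFinite (fa.Idx c.face)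
  rw [fa.hol_tuple_sum hn (Finset.univ : Finset (Fin m))
    (g := fun k w => g k w * u k fun i => w (Sum.inl i))
    fun k => (hg k).fun_mul (fa.differentiableOn_left (hu k))]
  refine Finset.sum_congr rfl fun k _ => ?_
  rw [fa.hol_tuple_mul hn (hg k) (fa.differentiableOn_left (hu k)), fa.hol_tuple_left hn (hu k)]

/-- Functions of the base variables are constant on slices, so the operators are linear over them.
This is the source of R⁰-linearity. -/
theorem hol_lift_linear (Θ : Op (fa.Idx c.face)) {m : ℕ} {u : Fin m → (ι → ℂ) → ℂ}
    (hu : ∀ k, DifferentiableOn ℂ (u k) A)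
    {g : Fin m → (ι ⊕ fa.Idx c.face → ℂ) → ℂ} (hg : ∀ k, DifferentiableOn ℂ (g k) (dom _ A r)) :
    fa.HQ.hol c (Θ.lift fun w => ∑ k, g k w * u k fun i => w (Sum.inl i)) (fa.tuple μ c a) =
      ∑ k, fa.HQ.hol c (Θ.lift (g k)) (fa.tuple μ c a) * ap0 fa.i c (HR.hol c (u k) a) := by
  have := Fintype.ofFinite ι
  have := Fintype.ofFinite (fa.Idx c.face)
  rw [← fa.hol_tuple_linear hn hu fun k => Θ.differentiableOn_lift hn.isOpen (hg k)]
  exact fa.hol_tuple_congr hn (Θ.differentiableOn_lift hn.isOpen (DifferentiableOn.fun_sum fun k _ =>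
    (hg k).fun_mul (fa.differentiableOn_left (hu k)))) (Θ.lift_sum u g hg)

end

/-- The action of operators on sections does not depend on the representing function. -/
theorem hol_lift_congr (hR : HR.IsComplexAnalytic) {c : Cell W} {ι ι' : Type u} [Finite ι] [Finite ι']
    {a : ι → (R.sec c).zero} {A : Set (ι → ℂ)} {r : ℝ} (hn : HR.Near a A r)
    {a' : ι' → (R.sec c).zero} {A' : Set (ι' → ℂ)} {r' : ℝ} (hn' : HR.Near a' A' r')
    {g : (ι ⊕ fa.Idx c.face → ℂ) → ℂ} (hg : DifferentiableOn ℂ g (dom _ A r))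
    {g' : (ι' ⊕ fa.Idx c.face → ℂ) → ℂ} (hg' : DifferentiableOn ℂ g' (dom _ A' r'))
    (Θ : Op (fa.Idx c.face))
    (h : fa.HQ.hol c g (fa.tuple μ c a) = fa.HQ.hol c g' (fa.tuple μ c a')) :
    fa.HQ.hol c (Θ.lift g) (fa.tuple μ c a) = fa.HQ.hol c (Θ.lift g') (fa.tuple μ c a') := by
  have := Fintype.ofFinite ι
  have := Fintype.ofFinite ι'
  have := Fintype.ofFinite (fa.Idx c.face)
  -- Two representations by different tuples are compared on the joint tuple, with the smaller of
  -- the two radii.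
  let A'' : Set (ι ⊕ ι' → ℂ) := {z | (fun l => z (Sum.inl l)) ∈ A ∧ (fun l => z (Sum.inr l)) ∈ A'}
  have hA'' : IsOpen A'' := (hn.isOpen.preimage (by fun_prop)).inter (hn'.isOpen.preimage (by fun_prop))
  have hn'' : HR.Near (Sum.elim a a') A'' (min r r') :=
    ⟨hA'', lt_min hn.pos hn'.pos, fun x => ⟨hn.mem x, hn'.mem x⟩⟩
  have htup : ∀ l, fa.tuple μ c (Sum.elim a a') (Sum.map Sum.inl id l) = fa.tuple μ c a l := fun l => by
    cases l <;> rfl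
  have htup' : ∀ l, fa.tuple μ c (Sum.elim a a') (Sum.map Sum.inr id l) = fa.tuple μ c a' l := fun l => by
    cases l <;> rfl
  have key : ∀ {G : (ι ⊕ fa.Idx c.face → ℂ) → ℂ}, DifferentiableOn ℂ G (dom _ A r) →
      fa.HQ.hol c G (fa.tuple μ c a) =
        fa.HQ.hol c (fun w => G fun l => w (Sum.map Sum.inl id l)) (fa.tuple μ c (Sum.elim a a')) :=
    fun hG => by
      rw [← fa.HQ.hol_reindex (fa.tuple μ c (Sum.elim a a')) (Sum.map Sum.inl id)
        (isOpen_dom hn.isOpen r) (by simpa only [htup] using fa.val_tuple_mem hn) hG]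
      simp only [htup]
  have key' : ∀ {G : (ι' ⊕ fa.Idx c.face → ℂ) → ℂ}, DifferentiableOn ℂ G (dom _ A' r') →
      fa.HQ.hol c G (fa.tuple μ c a') =
        fa.HQ.hol c (fun w => G fun l => w (Sum.map Sum.inr id l)) (fa.tuple μ c (Sum.elim a a')) :=
    fun hG => by
      rw [← fa.HQ.hol_reindex (fa.tuple μ c (Sum.elim a a')) (Sum.map Sum.inr id)
        (isOpen_dom hn'.isOpen r') (by simpa only [htup'] using fa.val_tuple_mem hn') hG]
      simp only [htup']
  -- The difference is written as a linear combination with coefficients 1 and -1, so that linearity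
  -- and the case of a vanishing section apply.
  let G : Fin 2 → (((ι ⊕ ι') ⊕ fa.Idx c.face) → ℂ) → ℂ :=
    ![fun w => g fun l => w (Sum.map Sum.inl id l), fun w => g' fun l => w (Sum.map Sum.inr id l)]
  have hG : ∀ k, DifferentiableOn ℂ (G k) (dom _ A'' (min r r')) := by
    intro k
    fin_cases k
    · exact hg.comp (by fun_prop) fun w hw => ⟨hw.1.1, fun n => (hw.2 n).trans_le (min_le_left _ _)⟩
    · exact hg'.comp (by fun_prop) fun w hw =>
        ⟨hw.1.2, fun n => (hw.2 n).trans_le (min_le_right _ _)⟩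
  let u : Fin 2 → (ι ⊕ ι' → ℂ) → ℂ := ![fun _ => 1, fun _ => -1]
  have hu : ∀ k, DifferentiableOn ℂ (u k) A'' := by
    intro k
    fin_cases k <;> exact differentiableOn_const _
  have h1 := fa.hol_tuple_linear (μ := μ) hn'' hu hG
  have h2 := fa.hol_lift_linear (μ := μ) hn'' Θ hu hG
  have h3 : ∑ k, fa.HQ.hol c (G k) (fa.tuple μ c (Sum.elim a a')) *
      ap0 fa.i c (HR.hol c (u k) (Sum.elim a a')) = 0 := by
    simp only [Fin.sum_univ_two, G, u, Matrix.cons_val_zero, Matrix.cons_val_one]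
    rw [HR.hol_const, HR.hol_const, ← key hg, ← key' hg', h]
    simp
  rw [fa.hol_lift_eq_zero hR hn'' (DifferentiableOn.fun_sum fun k _ =>
    (hG k).fun_mul (fa.differentiableOn_left (hu k))) Θ (h1.trans h3)] at h2
  simp only [Fin.sum_univ_two, G, u, Matrix.cons_val_zero, Matrix.cons_val_one] at h2
  rw [HR.hol_const, HR.hol_const, Op.lift_reindex, Op.lift_reindex,
    ← key (Θ.differentiableOn_lift hn.isOpen hg),
    ← key' (Θ.differentiableOn_lift hn'.isOpen hg')] at h2
  simp only [map_one, mul_one, map_neg, mul_neg, ← sub_eq_add_neg] at h2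
  exact sub_eq_zero.1 h2.symm

variable (μ) in
/-- The section `s` is obtained from `q` by applying an operator to the coordinates. -/
def IsOp {c : Cell W} (Θ : Op (fa.Idx c.face)) (q s : (fa.Q.sec c).zero) : Prop :=
  ∀ (V : Opens (W.pt c.face)) (hV : V ≤ c.U) {ι : Type u} [Finite ι]
    (a : ι → (R.sec ⟨c.face, V⟩).zero) (A : Set (ι → ℂ)) (r : ℝ) (g : (ι ⊕ fa.Idx c.face → ℂ) → ℂ),
    HR.Near a A r → DifferentiableOn ℂ g (dom _ A r) →
    fa.Q.res0 (Cell.le_of_le hV) q = fa.HQ.hol ⟨c.face, V⟩ g (fa.tuple μ ⟨c.face, V⟩ a) →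
    fa.Q.res0 (Cell.le_of_le hV) s = fa.HQ.hol ⟨c.face, V⟩ (Θ.lift g) (fa.tuple μ ⟨c.face, V⟩ a)

variable {fa} in
theorem IsOp.res {c : Cell W} {Θ : Op (fa.Idx c.face)} {q s : (fa.Q.sec c).zero} (h : fa.IsOp μ Θ q s)
    {V : Opens (W.pt c.face)} (hV : V ≤ c.U) :
    fa.IsOp μ (c := ⟨c.face, V⟩) Θ (fa.Q.res0 (Cell.le_of_le hV) q)
      (fa.Q.res0 (Cell.le_of_le hV) s) := fun V' hV' ι _ a A r g hn hg hq => by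
  have h1 := h V' (le_trans hV' hV) a A r g hn hg ((res0_res0 _ _ _).symm.trans hq)
  exact (res0_res0 _ _ _).trans h1

theorem isOp_unique (hR : HR.IsComplexAnalytic) {c : Cell W} {Θ : Op (fa.Idx c.face)}
    {q s s' : (fa.Q.sec c).zero} (h : fa.IsOp μ Θ q s) (h' : fa.IsOp μ Θ q s') : s = s' := by
  refine fa.isSheaf.ext0 fun x hx => ?_
  obtain ⟨V, hV, hxV, ι, _, a, A, r, hn, g, -, hg, hq, -⟩ :=
    fa.exists_rep hR (μ := μ) (X := Unit) (Y := Empty) (fun _ => q) Empty.elim x hx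
  exact ⟨V, hV, hxV, (h V hV a A r _ hn (hg ⟨⟩) (hq ⟨⟩)).trans
    (h' V hV a A r _ hn (hg ⟨⟩) (hq ⟨⟩)).symm⟩

/-- A given representation can be used to compute the operator because any other one, over any
smaller open set, leads to the same result by `hol_lift_congr`. -/
theorem isOp_hol (hR : HR.IsComplexAnalytic) {c : Cell W} (Θ : Op (fa.Idx c.face)) {ι : Type u}
    [Finite ι] {a : ι → (R.sec c).zero} {A : Set (ι → ℂ)} {r : ℝ} (hn : HR.Near a A r)
    {g : (ι ⊕ fa.Idx c.face → ℂ) → ℂ} (hg : DifferentiableOn ℂ g (dom _ A r)) :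
    fa.IsOp μ Θ (fa.HQ.hol c g (fa.tuple μ c a)) (fa.HQ.hol c (Θ.lift g) (fa.tuple μ c a)) := by
  intro V hV ι' _ a' A' r' g' hn' hg' hq
  rw [fa.res_hol_tuple hn hV hg] at hq
  rw [fa.res_hol_tuple hn hV (Θ.differentiableOn_lift hn.isOpen hg)]
  exact fa.hol_lift_congr (c := ⟨c.face, V⟩) hR (hn.res _) hn' hg hg' Θ hq

theorem isOp_of_locally {c : Cell W} {Θ : Op (fa.Idx c.face)} {q s : (fa.Q.sec c).zero}
    (h : ∀ x ∈ c.U, ∃ (V : Opens (W.pt c.face)) (hV : V ≤ c.U), x ∈ V ∧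
      fa.IsOp μ (c := ⟨c.face, V⟩) Θ (fa.Q.res0 (Cell.le_of_le hV) q)
        (fa.Q.res0 (Cell.le_of_le hV) s)) : fa.IsOp μ Θ q s := by
  intro V hV ι _ a A r g hn hg hq
  refine fa.isSheaf.ext0 fun x hx => ?_
  obtain ⟨V', hV', hx', h'⟩ := h x (hV hx)
  have l : V ⊓ V' ≤ V := inf_le_left
  have l' : V ⊓ V' ≤ V' := inf_le_right
  refine ⟨V ⊓ V', l, ⟨hx, hx'⟩, ?_⟩
  have h1 := h' (V ⊓ V') l' (fun k => R.res0 (Cell.le_of_le l) (a k)) A r g (hn.res _) hg (by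
    rw [res0_res0]
    have h2 := congrArg (fa.Q.res0 (Cell.le_of_le l)) hq
    rw [res0_res0] at h2
    rw [h2]
    exact fa.res_hol_tuple (c := ⟨c.face, V⟩) hn l hg)
  rw [res0_res0] at h1
  refine (res0_res0 _ _ _).trans (h1.trans ?_)
  exact (fa.res_hol_tuple (c := ⟨c.face, V⟩) hn l (Θ.differentiableOn_lift hn.isOpen hg)).symm

/-- Locally the section has a representing function, to which the operator is applied; the results
are unique and therefore glue. -/
theorem exists_isOp (hR : HR.IsComplexAnalytic) {c : Cell W} (Θ : Op (fa.Idx c.face))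
    (q : (fa.Q.sec c).zero) : ∃ s, fa.IsOp μ Θ q s := by
  obtain ⟨t, ht, h⟩ := fa.isSheaf.glue (c := c) 0
    (fun V hV s => ∃ s' : (fa.Q.sec ⟨c.face, V⟩).zero, s = s' ∧
      fa.IsOp μ (c := ⟨c.face, V⟩) Θ (fa.Q.res0 (Cell.le_of_le hV) q) s')
    (by
      rintro V V' hV hVV' _ ⟨s, rfl, hs⟩
      refine ⟨fa.Q.res0 (Cell.le_of_le hVV') s, rfl, ?_⟩
      have := hs.res (c := ⟨c.face, V⟩) hVV'
      rwa [res0_res0] at this)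
    (by
      rintro V hV _ _ ⟨s, rfl, hs⟩ ⟨s', rfl, hs'⟩
      exact congrArg _ (fa.isOp_unique (c := ⟨c.face, V⟩) hR hs hs'))
    (fun x hx => by
      obtain ⟨V, hV, hxV, ι, _, a, A, r, hn, g, -, hg, hq, -⟩ :=
        fa.exists_rep hR (μ := μ) (X := Unit) (Y := Empty) (fun _ => q) Empty.elim x hx
      refine ⟨V, hV, hxV, _, Subtype.property
        (fa.HQ.hol ⟨c.face, V⟩ (Θ.lift (g ⟨⟩)) (fa.tuple μ ⟨c.face, V⟩ a)), _, rfl, ?_⟩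
      rw [hq ⟨⟩]
      exact fa.isOp_hol (c := ⟨c.face, V⟩) hR Θ hn (hg ⟨⟩))
  refine ⟨⟨t, ht⟩, fa.isOp_of_locally fun x hx => ?_⟩
  obtain ⟨V, hV, hxV, s, hs, h'⟩ := h x hx
  refine ⟨V, hV, hxV, ?_⟩
  rwa [show fa.Q.res0 (Cell.le_of_le hV) ⟨t, ht⟩ = s from Subtype.ext hs]

end FreeAnalytic

end

/-! ### Operators as linear maps on Q⁰; the Euler operator and its inverses -/

section

variable {W : SimplicialSystem.{u}}

namespace CDGA

variable {A : CDGA.{u}}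

theorem mul_comm_of_mem_zero {a : A} (ha : a ∈ A.deg 0) (b : A) : a * b = b * a := by
  rw [mul_comm_sgn ha, sgn_zero]

theorem proj_mul_of_mem_zero (n : ℤ) (a : A) {b : A} (hb : b ∈ A.deg 0) :
    A.proj n (a * b) = A.proj n a * b := by
  induction a using homogeneous_induction with
  | h0 => simp
  | hadd a a' ha ha' => simp [add_mul, ha, ha']
  | hhom m a ha =>
    have hab : a * b ∈ A.deg m := by simpa using A.mul_mem ha hb
    by_cases h : n = m
    · subst h
      rw [proj_of_mem ha, proj_of_mem hab]
    · rw [proj_of_ne h ha, proj_of_ne h hab, zero_mul]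

end CDGA

namespace FreeAnalytic

open DGPresheaf Slice CDGA

variable {R S : DGPresheaf W} {HR : HolStructure R} {j : R ⟶ S} (fa : FreeAnalytic HR j) (μ : S ⟶ R)
  (hR : HR.IsComplexAnalytic)

instance (α : W.faces) : Fintype (fa.Idx α) := Fintype.ofFinite _

/-- All sections involved are represented by one tuple, where the sections of R⁰ are functions of
the base variables alone. Additivity, ℂ-linearity and R⁰-linearity of the operators are instances
with one or two terms. -/
theorem IsOp.linear {fa : FreeAnalytic HR j} {μ : S ⟶ R} (hR : HR.IsComplexAnalytic) {c : Cell W}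
    {Θ : Op (fa.Idx c.face)} {m : ℕ}
    {q s : Fin m → (fa.Q.sec c).zero} (h : ∀ k, fa.IsOp μ Θ (q k) (s k))
    (r : Fin m → (R.sec c).zero) :
    fa.IsOp μ Θ (∑ k, q k * ap0 fa.i c (r k)) (∑ k, s k * ap0 fa.i c (r k)) := by
  refine fa.isOp_of_locally fun x hx => ?_
  obtain ⟨V, hV, hxV, ι, _, a, A, ρ, hn, g, u, hg, hq, hu, hr⟩ := fa.exists_rep hR (μ := μ) q r x hx
  refine ⟨V, hV, hxV, ?_⟩
  have hs : ∀ k, fa.Q.res0 (Cell.le_of_le hV) (s k) =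
      fa.HQ.hol ⟨c.face, V⟩ (Θ.lift (g k)) (fa.tuple μ ⟨c.face, V⟩ a) := fun k =>
    h k V hV a A ρ (g k) hn (hg k) (hq k)
  simp only [map_sum, map_mul, res0_ap0, hq, hs, hr]
  rw [← fa.hol_tuple_linear (c := ⟨c.face, V⟩) hn hu hg,
    ← fa.hol_lift_linear (c := ⟨c.face, V⟩) hn Θ hu hg]
  have := Fintype.ofFinite ι
  exact fa.isOp_hol (c := ⟨c.face, V⟩) hR Θ hn (DifferentiableOn.fun_sum fun k _ =>
    (hg k).fun_mul (fa.differentiableOn_left (c := ⟨c.face, V⟩) (hu k)))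

/-- The action of an operator on sections of degree `0`. -/
def op0 (c : Cell W) (Θ : Op (fa.Idx c.face)) : (fa.Q.sec c).zero →ₗ[ℂ] (fa.Q.sec c).zero where
  toFun q := (fa.exists_isOp (μ := μ) hR Θ q).choose
  map_add' q q' := by
    have h := IsOp.linear hR (m := 2) (q := ![q, q'])
      (s := ![(fa.exists_isOp (μ := μ) hR Θ q).choose, (fa.exists_isOp (μ := μ) hR Θ q').choose])
      (Fin.forall_fin_two.2 ⟨(fa.exists_isOp (μ := μ) hR Θ q).choose_spec,
        (fa.exists_isOp (μ := μ) hR Θ q').choose_spec⟩) (fun _ => 1)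
    simp only [Fin.sum_univ_two, Matrix.cons_val_zero, Matrix.cons_val_one, map_one, mul_one] at h
    exact fa.isOp_unique hR (fa.exists_isOp hR Θ _).choose_spec h
  map_smul' z q := by
    have h := IsOp.linear hR (m := 1) (q := ![q])
      (s := ![(fa.exists_isOp (μ := μ) hR Θ q).choose])
      (fun k => by fin_cases k; exact (fa.exists_isOp (μ := μ) hR Θ q).choose_spec)
      (fun _ => algebraMap ℂ _ z)
    simp only [Fin.sum_univ_one, Matrix.cons_val_zero, AlgHom.commutes, ← Algebra.commutes z,
      ← Algebra.smul_def] at h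
    exact fa.isOp_unique hR (fa.exists_isOp hR Θ _).choose_spec h

variable {μ}

theorem isOp_op0 {c : Cell W} (Θ : Op (fa.Idx c.face)) (q : (fa.Q.sec c).zero) :
    fa.IsOp μ Θ q (fa.op0 μ hR c Θ q) := (fa.exists_isOp hR Θ q).choose_spec

theorem op0_eq {c : Cell W} {Θ : Op (fa.Idx c.face)} {q s : (fa.Q.sec c).zero}
    (h : fa.IsOp μ Θ q s) : fa.op0 μ hR c Θ q = s :=
  fa.isOp_unique hR (fa.isOp_op0 hR Θ q) h

theorem op0_mul {c : Cell W} (Θ : Op (fa.Idx c.face)) (r : (R.sec c).zero) (q : (fa.Q.sec c).zero) :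
    fa.op0 μ hR c Θ (ap0 fa.i c r * q) = ap0 fa.i c r * fa.op0 μ hR c Θ q := by
  have h := IsOp.linear hR (m := 1) (q := ![q]) (s := ![fa.op0 μ hR c Θ q])
    (fun k => by fin_cases k; exact fa.isOp_op0 hR Θ q) (fun _ => r)
  simp only [Fin.sum_univ_one, Matrix.cons_val_zero] at h
  rw [mul_comm, fa.op0_eq hR h, mul_comm]

theorem res0_op0 {c : Cell W} (Θ : Op (fa.Idx c.face)) {V : Opens (W.pt c.face)} (hV : V ≤ c.U)
    (q : (fa.Q.sec c).zero) : fa.Q.res0 (Cell.le_of_le hV) (fa.op0 μ hR c Θ q) =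
      fa.op0 μ hR ⟨c.face, V⟩ Θ (fa.Q.res0 (Cell.le_of_le hV) q) :=
  (fa.op0_eq (c := ⟨c.face, V⟩) hR ((fa.isOp_op0 hR Θ q).res hV)).symm

theorem op0_hol {c : Cell W} (Θ : Op (fa.Idx c.face)) {ι : Type u} [Finite ι]
    {a : ι → (R.sec c).zero} {A : Set (ι → ℂ)} {r : ℝ} (hn : HR.Near a A r)
    {g : (ι ⊕ fa.Idx c.face → ℂ) → ℂ} (hg : DifferentiableOn ℂ g (dom _ A r)) :
    fa.op0 μ hR c Θ (fa.HQ.hol c g (fa.tuple μ c a)) = fa.HQ.hol c (Θ.lift g) (fa.tuple μ c a) :=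
  fa.op0_eq hR (fa.isOp_hol hR Θ hn hg)

variable (μ) in
/-- The Euler operator on sections of degree `0`. -/
def euler0 (c : Cell W) : (fa.Q.sec c).zero →ₗ[ℂ] (fa.Q.sec c).zero :=
  ∑ n, LinearMap.mulLeft ℂ (fa.coord μ c n) ∘ₗ fa.op0 μ hR c (pdOp n)

theorem euler0_apply (c : Cell W) (q : (fa.Q.sec c).zero) :
    fa.euler0 μ hR c q = ∑ n, fa.coord μ c n * fa.op0 μ hR c (pdOp n) q := by
  simp [euler0]

theorem res0_euler0 {c : Cell W} {V : Opens (W.pt c.face)} (hV : V ≤ c.U) (q : (fa.Q.sec c).zero) :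
    fa.Q.res0 (Cell.le_of_le hV) (fa.euler0 μ hR c q) =
      fa.euler0 μ hR ⟨c.face, V⟩ (fa.Q.res0 (Cell.le_of_le hV) q) := by
  rw [euler0_apply, euler0_apply, map_sum]
  refine Finset.sum_congr rfl fun n _ => ?_
  rw [map_mul, fa.res0_op0 hR _ hV]
  congr 1
  exact fa.res0_coord μ (Cell.le_of_le hV) n

/-- Identities between sections of degree `0` can be checked on holomorphic functions. -/
theorem rep_induction (hR : HR.IsComplexAnalytic) {α : W.faces} (P : ∀ V : Opens (W.pt α), (fa.Q.sec ⟨α, V⟩).zero → Prop)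
    (loc : ∀ V q, (∀ x ∈ V, ∃ (V' : Opens (W.pt α)) (h : V' ≤ V), x ∈ V' ∧
      P V' (fa.Q.res0 (Cell.le_of_le h) q)) → P V q)
    (hol : ∀ (V : Opens (W.pt α)) (ι : Type u) [Finite ι] (a : ι → (R.sec ⟨α, V⟩).zero)
      (A : Set (ι → ℂ)) (r : ℝ) (g : (ι ⊕ fa.Idx α → ℂ) → ℂ), HR.Near a A r →
      DifferentiableOn ℂ g (dom _ A r) → P V (fa.HQ.hol ⟨α, V⟩ g (fa.tuple μ ⟨α, V⟩ a)))
    (V : Opens (W.pt α)) (q : (fa.Q.sec ⟨α, V⟩).zero) : P V q := by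
  refine loc V q fun x hx => ?_
  obtain ⟨V', hV', hxV', ι, _, a, A, r, hn, g, -, hg, hq, -⟩ :=
    fa.exists_rep (c := ⟨α, V⟩) hR (μ := μ) (X := Unit) (Y := Empty) (fun _ => q) Empty.elim x hx
  refine ⟨V', hV', hxV', ?_⟩
  rw [hq ⟨⟩]
  exact hol V' ι a A r _ hn (hg ⟨⟩)

section

variable {c : Cell W} {ι : Type u} [Finite ι] {a : ι → (R.sec c).zero} {A : Set (ι → ℂ)} {r : ℝ}

theorem hol_coord (n : fa.Idx c.face) :
    fa.HQ.hol c (fun w => w (Sum.inr n)) (fa.tuple μ c a) = fa.coord μ c n :=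
  fa.HQ.hol_coord c (fa.tuple μ c a) (Sum.inr n)

/-- The Euler operator on functions with parameters. -/
def _root_.Slice.eulerLift {κ : Type u} [Fintype κ] (g : (ι ⊕ κ → ℂ) → ℂ) (w : ι ⊕ κ → ℂ) : ℂ :=
  ∑ n, w (Sum.inr n) * (pdOp n).lift g w

theorem differentiableOn_eulerLift (hn : HR.Near a A r) {g : (ι ⊕ fa.Idx c.face → ℂ) → ℂ}
    (hg : DifferentiableOn ℂ g (dom _ A r)) : DifferentiableOn ℂ (eulerLift g) (dom _ A r) := by
  have := Fintype.ofFinite ι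
  exact DifferentiableOn.fun_sum fun n _ => (fa.differentiableOn_coord n).fun_mul
    ((pdOp n).differentiableOn_lift hn.isOpen hg)

theorem euler0_hol (hn : HR.Near a A r) {g : (ι ⊕ fa.Idx c.face → ℂ) → ℂ}
    (hg : DifferentiableOn ℂ g (dom _ A r)) :
    fa.euler0 μ hR c (fa.HQ.hol c g (fa.tuple μ c a)) = fa.HQ.hol c (eulerLift g) (fa.tuple μ c a) := by
  have := Fintype.ofFinite ι
  rw [euler0_apply]
  unfold eulerLift
  rw [fa.hol_tuple_sum hn Finset.univ (g := fun n w => w (Sum.inr n) * (pdOp n).lift g w)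
    fun n => (fa.differentiableOn_coord n).fun_mul ((pdOp n).differentiableOn_lift hn.isOpen hg)]
  refine Finset.sum_congr rfl fun n _ => ?_
  rw [fa.hol_tuple_mul hn (fa.differentiableOn_coord n) ((pdOp n).differentiableOn_lift hn.isOpen hg),
    fa.op0_hol hR _ hn hg, hol_coord]

theorem hol_smul (hn : HR.Near a A r) {g : (ι ⊕ fa.Idx c.face → ℂ) → ℂ}
    (hg : DifferentiableOn ℂ g (dom _ A r)) (z : ℂ) :
    fa.HQ.hol c (fun w => z * g w) (fa.tuple μ c a) = z • fa.HQ.hol c g (fa.tuple μ c a) := by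
  rw [fa.hol_tuple_mul hn (differentiableOn_const _) hg, fa.HQ.hol_const, Algebra.smul_def]

end

/-- All operations commute with restriction to open subsets, so the identity may be checked on
representing functions, where it is `ray_euler` on every slice. -/
theorem op0_ray_euler (c : Cell W) (k : ℕ) (q : (fa.Q.sec c).zero) :
    fa.op0 μ hR c (rayOp _ k) (fa.euler0 μ hR c q + ((k : ℂ) + 1) • q) = q := by
  refine fa.rep_induction (μ := μ) hR (α := c.face) (fun V q => fa.op0 μ hR ⟨c.face, V⟩ (rayOp _ k)
    (fa.euler0 μ hR ⟨c.face, V⟩ q + ((k : ℂ) + 1) • q) = q) ?_ ?_ c.U q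
  · intro V q h
    refine fa.isSheaf.ext0 fun x hx => ?_
    obtain ⟨V', hV', hxV', hp⟩ := h x hx
    refine ⟨V', hV', hxV', Eq.trans ?_ hp⟩
    refine (fa.res0_op0 (c := ⟨c.face, V⟩) hR _ hV' _).trans ?_
    rw [map_add, map_smul]
    refine congrArg _ (congrArg₂ _ ?_ rfl)
    exact fa.res0_euler0 (c := ⟨c.face, V⟩) hR hV' q
  · intro V ι _ a A r g hn hg
    have := Fintype.ofFinite ι
    have he := fa.differentiableOn_eulerLift (c := ⟨c.face, V⟩) hn hg
    rw [fa.euler0_hol (c := ⟨c.face, V⟩) hR hn hg, ← fa.hol_smul (c := ⟨c.face, V⟩) hn hg,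
      ← fa.hol_tuple_add (c := ⟨c.face, V⟩) hn he (hg.const_mul _),
      fa.op0_hol (c := ⟨c.face, V⟩) hR _ hn (he.fun_add (hg.const_mul _))]
    refine (fa.hol_tuple_congr (c := ⟨c.face, V⟩) hn hg fun w hw => ?_).symm
    have := ray_euler k (differentiableOn_slice hg hw.1) hw.2
    exact ((congrArg g (elim_comp w).symm).trans this.symm)

theorem euler_op0_ray (c : Cell W) (k : ℕ) (q : (fa.Q.sec c).zero) :
    fa.euler0 μ hR c (fa.op0 μ hR c (rayOp _ k) q) +
      ((k : ℂ) + 1) • fa.op0 μ hR c (rayOp _ k) q = q := by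
  refine fa.rep_induction (μ := μ) hR (α := c.face) (fun V q => fa.euler0 μ hR ⟨c.face, V⟩
    (fa.op0 μ hR ⟨c.face, V⟩ (rayOp _ k) q) +
      ((k : ℂ) + 1) • fa.op0 μ hR ⟨c.face, V⟩ (rayOp _ k) q = q) ?_ ?_ c.U q
  · intro V q h
    refine fa.isSheaf.ext0 fun x hx => ?_
    obtain ⟨V', hV', hxV', hp⟩ := h x hx
    refine ⟨V', hV', hxV', Eq.trans ?_ hp⟩
    have h1 := fa.res0_op0 (c := ⟨c.face, V⟩) (μ := μ) hR (rayOp _ k) hV' q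
    rw [map_add, map_smul]
    refine congrArg₂ _ ((fa.res0_euler0 (c := ⟨c.face, V⟩) hR hV' _).trans ?_) ?_
    · exact congrArg _ h1
    · exact congrArg _ h1
  · intro V ι _ a A r g hn hg
    have := Fintype.ofFinite ι
    have hl := (rayOp (fa.Idx c.face) k).differentiableOn_lift hn.isOpen hg
    rw [fa.op0_hol (c := ⟨c.face, V⟩) hR _ hn hg, fa.euler0_hol (c := ⟨c.face, V⟩) hR hn hl,
      ← fa.hol_smul (c := ⟨c.face, V⟩) hn hl,
      ← fa.hol_tuple_add (c := ⟨c.face, V⟩) hn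
        (fa.differentiableOn_eulerLift (c := ⟨c.face, V⟩) hn hl) (hl.const_mul _)]
    refine (fa.hol_tuple_congr (c := ⟨c.face, V⟩) hn hg fun w hw => ?_).symm
    have := euler_ray k (differentiableOn_slice hg hw.1) hw.2
    exact ((congrArg g (elim_comp w).symm).trans this.symm)

end FreeAnalytic

end

/-! ### Leibniz rule, Hadamard's lemma, and restriction to larger simplices -/

section

variable {W : SimplicialSystem.{u}}

namespace FreeAnalytic

open DGPresheaf Slice CDGA

variable {R S : DGPresheaf W} {HR : HolStructure R} {j : R ⟶ S} (fa : FreeAnalytic HR j) {μ : S ⟶ R}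
  (hR : HR.IsComplexAnalytic)

theorem op0_pd_mul (c : Cell W) (n : fa.Idx c.face) (q q' : (fa.Q.sec c).zero) :
    fa.op0 μ hR c (pdOp n) (q * q') =
      fa.op0 μ hR c (pdOp n) q * q' + q * fa.op0 μ hR c (pdOp n) q' := by
  refine fa.isSheaf.ext0 fun x hx => ?_
  -- Both factors are represented over the same tuple by treating them as a family indexed by
  -- `Bool`.
  obtain ⟨V, hV, hxV, ι, _, a, A, ρ, hn, g, -, hg, hq, -⟩ :=
    fa.exists_rep hR (μ := μ) (X := Bool) (Y := Empty) (fun b => cond b q q') Empty.elim x hx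
  have := Fintype.ofFinite ι
  refine ⟨V, hV, hxV, ?_⟩
  simp only [map_mul, map_add, fa.res0_op0 hR (pdOp n) hV]
  have h1 := hq true
  have h2 := hq false
  simp only [cond_true, cond_false] at h1 h2
  have d1 := hg true
  have d2 := hg false
  have l1 := (pdOp n).differentiableOn_lift hn.isOpen d1
  have l2 := (pdOp n).differentiableOn_lift hn.isOpen d2
  rw [h1, h2, ← fa.hol_tuple_mul (c := ⟨c.face, V⟩) hn d1 d2,
    fa.op0_hol (c := ⟨c.face, V⟩) hR _ hn (d1.fun_mul d2),
    fa.op0_hol (c := ⟨c.face, V⟩) hR _ hn d1, fa.op0_hol (c := ⟨c.face, V⟩) hR _ hn d2,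
    ← fa.hol_tuple_mul (c := ⟨c.face, V⟩) hn l1 d2,
    ← fa.hol_tuple_mul (c := ⟨c.face, V⟩) hn d1 l2,
    ← fa.hol_tuple_add (c := ⟨c.face, V⟩) hn (l1.fun_mul d2) (d1.fun_mul l2)]
  refine fa.hol_tuple_congr (c := ⟨c.face, V⟩) hn
    ((pdOp n).differentiableOn_lift hn.isOpen (d1.fun_mul d2)) fun w hw => ?_
  refine (pd_mul n (differentiableOn_slice d1 hw.1) (differentiableOn_slice d2 hw.1) hw.2).trans ?_
  unfold slice
  simp only [elim_comp]
  rfl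

/-- The Leibniz rule kills 1, and R⁰-linearity does the rest. -/
theorem op0_pd_hol_const (c : Cell W) (n : fa.Idx c.face) (r : (R.sec c).zero) :
    fa.op0 μ hR c (pdOp n) (ap0 fa.i c r) = 0 := by
  have h1 : fa.op0 μ hR c (pdOp n) 1 = 0 := by
    have h := fa.op0_pd_mul (μ := μ) hR c n 1 1
    simpa using h
  rw [← mul_one (ap0 fa.i c r), op0_mul, h1, mul_zero]

theorem _root_.Slice.slice_eulerLift {ι κ : Type u} [Fintype κ] (g : (ι ⊕ κ → ℂ) → ℂ) (z : ι → ℂ) :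
    slice (eulerLift g) z = euler (slice g z) := rfl

theorem op0_pd_euler (c : Cell W) (n : fa.Idx c.face) (q : (fa.Q.sec c).zero) :
    fa.op0 μ hR c (pdOp n) (fa.euler0 μ hR c q) =
      fa.euler0 μ hR c (fa.op0 μ hR c (pdOp n) q) + fa.op0 μ hR c (pdOp n) q := by
  refine fa.isSheaf.ext0 fun x hx => ?_
  obtain ⟨V, hV, hxV, ι, _, a, A, ρ, hn, g, -, hg, hq, -⟩ :=
    fa.exists_rep hR (μ := μ) (X := Unit) (Y := Empty) (fun _ => q) Empty.elim x hx
  have := Fintype.ofFinite ι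
  refine ⟨V, hV, hxV, ?_⟩
  have d1 := hg ⟨⟩
  have l1 := (pdOp n).differentiableOn_lift hn.isOpen d1
  have e1 := fa.differentiableOn_eulerLift (c := ⟨c.face, V⟩) hn d1
  have e2 := fa.differentiableOn_eulerLift (c := ⟨c.face, V⟩) hn l1
  change fa.Q.res0 (Cell.le_of_le hV) _ = fa.Q.res0 (Cell.le_of_le hV) _
  rw [map_add, fa.res0_op0 hR (pdOp n) hV, fa.res0_op0 hR (pdOp n) hV, fa.res0_euler0 hR hV,
    fa.res0_euler0 hR hV, fa.res0_op0 hR (pdOp n) hV, hq ⟨⟩]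
  rw [fa.euler0_hol (c := ⟨c.face, V⟩) hR hn d1, fa.op0_hol (c := ⟨c.face, V⟩) hR _ hn d1,
    fa.op0_hol (c := ⟨c.face, V⟩) hR _ hn e1, fa.euler0_hol (c := ⟨c.face, V⟩) hR hn l1,
    ← fa.hol_tuple_add (c := ⟨c.face, V⟩) hn e2 l1]
  refine fa.hol_tuple_congr (c := ⟨c.face, V⟩) hn
    ((pdOp n).differentiableOn_lift hn.isOpen e1) fun w hw => ?_
  have h1 := pd_euler n (differentiableOn_slice d1 hw.1) hw.2
  rw [← slice_eulerLift] at h1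
  exact h1

open Classical in
theorem op0_pd_coord (c : Cell W) (n m : fa.Idx c.face) :
    fa.op0 μ hR c (pdOp n) (fa.coord μ c m) = if n = m then 1 else 0 := by
  -- A coordinate is represented without any section of R⁰, so the empty tuple serves.
  have hn : HR.Near (c := c) (PEmpty.elim : PEmpty.{u + 1} → _) Set.univ 1 :=
    ⟨isOpen_univ, one_pos, fun _ => trivial⟩
  have hd := fa.differentiableOn_coord (c := c) (ι := PEmpty.{u + 1}) (A := Set.univ) (r := 1) m
  rw [← fa.hol_coord (c := c) (a := PEmpty.elim) m, fa.op0_hol hR _ hn hd]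
  have h1 : (pdOp n).lift (fun w : PEmpty.{u + 1} ⊕ fa.Idx c.face → ℂ => w (Sum.inr m)) =
      fun _ => if n = m then 1 else 0 := by
    funext w
    refine (pd_coord n m fun k => w (Sum.inr k)).trans ?_
    congr
  rw [h1, fa.HQ.hol_const]
  split_ifs <;> simp

/-- The augmentation of `Q`. -/
theorem aug_i (j_μ : j ≫ μ = 𝟙 R) (c : Cell W) (r : R.sec c) :
    ap μ c (ap fa.k c (ap fa.i c r)) = r := by
  rw [← ap_comp, ← ap_comp, ← Category.assoc, fa.i_k, j_μ, ap_id]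

theorem aug_coord (j_μ : j ≫ μ = 𝟙 R) (c : Cell W) (n : fa.Idx c.face) :
    ap μ c (ap fa.k c (fa.coord μ c n)) = 0 := by
  rw [coord_eq, AddSubgroupClass.coe_sub, map_sub, map_sub, coe_ap0, fa.aug_i j_μ, coe_res0,
    ← res_ap, ← res_ap]
  exact sub_self _

/-- Hadamard's lemma. -/
theorem eq_add_sum_op0 (j_μ : j ≫ μ = 𝟙 R) (c : Cell W) (q : (fa.Q.sec c).zero) :
    q = ap0 fa.i c (ap0 μ c (ap0 fa.k c q)) +
      ∑ n, fa.coord μ c n * fa.op0 μ hR c (rayOp _ 0) (fa.op0 μ hR c (pdOp n) q) := by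
  refine fa.isSheaf.ext0 fun x hx => ?_
  obtain ⟨V, hV, hxV, ι, _, a, A, ρ, hn, g, -, hg, hq, -⟩ :=
    fa.exists_rep hR (μ := μ) (X := Unit) (Y := Empty) (fun _ => q) Empty.elim x hx
  have := Fintype.ofFinite ι
  refine ⟨V, hV, hxV, ?_⟩
  have d1 := hg ⟨⟩
  have l1 := fun n => (pdOp n).differentiableOn_lift hn.isOpen d1
  have r1 := fun n => (rayOp _ 0).differentiableOn_lift hn.isOpen (l1 n)
  have t1 := fun n => (fa.differentiableOn_coord (c := ⟨c.face, V⟩) n).fun_mul (r1 n)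
  have hu : DifferentiableOn ℂ (fun z : ι → ℂ => g ⟨⟩ (Sum.elim z 0)) A := by
    refine d1.comp (t := dom _ A ρ) ?_ fun z hz => elim_mem_dom.2 ⟨hz, fun n => by simpa using hn.pos⟩
    refine Differentiable.differentiableOn ?_
    rw [differentiable_pi]
    rintro (i | n)
    · exact differentiable_apply i
    · exact differentiable_const _
  have hu' := fa.differentiableOn_left (c := ⟨c.face, V⟩) (r := ρ) hu
  have hcoord : ∀ n, fa.Q.res0 (Cell.le_of_le hV) (fa.coord μ c n) = fa.coord μ ⟨c.face, V⟩ n :=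
    fun n => fa.res0_coord μ (Cell.le_of_le hV) n
  simp only [map_add, map_sum, map_mul, fa.res0_op0 hR _ hV, res0_ap0, hq ⟨⟩, hcoord]
  have key : fa.HQ.hol ⟨c.face, V⟩ (g ⟨⟩) (fa.tuple μ ⟨c.face, V⟩ a) =
      ap0 fa.i _ (HR.hol ⟨c.face, V⟩ (fun z => g ⟨⟩ (Sum.elim z 0)) a) +
      ∑ n, fa.coord μ ⟨c.face, V⟩ n * fa.op0 μ hR ⟨c.face, V⟩ (rayOp _ 0)
        (fa.op0 μ hR ⟨c.face, V⟩ (pdOp n)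
          (fa.HQ.hol ⟨c.face, V⟩ (g ⟨⟩) (fa.tuple μ ⟨c.face, V⟩ a))) := by
    have h1 : ∀ n, fa.coord μ ⟨c.face, V⟩ n * fa.op0 μ hR ⟨c.face, V⟩ (rayOp _ 0)
        (fa.op0 μ hR ⟨c.face, V⟩ (pdOp n)
          (fa.HQ.hol ⟨c.face, V⟩ (g ⟨⟩) (fa.tuple μ ⟨c.face, V⟩ a))) =
        fa.HQ.hol ⟨c.face, V⟩ (fun w => w (Sum.inr n) * (rayOp _ 0).lift ((pdOp n).lift (g ⟨⟩)) w)
          (fa.tuple μ ⟨c.face, V⟩ a) := fun n => by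
      rw [fa.op0_hol (c := ⟨c.face, V⟩) hR _ hn d1, fa.op0_hol (c := ⟨c.face, V⟩) hR _ hn (l1 n),
        fa.hol_tuple_mul (c := ⟨c.face, V⟩) hn (fa.differentiableOn_coord (c := ⟨c.face, V⟩) n) (r1 n),
        fa.hol_coord (c := ⟨c.face, V⟩)]
    simp only [h1]
    rw [← fa.hol_tuple_left (c := ⟨c.face, V⟩) (μ := μ) hn hu,
      ← fa.hol_tuple_sum (c := ⟨c.face, V⟩) hn Finset.univ t1,
      ← fa.hol_tuple_add (c := ⟨c.face, V⟩) hn hu' (DifferentiableOn.fun_sum fun n _ => t1 n)]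
    refine fa.hol_tuple_congr (c := ⟨c.face, V⟩) hn d1 fun w hw => ?_
    have := eq_add_sum_ray (differentiableOn_slice d1 hw.1) hw.2
    exact (congrArg (g ⟨⟩) (elim_comp w).symm).trans this
  -- The augmentation removes all terms with a coordinate; this identifies the constant term g(a, 0)
  -- with the augmentation of the section.
  have h2 := congrArg (fun q => ap0 μ _ (ap0 fa.k _ q)) key
  have h3 : ∀ (V' : Opens (W.pt c.face)) n, ap0 μ ⟨c.face, V'⟩ (ap0 fa.k ⟨c.face, V'⟩
    (fa.coord μ ⟨c.face, V'⟩ n)) = 0 := fun V' n => Subtype.ext (fa.aug_coord j_μ ⟨c.face, V'⟩ n)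
  have h4 : ∀ (V' : Opens (W.pt c.face)) r, ap0 μ ⟨c.face, V'⟩ (ap0 fa.k ⟨c.face, V'⟩
    (ap0 fa.i _ r)) = r := fun V' r => Subtype.ext (fa.aug_i j_μ ⟨c.face, V'⟩ r)
  simp only [map_add, map_sum, map_mul, h3, h4, zero_mul, Finset.sum_const_zero, add_zero] at h2
  rw [h2]
  exact key

theorem res_tuple' {c' c : Cell W} (h : c' ≤ c) {ι : Type u} (a : ι → (R.sec c).zero) :
    (fun l => fa.Q.res0 h (fa.tuple μ c a l)) = fun l => fa.tuple μ c' (fun l => R.res0 h (a l))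
      (Sum.map id (fun n : fa.Idx c.face => (⟨n.1, n.2.trans h.fst⟩ : fa.Idx c'.face)) l) := by
  funext l
  rcases l with l | n
  · exact res0_ap0 fa.i _ _
  · exact fa.res0_coord μ h n

/-- Restriction to a larger simplex in terms of holomorphic functions. -/
theorem res_hol_tuple' {c' c : Cell W} (h : c' ≤ c) {ι : Type u} [Finite ι]
    {a : ι → (R.sec c).zero} {A : Set (ι → ℂ)} {r : ℝ} (hn : HR.Near a A r)
    {g : (ι ⊕ fa.Idx c.face → ℂ) → ℂ} (hg : DifferentiableOn ℂ g (dom _ A r)) :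
    fa.Q.res0 h (fa.HQ.hol c g (fa.tuple μ c a)) =
      fa.HQ.hol c' (fun w => g fun l => w
        (Sum.map id (fun n : fa.Idx c.face => (⟨n.1, n.2.trans h.fst⟩ : fa.Idx c'.face)) l))
        (fa.tuple μ c' fun l => R.res0 h (a l)) := by
  rw [fa.HQ.hol_res h _ g _ (isOpen_dom hn.isOpen r) (fa.val_tuple_mem hn) hg, res_tuple']
  refine fa.HQ.hol_reindex (fa.tuple μ c' fun l => R.res0 h (a l)) _ (isOpen_dom hn.isOpen r)
    (fun x => ?_) hg
  have h1 := fa.HQ.val_res' h _ (fa.val_tuple_mem (μ := μ) hn) x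
  rw [show (fun l => fa.HQ.val c' x (fa.Q.res0 h (fa.tuple μ c a l))) = _ from
    funext fun l => congrArg (fa.HQ.val c' x) (congrFun (fa.res_tuple' h a) l)] at h1
  exact h1

-- A larger simplex carries more coordinates. The pullback of a representing function does not
-- involve the new ones, so its derivatives in these directions vanish, and the derivatives in the
-- old directions are the pulled-back derivatives.
open Classical in
theorem res0_op0_pd {c' c : Cell W} (h : c' ≤ c) (n' : fa.Idx c'.face) (q : (fa.Q.sec c).zero) :
    fa.op0 μ hR c' (pdOp n') (fa.Q.res0 h q) =
      if hn : fa.gens0.face n'.1 ≤ c.face then fa.Q.res0 h (fa.op0 μ hR c (pdOp ⟨n'.1, hn⟩) q)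
      else 0 := by
  refine fa.isSheaf.ext0 fun x hx => ?_
  obtain ⟨V, hV, hxV, ι, _, a, A, ρ, hn, g, -, hg, hq, -⟩ :=
    fa.exists_rep hR (μ := μ) (X := Unit) (Y := Empty) (fun _ => q) Empty.elim _ (h.snd x hx)
  have := Fintype.ofFinite ι
  have d1 := hg ⟨⟩
  let V' : Opens (W.pt c'.face) := ⟨SimplicialSystem.trans h.fst ⁻¹' V,
    V.2.preimage (Cell.trans_continuous h.fst)⟩ ⊓ c'.U
  have hV' : V' ≤ c'.U := inf_le_right
  have hr : (⟨c'.face, V'⟩ : Cell W) ≤ ⟨c.face, V⟩ := ⟨h.fst, fun y hy => hy.1⟩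
  refine ⟨V', hV', ⟨hxV, hx⟩, ?_⟩
  have e1 : fa.Q.res0 (Cell.le_of_le hV') (fa.Q.res0 h q) =
      fa.Q.res0 hr (fa.HQ.hol ⟨c.face, V⟩ (g ⟨⟩) (fa.tuple μ ⟨c.face, V⟩ a)) := by
    rw [← hq ⟨⟩, res0_res0, res0_res0]
  have e2 := fa.res_hol_tuple' (μ := μ) hr hn d1
  change fa.Q.res0 (Cell.le_of_le hV') _ = fa.Q.res0 (Cell.le_of_le hV') _
  rw [fa.res0_op0 hR _ hV', e1, e2]
  have hf : DifferentiableOn ℂ (fun w : ι ⊕ fa.Idx c'.face → ℂ => g ⟨⟩ fun l => w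
      (Sum.map id (fun n : fa.Idx c.face => (⟨n.1, n.2.trans h.fst⟩ : fa.Idx c'.face)) l))
      (dom _ A ρ) :=
    d1.comp (t := dom _ A ρ) (by fun_prop) fun w hw => ⟨hw.1, fun n => hw.2 _⟩
  rw [fa.op0_hol (c := ⟨c'.face, V'⟩) hR _ (hn.res hr) hf]
  split_ifs with hn'
  · have e3 : fa.Q.res0 (Cell.le_of_le hV') (fa.Q.res0 h (fa.op0 μ hR c (pdOp ⟨n'.1, hn'⟩) q)) =
        fa.Q.res0 hr (fa.HQ.hol ⟨c.face, V⟩ ((pdOp ⟨n'.1, hn'⟩).lift (g ⟨⟩))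
          (fa.tuple μ ⟨c.face, V⟩ a)) := by
      rw [← fa.op0_hol (c := ⟨c.face, V⟩) hR _ hn d1, ← hq ⟨⟩, ← fa.res0_op0 hR _ hV, res0_res0,
        res0_res0]
    have l1 := (pdOp (⟨n'.1, hn'⟩ : fa.Idx c.face)).differentiableOn_lift hn.isOpen d1
    rw [e3]
    refine Eq.trans ?_ (fa.res_hol_tuple' (μ := μ) hr hn l1).symm
    congr 1
    funext w
    change deriv _ _ = deriv _ _
    congr 1
    funext ζ
    change g ⟨⟩ _ = g ⟨⟩ _
    congr 1
    funext l
    rcases l with l | n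
    · rfl
    · change _ + ζ * _ = _ + ζ * _
      simp only [Pi.single_apply, Subtype.ext_iff]
      rfl
  · have e4 : (pdOp n').lift (fun w : ι ⊕ fa.Idx c'.face → ℂ => g ⟨⟩ fun l => w
        (Sum.map id (fun n : fa.Idx c.face => (⟨n.1, n.2.trans h.fst⟩ : fa.Idx c'.face)) l)) =
        fun _ => 0 := by
      funext w
      have h5 : (fun ζ : ℂ => g ⟨⟩ fun l => (Sum.elim (fun i => w (Sum.inl i))
          ((fun k => w (Sum.inr k)) + ζ • Pi.single n' 1) : ι ⊕ fa.Idx c'.face → ℂ)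
          (Sum.map id (fun n : fa.Idx c.face => (⟨n.1, n.2.trans h.fst⟩ : fa.Idx c'.face)) l)) =
          fun _ => g ⟨⟩ fun l => w
            (Sum.map id (fun n : fa.Idx c.face => (⟨n.1, n.2.trans h.fst⟩ : fa.Idx c'.face)) l) := by
        funext ζ
        congr 1
        funext l
        rcases l with l | n
        · rfl
        · have : (Pi.single n' 1 : fa.Idx c'.face → ℂ) ⟨n.1, n.2.trans h.fst⟩ = 0 := by
            rw [Pi.single_apply, if_neg]
            rintro rfl
            exact hn' n.2
          change _ + ζ * (Pi.single n' 1 : fa.Idx c'.face → ℂ) ⟨n.1, n.2.trans h.fst⟩ = _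
          rw [this, mul_zero, add_zero]
          rfl
      refine (congrArg (fun f => deriv f 0) ?_).trans (deriv_const (0 : ℂ) (g ⟨⟩ fun l => w
        (Sum.map id (fun n : fa.Idx c.face => (⟨n.1, n.2.trans h.fst⟩ : fa.Idx c'.face)) l)))
      refine Eq.trans ?_ h5
      funext ζ
      change g ⟨⟩ _ = g ⟨⟩ _
      congr!
    rw [e4, fa.HQ.hol_const, map_zero, map_zero]

end FreeAnalytic

end

/-! ### R-linear extension of the operators to Q -/

section

variable {W : SimplicialSystem.{u}}

namespace FreeAnalytic

open DGPresheaf Slice CDGA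

variable {R S : DGPresheaf W} {HR : HolStructure R} {j : R ⟶ S} (fa : FreeAnalytic HR j) {μ : S ⟶ R}
  (hR : HR.IsComplexAnalytic)

/-- `q` and `s` have the form `∑ rₗ bₗ` and `∑ rₗ Θ(bₗ)`. -/
def TensorRel (c : Cell W) (Θ : (fa.Q.sec c).zero →ₗ[ℂ] (fa.Q.sec c).zero) (q s : fa.Q.sec c) :
    Prop :=
  ∃ (n : ℕ) (r : Fin n → R.sec c) (b : Fin n → (fa.Q.sec c).zero),
    q = ∑ l, ap fa.i c (r l) * (b l).1 ∧ s = ∑ l, ap fa.i c (r l) * (Θ (b l)).1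

section

variable {fa} {c : Cell W} {Θ : (fa.Q.sec c).zero →ₗ[ℂ] (fa.Q.sec c).zero} {q s q' s' : fa.Q.sec c}

theorem TensorRel.add (h : fa.TensorRel c Θ q s) (h' : fa.TensorRel c Θ q' s') :
    fa.TensorRel c Θ (q + q') (s + s') := by
  obtain ⟨n, r, b, rfl, rfl⟩ := h
  obtain ⟨n', r', b', rfl, rfl⟩ := h'
  exact ⟨n + n', Fin.append r r', Fin.append b b', by simp [Fin.sum_univ_add],
    by simp [Fin.sum_univ_add]⟩

theorem TensorRel.mul (h : fa.TensorRel c Θ q s) (r' : R.sec c) :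
    fa.TensorRel c Θ (ap fa.i c r' * q) (ap fa.i c r' * s) := by
  obtain ⟨n, r, b, rfl, rfl⟩ := h
  exact ⟨n, fun l => r' * r l, b, by simp [Finset.mul_sum, mul_assoc],
    by simp [Finset.mul_sum, mul_assoc]⟩

theorem TensorRel.of_zero (b : (fa.Q.sec c).zero) : fa.TensorRel c Θ b.1 (Θ b).1 :=
  ⟨1, fun _ => 1, fun _ => b, by simp, by simp⟩

end

theorem TensorRel.res {fa : FreeAnalytic HR j} {c : Cell W} {Θ : Op (fa.Idx c.face)}
    {q s : fa.Q.sec c} (h : fa.TensorRel c (fa.op0 μ hR c Θ) q s) {V : Opens (W.pt c.face)}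
    (hV : V ≤ c.U) : fa.TensorRel ⟨c.face, V⟩ (fa.op0 μ hR ⟨c.face, V⟩ Θ)
      (fa.Q.res (Cell.le_of_le hV) q) (fa.Q.res (Cell.le_of_le hV) s) := by
  obtain ⟨n, r, b, rfl, rfl⟩ := h
  refine ⟨n, fun l => R.res (Cell.le_of_le hV) (r l), fun l => fa.Q.res0 (Cell.le_of_le hV) (b l),
    ?_, ?_⟩
  · simp only [map_sum, map_mul, res_ap, coe_res0]
  · simp only [map_sum, map_mul, res_ap, ← fa.res0_op0 hR Θ hV, coe_res0]

/-- By local injectivity of R ⊗ Q⁰ → Q, the relation already holds in the tensor product on a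
smaller open set. The assignment r ⊗ b ↦ r Θ(b) is well defined there because the operator is
R⁰-linear. -/
theorem TensorRel.eq_zero {fa : FreeAnalytic HR j} {c : Cell W} {Θ : Op (fa.Idx c.face)}
    {s : fa.Q.sec c} (h : fa.TensorRel c (fa.op0 μ hR c Θ) 0 s) : s = 0 := by
  obtain ⟨n, r, b, h0, rfl⟩ := h
  refine fa.isSheaf.ext fun x hx => ?_
  obtain ⟨V, hV, hxV, ht⟩ := fa.tensor_inj c n r b h0.symm x hx
  refine ⟨V, hV, hxV, ?_⟩
  let d : Cell W := ⟨c.face, V⟩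
  let _ : Module (R.sec d).zero (fa.Q.sec d).zero :=
    Module.compHom (fa.Q.sec d).zero (fn0 (fa.i.app (op d))).toRingHom
  let f : R.sec d →+ (fa.Q.sec d).zero →+ fa.Q.sec d :=
    { toFun := fun r => (AddMonoidHom.mulLeft (ap fa.i d r)).comp
        ((fa.Q.sec d).zero.subtype.toAddMonoidHom.comp (fa.op0 μ hR d Θ).toAddMonoidHom)
      map_zero' := by ext; simp
      map_add' := fun r r' => by ext; simp [add_mul] }
  have hf : ∀ (t : (R.sec d).zero) (r : R.sec d) (b : (fa.Q.sec d).zero), f (t • r) b = f r (t • b) := by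
    intro t r b
    change ap fa.i d (t.1 * r) * (fa.op0 μ hR d Θ b).1 =
      ap fa.i d r * (fa.op0 μ hR d Θ (ap0 fa.i d t * b)).1
    rw [op0_mul, mul_comm_of_mem_zero t.2, map_mul, mul_assoc]
    rfl
  have h1 := congrArg (TensorProduct.liftAddHom f hf) ht
  rw [map_sum, map_zero] at h1
  change fa.Q.res (Cell.le_of_le hV) _ = fa.Q.res (Cell.le_of_le hV) 0
  rw [map_zero, map_sum, ← h1]
  refine Finset.sum_congr rfl fun l _ => ?_
  rw [map_mul, res_ap, ← coe_res0, fa.res0_op0 hR Θ hV]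
  rfl

variable (μ) in
/-- The `R`-linear extension of an operator to `Q`. -/
def IsOpQ (c : Cell W) (Θ : Op (fa.Idx c.face)) (q s : fa.Q.sec c) : Prop :=
  ∀ x ∈ c.U, ∃ (V : Opens (W.pt c.face)) (hV : V ≤ c.U), x ∈ V ∧
    fa.TensorRel ⟨c.face, V⟩ (fa.op0 μ hR ⟨c.face, V⟩ Θ) (fa.Q.res (Cell.le_of_le hV) q)
      (fa.Q.res (Cell.le_of_le hV) s)

variable {fa hR}

theorem TensorRel.isOpQ {c : Cell W} {Θ : Op (fa.Idx c.face)} {q s : fa.Q.sec c}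
    (h : fa.TensorRel c (fa.op0 μ hR c Θ) q s) : fa.IsOpQ μ hR c Θ q s := fun _ hx =>
  ⟨c.U, le_rfl, hx, h.res hR le_rfl⟩

theorem IsOpQ.add {c : Cell W} {Θ : Op (fa.Idx c.face)} {q s q' s' : fa.Q.sec c}
    (h : fa.IsOpQ μ hR c Θ q s) (h' : fa.IsOpQ μ hR c Θ q' s') :
    fa.IsOpQ μ hR c Θ (q + q') (s + s') := fun x hx => by
  obtain ⟨V, hV, hxV, hp⟩ := h x hx
  obtain ⟨V', hV', hxV', hp'⟩ := h' x hx
  have l : V ⊓ V' ≤ V := inf_le_left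
  have l' : V ⊓ V' ≤ V' := inf_le_right
  refine ⟨V ⊓ V', l.trans hV, ⟨hxV, hxV'⟩, ?_⟩
  have h1 := (TensorRel.res (c := ⟨c.face, V⟩) hR hp l).add
    (TensorRel.res (c := ⟨c.face, V'⟩) hR hp' l')
  rw [res_res, res_res, res_res, res_res] at h1
  rw [map_add, map_add]
  exact h1

theorem IsOpQ.mul {c : Cell W} {Θ : Op (fa.Idx c.face)} {q s : fa.Q.sec c}
    (h : fa.IsOpQ μ hR c Θ q s) (r : R.sec c) :
    fa.IsOpQ μ hR c Θ (ap fa.i c r * q) (ap fa.i c r * s) := fun x hx => by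
  obtain ⟨V, hV, hxV, hp⟩ := h x hx
  refine ⟨V, hV, hxV, ?_⟩
  rw [map_mul, map_mul, res_ap]
  exact hp.mul _

theorem IsOpQ.smul {c : Cell W} {Θ : Op (fa.Idx c.face)} {q s : fa.Q.sec c}
    (h : fa.IsOpQ μ hR c Θ q s) (z : ℂ) : fa.IsOpQ μ hR c Θ (z • q) (z • s) := by
  have := h.mul (algebraMap ℂ _ z)
  simpa only [AlgHom.commutes, ← Algebra.smul_def] using this

theorem IsOpQ.res {c : Cell W} {Θ : Op (fa.Idx c.face)} {q s : fa.Q.sec c}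
    (h : fa.IsOpQ μ hR c Θ q s) {V : Opens (W.pt c.face)} (hV : V ≤ c.U) :
    fa.IsOpQ μ hR ⟨c.face, V⟩ Θ (fa.Q.res (Cell.le_of_le hV) q)
      (fa.Q.res (Cell.le_of_le hV) s) := fun x hx => by
  obtain ⟨V', hV', hxV', hp⟩ := h x (hV hx)
  have l : V ⊓ V' ≤ V := inf_le_left
  have l' : V ⊓ V' ≤ V' := inf_le_right
  refine ⟨V ⊓ V', l, ⟨hx, hxV'⟩, ?_⟩
  have h1 := TensorRel.res (c := ⟨c.face, V'⟩) hR hp l'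
  rw [res_res, res_res] at h1
  rw [res_res, res_res]
  exact h1

theorem IsOpQ.of_locally {c : Cell W} {Θ : Op (fa.Idx c.face)} {q s : fa.Q.sec c}
    (h : ∀ x ∈ c.U, ∃ (V : Opens (W.pt c.face)) (hV : V ≤ c.U), x ∈ V ∧
      fa.IsOpQ μ hR ⟨c.face, V⟩ Θ (fa.Q.res (Cell.le_of_le hV) q)
        (fa.Q.res (Cell.le_of_le hV) s)) : fa.IsOpQ μ hR c Θ q s := fun x hx => by
  obtain ⟨V, hV, hxV, hp⟩ := h x hx
  obtain ⟨V', hV', hxV', hp'⟩ := hp x hxV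
  refine ⟨V', le_trans hV' hV, hxV', ?_⟩
  rw [res_res, res_res] at hp'
  exact hp'

theorem IsOpQ.eq_zero {c : Cell W} {Θ : Op (fa.Idx c.face)} {s : fa.Q.sec c}
    (h : fa.IsOpQ μ hR c Θ 0 s) : s = 0 := by
  refine fa.isSheaf.ext fun x hx => ?_
  obtain ⟨V, hV, hxV, hp⟩ := h x hx
  rw [map_zero] at hp
  exact ⟨V, hV, hxV, hp.eq_zero.trans (map_zero _).symm⟩

theorem IsOpQ.unique {c : Cell W} {Θ : Op (fa.Idx c.face)} {q s s' : fa.Q.sec c}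
    (h : fa.IsOpQ μ hR c Θ q s) (h' : fa.IsOpQ μ hR c Θ q s') : s = s' := by
  have h1 := h.add (h'.smul (-1))
  rw [neg_smul, one_smul, add_neg_cancel, neg_smul, one_smul] at h1
  exact add_neg_eq_zero.1 h1.eq_zero

variable (fa hR)

/-- Local surjectivity of R ⊗ Q⁰ → Q gives local expressions ∑ r b, and uniqueness lets the results
glue. The coefficients r may be replaced by their components of degree n, as the b have degree 0;
this keeps the result homogeneous, which gluing requires. -/
theorem exists_isOpQ_of_mem {c : Cell W} (Θ : Op (fa.Idx c.face)) {n : ℤ} {q : fa.Q.sec c}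
    (hq : q ∈ (fa.Q.sec c).deg n) : ∃ s ∈ (fa.Q.sec c).deg n, fa.IsOpQ μ hR c Θ q s := by
  obtain ⟨t, ht, h⟩ := fa.isSheaf.glue (c := c) n
    (fun V hV s => fa.IsOpQ μ hR ⟨c.face, V⟩ Θ (fa.Q.res (Cell.le_of_le hV) q) s)
    (fun V V' hV hVV' s hs => by
      have := hs.res (c := ⟨c.face, V⟩) hVV'
      rwa [res_res] at this)
    (fun V hV s s' hs hs' => hs.unique hs')
    (fun x hx => by
      obtain ⟨V, hV, hxV, m, r, b, h⟩ := fa.tensor_surj c q x hx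
      have h1 : fa.Q.res (Cell.le_of_le hV) q =
          ∑ l, ap fa.i _ ((R.sec ⟨c.face, V⟩).proj n (r l)) * (b l).1 := by
        rw [← proj_of_mem (fa.Q.res_mem (Cell.le_of_le hV) hq), h, map_sum]
        refine Finset.sum_congr rfl fun l _ => ?_
        rw [proj_mul_of_mem_zero _ _ (b l).2]
        exact congrArg (· * _) ((apG fa.i _).map_proj n (r l)).symm
      refine ⟨V, hV, hxV, _, ?_, TensorRel.isOpQ ⟨m, _, b, h1, rfl⟩⟩
      refine Submodule.sum_mem _ fun l _ => ?_
      simpa using (fa.Q.sec ⟨c.face, V⟩).mul_mem (ap_mem fa.i _ (proj_mem n (r l)))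
        (fa.op0 μ hR ⟨c.face, V⟩ Θ (b l)).2)
  exact ⟨t, ht, IsOpQ.of_locally h⟩

theorem exists_isOpQ {c : Cell W} (Θ : Op (fa.Idx c.face)) (q : fa.Q.sec c) :
    ∃ s, fa.IsOpQ μ hR c Θ q s := by
  induction q using homogeneous_induction with
  | h0 => exact ⟨0, fun _ hx => ⟨c.U, le_rfl, hx, 0, Fin.elim0, Fin.elim0, by simp, by simp⟩⟩
  | hadd q q' h h' =>
    obtain ⟨s, hs⟩ := h
    obtain ⟨s', hs'⟩ := h'
    exact ⟨_, hs.add hs'⟩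
  | hhom n q hq =>
    obtain ⟨s, -, hs⟩ := fa.exists_isOpQ_of_mem hR Θ hq
    exact ⟨s, hs⟩

variable (μ) in
/-- The `R`-linear extension of an operator to `Q`. -/
def opQ (c : Cell W) (Θ : Op (fa.Idx c.face)) : fa.Q.sec c →ₗ[ℂ] fa.Q.sec c where
  toFun q := (fa.exists_isOpQ (μ := μ) hR Θ q).choose
  map_add' q q' := (fa.exists_isOpQ hR Θ _).choose_spec.unique
    ((fa.exists_isOpQ hR Θ q).choose_spec.add (fa.exists_isOpQ hR Θ q').choose_spec)
  map_smul' z q := (fa.exists_isOpQ hR Θ _).choose_spec.unique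
    ((fa.exists_isOpQ hR Θ q).choose_spec.smul z)

section

variable {c : Cell W} (Θ : Op (fa.Idx c.face))

theorem isOpQ_opQ (q : fa.Q.sec c) : fa.IsOpQ μ hR c Θ q (fa.opQ μ hR c Θ q) :=
  (fa.exists_isOpQ hR Θ q).choose_spec

theorem opQ_eq {q s : fa.Q.sec c} (h : fa.IsOpQ μ hR c Θ q s) : fa.opQ μ hR c Θ q = s :=
  (fa.isOpQ_opQ hR Θ q).unique h

theorem opQ_mem {n : ℤ} {q : fa.Q.sec c} (hq : q ∈ (fa.Q.sec c).deg n) :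
    fa.opQ μ hR c Θ q ∈ (fa.Q.sec c).deg n := by
  obtain ⟨s, hs, h⟩ := fa.exists_isOpQ_of_mem (μ := μ) hR Θ hq
  rwa [fa.opQ_eq hR Θ h]

theorem opQ_mul (r : R.sec c) (q : fa.Q.sec c) :
    fa.opQ μ hR c Θ (ap fa.i c r * q) = ap fa.i c r * fa.opQ μ hR c Θ q :=
  fa.opQ_eq hR Θ ((fa.isOpQ_opQ hR Θ q).mul r)

theorem opQ_zero (b : (fa.Q.sec c).zero) : fa.opQ μ hR c Θ b = fa.op0 μ hR c Θ b :=
  fa.opQ_eq hR Θ (TensorRel.of_zero b).isOpQ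

theorem res_opQ {V : Opens (W.pt c.face)} (hV : V ≤ c.U) (q : fa.Q.sec c) :
    fa.Q.res (Cell.le_of_le hV) (fa.opQ μ hR c Θ q) =
      fa.opQ μ hR ⟨c.face, V⟩ Θ (fa.Q.res (Cell.le_of_le hV) q) :=
  (fa.opQ_eq (c := ⟨c.face, V⟩) hR Θ ((fa.isOpQ_opQ hR Θ q).res hV)).symm

end

/-- Induction on sections of `Q`. -/
theorem tensor_induction {c : Cell W}
    (P : ∀ V : Opens (W.pt c.face), V ≤ c.U → fa.Q.sec ⟨c.face, V⟩ → Prop)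
    (loc : ∀ q : fa.Q.sec c, (∀ x ∈ c.U, ∃ (V : Opens (W.pt c.face)) (hV : V ≤ c.U), x ∈ V ∧
      P V hV (fa.Q.res (Cell.le_of_le hV) q)) → P c.U le_rfl q)
    (zero : ∀ V hV, P V hV 0)
    (add : ∀ V hV q q', P V hV q → P V hV q' → P V hV (q + q'))
    (mul : ∀ V hV (r : R.sec ⟨c.face, V⟩) (b : (fa.Q.sec ⟨c.face, V⟩).zero),
      P V hV (ap fa.i _ r * b.1)) (q : fa.Q.sec c) : P c.U le_rfl q := by
  refine loc q fun x hx => ?_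
  obtain ⟨V, hV, hxV, m, r, b, h⟩ := fa.tensor_surj c q x hx
  refine ⟨V, hV, hxV, ?_⟩
  rw [h]
  exact Finset.sum_induction _ (P V hV) (add V hV) (zero V hV) fun l _ => mul V hV _ _

end FreeAnalytic

end

/-! ### Partial derivatives, Euler operator and averages on Q -/

section

variable {W : SimplicialSystem.{u}}

namespace FreeAnalytic

open DGPresheaf Slice CDGA

variable {R S : DGPresheaf W} {HR : HolStructure R} {j : R ⟶ S} (fa : FreeAnalytic HR j) {μ : S ⟶ R}
  (hR : HR.IsComplexAnalytic)

/-- Natural linear maps on `Q` that agree on products of sections of `R` and of `Q⁰` agree. -/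
theorem linear_ext {c : Cell W}
    (f f' : ∀ V : Opens (W.pt c.face), fa.Q.sec ⟨c.face, V⟩ →ₗ[ℂ] fa.Q.sec ⟨c.face, V⟩)
    (nat : ∀ (V : Opens (W.pt c.face)) (hV : V ≤ c.U) (q : fa.Q.sec c),
      fa.Q.res (Cell.le_of_le hV) (f c.U q) = f V (fa.Q.res (Cell.le_of_le hV) q))
    (nat' : ∀ (V : Opens (W.pt c.face)) (hV : V ≤ c.U) (q : fa.Q.sec c),
      fa.Q.res (Cell.le_of_le hV) (f' c.U q) = f' V (fa.Q.res (Cell.le_of_le hV) q))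
    (h : ∀ V (r : R.sec ⟨c.face, V⟩) (b : (fa.Q.sec ⟨c.face, V⟩).zero),
      f V (ap fa.i _ r * b.1) = f' V (ap fa.i _ r * b.1)) (q : fa.Q.sec c) : f c.U q = f' c.U q :=
  fa.tensor_induction (fun V _ q => f V q = f' V q)
    (fun q hq => fa.isSheaf.ext fun x hx => by
      obtain ⟨V, hV, hxV, hp⟩ := hq x hx
      exact ⟨V, hV, hxV, (nat V hV q).trans (hp.trans (nat' V hV q).symm)⟩)
    (fun V _ => by rw [map_zero, map_zero])
    (fun V _ q q' hq hq' => by rw [map_add, map_add, hq, hq'])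
    (fun V _ r b => h V r b) q

/-- Locally a section is ∑ r b with b of degree 0, so its component of degree n only involves the
components of degree n of the r. -/
theorem Q_nonpos (R_nonpos : R.IsNonpos) : fa.Q.IsNonpos := fun c n hn => by
  rw [eq_bot_iff]
  intro q hq
  have := fa.linear_ext (c := c) (fun V => (fa.Q.sec ⟨c.face, V⟩).proj n) (fun _ => 0)
    (fun V hV q => res_proj _ _ _) (fun V hV q => map_zero _) (fun V r b => by
      have h1 : (R.sec ⟨c.face, V⟩).proj n r = 0 := by
        have := proj_mem n r
        rwa [R_nonpos _ n hn] at this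
      rw [proj_mul_of_mem_zero _ _ b.2]
      have h2 := (apG fa.i ⟨c.face, V⟩).map_proj n r
      rw [h1, map_zero] at h2
      exact (congrArg (· * b.1) h2.symm).trans (zero_mul _)) q
  rw [Submodule.mem_bot, ← proj_of_mem hq]
  exact this

theorem opQ_mul_zero {c : Cell W} (Θ : Op (fa.Idx c.face)) (r : R.sec c) (b : (fa.Q.sec c).zero) :
    fa.opQ μ hR c Θ (ap fa.i c r * b.1) = ap fa.i c r * (fa.op0 μ hR c Θ b).1 := by
  rw [opQ_mul, opQ_zero]

theorem zero_mul_i {c : Cell W} (r : R.sec c) (b : (fa.Q.sec c).zero) (q : fa.Q.sec c) :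
    b.1 * (ap fa.i c r * q) = ap fa.i c r * (b.1 * q) := by
  rw [← mul_assoc, mul_comm_of_mem_zero b.2, mul_assoc]

theorem opQ_pd_zero_mul {c : Cell W} (n : fa.Idx c.face) (b : (fa.Q.sec c).zero) (q : fa.Q.sec c) :
    fa.opQ μ hR c (pdOp n) (b.1 * q) =
      (fa.op0 μ hR c (pdOp n) b).1 * q + b.1 * fa.opQ μ hR c (pdOp n) q := by
  refine fa.tensor_induction (c := c) (fun V hV q => ∀ b : (fa.Q.sec ⟨c.face, V⟩).zero,
    fa.opQ μ hR ⟨c.face, V⟩ (pdOp n) (b.1 * q) =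
      (fa.op0 μ hR ⟨c.face, V⟩ (pdOp n) b).1 * q + b.1 * fa.opQ μ hR ⟨c.face, V⟩ (pdOp n) q)
    (fun q hq b => fa.isSheaf.ext fun x hx => ?_) (fun V _ b => by simp)
    (fun V _ q q' hq hq' b => by rw [mul_add, map_add, hq, hq', map_add]; noncomm_ring)
    (fun V _ r b' b => ?_) q b
  · obtain ⟨V, hV, hxV, hp⟩ := hq x hx
    refine ⟨V, hV, hxV, (fa.res_opQ hR (pdOp n) hV _).trans ?_⟩
    have h1 := hp (fa.Q.res0 (Cell.le_of_le hV) b)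
    have h2 := congrArg Subtype.val (fa.res0_op0 (μ := μ) hR (pdOp n) hV b)
    have h3 := fa.res_opQ (μ := μ) hR (pdOp n) hV q
    rw [coe_res0] at h2
    refine (congrArg _ (map_mul _ _ _)).trans (h1.trans ?_)
    refine Eq.trans ?_ (((map_add _ _ _).trans (congrArg₂ _ (map_mul _ _ _) (map_mul _ _ _)))).symm
    rw [h2, h3]
    rfl
  · rw [zero_mul_i, fa.opQ_mul (c := ⟨c.face, V⟩) hR, fa.opQ_mul (c := ⟨c.face, V⟩) hR]
    have h1 := fa.opQ_zero (c := ⟨c.face, V⟩) (μ := μ) hR (pdOp n) (b * b')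
    have h2 := fa.op0_pd_mul (μ := μ) hR ⟨c.face, V⟩ n b b'
    rw [h2] at h1
    rw [fa.opQ_zero (c := ⟨c.face, V⟩) hR (pdOp n), zero_mul_i, zero_mul_i, ← mul_add]
    exact congrArg _ h1

/-- Writing the first factor locally as ∑ r b reduces the rule by R-linearity to a factor b of
degree 0; writing the second factor in the same way then reduces it to the Leibniz rule on Q⁰. -/
theorem opQ_pd_mul {c : Cell W} (n : fa.Idx c.face) (q q' : fa.Q.sec c) :
    fa.opQ μ hR c (pdOp n) (q * q') =
      fa.opQ μ hR c (pdOp n) q * q' + q * fa.opQ μ hR c (pdOp n) q' := by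
  refine fa.tensor_induction (c := c) (fun V hV q => ∀ q' : fa.Q.sec ⟨c.face, V⟩,
    fa.opQ μ hR ⟨c.face, V⟩ (pdOp n) (q * q') =
      fa.opQ μ hR ⟨c.face, V⟩ (pdOp n) q * q' + q * fa.opQ μ hR ⟨c.face, V⟩ (pdOp n) q')
    (fun q hq b => fa.isSheaf.ext fun x hx => ?_) (fun V _ b => by simp)
    (fun V _ q q' hq hq' b => by rw [add_mul, map_add, hq, hq', map_add]; noncomm_ring)
    (fun V _ r b q => ?_) q q'
  · obtain ⟨V, hV, hxV, hp⟩ := hq x hx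
    refine ⟨V, hV, hxV, (fa.res_opQ hR (pdOp n) hV _).trans ?_⟩
    have h2 := fa.res_opQ (μ := μ) hR (pdOp n) hV b
    have h3 := fa.res_opQ (μ := μ) hR (pdOp n) hV q
    refine (congrArg _ (map_mul _ _ _)).trans ((hp (fa.Q.res (Cell.le_of_le hV) b)).trans ?_)
    refine Eq.trans ?_ (((map_add _ _ _).trans (congrArg₂ _ (map_mul _ _ _) (map_mul _ _ _)))).symm
    rw [h2, h3]
  · rw [mul_assoc, fa.opQ_mul (c := ⟨c.face, V⟩) hR, fa.opQ_mul (c := ⟨c.face, V⟩) hR,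
      fa.opQ_pd_zero_mul (c := ⟨c.face, V⟩) hR, fa.opQ_zero (c := ⟨c.face, V⟩) hR, mul_add,
      mul_assoc, mul_assoc]

/-- The partial derivatives as derivations of `Q`. -/
def pdQ (μ : S ⟶ R) (c : Cell W) (n : fa.Idx c.face) : GrDer (GrHom.id (fa.Q.sec c)) 0 where
  lin := fa.opQ μ hR c (pdOp n)
  map_deg h := by simpa using fa.opQ_mem hR (pdOp n) h
  leibniz a b := by
    rw [opQ_pd_mul, sgn_zero]
    rfl

theorem pdQ_i (c : Cell W) (n : fa.Idx c.face) (r : R.sec c) :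
    (fa.pdQ hR μ c n).lin (ap fa.i c r) = 0 := by
  have := fa.opQ_mul_zero (μ := μ) hR (pdOp n) r 1
  have h1 := fa.op0_pd_hol_const (μ := μ) hR c n 1
  rw [map_one] at h1
  rw [h1] at this
  simpa using! this

/-- The differential kills Q⁰, because there is nothing in degree 1, and hence acts only on the
factor from R, while the partial derivative acts only on the factor from Q⁰. -/
theorem pdQ_d (R_nonpos : R.IsNonpos) (c : Cell W) (n : fa.Idx c.face) (q : fa.Q.sec c) :
    (fa.pdQ hR μ c n).lin ((fa.Q.sec c).d q) = (fa.Q.sec c).d ((fa.pdQ hR μ c n).lin q) := by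
  have hd : ∀ (V : Opens (W.pt c.face)) (r : R.sec ⟨c.face, V⟩) (b : (fa.Q.sec ⟨c.face, V⟩).zero),
      (fa.Q.sec ⟨c.face, V⟩).d (ap fa.i _ r * b.1) =
        ap fa.i _ ((R.sec ⟨c.face, V⟩).d r) * b.1 := fun V r b => by
    have h1 : (fa.Q.sec ⟨c.face, V⟩).d b.1 = 0 := by
      have h2 := (fa.Q.sec ⟨c.face, V⟩).d_mem b.2
      rwa [fa.Q_nonpos R_nonpos _ _ (by norm_num)] at h2
    have h3 := (dDer (fa.Q.sec ⟨c.face, V⟩)).leibniz (ap fa.i _ r) b.1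
    refine h3.trans ?_
    rw [ap_d]
    change _ + _ * (fa.Q.sec ⟨c.face, V⟩).d b.1 = _
    rw [h1, mul_zero, add_zero]
    rfl
  refine fa.linear_ext (c := c)
    (fun V => fa.opQ μ hR ⟨c.face, V⟩ (pdOp n) ∘ₗ (fa.Q.sec ⟨c.face, V⟩).d)
    (fun V => (fa.Q.sec ⟨c.face, V⟩).d ∘ₗ fa.opQ μ hR ⟨c.face, V⟩ (pdOp n))
    (fun V hV q => ?_) (fun V hV q => ?_) (fun V r b => ?_) q
  · exact (fa.res_opQ hR (pdOp n) hV _).trans (congrArg _ (res_d _ _))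
  · exact (res_d _ _).trans (congrArg _ (fa.res_opQ hR (pdOp n) hV _))
  · change fa.opQ μ hR ⟨c.face, V⟩ (pdOp n) _ = (fa.Q.sec ⟨c.face, V⟩).d _
    rw [hd, fa.opQ_mul_zero (c := ⟨c.face, V⟩) hR]
    exact (congrArg _ (fa.opQ_mul_zero (c := ⟨c.face, V⟩) hR (pdOp n) r b)).trans (hd V r _) |>.symm

open Classical in
theorem pdQ_coord (c : Cell W) (n m : fa.Idx c.face) :
    (fa.pdQ hR μ c n).lin (fa.coord μ c m) = if n = m then 1 else 0 := by
  refine (fa.opQ_zero (μ := μ) hR (pdOp n) (fa.coord μ c m)).trans ?_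
  rw [fa.op0_pd_coord hR]
  split_ifs <;> rfl

-- The case of degree 0 extends because restrictions respect local expressions ∑ r b. Neighbourhoods
-- in the larger simplex are obtained as preimages under the transition map.
open Classical in
theorem pdQ_res {c' c : Cell W} (h : c' ≤ c) (n' : fa.Idx c'.face) (q : fa.Q.sec c) :
    (fa.pdQ hR μ c' n').lin (fa.Q.res h q) =
      if hn : fa.gens0.face n'.1 ≤ c.face then fa.Q.res h ((fa.pdQ hR μ c ⟨n'.1, hn⟩).lin q)
      else 0 := by
  revert c' h n'
  refine fa.tensor_induction (c := c) (fun V _ q => ∀ {c' : Cell W} (h : c' ≤ ⟨c.face, V⟩)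
    (n' : fa.Idx c'.face), (fa.pdQ hR μ c' n').lin (fa.Q.res h q) =
      if hn : fa.gens0.face n'.1 ≤ c.face then
        fa.Q.res h ((fa.pdQ hR μ ⟨c.face, V⟩ ⟨n'.1, hn⟩).lin q) else 0)
    (fun q hq {c'} h n' => fa.isSheaf.ext fun x hx => ?_) (fun V _ c' h n' => by simp)
    (fun V _ q q' hq hq' c' h n' => by
      rw [map_add, map_add, hq, hq']
      split_ifs
      · rw [map_add, map_add]
      · rw [add_zero])
    (fun V _ r b c' h n' => ?_) q
  · obtain ⟨V, hV, hxV, hp⟩ := hq _ (h.snd x hx)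
    let V' : Opens (W.pt c'.face) := ⟨SimplicialSystem.trans h.fst ⁻¹' V,
      V.2.preimage (Cell.trans_continuous h.fst)⟩ ⊓ c'.U
    have hV' : V' ≤ c'.U := inf_le_right
    have hr : (⟨c'.face, V'⟩ : Cell W) ≤ ⟨c.face, V⟩ := ⟨h.fst, fun y hy => hy.1⟩
    refine ⟨V', hV', ⟨hxV, hx⟩, (fa.res_opQ hR (pdOp n') hV' _).trans ?_⟩
    have h1 := hp hr n'
    rw [res_res] at h1 ⊢
    refine h1.trans ?_
    split_ifs with hn
    · change _ = fa.Q.res (Cell.le_of_le hV') (fa.Q.res h _)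
      rw [res_res]
      have h2 := fa.res_opQ (μ := μ) hR (c := c) (pdOp ⟨n'.1, hn⟩) hV q
      refine (congrArg (fa.Q.res hr) h2.symm).trans ?_
      rw [res_res]
      rfl
    · exact (map_zero _).symm
  · rw [map_mul, res_ap]
    refine (fa.opQ_mul_zero (μ := μ) hR (pdOp n') _ (fa.Q.res0 h b)).trans ?_
    rw [fa.res0_op0_pd hR h n' b]
    split_ifs with hn
    · refine Eq.trans ?_ (congrArg (fa.Q.res h)
        (fa.opQ_mul_zero (c := ⟨c.face, V⟩) (μ := μ) hR (pdOp ⟨n'.1, hn⟩) r b)).symm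
      rw [map_mul, res_ap]
      rfl
    · exact mul_zero _

variable (μ) in
/-- The Euler operator. -/
def eulerQ (c : Cell W) : fa.Q.sec c →ₗ[ℂ] fa.Q.sec c :=
  ∑ n, LinearMap.mulLeft ℂ (fa.coord μ c n).1 ∘ₗ (fa.pdQ hR μ c n).lin

theorem eulerQ_apply (c : Cell W) (q : fa.Q.sec c) :
    fa.eulerQ μ hR c q = ∑ n, (fa.coord μ c n).1 * (fa.pdQ hR μ c n).lin q := by
  simp [eulerQ]

theorem res_eulerQ {c : Cell W} {V : Opens (W.pt c.face)} (hV : V ≤ c.U) (q : fa.Q.sec c) :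
    fa.Q.res (Cell.le_of_le hV) (fa.eulerQ μ hR c q) =
      fa.eulerQ μ hR ⟨c.face, V⟩ (fa.Q.res (Cell.le_of_le hV) q) := by
  rw [eulerQ_apply, eulerQ_apply, map_sum]
  refine Finset.sum_congr rfl fun n _ => ?_
  rw [map_mul]
  exact congrArg₂ _ (congrArg Subtype.val (fa.res0_coord μ (Cell.le_of_le hV) n))
    (fa.res_opQ hR (pdOp n) hV q)

theorem eulerQ_mul_zero {c : Cell W} (r : R.sec c) (b : (fa.Q.sec c).zero) :
    fa.eulerQ μ hR c (ap fa.i c r * b.1) = ap fa.i c r * (fa.euler0 μ hR c b).1 := by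
  rw [eulerQ_apply, euler0_apply, AddSubmonoidClass.coe_finsetSum, Finset.mul_sum]
  refine Finset.sum_congr rfl fun n _ => ?_
  refine (congrArg _ (fa.opQ_mul_zero hR (pdOp n) r b)).trans ?_
  exact fa.zero_mul_i _ _ _

variable (μ) in
/-- The inverse of `E + (k + 1)`. -/
def rayQ (c : Cell W) (k : ℕ) : fa.Q.sec c →ₗ[ℂ] fa.Q.sec c := fa.opQ μ hR c (rayOp _ k)

theorem rayQ_mem (c : Cell W) (k : ℕ) {n : ℤ} {q : fa.Q.sec c} (hq : q ∈ (fa.Q.sec c).deg n) :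
    fa.rayQ μ hR c k q ∈ (fa.Q.sec c).deg n := fa.opQ_mem hR _ hq

theorem rayQ_euler (c : Cell W) (k : ℕ) (q : fa.Q.sec c) :
    fa.rayQ μ hR c k (fa.eulerQ μ hR c q + ((k : ℂ) + 1) • q) = q := by
  refine fa.linear_ext (c := c)
    (fun V => fa.rayQ μ hR ⟨c.face, V⟩ k ∘ₗ
      (fa.eulerQ μ hR ⟨c.face, V⟩ + ((k : ℂ) + 1) • LinearMap.id))
    (fun V => LinearMap.id) (fun V hV q => ?_) (fun V hV q => rfl) (fun V r b => ?_) q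
  · refine (fa.res_opQ hR (rayOp _ k) hV _).trans (congrArg _ ?_)
    change fa.Q.res (Cell.le_of_le hV) (fa.eulerQ μ hR c q + ((k : ℂ) + 1) • q) = _
    rw [map_add, map_smul, res_eulerQ _ _ hV]
    rfl
  · have h1 := fa.op0_ray_euler (μ := μ) hR ⟨c.face, V⟩ k b
    have h2 := fa.opQ_mul_zero (c := ⟨c.face, V⟩) (μ := μ) hR (rayOp _ k) r
      (fa.euler0 μ hR ⟨c.face, V⟩ b + ((k : ℂ) + 1) • b)
    rw [h1] at h2
    refine Eq.trans (congrArg (fa.opQ μ hR ⟨c.face, V⟩ (rayOp _ k)) ?_) h2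
    change fa.eulerQ μ hR ⟨c.face, V⟩ _ + ((k : ℂ) + 1) • _ = _ * (_ + ((k : ℂ) + 1) • b.1)
    rw [eulerQ_mul_zero, mul_add, mul_smul_comm]
    rfl

theorem euler_rayQ (c : Cell W) (k : ℕ) (q : fa.Q.sec c) :
    fa.eulerQ μ hR c (fa.rayQ μ hR c k q) + ((k : ℂ) + 1) • fa.rayQ μ hR c k q = q := by
  refine fa.linear_ext (c := c)
    (fun V => (fa.eulerQ μ hR ⟨c.face, V⟩ + ((k : ℂ) + 1) • LinearMap.id) ∘ₗ
      fa.rayQ μ hR ⟨c.face, V⟩ k)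
    (fun V => LinearMap.id) (fun V hV q => ?_) (fun V hV q => rfl) (fun V r b => ?_) q
  · have h1 := fa.res_opQ (μ := μ) hR (rayOp _ k) hV q
    change fa.Q.res (Cell.le_of_le hV) (fa.eulerQ μ hR c _ + ((k : ℂ) + 1) • _) = _
    rw [map_add, map_smul, res_eulerQ _ _ hV]
    exact congrArg (fun z => fa.eulerQ μ hR ⟨c.face, V⟩ z + ((k : ℂ) + 1) • z) h1
  · have h1 := fa.euler_op0_ray (μ := μ) hR ⟨c.face, V⟩ k b
    have h2 := fa.opQ_mul_zero (c := ⟨c.face, V⟩) (μ := μ) hR (rayOp _ k) r b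
    change fa.eulerQ μ hR ⟨c.face, V⟩ (fa.opQ μ hR _ _ _) + ((k : ℂ) + 1) • fa.opQ μ hR _ _ _ = _
    rw [h2, eulerQ_mul_zero, ← mul_smul_comm, ← mul_add]
    exact congrArg (fun z : (fa.Q.sec ⟨c.face, V⟩).zero => ap fa.i _ r * z.1) h1

/-- The Euler operator lowers to the one on Q⁰ on products of R and Q⁰, and the identity follows
there from [∂ₙ, E] = ∂ₙ on functions. -/
theorem pdQ_euler (c : Cell W) (n : fa.Idx c.face) (q : fa.Q.sec c) :
    (fa.pdQ hR μ c n).lin (fa.eulerQ μ hR c q) =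
      fa.eulerQ μ hR c ((fa.pdQ hR μ c n).lin q) + (fa.pdQ hR μ c n).lin q := by
  refine fa.linear_ext (c := c)
    (fun V => fa.opQ μ hR ⟨c.face, V⟩ (pdOp n) ∘ₗ fa.eulerQ μ hR ⟨c.face, V⟩)
    (fun V => fa.eulerQ μ hR ⟨c.face, V⟩ ∘ₗ fa.opQ μ hR ⟨c.face, V⟩ (pdOp n) +
      fa.opQ μ hR ⟨c.face, V⟩ (pdOp n)) (fun V hV q => ?_) (fun V hV q => ?_) (fun V r b => ?_) q
  · exact (fa.res_opQ hR (pdOp n) hV _).trans (congrArg _ (fa.res_eulerQ hR hV q))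
  · have h1 := fa.res_opQ (μ := μ) hR (pdOp n) hV q
    change fa.Q.res (Cell.le_of_le hV) (fa.eulerQ μ hR c _ + _) = _
    rw [map_add, res_eulerQ _ _ hV]
    exact congrArg (fun z => fa.eulerQ μ hR ⟨c.face, V⟩ z + z) h1
  · have h2 := fun b => fa.opQ_mul_zero (c := ⟨c.face, V⟩) (μ := μ) hR (pdOp n) r b
    change fa.opQ μ hR _ _ (fa.eulerQ μ hR _ _) =
      fa.eulerQ μ hR ⟨c.face, V⟩ (fa.opQ μ hR _ _ _) + fa.opQ μ hR _ _ _
    rw [eulerQ_mul_zero, h2, h2, eulerQ_mul_zero, ← mul_add]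
    exact congrArg (fun z : (fa.Q.sec ⟨c.face, V⟩).zero => ap fa.i _ r * z.1)
      (fa.op0_pd_euler (μ := μ) hR ⟨c.face, V⟩ n b)

/-- Hadamard's lemma. -/
theorem eq_add_sum_ray_pdQ (j_μ : j ≫ μ = 𝟙 R) (c : Cell W) (q : fa.Q.sec c) :
    q = ap fa.i c (ap μ c (ap fa.k c q)) +
      ∑ n, (fa.coord μ c n).1 * fa.rayQ μ hR c 0 ((fa.pdQ hR μ c n).lin q) := by
  refine fa.linear_ext (c := c) (fun V => LinearMap.id)
    (fun V => (ap fa.i ⟨c.face, V⟩).toLinearMap ∘ₗ (ap μ ⟨c.face, V⟩).toLinearMap ∘ₗ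
      (ap fa.k ⟨c.face, V⟩).toLinearMap +
      ∑ n, LinearMap.mulLeft ℂ (fa.coord μ ⟨c.face, V⟩ n).1 ∘ₗ
        fa.rayQ μ hR ⟨c.face, V⟩ 0 ∘ₗ fa.opQ μ hR ⟨c.face, V⟩ (pdOp n)) (fun V hV q => rfl)
    (fun V hV q => ?_) (fun V r b => ?_) q |>.trans ?_
  · simp only [LinearMap.add_apply, LinearMap.comp_apply, AlgHom.toLinearMap_apply, map_add,
      LinearMap.sum_apply, map_sum, LinearMap.mulLeft_apply, map_mul, res_ap]
    refine congrArg _ (Finset.sum_congr rfl fun n _ => ?_)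
    refine congrArg₂ _ (congrArg Subtype.val (fa.res0_coord μ (Cell.le_of_le hV) n)) ?_
    exact (fa.res_opQ hR (rayOp _ 0) hV _).trans (congrArg _ (fa.res_opQ hR (pdOp n) hV q))
  · have h1 := congrArg Subtype.val (fa.eq_add_sum_op0 (μ := μ) hR j_μ ⟨c.face, V⟩ b)
    have h2 := fun Θ b => fa.opQ_mul_zero (c := ⟨c.face, V⟩) (μ := μ) hR Θ r b
    simp only [LinearMap.add_apply, LinearMap.comp_apply, AlgHom.toLinearMap_apply,
      LinearMap.sum_apply, LinearMap.mulLeft_apply, map_mul, fa.aug_i j_μ, LinearMap.id_apply, rayQ,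
      h2, zero_mul_i]
    rw [← Finset.mul_sum, ← mul_add]
    refine congrArg _ (h1.trans ?_)
    rw [AddMemClass.coe_add, AddSubmonoidClass.coe_finsetSum]
    rfl
  · simp only [LinearMap.add_apply, LinearMap.comp_apply, AlgHom.toLinearMap_apply,
      LinearMap.sum_apply, LinearMap.mulLeft_apply]
    rfl

end FreeAnalytic

end

/-! ### Derivations of Q of the form ∑ yₙ ∂ₙ -/

section

namespace CDGA

open CDGA.Mono

variable {A B : CDGA.{u}} {X : Type u} [LinearOrder X] {deg : X → ℤ} {φ : GrHom A B} {e : X → B}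

theorem IsFreeOn.adjoin_eq_top (h : IsFreeOn φ deg e) :
    Algebra.adjoin ℂ (Set.range φ.toAlgHom ∪ Set.range e) = ⊤ := by
  refine eq_top_iff.2 fun b _ => ?_
  refine homogeneous_induction (P := fun b => b ∈ Algebra.adjoin ℂ _) (Subalgebra.zero_mem _)
    (fun _ _ => Subalgebra.add_mem _) (fun i b hb => ?_) b
  refine h.degree_induction (P := fun b => b ∈ Algebra.adjoin ℂ _) (Subalgebra.zero_mem _)
    (fun _ _ => Subalgebra.add_mem _) (fun s i _ _ a _ => ?_) hb
  exact Subalgebra.mul_mem _ (Algebra.subset_adjoin (Or.inl ⟨a, rfl⟩))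
    (monoProd_mem_adjoin fun j _ => Or.inr ⟨j, rfl⟩)

end CDGA

variable {W : SimplicialSystem.{u}}

namespace FreeAnalytic

open DGPresheaf Slice CDGA

variable {R S : DGPresheaf W} {HR : HolStructure R} {j : R ⟶ S} (fa : FreeAnalytic HR j) {μ : S ⟶ R}
  (hR : HR.IsComplexAnalytic)

theorem d_zero (R_nonpos : R.IsNonpos) {c : Cell W} {b : fa.Q.sec c}
    (hb : b ∈ (fa.Q.sec c).deg 0) : (fa.Q.sec c).d b = 0 := by
  have h2 := (fa.Q.sec c).d_mem hb
  rwa [fa.Q_nonpos R_nonpos _ _ (by norm_num)] at h2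

variable (μ) in
/-- The derivation `q ↦ ∑ yₙ ∂ₙ q` over a cell. -/
def totalDerAt {Z : CDGA.{u}} {c : Cell W} (f : GrHom (fa.Q.sec c) Z) {m : ℤ}
    (y : fa.Idx c.face → Z) (hy : ∀ n, y n ∈ Z.deg m) : GrDer f m where
  lin := ∑ n : fa.Idx c.face, LinearMap.mulLeft ℂ (y n) ∘ₗ f.toAlgHom.toLinearMap ∘ₗ
    (fa.pdQ hR μ c n).lin
  map_deg {i a} ha := by
    rw [LinearMap.sum_apply, add_comm]
    refine Submodule.sum_mem _ fun n _ => Z.mul_mem (hy n) (f.map_deg ?_)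
    simpa using (fa.pdQ hR μ c n).map_deg ha
  leibniz a b := by
    simp only [LinearMap.sum_apply, LinearMap.comp_apply, AlgHom.toLinearMap_apply,
      LinearMap.mulLeft_apply, Finset.sum_mul, Finset.mul_sum, ← Finset.sum_add_distrib]
    refine Finset.sum_congr rfl fun n _ => ?_
    -- The partial derivatives have degree 0, so the Koszul sign comes entirely from moving yₙ, of
    -- degree m, past the first factor.
    rw [(fa.pdQ hR μ c n).leibniz, map_add, map_mul, map_mul, mul_add, sgn_zero,
      ← mul_assoc, ← mul_assoc, ← mul_assoc, f.map_sgn, ← mul_comm_sgn (hy n)]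
    rfl

theorem totalDerAt_lin {Z : CDGA.{u}} {c : Cell W} (f : GrHom (fa.Q.sec c) Z) {m : ℤ}
    (y : fa.Idx c.face → Z) (hy : ∀ n, y n ∈ Z.deg m) (q : fa.Q.sec c) :
    (fa.totalDerAt μ hR f y hy).lin q = ∑ n, y n * f.toAlgHom ((fa.pdQ hR μ c n).lin q) := by
  refine (LinearMap.sum_apply _ _ _).trans ?_
  rfl

section

variable {C : DGPresheaf W} (v : fa.Q ⟶ C) {m : ℤ} (y : fa.gens0.Sections C)
  (hy : ∀ n, y n ∈ (C.sec _).deg m)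

variable (μ) in
/-- The total derivative `q ↦ ∑ yₙ ∂ₙ q`. -/
def totalDer : Der v m :=
  Der.ofGrDer (fun c => fa.totalDerAt μ hR (apG v c)
      (fun n => C.res (Cell.le_whole n.2) (y n.1)) fun n => res_mem _ (hy n.1))
    (fun {c' c} h a => by
      classical
      simp only [totalDerAt_lin, apG_toAlgHom, map_sum, map_mul, res_res, res_ap, fa.pdQ_res hR h]
      -- The coordinates of the smaller simplex embed into those of the larger one. The remaining
      -- ones contribute nothing, since sections restricted from `c` do not depend on them.
      let emb : fa.Idx c.face → fa.Idx c'.face := fun n => ⟨n.1, n.2.trans h.fst⟩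
      have hemb : Function.Injective emb := fun n n' hn => Subtype.ext (congrArg (fun x => x.1) hn)
      refine Finset.sum_of_injOn emb (fun n _ n' _ hn => hemb hn) (fun n _ => Finset.mem_coe.2
        (Finset.mem_univ _)) (fun n' _ hn' => ?_) (fun n _ => ?_)
      · rw [dif_neg, map_zero, mul_zero]
        intro hn
        exact hn' ⟨⟨n'.1, hn⟩, Finset.mem_coe.2 (Finset.mem_univ _), rfl⟩
      · rw [dif_pos n.2])

theorem totalDer_app (c : Cell W) (q : fa.Q.sec c) : (fa.totalDer μ hR v y hy).app c q =
    ∑ n : fa.Idx c.face, C.res (Cell.le_whole n.2) (y n.1) *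
      ap v c ((fa.pdQ hR μ c n).lin q) :=
  fa.totalDerAt_lin hR (apG v c) _ (fun n => res_mem _ (hy n.1)) q

theorem totalDer_i (c : Cell W) (r : R.sec c) :
    (fa.totalDer μ hR v y hy).app c (ap fa.i c r) = 0 := by
  rw [totalDer_app]
  refine Finset.sum_eq_zero fun n _ => ?_
  rw [pdQ_i, map_zero, mul_zero]

theorem totalDer_coord (c : Cell W) (n : fa.Idx c.face) :
    (fa.totalDer μ hR v y hy).app c (fa.coord μ c n) = C.res (Cell.le_whole n.2) (y n.1) := by
  classical
  rw [totalDer_app, Finset.sum_eq_single n]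
  · rw [pdQ_coord, if_pos rfl, map_one, mul_one]
  · intro m _ hm
    rw [pdQ_coord, if_neg hm, map_zero, mul_zero]
  · simp

theorem totalDer_t (n : fa.gens0.idx) :
    (fa.totalDer μ hR v y hy).app _ (fa.t n).1 = y n := by
  have h1 := congrArg Subtype.val
    (fa.coord_eq μ (Cell.whole (fa.gens0.face n)) ⟨n, le_refl (fa.gens0.face n)⟩)
  have h2 := fa.totalDer_coord (μ := μ) hR v y hy (Cell.whole (fa.gens0.face n))
    ⟨n, le_refl (fa.gens0.face n)⟩
  rw [h1, AddSubgroupClass.coe_sub, map_sub, coe_ap0, totalDer_i, sub_zero, coe_res0] at h2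
  rwa [res_self, res_self] at h2

end

end FreeAnalytic

end

/-! ### Derivations of S over R, and the algebra of differential forms -/

section

variable {W : SimplicialSystem.{u}}

theorem CDGA.GrDer.bracket_neg_one {A B : CDGA.{u}} {f : GrHom A B} (D : GrDer f (-1))
    (d : GrDer (GrHom.id A) 1) (d' : GrDer (GrHom.id B) 1)
    (h : ∀ a, d'.lin (f.toAlgHom a) = f.toAlgHom (d.lin a)) (a : A) :
    (D.bracket d d' h).lin a = d'.lin (D.lin a) + D.lin (d.lin a) := by
  rw [GrDer.bracket_lin, Int.negOnePow_odd _ (by decide), Units.neg_smul, one_smul, sub_neg_eq_add]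

namespace Gens.Boundary

open DGPresheaf CDGA Gens

variable {A : DGPresheaf W} {G : Gens W} {y : Boundary A G} (h : y.IsClosed) {n : ℤ}

/-- A derivation along the inclusion of the coefficients, without the differential. -/
def ofDer (D : Der (inclusion h) n) (c : Cell W) : GrDer (freeIncl (A.sec c) (G.degAt c)) n where
  lin := (D.grDer c).lin
  map_deg := (D.grDer c).map_deg
  leibniz := (D.grDer c).leibniz

theorem ofDer_natural (D : Der (inclusion h) n) {c' c : Cell W} (hc : c' ≤ c) (a : A.sec c) :
    (freeRes A G hc).toAlgHom ((ofDer h D c).lin a) = (ofDer h D c').lin (A.res hc a) :=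
  D.natural hc a

/-- A derivation along the inclusion of the coefficients, given without the differential. -/
def toDer (D : ∀ c, GrDer (freeIncl (A.sec c) (G.degAt c)) n)
    (hD : ∀ {c' c : Cell W} (hc : c' ≤ c) (a : A.sec c),
      (freeRes A G hc).toAlgHom ((D c).lin a) = (D c').lin (A.res hc a)) : Der (inclusion h) n :=
  Der.ofGrDer (fun c => ⟨(D c).lin, (D c).map_deg, (D c).leibniz⟩) hD

end Gens.Boundary

namespace FreeAnalytic

open DGPresheaf Slice CDGA Gens

variable {R S : DGPresheaf W} {HR : HolStructure R} {j : R ⟶ S} (fa : FreeAnalytic HR j) {μ : S ⟶ R}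
  (hR : HR.IsComplexAnalytic)

theorem S_adjoin (c : Cell W) :
    Algebra.adjoin ℂ (Set.range (ap fa.k c) ∪ Set.range (fa.G.resTo fa.f c)) = ⊤ := by
  refine eq_top_iff.2 ((fa.free.on c).adjoin_eq_top.symm.le.trans (Algebra.adjoin_mono ?_))
  refine Set.union_subset_union_right _ ?_
  rintro _ ⟨n, rfl⟩
  exact ⟨⟨n.1.1, n.2⟩, rfl⟩

include hR in
/-- The derivation of `S` over `R` with given values on the generators. -/
theorem exists_der (μ : S ⟶ R) {C : DGPresheaf W} (v : S ⟶ C) {m : ℤ} (y : fa.G.Sections C)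
    (hy : ∀ n, y n ∈ (C.sec _).deg (fa.G.deg n + m)) :
    ∃ D : Der v m, (∀ n, D.app _ (fa.f n) = y n) ∧ (∀ c r, D.app c (ap j c r) = 0) ∧
      ∀ c q, D.app c (ap fa.k c q) = ∑ n : fa.Idx c.face,
        C.res (Cell.le_whole n.2) (y n.1.1) * ap v c (ap fa.k c ((fa.pdQ hR μ c n).lin q)) := by
  have hy0 : ∀ n : fa.gens0.idx, y n.1 ∈ (C.sec (Cell.whole (fa.gens0.face n))).deg m := fun n => by
    have h := hy n.1
    rwa [n.2, zero_add] at h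
  obtain ⟨D, h1, h2⟩ := fa.free.exists_der v
    (fa.totalDer μ hR (fa.k ≫ v) (fun n => y n.1) hy0) (fun n => y n.1) fun n => hy n.1
  refine ⟨D, fun n => ?_, fun c r => ?_, fun c q => ?_⟩
  · rcases (fa.deg_nonpos n).lt_or_eq with hn | hn
    · exact h2 ⟨n, hn⟩
    · rw [← fa.k_t ⟨n, hn⟩]
      exact (h1 _ _).trans (fa.totalDer_t hR (fa.k ≫ v) (fun n => y n.1) hy0 ⟨n, hn⟩)
  · rw [← fa.i_k, ap_comp, h1]
    exact fa.totalDer_i hR (fa.k ≫ v) (fun n => y n.1) hy0 c r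
  · rw [h1]
    exact fa.totalDer_app hR (fa.k ≫ v) (fun n => y n.1) hy0 c q

/-- The span is stable under multiplication by S on both sides, by graded commutativity on the
right. By the Leibniz rule it therefore contains all values of D once it contains those on algebra
generators, namely on Q and on the f. -/
theorem der_mem_span {Ω : DGPresheaf W} {ω : S ⟶ Ω} {m : ℤ} (D : Der ω m)
    (hD : ∀ c q, D.app c (ap fa.k c q) ∈ Submodule.span ℂ
      {y : Ω.sec c | ∃ (b : S.sec c) (n : fa.G.At c),
        y = ap ω c b * D.app c (fa.G.resTo fa.f c n)})
    (hf : ∀ n, fa.f n ∈ (S.sec _).deg (fa.G.deg n)) (c : Cell W) (s : S.sec c) :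
    D.app c s ∈ Submodule.span ℂ {y : Ω.sec c | ∃ (b : S.sec c) (n : fa.G.At c),
      y = ap ω c b * D.app c (fa.G.resTo fa.f c n)} := by
  set N := Submodule.span ℂ {y : Ω.sec c | ∃ (b : S.sec c) (n : fa.G.At c),
    y = ap ω c b * D.app c (fa.G.resTo fa.f c n)} with hN
  have hl : ∀ (b : S.sec c), ∀ x ∈ N, ap ω c b * x ∈ N := fun b x hx => by
    induction hx using Submodule.span_induction with
    | mem x hx =>
      obtain ⟨b', n, rfl⟩ := hx
      rw [← mul_assoc, ← map_mul]
      exact Submodule.subset_span ⟨_, n, rfl⟩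
    | zero => rw [mul_zero]; exact N.zero_mem
    | add x y _ _ hx hy => rw [mul_add]; exact N.add_mem hx hy
    | smul r x _ hx => rw [mul_smul_comm]; exact N.smul_mem r hx
  have hr : ∀ (b : S.sec c), ∀ x ∈ N, x * ap ω c b ∈ N := fun b x hx => by
    induction hx using Submodule.span_induction with
    | mem x hx =>
      obtain ⟨b', n, rfl⟩ := hx
      have h1 := mul_comm_sgn (D.app_deg c (resTo_mem hf c n)) (ap ω c b)
      have h2 := (apG ω c).map_sgn (fa.G.degAt c n + m) b
      rw [mul_assoc, h1]
      refine Submodule.subset_span ⟨b' * (S.sec c).sgn (fa.G.degAt c n + m) b, n, ?_⟩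
      rw [map_mul, mul_assoc]
      exact congrArg _ (congrArg (· * _) h2.symm)
    | zero => rw [zero_mul]; exact N.zero_mem
    | add x y _ _ hx hy => rw [add_mul]; exact N.add_mem hx hy
    | smul r x _ hx => rw [smul_mul_assoc]; exact N.smul_mem r hx
  have hs : s ∈ Algebra.adjoin ℂ (Set.range (ap fa.k c) ∪ Set.range (fa.G.resTo fa.f c)) := by
    rw [S_adjoin]
    trivial
  induction hs using Algebra.adjoin_induction with
  | mem x hx =>
    rcases hx with ⟨q, rfl⟩ | ⟨n, rfl⟩
    · exact hD c q
    · exact Submodule.subset_span ⟨1, n, by rw [map_one, one_mul]⟩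
  | algebraMap r =>
    have : D.app c (algebraMap ℂ _ r) = 0 := by
      rw [Algebra.algebraMap_eq_smul_one, map_smul]
      exact (congrArg _ (D.grDer c).map_one).trans (smul_zero _)
    rw [this]
    exact N.zero_mem
  | add x y _ _ hx hy => rw [map_add]; exact N.add_mem hx hy
  | mul x y _ _ hx hy =>
    have := (D.grDer c).leibniz x y
    rw [Der.grDer_lin] at this
    rw [this]
    exact N.add_mem (hr _ _ hx) (hl _ _ hy)

theorem f_mem (n : fa.G.idx) : fa.f n ∈ (S.sec _).deg (fa.G.deg n) := by
  rcases (fa.deg_nonpos n).lt_or_eq with hn | hn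
  · exact fa.free.1 ⟨n, hn⟩
  · rw [← fa.k_t ⟨n, hn⟩, hn]
    exact ap_mem _ _ (fa.t ⟨n, hn⟩).2

theorem d_f_zero (R_nonpos : R.IsNonpos) (n : fa.gens0.idx) : (S.sec _).d (fa.f n.1) = 0 := by
  rw [← fa.k_t n]
  exact (ap_d fa.k _ _).symm.trans
    ((congrArg _ (fa.d_zero R_nonpos (fa.t n).2)).trans (map_zero _))

include hR in
/-- The algebra of differential forms exists. -/
theorem exists_differentialAlgebra (μ : S ⟶ R) (R_nonpos : R.IsNonpos) :
    ∃ (Ω : DGPresheaf W) (ω : S ⟶ Ω) (D : Der ω (-1)), fa.IsDifferentialAlgebra ω D := by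
  -- The differential of T df is to be -T d(∂f), which presupposes the derivation. So the derivation
  -- is first constructed into the free algebra with zero differential on the generators T df, then
  -- freed from that differential, and only then used to define the right one.
  let y₀ : Boundary S fa.G.shift := ⟨fun _ => 0, fun _ => Submodule.zero_mem _⟩
  have h₀ : y₀.IsClosed := fun _ => map_zero _
  obtain ⟨D₁, D₁f, D₁j, D₁k⟩ := fa.exists_der hR μ (Boundary.inclusion h₀) (m := -1)
    (Boundary.gens h₀) (Boundary.isFree h₀).1
  let D₀ := Boundary.ofDer h₀ D₁
  let y : Boundary S fa.G.shift := ⟨fun n => -(D₀ _).lin ((S.sec _).d (fa.f n)), fun n => by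
    have h := (D₀ _).map_deg ((S.sec _).d_mem (fa.f_mem n))
    rw [show fa.G.deg n + 1 + -1 = fa.G.deg n - 1 + 1 by ring] at h
    exact Submodule.neg_mem _ h⟩
  have y0 : ∀ n : fa.gens0.idx, y.val n.1 = 0 := fun n =>
    (congrArg (fun x => -(D₀ _).lin x) (fa.d_f_zero R_nonpos n)).trans
      ((congrArg Neg.neg (map_zero (D₀ _).lin)).trans neg_zero)
  have D₀f : ∀ c n, (D₀ c).lin (fa.G.resTo fa.f c n) = freeGen _ (fa.G.shift.degAt c) n := by
    intro c n
    refine (Boundary.ofDer_natural h₀ D₁ (Cell.le_whole n.2) (fa.f n.1)).symm.trans ?_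
    refine (congrArg _ (D₁f n.1)).trans ?_
    exact freeRes_gen (A := S) (G := fa.G.shift) (Cell.le_whole n.2) (fa.G.shift.self n.1)
  have dgen : ∀ c n, (y.der c).lin (freeGen _ (fa.G.shift.degAt c) n) =
      -(D₀ c).lin ((S.sec c).d (fa.G.resTo fa.f c n)) := fun c n => by
    rw [y.der_gen]
    refine (map_neg _ _).trans (congrArg _ ?_)
    refine (Boundary.ofDer_natural h₀ D₁ (Cell.le_whole n.2) ((S.sec _).d (fa.f n.1))).trans ?_
    exact congrArg (D₀ c).lin (res_d (F := S) (Cell.le_whole n.2) (fa.f n.1))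
  have D₀k : ∀ c q, (D₀ c).lin (ap fa.k c q) = ∑ n : fa.Idx c.face,
      freeGen _ (fa.G.shift.degAt c) ⟨n.1.1, n.2⟩ *
        (freeIncl (S.sec c) (fa.G.shift.degAt c)).toAlgHom
          (ap fa.k c ((fa.pdQ hR μ c n).lin q)) := fun c q => by
    refine (D₁k c q).trans (Finset.sum_congr rfl fun n _ => congrArg (· * _) ?_)
    exact Boundary.resTo_gens h₀ c ⟨n.1.1, n.2⟩
  -- The anticommutator of D with the differential is a derivation of degree 0. On Q it vanishes
  -- because partial derivatives commute with the differential and the T dt are cycles of odd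
  -- degree; on the generators of negative degree it vanishes by the choice of the differential.
  have comm : ∀ c s, (y.der c).lin ((D₀ c).lin s) + (D₀ c).lin ((S.sec c).d s) = 0 := by
    intro c s
    have hs : ∀ s, ((D₀ c).bracket (S.sec c).dDer (y.der c) (y.der_incl c)).lin s =
      (y.der c).lin ((D₀ c).lin s) + (D₀ c).lin ((S.sec c).d s) :=
      (D₀ c).bracket_neg_one (S.sec c).dDer (y.der c) (y.der_incl c)
    rw [← hs]
    refine (fa.free.on c).der_eq_zero (fun q => ?_) (fun n => ?_) s
    · rw [hs]
      change (y.der c).lin ((D₀ c).lin (ap fa.k c q)) + (D₀ c).lin ((S.sec c).d (ap fa.k c q)) = 0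
      rw [← ap_d, D₀k, D₀k]
      refine (congrArg (· + _) (map_sum (y.der c).lin _ _)).trans ?_
      refine Finset.sum_add_distrib.symm.trans (Finset.sum_eq_zero fun n _ => ?_)
      have h1 := (freeSec S fa.G.shift c).sgn_of_mem 1 (freeGen_mem (A := S.sec c)
        (deg := fa.G.shift.degAt c) ⟨n.1.1, n.2⟩)
      have h2 : fa.G.shift.degAt c ⟨n.1.1, n.2⟩ = -1 := by
        change fa.G.deg n.1.1 - 1 = -1
        rw [n.1.2]
        rfl
      rw [h2, Int.negOnePow_odd _ (by decide), Units.neg_smul, one_smul] at h1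
      have h3 : (y.der c).lin (freeGen _ (fa.G.shift.degAt c) ⟨n.1.1, n.2⟩) = 0 := by
        exact (y.der_gen c ⟨n.1.1, n.2⟩).trans ((congrArg _ (y0 n.1)).trans (map_zero _))
      have h4 := (y.der c).leibniz (freeGen _ (fa.G.shift.degAt c) ⟨n.1.1, n.2⟩)
        ((freeIncl (S.sec c) (fa.G.shift.degAt c)).toAlgHom
          (ap fa.k c ((fa.pdQ hR μ c n).lin q)))
      rw [h3, h1, y.der_incl, ← ap_d, ← pdQ_d _ _ R_nonpos] at h4
      refine (congrArg (· + _) h4).trans ?_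
      rw [zero_mul, zero_add, GrHom.id_apply, neg_mul]
      exact neg_add_cancel _
    · rw [hs]
      have h1 := D₀f c ⟨n.1.1, n.2⟩
      have h2 := dgen c ⟨n.1.1, n.2⟩
      refine (congrArg (· + _) ((congrArg (y.der c).lin h1).trans h2)).trans (neg_add_cancel _)
  -- Anticommutation applied to ∂f, together with ∂∂f = 0, shows that T d(∂f) is a cycle.
  have hy : y.IsClosed := fun n => by
    have := comm _ ((S.sec _).d (fa.f n))
    rw [(S.sec _).d_d, map_zero, add_zero] at this
    exact (map_neg _ _).trans ((congrArg Neg.neg this).trans neg_zero)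
  let D : Der (Boundary.inclusion hy) (-1) := Boundary.toDer hy D₀ (Boundary.ofDer_natural h₀ D₁)
  have Df : (fun n => D.app _ (fa.f n)) = Boundary.gens hy := funext fun n => by
    have := D₀f _ (fa.G.self n)
    rw [resTo_self] at this
    exact this
  refine ⟨Boundary.presheaf hy, Boundary.inclusion hy, D, fun c r => D₁j c r, comm, ?_, ?_⟩
  · refine fa.der_mem_span D (fun c q => ?_) fa.f_mem
    rw [show D.app c (ap fa.k c q) = _ from D₀k c q]
    refine Submodule.sum_mem _ fun n _ => Submodule.subset_span
      ⟨(S.sec c).sgn (fa.G.shift.degAt c ⟨n.1.1, n.2⟩) (ap fa.k c ((fa.pdQ hR μ c n).lin q)),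
        ⟨n.1.1, n.2⟩, ?_⟩
    have h1 := mul_comm_sgn (freeGen_mem (A := S.sec c) (deg := fa.G.shift.degAt c) ⟨n.1.1, n.2⟩)
      ((freeIncl (S.sec c) (fa.G.shift.degAt c)).toAlgHom (ap fa.k c ((fa.pdQ hR μ c n).lin q)))
    refine h1.trans (congrArg₂ (· * ·) ?_ (D₀f c ⟨n.1.1, n.2⟩).symm)
    exact ((freeIncl (S.sec c) (fa.G.shift.degAt c)).map_sgn _ _).symm
  · exact (congrArg (fa.G.shift.IsFree (Boundary.inclusion hy)) Df).mpr (Boundary.isFree hy)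

end FreeAnalytic

end

/-! ### Degree bounds, finiteness, and the sheaf property of free algebras -/

section

namespace CDGA

open CDGA.Mono CDGA.Poly

variable {A B C : CDGA.{u}} {X Y : Type u} {deg : X → ℤ} {φ : GrHom A B} {e : X → B}

/-- A derivation is determined by its values on generators of an algebra. -/
theorem GrDer.eq_zero_of_mem_adjoin {f : GrHom A B} {n : ℤ} (D : GrDer f n) {T : Set A}
    (h : ∀ a ∈ T, D.lin a = 0) {a : A} (ha : a ∈ Algebra.adjoin ℂ T) : D.lin a = 0 := by
  induction ha using Algebra.adjoin_induction with
  | mem x hx => exact h x hx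
  | algebraMap r => rw [Algebra.algebraMap_eq_smul_one, map_smul, D.map_one, smul_zero]
  | add x y _ _ hx hy => rw [map_add, hx, hy, add_zero]
  | mul x y _ _ hx hy => rw [D.leibniz, hx, hy, zero_mul, mul_zero, add_zero]

theorem IsFreeOn.reindex (h : IsFreeOn φ deg e) (σ : Y ≃ X) :
    IsFreeOn φ (fun y => deg (σ y)) fun y => e (σ y) := by
  refine of_lift (fun y => h.1 (σ y)) (fun Z v z hz => ?_) fun Z w w' h1 h2 =>
    h.hom_ext h1 fun j => by simpa using h2 (σ.symm j)
  obtain ⟨w, h1, h2⟩ := h.exists_lift v (fun j => z (σ.symm j)) fun j => by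
    simpa using hz (σ.symm j)
  exact ⟨w, h1, fun y => by simpa using h2 (σ y)⟩

theorem mdeg_le_of_mem {s : Multiset X} (hd : ∀ j ∈ s, deg j ≤ 0) {j : X} (hj : j ∈ s) :
    mdeg deg s ≤ deg j := by
  obtain ⟨t, rfl⟩ := Multiset.exists_cons_of_mem hj
  rw [mdeg_cons]
  have : mdeg deg t ≤ 0 := by
    refine (Multiset.sum_le_card_nsmul _ 0 fun x hx => ?_).trans (by simp)
    obtain ⟨i, hi, rfl⟩ := Multiset.mem_map.1 hx
    exact hd i (Multiset.mem_cons_of_mem hi)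
  omega

theorem card_le_of_mdeg {s : Multiset X} (hd : ∀ j ∈ s, deg j < 0) :
    mdeg deg s ≤ -(s.card : ℤ) := by
  refine (Multiset.sum_le_card_nsmul _ (-1) fun x hx => ?_).trans (by simp)
  obtain ⟨i, hi, rfl⟩ := Multiset.mem_map.1 hx
  have := hd i hi
  omega

variable [LinearOrder X]

/-- In a monomial of degree n the coefficient and all generators have degree at most 0, so no
generator of degree below n can occur. This is the basis of all inductions on the degree. -/
theorem IsFreeOn.mem_adjoin (h : IsFreeOn φ deg e) (hA : ∀ n, 0 < n → A.deg n = ⊥)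
    (hd : ∀ j, deg j ≤ 0) {n : ℤ} {b : B} (hb : b ∈ B.deg n) :
    b ∈ Algebra.adjoin ℂ (Set.range φ.toAlgHom ∪ e '' {j | n ≤ deg j}) := by
  refine h.degree_induction (P := fun b => b ∈ Algebra.adjoin ℂ _) (Subalgebra.zero_mem _)
    (fun _ _ => Subalgebra.add_mem _) (fun s i _ hi a ha => ?_) hb
  rcases lt_or_ge 0 i with h0 | h0
  · rw [hA i h0, Submodule.mem_bot] at ha
    rw [ha, map_zero, zero_mul]
    exact Subalgebra.zero_mem _
  · refine Subalgebra.mul_mem _ (Algebra.subset_adjoin (Or.inl ⟨a, rfl⟩))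
      (monoProd_mem_adjoin fun j hj => Or.inr ⟨j, ?_, rfl⟩)
    have := mdeg_le_of_mem (fun j _ => hd j) hj
    change n ≤ deg j
    omega

end CDGA

variable {W : SimplicialSystem.{u}}

namespace Gens

open CDGA DGPresheaf CDGA.Mono CDGA.Poly

/-- The generators of a direct sum. -/
def sum (G H : Gens W) : Gens W where
  idx := G.idx ⊕ H.idx
  face := Sum.elim G.face H.face
  deg := Sum.elim G.deg H.deg
  finite α n := by
    refine (((G.finite α n).image Sum.inl).union ((H.finite α n).image Sum.inr)).subset ?_
    rintro (j | j) hj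
    · exact Or.inl ⟨j, hj, rfl⟩
    · exact Or.inr ⟨j, hj, rfl⟩

/-- The generators of a direct sum over a cell. -/
def sumAt (G H : Gens W) (c : Cell W) : G.At c ⊕ H.At c ≃ (G.sum H).At c where
  toFun := Sum.elim (fun j => ⟨Sum.inl j.1, j.2⟩) fun j => ⟨Sum.inr j.1, j.2⟩
  invFun
    | ⟨Sum.inl j, h⟩ => Sum.inl ⟨j, h⟩
    | ⟨Sum.inr j, h⟩ => Sum.inr ⟨j, h⟩
  left_inv := by rintro (j | j) <;> rfl
  right_inv := by rintro ⟨j | j, h⟩ <;> rfl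

variable {A : DGPresheaf W} {G : Gens W}

theorem finite_at (G : Gens W) (c : Cell W) (n m : ℤ) :
    {j : G.At c | n ≤ G.degAt c j ∧ G.degAt c j ≤ m}.Finite := by
  have h1 : {α : W.faces | α ≤ c.face}.Finite :=
    (c.face.1.powerset.finite_toSet.preimage Subtype.val_injective.injOn).subset
      fun α h => by simpa using h
  refine ((h1.biUnion fun α _ => (Set.finite_Icc n m).biUnion fun k _ =>
    G.finite α k).preimage Subtype.val_injective.injOn).subset fun j hj => ?_
  simp only [Set.mem_preimage, Set.mem_iUnion]
  exact ⟨G.face j.1, j.2, G.deg j.1, hj, rfl, rfl⟩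

/-- A monomial of degree at least n has at most -n factors, each of degree between n and 0. A
simplex has finitely many faces, each with finitely many generators of these degrees. -/
theorem finite_monomials (hG : ∀ j, G.deg j < 0) (c : Cell W) (n : ℤ) :
    {s : Multiset (G.At c) | n ≤ mdeg (G.degAt c) s}.Finite := by
  classical
  have hd : ∀ j, G.degAt c j < 0 := fun j => hG j.1
  have hT := G.finite_at c n 0
  refine (Set.finite_Iic ((-n).toNat • hT.toFinset.val)).subset fun s hs => ?_
  refine Multiset.le_iff_count.2 fun j => ?_
  by_cases hj : j ∈ s
  · have h1 : j ∈ hT.toFinset := hT.mem_toFinset.2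
      ⟨hs.trans (mdeg_le_of_mem (fun j _ => (hd j).le) hj), (hd j).le⟩
    have h2 := card_le_of_mdeg (s := s) fun j _ => hd j
    have h3 := Multiset.count_le_card j s
    have h4 : n ≤ mdeg (G.degAt c) s := hs
    rw [Multiset.count_nsmul, Multiset.count_eq_one_of_mem hT.toFinset.nodup h1]
    omega
  · rw [Multiset.count_eq_zero_of_notMem hj]
    exact Nat.zero_le _

theorem coeff_freeRes {α : W.faces} {U V : Opens (W.pt α)} (h : V ≤ U)
    (s : {s : Multiset (G.At ⟨α, V⟩) // Reduced (G.degAt ⟨α, V⟩) s})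
    (s' : {s : Multiset (G.At ⟨α, U⟩) // Reduced (G.degAt ⟨α, U⟩) s}) (hs : s.1 = s'.1)
    (x : freeSec A G ⟨α, U⟩) :
    coeff s ((freeRes A G (Cell.le_of_le h)).toAlgHom x) =
      A.res (Cell.le_of_le h) (coeff s' x) := by
  classical
  refine induction_mono (A := A.sec ⟨α, U⟩) (deg := G.degAt ⟨α, U⟩)
    (P := fun x => coeff s ((freeRes A G (Cell.le_of_le h)).toAlgHom x) =
      A.res (Cell.le_of_le h) (coeff s' x)) ?_ (fun x y hx hy => ?_) (fun t _ a => ?_) x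
  · exact ((congrArg _ (map_zero (freeRes A G (Cell.le_of_le h)).toAlgHom)).trans
      (map_zero _)).trans ((congrArg _ (map_zero _)).trans (map_zero _)).symm
  · refine ((congrArg _ (map_add (freeRes A G (Cell.le_of_le h)).toAlgHom x y)).trans
      (map_add _ _ _)).trans ((congrArg₂ _ hx hy).trans ?_)
    exact ((congrArg _ (map_add (coeff s') _ _)).trans (map_add _ _ _)).symm
  · refine (congrArg _ (freeRes_mono _ t a)).trans ?_
    have ht : t.map (G.incl (Cell.le_of_le h : (⟨α, V⟩ : Cell W) ≤ ⟨α, U⟩)) = t := Multiset.map_id t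
    rw [coeff_mono, coeff_mono]
    by_cases hts : t = s'.1
    · rw [if_pos hts, if_pos (ht.trans (hts.trans hs.symm))]
    · rw [if_neg hts, if_neg fun hh => hts (ht.symm.trans (hh.trans hs)), map_zero]

/-- Free algebras on generators of negative degrees over sheaves in nonpositive degrees are
sheaves. -/
theorem Boundary.isSheaf {y : Boundary A G} (h : y.IsClosed) (hA : A.IsSheaf) (hA' : A.IsNonpos)
    (hG : ∀ j, G.deg j < 0) : (Boundary.presheaf h).IsSheaf := by
  classical
  intro α ι U n s hs hc
  let S' := {s : Multiset (G.At ⟨α, iSup U⟩) // Reduced (G.degAt ⟨α, iSup U⟩) s}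
  have key : ∀ r : S', ∃! t : A.sec ⟨α, iSup U⟩, t ∈ (A.sec ⟨α, iSup U⟩).deg
      (n - mdeg (G.degAt ⟨α, iSup U⟩) r.1) ∧
      ∀ i, A.res (Cell.le_of_le (le_iSup U i)) t =
        coeff (A := A.sec ⟨α, U i⟩) (deg := G.degAt ⟨α, U i⟩) r (s i) := fun r =>
    hA α ι U _ (fun i => coeff (A := A.sec ⟨α, U i⟩) (deg := G.degAt ⟨α, U i⟩) r (s i))
      (fun i => hs i r) fun i k => by
        have h1 := coeff_freeRes (A := A) (G := G) (inf_le_left : U i ⊓ U k ≤ U i) r r rfl (s i)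
        have h2 := coeff_freeRes (A := A) (G := G) (inf_le_right : U i ⊓ U k ≤ U k) r r rfl (s k)
        exact h1.symm.trans ((congrArg _ (hc i k)).trans h2)
  choose t ht ht' using key
  -- The coefficients glue separately. In total degree n, a monomial of degree below n would need a
  -- coefficient of positive degree, so only finitely many glued coefficients are nonzero and they
  -- form a polynomial. This is where negative degrees of the generators are essential.
  have hfin : {r : S' | n ≤ mdeg (G.degAt ⟨α, iSup U⟩) r.1}.Finite :=
    Set.Finite.preimage (f := Subtype.val) Subtype.val_injective.injOn
      (finite_monomials hG ⟨α, iSup U⟩ n)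
  let T : freeSec A G ⟨α, iSup U⟩ :=
    ∑ r ∈ hfin.toFinset, mono (A.sec ⟨α, iSup U⟩) (G.degAt ⟨α, iSup U⟩) r.1 (t r)
  have t0 : ∀ r : S', ¬ n ≤ mdeg (G.degAt ⟨α, iSup U⟩) r.1 → t r = 0 := fun r hr => by
    have := (ht r).1
    rw [hA' _ _ (by omega)] at this
    exact (Submodule.mem_bot ℂ).1 this
  have hT : ∀ r : S', coeff (A := A.sec ⟨α, iSup U⟩) (deg := G.degAt ⟨α, iSup U⟩) r T = t r := by
    intro r
    refine (map_sum _ _ _).trans ?_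
    simp only [coeff_mono]
    by_cases hr : n ≤ mdeg (G.degAt ⟨α, iSup U⟩) r.1
    · rw [Finset.sum_eq_single_of_mem r (hfin.mem_toFinset.2 hr), if_pos rfl]
      exact fun r' _ hr' => if_neg fun h => hr' (Subtype.ext h)
    · rw [t0 r hr]
      refine Finset.sum_eq_zero fun r' hr' => if_neg fun h => hr ?_
      rw [← h]
      exact hfin.mem_toFinset.1 hr'
  refine ⟨T, ⟨fun r => (hT r).symm ▸ (ht r).1, fun i => ?_⟩, fun x hx => ?_⟩
  · refine ext_coeff (A := A.sec ⟨α, U i⟩) (deg := G.degAt ⟨α, U i⟩) fun r => ?_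
    refine (coeff_freeRes (A := A) (G := G) (le_iSup U i) r r rfl T).trans ?_
    exact (congrArg _ (hT r)).trans ((ht r).2 i)
  · refine ext_coeff (A := A.sec ⟨α, iSup U⟩) (deg := G.degAt ⟨α, iSup U⟩) fun r => ?_
    rw [hT]
    refine ht' r _ ⟨hx.1 r, fun i => ?_⟩
    refine (coeff_freeRes (A := A) (G := G) (le_iSup U i) r r rfl x).symm.trans ?_
    exact congrArg _ (hx.2 i)

end Gens

end

/-! ### Monomial ideals and the contraction of the Koszul algebra -/

section

namespace CDGA

open CDGA.Mono CDGA.Poly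

variable {A Z : CDGA.{u}} {X : Type u} [LinearOrder X] {deg : X → ℤ}

theorem monoProd_eq_zero {z : X → Z} (hz : ∀ j, z j ∈ Z.deg (deg j)) {s : Multiset X} {j : X}
    (hj : j ∈ s) (h : z j = 0) : monoProd z s = 0 := by
  obtain ⟨t, rfl⟩ := Multiset.exists_cons_of_mem hj
  rw [monoProd_cons hz, h, zero_mul, smul_zero]

theorem map_mono {B : CDGA.{u}} (w : GrHom (free A deg) B) (s : Multiset X) (a : A) :
    w.toAlgHom (mono A deg s a) = w.toAlgHom ((freeIncl A deg).toAlgHom a) *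
      monoProd (fun j => w.toAlgHom (freeGen A deg j)) s := by
  rw [← map_monoProd, ← map_mul]
  exact congrArg w.toAlgHom (mono_eq s a)

theorem map_mono_eq_zero {B : CDGA.{u}} (w : GrHom (free A deg) B) {s : Multiset X} {j : X}
    (hj : j ∈ s) (h : w.toAlgHom (freeGen A deg j) = 0) (a : A) :
    w.toAlgHom (mono A deg s a) = 0 := by
  rw [map_mono, monoProd_eq_zero (fun i => w.map_deg (freeGen_mem i)) hj h, mul_zero]

/-- The span of the monomials that contain one of the given generators. -/
def monoIdeal (A : CDGA.{u}) (deg : X → ℤ) (T : Set X) : Submodule ℂ (free A deg) where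
  carrier := {y | ∀ s, (∀ j ∈ s.1, j ∉ T) → coeff s y = 0}
  add_mem' ha hb s hs := (map_add (coeff s) _ _).trans (by rw [ha s hs, hb s hs, add_zero])
  zero_mem' s _ := map_zero (coeff s)
  smul_mem' r a ha s hs := (map_smul (coeff s) r a).trans (by rw [ha s hs, smul_zero])

section

variable {T : Set X}

open Classical in
/-- The homomorphism that sends the given generators to zero. -/
def killGens (A : CDGA.{u}) (deg : X → ℤ) (T : Set X) : GrHom (free A deg) (free A deg) :=
  (isFreeOn_free A deg).lift (freeIncl A deg) (fun j => if j ∈ T then 0 else freeGen A deg j)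
    fun j => by
      split_ifs
      · exact Submodule.zero_mem _
      · exact freeGen_mem j

theorem killGens_incl (a : A) : (killGens A deg T).toAlgHom ((freeIncl A deg).toAlgHom a) =
    (freeIncl A deg).toAlgHom a := (isFreeOn_free A deg).lift_base _ _ _ a

open Classical in
theorem killGens_gen (j : X) : (killGens A deg T).toAlgHom (freeGen A deg j) =
    if j ∈ T then 0 else freeGen A deg j := by
  unfold killGens
  rw [IsFreeOn.lift_gen]

theorem killGens_mono_of_mem {s : Multiset X} {j : X} (hj : j ∈ s) (hT : j ∈ T) (a : A) :
    (killGens A deg T).toAlgHom (mono A deg s a) = 0 :=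
  map_mono_eq_zero _ hj (by rw [killGens_gen, if_pos hT]) a

theorem killGens_mono {s : Multiset X} (h : ∀ j ∈ s, j ∉ T) (a : A) :
    (killGens A deg T).toAlgHom (mono A deg s a) = mono A deg s a := by
  rw [map_mono, killGens_incl]
  refine Eq.trans (congrArg _ ?_) (mono_eq s a).symm
  unfold monoProd
  refine congrArg _ (List.map_congr_left fun j hj => ?_)
  rw [killGens_gen, if_neg (h j ((Multiset.mem_sort _).1 hj))]

/-- The homomorphism keeps the coefficients of the monomials that avoid T and deletes all others. As
the kernel of a homomorphism, the span of the remaining monomials is a two-sided ideal. -/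
theorem mem_monoIdeal_iff (y : free A deg) :
    y ∈ monoIdeal A deg T ↔ (killGens A deg T).toAlgHom y = 0 := by
  classical
  have h1 : ∀ (s : {s : Multiset X // Reduced deg s}), (∀ j ∈ s.1, j ∉ T) → ∀ y : free A deg,
      coeff s ((killGens A deg T).toAlgHom y) = coeff s y := fun s hs y => by
    refine LinearMap.congr_fun (f := coeff s ∘ₗ (killGens A deg T).toAlgHom.toLinearMap)
      (g := coeff s) (lin_ext fun t a => ?_) y
    change coeff s ((killGens A deg T).toAlgHom (mono A deg t a)) = _
    by_cases ht : ∀ j ∈ t, j ∉ T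
    · rw [killGens_mono ht]
    · push Not at ht
      obtain ⟨j, hj, hjT⟩ := ht
      rw [killGens_mono_of_mem hj hjT, coeff_mono, if_neg]
      · exact map_zero (coeff s)
      · rintro rfl
        exact hs j hj hjT
  have h2 : ∀ (s : {s : Multiset X // Reduced deg s}), (¬ ∀ j ∈ s.1, j ∉ T) → ∀ y : free A deg,
      coeff s ((killGens A deg T).toAlgHom y) = 0 := fun s hs y => by
    refine LinearMap.congr_fun (f := coeff s ∘ₗ (killGens A deg T).toAlgHom.toLinearMap)
      (g := 0) (lin_ext fun t a => ?_) y
    change coeff s ((killGens A deg T).toAlgHom (mono A deg t a)) = 0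
    by_cases ht : ∀ j ∈ t, j ∉ T
    · rw [killGens_mono ht, coeff_mono, if_neg]
      rintro rfl
      exact hs ht
    · push Not at ht
      obtain ⟨j, hj, hjT⟩ := ht
      rw [killGens_mono_of_mem hj hjT]
      exact map_zero (coeff s)
  refine ⟨fun h => ext_coeff fun s => ?_, fun h s hs => ?_⟩
  · refine Eq.trans ?_ (map_zero (coeff s)).symm
    by_cases hs : ∀ j ∈ s.1, j ∉ T
    · rw [h1 s hs, h s hs]
    · exact h2 s hs y
  · rw [← h1 s hs, h]
    exact map_zero (coeff s)

theorem monoIdeal_mono {T' : Set X} (h : T ⊆ T') : monoIdeal A deg T ≤ monoIdeal A deg T' :=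
  fun _ hy s hs => hy s fun j hj hT => hs j hj (h hT)

theorem gen_mul_mem_monoIdeal {j : X} (hj : j ∈ T) (b : free A deg) :
    freeGen A deg j * b ∈ monoIdeal A deg T := by
  rw [mem_monoIdeal_iff, map_mul, killGens_gen, if_pos hj, zero_mul]

/-- Followed by the homomorphism that kills the generators in T, the derivation vanishes on
coefficients and generators, hence everywhere. -/
theorem der_mem_monoIdeal {n : ℤ} (D : GrDer (GrHom.id (free A deg)) n)
    (h0 : ∀ a, D.lin ((freeIncl A deg).toAlgHom a) ∈ monoIdeal A deg T)
    (h1 : ∀ j, D.lin (freeGen A deg j) ∈ monoIdeal A deg T) (y : free A deg) :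
    D.lin y ∈ monoIdeal A deg T :=
  (mem_monoIdeal_iff _).2 ((isFreeOn_free A deg).der_eq_zero (D := D.comp (killGens A deg T))
    (fun a => (mem_monoIdeal_iff _).1 (h0 a)) (fun j => (mem_monoIdeal_iff _).1 (h1 j)) y)

theorem mono_eq_mul {s : Multiset X} {j : X} (hj : j ∈ s) (a : A) : ∃ b b' : free A deg,
    (mono A deg s a : free A deg) = b * freeGen A deg j * b' := by
  obtain ⟨t, rfl⟩ := Multiset.exists_cons_of_mem hj
  refine ⟨cocycle deg {j} t • (freeIncl A deg).toAlgHom a, monoProd (freeGen A deg) t, ?_⟩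
  refine (mono_eq _ a).trans ?_
  rw [monoProd_cons freeGen_mem, mul_smul_comm, mul_assoc, smul_mul_assoc]

theorem monoIdeal_le_span : monoIdeal A deg T ≤ Submodule.span ℂ
    {y | ∃ j ∈ T, ∃ b b' : free A deg, y = b * freeGen A deg j * b'} := by
  intro y hy
  rw [eq_sum y]
  refine Submodule.sum_mem _ fun s _ => ?_
  by_cases hs : ∀ j ∈ s.1, j ∉ T
  · rw [hy s hs, map_zero]
    exact Submodule.zero_mem _
  · push Not at hs
    obtain ⟨j, hj, hjT⟩ := hs
    obtain ⟨b, b', h⟩ := mono_eq_mul (deg := deg) hj (coeff s y)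
    exact Submodule.subset_span ⟨j, hjT, b, b', h⟩

/-- Each monomial contains a factor from T, of negative degree, and the coefficient has degree at
most 0. Any other factor therefore has degree strictly above the total degree n. This strictness is
what makes the later changes of generators triangular. -/
theorem monoIdeal_mem_adjoin (hA : ∀ n, 0 < n → A.deg n = ⊥) (hd : ∀ j, deg j < 0) {n : ℤ}
    {y : free A deg} (hy : y ∈ monoIdeal A deg T) (hn : y ∈ (free A deg).deg n) :
    y ∈ Algebra.adjoin ℂ (Set.range (freeIncl A deg).toAlgHom ∪
      freeGen A deg '' {j | j ∈ T ∨ n < deg j}) := by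
  rw [eq_sum y]
  refine Subalgebra.sum_mem _ fun s _ => ?_
  by_cases hs : ∀ j ∈ s.1, j ∉ T
  · rw [hy s hs, map_zero]
    exact Subalgebra.zero_mem _
  push Not at hs
  obtain ⟨j, hj, hjT⟩ := hs
  rcases lt_or_ge 0 (n - mdeg deg s.1) with h0 | h0
  · have h1 := hn s
    rw [hA _ h0, Submodule.mem_bot] at h1
    rw [h1, map_zero]
    exact Subalgebra.zero_mem _
  · refine (mono_eq s.1 (coeff s y)).symm ▸ Subalgebra.mul_mem _ 
      (Algebra.subset_adjoin (Or.inl ⟨_, rfl⟩)) (monoProd_mem_adjoin fun i hi => Or.inr ⟨i, ?_, rfl⟩)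
    by_cases hij : i = j
    · exact Or.inl (hij ▸ hjT)
    · refine Or.inr ?_
      obtain ⟨t, ht⟩ := Multiset.exists_cons_of_mem hj
      rw [ht, Multiset.mem_cons] at hi
      have h2 := mdeg_le_of_mem (deg := deg) (fun j _ => (hd j).le) (hi.resolve_left hij)
      rw [ht, mdeg_cons] at h0
      have := hd j
      omega

end

section

variable (E : A →ₗ[ℂ] A) (M : ℕ → A →ₗ[ℂ] A) (δ : GrDer (GrHom.id (free A deg)) 1)
  (D : GrDer (GrHom.id (free A deg)) (-1))

/-- The operator that acts by `M k` on the coefficients of the monomials of length `k + 1`. -/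
def rayFree (deg : X → ℤ) : free A deg →ₗ[ℂ] free A deg :=
  lsum fun s => if s.card = 0 then 0 else mono A deg s ∘ₗ M (s.card - 1)

theorem rayFree_mono (s : Multiset X) (a : A) : rayFree M deg (mono A deg s a) =
    if s.card = 0 then 0 else mono A deg s (M (s.card - 1) a) := by
  refine (lsum_mono' _ (fun s hs => ?_) s a).trans ?_
  · split_ifs
    · rfl
    · exact LinearMap.ext fun a => mono_of_not hs _
  · split_ifs <;> rfl

theorem coeff_rayFree (s : {s : Multiset X // Reduced deg s}) (y : free A deg) :
    coeff s (rayFree M deg y) = if s.1.card = 0 then 0 else M (s.1.card - 1) (coeff s y) := by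
  classical
  refine LinearMap.congr_fun (f := coeff s ∘ₗ rayFree M deg)
    (g := if s.1.card = 0 then 0 else M (s.1.card - 1) ∘ₗ coeff s) (lin_ext fun t a => ?_) y |>.trans ?_
  · change coeff s (rayFree M deg (mono A deg t a)) = _
    rw [rayFree_mono]
    split_ifs with h1 h2 h2
    · exact map_zero (coeff s)
    · change _ = M _ (coeff s _)
      rw [coeff_mono, if_neg, map_zero, map_zero]
      rintro rfl
      exact h2 h1
    · rw [coeff_mono, if_neg]
      · rfl
      · rintro rfl
        exact h1 h2
    · change _ = M _ (coeff s _)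
      rw [coeff_mono, coeff_mono]
      split_ifs with h
      · rw [h]
      · rw [map_zero]
  · split_ifs <;> rfl

theorem rayFree_mem_monoIdeal {T : Set X} {y : free A deg} (hy : y ∈ monoIdeal A deg T) :
    rayFree M deg y ∈ monoIdeal A deg T := fun s hs => by
  rw [coeff_rayFree, hy s hs, map_zero, ite_self]

theorem rayFree_mem (hM : ∀ k n a, a ∈ A.deg n → M k a ∈ A.deg n) {n : ℤ} {y : free A deg}
    (hy : y ∈ (free A deg).deg n) : rayFree M deg y ∈ (free A deg).deg n := fun s => by
  rw [coeff_rayFree]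
  split_ifs
  · exact Submodule.zero_mem _
  · exact hM _ _ _ (hy s)

theorem map_rayFree (w : GrHom (free A deg) Z) (hw : ∀ j, w.toAlgHom (freeGen A deg j) = 0)
    (y : free A deg) : w.toAlgHom (rayFree M deg y) = 0 := by
  refine LinearMap.congr_fun (f := w.toAlgHom.toLinearMap ∘ₗ rayFree M deg)
    (g := 0) (lin_ext fun s a => ?_) y
  change w.toAlgHom (rayFree M deg (mono A deg s a)) = 0
  rw [rayFree_mono]
  split_ifs with h
  · exact map_zero w.toAlgHom
  · obtain ⟨j, hj⟩ := Multiset.card_pos_iff_exists_mem.1 (Nat.pos_of_ne_zero h)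
    exact map_mono_eq_zero w hj (hw j) _

variable {E δ D}

/-- A derivation that multiplies the generators by `1` acts on monomials through their length. -/
theorem coeff_der (L : GrDer (GrHom.id (free A deg)) 0)
    (L0 : ∀ a, L.lin ((freeIncl A deg).toAlgHom a) = (freeIncl A deg).toAlgHom (E a))
    (L1 : ∀ j, L.lin (freeGen A deg j) = freeGen A deg j)
    (s : {s : Multiset X // Reduced deg s}) (y : free A deg) :
    coeff s (L.lin y) = E (coeff s y) + (s.1.card : ℂ) • coeff s y := by
  classical
  have h1 : ∀ s : Multiset X, L.lin (monoProd (freeGen A deg) s) =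
      (s.card : ℂ) • monoProd (freeGen A deg) s := fun s => by
    induction s using Multiset.induction with
    | empty => simp [L.map_one]
    | cons j s ih =>
      rw [monoProd_cons freeGen_mem, map_units_smul, L.leibniz, L1, ih, sgn_zero, GrHom.id_apply,
        GrHom.id_apply, mul_smul_comm, Multiset.card_cons, Nat.cast_succ, add_smul, one_smul,
        smul_add, add_comm, smul_comm]
  have h2 : ∀ (t : Multiset X) (a : A), L.lin (mono A deg t a) =
      mono A deg t (E a + (t.card : ℂ) • a) := fun t a => by
    refine (congrArg L.lin (mono_eq t a)).trans ?_
    rw [L.leibniz, L0, h1, sgn_zero, GrHom.id_apply, GrHom.id_apply, mul_smul_comm,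
      map_add, map_smul]
    exact congrArg₂ (· + ·) (mono_eq t (E a)).symm (congrArg _ (mono_eq t a).symm)
  refine LinearMap.congr_fun (f := coeff s ∘ₗ L.lin)
    (g := E ∘ₗ coeff s + (s.1.card : ℂ) • coeff s) (lin_ext fun t a => ?_) y
  change coeff s (L.lin (mono A deg t a)) = E (coeff s (mono A deg t a)) +
    (s.1.card : ℂ) • coeff s (mono A deg t a)
  rw [h2, coeff_mono, coeff_mono]
  split_ifs with h
  · rw [h]
  · rw [map_zero, smul_zero, add_zero]

/-- The bracket L = [δ, D] acts on coefficients of monomials of length k as E + k, so the ray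
operators invert it on monomials of positive length. Since L commutes with δ, the element x = δhy +
hδy - y, with h the ray operator after D, satisfies Lx = 0. Hence its coefficients of positive
length vanish, and its constant term is killed by E and so comes from Z; applying `w`, which kills
h, identifies it as the negative of the augmentation of y. -/
theorem koszul_homotopy (δδ : ∀ y, δ.lin (δ.lin y) = 0)
    (L0 : ∀ a, δ.lin (D.lin ((freeIncl A deg).toAlgHom a)) +
      D.lin (δ.lin ((freeIncl A deg).toAlgHom a)) = (freeIncl A deg).toAlgHom (E a))
    (L1 : ∀ j, δ.lin (D.lin (freeGen A deg j)) + D.lin (δ.lin (freeGen A deg j)) =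
      freeGen A deg j)
    (EM : ∀ k a, E (M k a) + ((k : ℂ) + 1) • M k a = a)
    (ME : ∀ k a, M k (E a + ((k : ℂ) + 1) • a) = a)
    (w : GrHom (free A deg) Z) (hw : ∀ j, w.toAlgHom (freeGen A deg j) = 0)
    (wδ : ∀ y, w.toAlgHom (δ.lin y) = Z.d (w.toAlgHom y)) (i : GrHom Z A)
    (hE : ∀ a, E a = 0 → a = i.toAlgHom (w.toAlgHom ((freeIncl A deg).toAlgHom a)))
    (hD : ∀ y, D.lin y ∈ monoIdeal A deg Set.univ) (y : free A deg) :
    δ.lin (rayFree M deg (D.lin y)) + rayFree M deg (D.lin (δ.lin y)) =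
      y - (freeIncl A deg).toAlgHom (i.toAlgHom (w.toAlgHom y)) := by
  let L : GrDer (GrHom.id (free A deg)) 0 := D.bracket δ δ fun _ => rfl
  have hL : ∀ y, L.lin y = δ.lin (D.lin y) + D.lin (δ.lin y) :=
    fun y => D.bracket_neg_one δ δ (fun _ => rfl) y
  have Lc := coeff_der (E := E) L (fun a => (hL _).trans (L0 a)) fun j => (hL _).trans (L1 j)
  have LM : ∀ y ∈ monoIdeal A deg Set.univ, L.lin (rayFree M deg y) = y := fun y hy => by
    refine ext_coeff fun s => ?_
    rw [Lc, coeff_rayFree]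
    split_ifs with h
    · rw [map_zero, smul_zero, add_zero, hy s]
      intro j hj
      rw [Multiset.card_eq_zero.1 h] at hj
      simp at hj
    · have := EM (s.1.card - 1) (coeff s y)
      rwa [Nat.cast_sub (Nat.pos_of_ne_zero h), Nat.cast_one, sub_add_cancel] at this
  have Lδ : ∀ y, L.lin (δ.lin y) = δ.lin (L.lin y) := fun y => by
    rw [hL, hL, δδ, map_add, δδ, map_zero, add_zero, zero_add]
  set x := δ.lin (rayFree M deg (D.lin y)) + rayFree M deg (D.lin (δ.lin y)) - y with hx
  have Lx : L.lin x = 0 := by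
    rw [hx, map_sub, map_add, Lδ, LM _ (hD _), LM _ (hD _), hL, sub_self]
  have hc : ∀ s : {s : Multiset X // Reduced deg s}, E (coeff s x) + (s.1.card : ℂ) • coeff s x = 0 :=
    fun s => by
      rw [← Lc, Lx]
      exact map_zero (coeff s)
  have hx0 : x = (freeIncl A deg).toAlgHom (coeff ⟨0, reduced_zero deg⟩ x) := by
    classical
    refine ext_coeff fun s => ?_
    rw [freeIncl_apply, coeff_mono]
    split_ifs with h
    · rw [show s = ⟨0, reduced_zero deg⟩ from Subtype.ext h.symm]
    · have h1 : s.1.card ≠ 0 := fun hh => h (Multiset.card_eq_zero.1 hh).symm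
      have h2 := hc s
      have h3 := ME (s.1.card - 1) (coeff s x)
      rw [Nat.cast_sub (Nat.pos_of_ne_zero h1), Nat.cast_one, sub_add_cancel, h2, map_zero] at h3
      exact h3.symm
  have hx1 := hE (coeff ⟨0, reduced_zero deg⟩ x) (by
    have := hc ⟨0, reduced_zero deg⟩
    rwa [Multiset.card_zero, Nat.cast_zero, zero_smul, add_zero] at this)
  rw [← hx0] at hx1
  have hwx : w.toAlgHom x = - w.toAlgHom y := by
    rw [hx, map_sub, map_add, wδ, map_rayFree M w hw, map_rayFree M w hw, map_zero, add_zero,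
      zero_sub]
  rw [hwx, map_neg] at hx1
  rw [hx1, map_neg] at hx0
  rw [sub_eq_add_neg, ← hx0, hx]
  abel

end

end CDGA

end

/-! ### The Koszul resolution of R over Q -/

section

variable {W : SimplicialSystem.{u}}

/-- Sections on the generators of a direct sum. -/
def Gens.sumSections {G H : Gens W} {F : DGPresheaf W} (a : G.Sections F) (b : H.Sections F) :
    (G.sum H).Sections F
  | Sum.inl j => a j
  | Sum.inr j => b j

namespace FreeAnalytic

open DGPresheaf Slice CDGA Gens CDGA.Poly

variable {R S : DGPresheaf W} {HR : HolStructure R} {j : R ⟶ S} (fa : FreeAnalytic HR j) (μ : S ⟶ R)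

/-- The generators of negative degree. -/
abbrev gensNeg : Gens W := fa.G.filter (· < 0)

/-- The Koszul resolution of `R` over `Q` on generators `x` and `e`, with its contraction. -/
structure Koszul where
  K : DGPresheaf W
  isSheaf : K.IsSheaf
  κ : fa.Q ⟶ K
  x : fa.gensNeg.Sections K
  e : fa.G.shift.Sections K
  isFree : (fa.gensNeg.sum fa.G.shift).IsFree κ (sumSections x e)
  ν : K ⟶ R
  κ_ν : κ ≫ ν = fa.k ≫ μ
  ν_x : ∀ n, ap ν _ (x n) = 0
  ν_e : ∀ n, ap ν _ (e n) = 0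
  d_x : ∀ n, (K.sec _).d (x n) = 0
  d_e_zero : ∀ n : fa.gens0.idx, (K.sec _).d (e n.1) = ap κ _ (fa.tau μ n).1
  d_e_neg : ∀ n : fa.gensNeg.idx, (K.sec _).d (e n.1) = x n
  h : ∀ c, K.sec c →ₗ[ℂ] K.sec c
  h_mem : ∀ c {m} {y : K.sec c}, y ∈ (K.sec c).deg m → h c y ∈ (K.sec c).deg (m - 1)
  ν_h : ∀ c y, ap ν c (h c y) = 0
  homotopy : ∀ c y, (K.sec c).d (h c y) + h c ((K.sec c).d y) =
    y - ap κ c (ap fa.i c (ap ν c y))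
  h_mem_span : ∀ c y, h c y ∈ Submodule.span ℂ
    {y : K.sec c | ∃ (n : fa.G.shift.At c) (b b' : K.sec c), y = b * fa.G.shift.resTo e c n * b'}
  h_mem_adjoin : ∀ c {m} {y : K.sec c}, y ∈ (K.sec c).deg m → h c y ∈ Algebra.adjoin ℂ
    (Set.range (ap κ c) ∪ (Set.range (fa.G.shift.resTo e c) ∪
      fa.gensNeg.resTo x c '' {n | m - 1 < fa.gensNeg.degAt c n}))

/-- The generators of the Koszul resolution. -/
abbrev koszulGens : Gens W := fa.gensNeg.sum fa.G.shift

theorem koszulGens_neg (n : fa.koszulGens.idx) : fa.koszulGens.deg n < 0 := by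
  rcases n with n | n
  · exact n.2
  · have := fa.deg_nonpos n
    change fa.G.deg n - 1 < 0
    omega

/-- The generator `x`. -/
def genX (c : Cell W) (n : fa.gensNeg.At c) : freeSec fa.Q fa.koszulGens c :=
  freeGen (fa.Q.sec c) (fa.koszulGens.degAt c) ⟨Sum.inl n.1, n.2⟩

/-- The generator `e`. -/
def genE (c : Cell W) (n : fa.G.shift.At c) : freeSec fa.Q fa.koszulGens c :=
  freeGen (fa.Q.sec c) (fa.koszulGens.degAt c) ⟨Sum.inr n.1, n.2⟩

theorem genX_mem (c : Cell W) (n : fa.gensNeg.At c) :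
    fa.genX c n ∈ (freeSec fa.Q fa.koszulGens c).deg (fa.G.deg n.1.1) :=
  freeGen_mem (A := fa.Q.sec c) (deg := fa.koszulGens.degAt c) ⟨Sum.inl n.1, n.2⟩

theorem genE_mem (c : Cell W) (n : fa.G.shift.At c) :
    fa.genE c n ∈ (freeSec fa.Q fa.koszulGens c).deg (fa.G.deg n.1 - 1) :=
  freeGen_mem (A := fa.Q.sec c) (deg := fa.koszulGens.degAt c) ⟨Sum.inr n.1, n.2⟩

theorem deg_neg {n : fa.G.idx} (h : ¬ fa.G.deg n = 0) : fa.G.deg n < 0 :=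
  lt_of_le_of_ne (fa.deg_nonpos n) h

/-- The Koszul differential on `e`. -/
def koszulVal (n : fa.G.shift.idx) : freeSec fa.Q fa.koszulGens (Cell.whole (fa.G.face n)) :=
  if h : fa.G.deg n = 0 then (freeIncl (fa.Q.sec _) _).toAlgHom (fa.tau μ ⟨n, h⟩).1
    else fa.genX _ (fa.gensNeg.self ⟨n, fa.deg_neg h⟩)

theorem koszulVal_mem (n : fa.G.shift.idx) : fa.koszulVal μ n ∈
    (freeSec fa.Q fa.koszulGens (Cell.whole (fa.G.face n))).deg (fa.G.deg n) := by
  unfold koszulVal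
  split_ifs with h
  · rw [h]
    exact (freeIncl _ _).map_deg (fa.tau μ ⟨n, h⟩).2
  · exact fa.genX_mem _ (fa.gensNeg.self ⟨n, fa.deg_neg h⟩)

/-- The Koszul differential on the generators. -/
def koszulBoundary : Boundary fa.Q fa.koszulGens where
  val
    | Sum.inl _ => 0
    | Sum.inr n => fa.koszulVal μ n
  mem
    | Sum.inl _ => Submodule.zero_mem _
    | Sum.inr n => by
      have := fa.koszulVal_mem μ n
      have h : fa.koszulGens.deg (Sum.inr n) + 1 = fa.G.deg n := sub_add_cancel _ _
      rw [h]
      exact this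

theorem gen_cases (c : Cell W) (n : fa.koszulGens.At c) :
    (∃ m, freeGen (fa.Q.sec c) (fa.koszulGens.degAt c) n = fa.genX c m) ∨
      ∃ m, freeGen (fa.Q.sec c) (fa.koszulGens.degAt c) n = fa.genE c m := by
  obtain ⟨n | n, hn⟩ := n
  · exact Or.inl ⟨⟨n, hn⟩, rfl⟩
  · exact Or.inr ⟨⟨n, hn⟩, rfl⟩

theorem koszul_der_genX (c : Cell W) (n : fa.gensNeg.At c) :
    ((fa.koszulBoundary μ).der c).lin (fa.genX c n) = 0 :=
  ((fa.koszulBoundary μ).der_gen c ⟨Sum.inl n.1, n.2⟩).trans (map_zero _)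

theorem koszul_der_genE_zero (c : Cell W) (n : fa.Idx c.face) :
    ((fa.koszulBoundary μ).der c).lin (fa.genE c ⟨n.1.1, n.2⟩) =
      (freeIncl (fa.Q.sec c) (fa.koszulGens.degAt c)).toAlgHom (fa.coord μ c n).1 := by
  refine ((fa.koszulBoundary μ).der_gen c ⟨Sum.inr n.1.1, n.2⟩).trans ?_
  have h : fa.koszulVal μ n.1.1 = (freeIncl (fa.Q.sec _) _).toAlgHom (fa.tau μ n.1).1 :=
    dif_pos n.1.2
  refine (congrArg _ h).trans ?_
  exact freeRes_incl (A := fa.Q) (G := fa.koszulGens) (Cell.le_whole n.2) (fa.tau μ n.1).1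

theorem koszul_der_genE_neg (c : Cell W) (n : fa.gensNeg.At c) :
    ((fa.koszulBoundary μ).der c).lin (fa.genE c ⟨n.1.1, n.2⟩) = fa.genX c n := by
  refine ((fa.koszulBoundary μ).der_gen c ⟨Sum.inr n.1.1, n.2⟩).trans ?_
  have h : fa.koszulVal μ n.1.1 = fa.genX _ (fa.gensNeg.self n.1) :=
    dif_neg (show ¬ fa.G.deg n.1.1 = 0 from n.1.2.ne)
  refine (congrArg _ h).trans ?_
  exact freeRes_gen (A := fa.Q) (G := fa.koszulGens) (Cell.le_whole n.2)
    (fa.koszulGens.self (Sum.inl n.1))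

variable {μ}

theorem koszulBoundary_isClosed (R_nonpos : R.IsNonpos) : (fa.koszulBoundary μ).IsClosed := by
  rintro (n | n)
  · exact map_zero _
  · change ((fa.koszulBoundary μ).der _).lin (fa.koszulVal μ n) = 0
    unfold koszulVal
    split_ifs with h
    · refine ((fa.koszulBoundary μ).der_incl _ _).trans ?_
      exact (congrArg _ (fa.d_zero R_nonpos (fa.tau μ ⟨n, h⟩).2)).trans (map_zero _)
    · exact fa.koszul_der_genX μ _ _

variable (hR : HR.IsComplexAnalytic)

theorem genE_zero_mem (c : Cell W) (n : fa.Idx c.face) :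
    fa.genE c ⟨n.1.1, n.2⟩ ∈ (freeSec fa.Q fa.koszulGens c).deg (-1) := by
  have := fa.genE_mem c ⟨n.1.1, n.2⟩
  rwa [show fa.G.deg n.1.1 = 0 from n.1.2] at this

/-- The derivation that is inverse to the Koszul differential up to the action of the Euler
operator. -/
theorem exists_contraction (c : Cell W) :
    ∃ D : GrDer (GrHom.id (freeSec fa.Q fa.koszulGens c)) (-1),
      (∀ q, D.lin ((freeIncl _ _).toAlgHom q) = ∑ n : fa.Idx c.face, fa.genE c ⟨n.1.1, n.2⟩ *
        (freeIncl _ _).toAlgHom ((fa.pdQ hR μ c n).lin q)) ∧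
      (∀ n, D.lin (fa.genX c n) = fa.genE c ⟨n.1.1, n.2⟩) ∧ ∀ n, D.lin (fa.genE c n) = 0 := by
  let y : fa.koszulGens.At c → freeSec fa.Q fa.koszulGens c
    | ⟨Sum.inl n, hn⟩ => fa.genE c ⟨n.1, hn⟩
    | ⟨Sum.inr n, hn⟩ => 0
  obtain ⟨D, h1, h2⟩ := (isFreeOn_free (fa.Q.sec c) (fa.koszulGens.degAt c)).exists_der
    (GrHom.id _) (fa.totalDerAt μ hR (freeIncl (fa.Q.sec c) (fa.koszulGens.degAt c))
      (fun n => fa.genE c ⟨n.1.1, n.2⟩) (fa.genE_zero_mem c)) y (by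
      rintro ⟨n | n, hn⟩
      · exact fa.genE_mem c ⟨n.1, hn⟩
      · exact Submodule.zero_mem _)
  exact ⟨D, fun q => (h1 q).trans (fa.totalDerAt_lin hR _ _ _ q), fun n => h2 ⟨Sum.inl n.1, n.2⟩,
    fun n => h2 ⟨Sum.inr n.1, n.2⟩⟩

theorem aug_tau (j_μ : j ≫ μ = 𝟙 R) (n : fa.gens0.idx) : ap μ _ (ap fa.k _ (fa.tau μ n).1) = 0 := by
  have h := fa.aug_coord j_μ (Cell.whole (fa.gens0.face n)) ⟨n, le_refl (fa.gens0.face n)⟩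
  rwa [coord, coe_res0, res_self] at h

/-- From Eq = 0 and [∂ₙ, E] = ∂ₙ one gets (E + 1) ∂ₙ q = 0, and E + 1 is injective. So all partial
derivatives vanish, and Hadamard's lemma leaves the constant term. -/
theorem eq_of_eulerQ_eq_zero (j_μ : j ≫ μ = 𝟙 R) (c : Cell W) (q : fa.Q.sec c)
    (hq : fa.eulerQ μ hR c q = 0) : q = ap fa.i c (ap μ c (ap fa.k c q)) := by
  have h1 : ∀ n, (fa.pdQ hR μ c n).lin q = 0 := fun n => by
    have h2 := fa.pdQ_euler (μ := μ) hR c n q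
    have h3 := fa.rayQ_euler (μ := μ) hR c 0 ((fa.pdQ hR μ c n).lin q)
    rw [hq, map_zero] at h2
    rw [Nat.cast_zero, zero_add, one_smul, ← h2, map_zero] at h3
    exact h3.symm
  refine (fa.eq_add_sum_ray_pdQ hR j_μ c q).trans ?_
  rw [Finset.sum_eq_zero, add_zero]
  intro n _
  rw [h1, map_zero, mul_zero]

section

variable {c : Cell W} {D : GrDer (GrHom.id (freeSec fa.Q fa.koszulGens c)) (-1)}
  (D1 : ∀ q, D.lin ((freeIncl _ _).toAlgHom q) = ∑ n : fa.Idx c.face, fa.genE c ⟨n.1.1, n.2⟩ *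
    (freeIncl _ _).toAlgHom ((fa.pdQ hR μ c n).lin q))
  (D2 : ∀ n, D.lin (fa.genX c n) = fa.genE c ⟨n.1.1, n.2⟩) (D3 : ∀ n, D.lin (fa.genE c n) = 0)

-- On a coefficient q the terms e ∂ₙ(dq) cancel against each other, as partial derivatives commute
-- with d and e has odd degree -1. What remains is ∂e ∂ₙ q = τₙ ∂ₙ q, summed over n.
include D1 in
theorem contraction_base (R_nonpos : R.IsNonpos) (q : fa.Q.sec c) :
    ((fa.koszulBoundary μ).der c).lin (D.lin ((freeIncl _ _).toAlgHom q)) +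
      D.lin (((fa.koszulBoundary μ).der c).lin ((freeIncl _ _).toAlgHom q)) =
        (freeIncl _ _).toAlgHom (fa.eulerQ μ hR c q) := by
  rw [Boundary.der_incl, D1, D1, map_sum, ← Finset.sum_add_distrib, eulerQ_apply, map_sum]
  refine Finset.sum_congr rfl fun n _ => ?_
  have h1 := (freeSec fa.Q fa.koszulGens c).sgn_of_mem 1 (fa.genE_zero_mem c n)
  rw [Int.negOnePow_odd _ (by decide), Units.neg_smul, one_smul] at h1
  rw [GrDer.leibniz, h1, koszul_der_genE_zero, Boundary.der_incl, map_mul, pdQ_d _ _ R_nonpos,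
    GrHom.id_apply, GrHom.id_apply, neg_mul, neg_add_cancel_right]

-- The differential turns e into x or τ, and D turns x and τ back into e.
include D1 D2 D3 in
theorem contraction_gen (n : fa.koszulGens.At c) :
    ((fa.koszulBoundary μ).der c).lin (D.lin (freeGen _ _ n)) +
      D.lin (((fa.koszulBoundary μ).der c).lin (freeGen _ _ n)) =
        freeGen (fa.Q.sec c) (fa.koszulGens.degAt c) n := by
  classical
  rcases fa.gen_cases c n with ⟨m, hm⟩ | ⟨m, hm⟩ <;> rw [hm]
  · rw [D2, koszul_der_genX, map_zero, add_zero]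
    exact fa.koszul_der_genE_neg μ c m
  · rw [D3, map_zero, zero_add]
    obtain ⟨n, hn⟩ := m
    by_cases h : fa.G.deg n = 0
    · refine (congrArg D.lin (fa.koszul_der_genE_zero μ c ⟨⟨n, h⟩, hn⟩)).trans ?_
      rw [D1, Finset.sum_eq_single ⟨⟨n, h⟩, hn⟩]
      · rw [pdQ_coord, if_pos rfl, map_one, mul_one]
      · intro m _ hm
        rw [pdQ_coord, if_neg hm, map_zero, mul_zero]
      · simp
    · exact (congrArg D.lin (fa.koszul_der_genE_neg μ c ⟨⟨n, fa.deg_neg h⟩, hn⟩)).trans (D2 _)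

-- All values of D on coefficients and generators are multiples of generators e, or zero.
include D1 D2 D3 in
theorem contraction_mem (y : freeSec fa.Q fa.koszulGens c) : D.lin y ∈
    monoIdeal (fa.Q.sec c) (fa.koszulGens.degAt c) {n | ∃ m, n.1 = Sum.inr m} := by
  refine der_mem_monoIdeal D (fun q => ?_) ?_ y
  · rw [D1]
    exact Submodule.sum_mem _ fun n _ => gen_mul_mem_monoIdeal
      (show _ ∈ {n : fa.koszulGens.At c | ∃ m, n.1 = Sum.inr m} from ⟨n.1.1, rfl⟩) _
  · rintro ⟨n | n, hn⟩
    · have := gen_mul_mem_monoIdeal (A := fa.Q.sec c) (deg := fa.koszulGens.degAt c)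
        (T := {n | ∃ m, n.1 = Sum.inr m}) (j := ⟨Sum.inr n.1, hn⟩) ⟨n.1, rfl⟩ 1
      rw [mul_one] at this
      exact (congrArg (· ∈ monoIdeal _ _ _) (D2 ⟨n, hn⟩)).mpr this
    · exact (congrArg (· ∈ monoIdeal _ _ _) (D3 ⟨n, hn⟩)).mpr (Submodule.zero_mem _)

end

/-- Sending all generators to zero respects the differential: ∂e is a generator x or a coordinate τ,
and the augmentation kills τ by the choice of the translation. -/
theorem exists_koszulAug (R_nonpos : R.IsNonpos) (j_μ : j ≫ μ = 𝟙 R) :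
    ∃ ν : Boundary.presheaf (fa.koszulBoundary_isClosed (μ := μ) R_nonpos) ⟶ R,
      Boundary.inclusion _ ≫ ν = fa.k ≫ μ ∧ ∀ n, ap ν _ (Boundary.gens _ n) = 0 := by
  have hy := fa.koszulBoundary_isClosed (μ := μ) R_nonpos
  have free := Boundary.isFree hy
  exact free.exists_hom (fa.k ≫ μ) (fun _ => 0) (fun _ => Submodule.zero_mem _) (by
    rintro (n | n)
    · exact (congrArg _ (Boundary.d_gens hy (Sum.inl n))).trans ((map_zero _).trans (map_zero _).symm)
    · refine (congrArg _ (Boundary.d_gens hy (Sum.inr n))).trans (Eq.trans ?_ (map_zero _).symm)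
      change (free.gr _ _ _ _).toAlgHom (fa.koszulVal μ n) = 0
      unfold koszulVal
      split_ifs with h
      · refine (free.gr_base _ _ _ _ _).trans ?_
        exact (ap_comp _ _ _ _).trans (fa.aug_tau j_μ ⟨n, h⟩)
      · have := free.gr_gen (fa.k ≫ μ) (fun _ => 0) (fun _ => Submodule.zero_mem _) _
          (fa.koszulGens.self (Sum.inl ⟨n, fa.deg_neg h⟩))
        exact (congrArg _ (resTo_self _ _).symm).trans (this.trans (resTo_self _ _)))

theorem koszul_mem_adjoin (R_nonpos : R.IsNonpos) (c : Cell W) {m : ℤ}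
    {y : freeSec fa.Q fa.koszulGens c}
    (hT : y ∈ monoIdeal (fa.Q.sec c) (fa.koszulGens.degAt c) {n | ∃ m, n.1 = Sum.inr m})
    (hm : y ∈ (freeSec fa.Q fa.koszulGens c).deg m) : y ∈ Algebra.adjoin ℂ
      (Set.range (freeIncl (fa.Q.sec c) (fa.koszulGens.degAt c)).toAlgHom ∪
        (Set.range (fa.genE c) ∪ fa.genX c '' {n | m < fa.gensNeg.degAt c n})) := by
  have h1 := monoIdeal_mem_adjoin (fa.Q_nonpos R_nonpos c) 
    (fun n : fa.koszulGens.At c => fa.koszulGens_neg n.1) hT hm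
  refine Algebra.adjoin_mono (Set.union_subset_union_right _ ?_) h1
  rintro _ ⟨⟨n | n, hn⟩, h1, rfl⟩
  · refine Or.inr ⟨⟨n, hn⟩, ?_, rfl⟩
    rcases h1 with ⟨_, h1⟩ | h1
    · cases h1
    · exact h1
  · exact Or.inl ⟨⟨n, hn⟩, rfl⟩

-- The abstract contraction is applied with the Euler operator on Q and the averages along rays as
-- its inverses. The averages act on coefficients only, so the contraction inherits from D that its
-- values lie in the ideal of the e.
include hR in

theorem nonempty_koszul (R_nonpos : R.IsNonpos) (j_μ : j ≫ μ = 𝟙 R) : Nonempty (fa.Koszul μ) := by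
  have hy := fa.koszulBoundary_isClosed (μ := μ) R_nonpos
  have free := Boundary.isFree hy
  have hgens : Boundary.gens hy = sumSections (fun n => Boundary.gens hy (Sum.inl n))
      fun n => Boundary.gens hy (Sum.inr n) := by
    funext n
    rcases n with n | n <;> rfl
  obtain ⟨ν, hν, hνg⟩ := fa.exists_koszulAug R_nonpos j_μ
  choose D D1 D2 D3 using fun c => fa.exists_contraction (μ := μ) hR c
  have νg : ∀ c n, ap ν c (freeGen (fa.Q.sec c) (fa.koszulGens.degAt c) n) = 0 := fun c n => by
    refine (congrArg (ap ν c) (Boundary.resTo_gens hy c n).symm).trans ?_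
    rw [resTo_eq, ← res_ap, hνg, map_zero]
  have νκ : ∀ c q, ap ν c ((freeIncl (fa.Q.sec c) (fa.koszulGens.degAt c)).toAlgHom q) =
      ap μ c (ap fa.k c q) := fun c q => by
    have h1 := congrArg (fun f => ap f c q) hν
    simp only [ap_comp] at h1
    exact h1
  let w : ∀ c, GrHom (freeSec fa.Q fa.koszulGens c) (R.sec c) := fun c =>
    (toTwist ((fa.koszulBoundary μ).der c) (hy.der_der c)).comp (apG ν c)
  let T : ∀ c, Set (fa.koszulGens.At c) := fun c => {n | ∃ m, n.1 = Sum.inr m}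
  have DT : ∀ c y, (D c).lin y ∈ monoIdeal (fa.Q.sec c) (fa.koszulGens.degAt c) (T c) :=
    fun c y => fa.contraction_mem hR (D1 c) (D2 c) (D3 c) y
  let h : ∀ c, freeSec fa.Q fa.koszulGens c →ₗ[ℂ] freeSec fa.Q fa.koszulGens c := fun c => 
    rayFree (fa.rayQ μ hR c) (fa.koszulGens.degAt c) ∘ₗ (D c).lin
  have hT : ∀ c y, h c y ∈ monoIdeal (fa.Q.sec c) (fa.koszulGens.degAt c) (T c) := fun c y =>
    rayFree_mem_monoIdeal _ (DT c y)
  have h_mem : ∀ c {m} {y : freeSec fa.Q fa.koszulGens c},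
      y ∈ (freeSec fa.Q fa.koszulGens c).deg m → h c y ∈ (freeSec fa.Q fa.koszulGens c).deg (m - 1) :=
    fun c m y hm => rayFree_mem _ (fun k n a ha => fa.rayQ_mem hR c k ha) ((D c).map_deg hm)
  exact ⟨{
    K := Boundary.presheaf hy
    isSheaf := Boundary.isSheaf hy fa.isSheaf (fa.Q_nonpos R_nonpos) fa.koszulGens_neg
    κ := Boundary.inclusion hy
    x := fun n => Boundary.gens hy (Sum.inl n)
    e := fun n => Boundary.gens hy (Sum.inr n)
    isFree := (congrArg (fa.koszulGens.IsFree (Boundary.inclusion hy)) hgens).mp free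
    ν := ν
    κ_ν := hν
    ν_x := fun n => hνg (Sum.inl n)
    ν_e := fun n => hνg (Sum.inr n)
    d_x := fun n => Boundary.d_gens hy (Sum.inl n)
    d_e_zero := fun n => (Boundary.d_gens hy (Sum.inr n.1)).trans (dif_pos n.2)
    d_e_neg := fun n => (Boundary.d_gens hy (Sum.inr n.1)).trans
      (dif_neg (show ¬ fa.G.deg n.1 = 0 from n.2.ne))
    h := h
    h_mem := h_mem
    ν_h := fun c y => map_rayFree _ (w c) (νg c) _
    homotopy := fun c y => koszul_homotopy (E := fa.eulerQ μ hR c) (fa.rayQ μ hR c) (hy.der_der c)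
      (fa.contraction_base hR (D1 c) R_nonpos) (fa.contraction_gen hR (D1 c) (D2 c) (D3 c))
      (fun k q => fa.euler_rayQ hR c k q) (fun k q => fa.rayQ_euler hR c k q) (w c) (νg c)
      (fun y => ap_d ν c y) (apG fa.i c)
      (fun q hq => (fa.eq_of_eulerQ_eq_zero hR j_μ c q hq).trans
        (congrArg (ap fa.i c) (νκ c q).symm))
      (fun y => monoIdeal_mono (Set.subset_univ _) (DT c y)) y
    h_mem_span := fun c y => by
      refine Submodule.span_mono ?_ (monoIdeal_le_span (hT c y))
      rintro _ ⟨⟨_, hn⟩, ⟨m, rfl⟩, b, b', rfl⟩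
      exact ⟨⟨m, hn⟩, b, b', congrArg (fun z => b * z * b')
        (Boundary.resTo_gens hy c ⟨Sum.inr m, hn⟩).symm⟩
    h_mem_adjoin := fun c m y hm => by
      have h1 := fa.koszul_mem_adjoin R_nonpos c (hT c y) (h_mem c hm)
      have h2 : fa.G.shift.resTo (fun n => Boundary.gens hy (Sum.inr n)) c = fa.genE c :=
        funext fun n => Boundary.resTo_gens hy c ⟨Sum.inr n.1, n.2⟩
      have h3 : fa.gensNeg.resTo (fun n => Boundary.gens hy (Sum.inl n)) c = fa.genX c :=
        funext fun n => Boundary.resTo_gens hy c ⟨Sum.inl n.1, n.2⟩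
      rw [h2, h3]
      exact h1
  }⟩

end FreeAnalytic

end

/-! ### The Koszul resolution as a free algebra over S -/

section

variable {W : SimplicialSystem.{u}}

theorem CDGA.eq_of_mem_adjoin {A B : CDGA.{u}} (f g : A →ₐ[ℂ] B) {T : Set A}
    (h : ∀ a ∈ T, f a = g a) {a : A} (ha : a ∈ Algebra.adjoin ℂ T) : f a = g a := by
  induction ha using Algebra.adjoin_induction with
  | mem x hx => exact h x hx
  | algebraMap r => simp
  | add x y _ _ hx hy => rw [map_add, map_add, hx, hy]
  | mul x y _ _ hx hy => rw [map_mul, map_mul, hx, hy]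

theorem CDGA.map_mem_adjoin {A B : CDGA.{u}} (f : A →ₐ[ℂ] B) {T : Set A} {T' : Set B}
    {a : A} (ha : a ∈ Algebra.adjoin ℂ T) (h : ∀ a ∈ T, f a ∈ Algebra.adjoin ℂ T') :
    f a ∈ Algebra.adjoin ℂ T' :=
  Algebra.adjoin_le (S := (Algebra.adjoin ℂ T').comap f) h ha

namespace FreeAnalytic

open DGPresheaf Gens

variable {R S : DGPresheaf W} {HR : HolStructure R} {j : R ⟶ S} (fa : FreeAnalytic HR j)

/-- The generators of negative degree of `S`. -/
def fneg : fa.gensNeg.Sections S := fun n => fa.f n.1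

theorem free_neg : fa.gensNeg.IsFree fa.k fa.fneg := fa.free

theorem d_fneg_mem (n : fa.gensNeg.idx) : (S.sec _).d (fa.fneg n) ∈
    (S.sec (Cell.whole (fa.gensNeg.face n))).deg (fa.gensNeg.deg n + 1) :=
  (S.sec _).d_mem (fa.free.1 n)

end FreeAnalytic

namespace FreeAnalytic.Koszul

open DGPresheaf Slice CDGA Gens CDGA.Poly

variable {R S : DGPresheaf W} {HR : HolStructure R} {j : R ⟶ S} {fa : FreeAnalytic HR j} {μ : S ⟶ R}
  (kz : fa.Koszul μ)

/-- Values of a graded homomorphism on the generators of negative degree. -/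
abbrev Values : Type u :=
  {z : fa.gensNeg.Sections kz.K // ∀ n, z n ∈ (kz.K.sec _).deg (fa.gensNeg.deg n)}

variable {kz} in
/-- The graded homomorphism with given values. -/
def Values.hom (z : kz.Values) (c : Cell W) : GrHom (S.sec c) (kz.K.sec c) :=
  fa.free_neg.gr kz.κ z.1 z.2 c

/-- The augmentation followed by the inclusion of `R`. -/
def unit (c : Cell W) : S.sec c →ₐ[ℂ] kz.K.sec c :=
  (ap kz.κ c).comp ((ap fa.i c).comp (ap μ c))

theorem unit_mem (c : Cell W) {m : ℤ} {s : S.sec c} (hs : s ∈ (S.sec c).deg m) :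
    kz.unit c s ∈ (kz.K.sec c).deg m := ap_mem _ _ (ap_mem _ _ (ap_mem _ _ hs))

theorem d_unit (c : Cell W) (s : S.sec c) :
    (kz.K.sec c).d (kz.unit c s) = kz.unit c ((S.sec c).d s) := by
  simp only [unit, AlgHom.comp_apply, ap_d]

theorem res_unit {c' c : Cell W} (h : c' ≤ c) (s : S.sec c) :
    kz.K.res h (kz.unit c s) = kz.unit c' (S.res h s) := by
  simp only [unit, AlgHom.comp_apply, res_ap]

theorem ν_κ (c : Cell W) (q : fa.Q.sec c) : ap kz.ν c (ap kz.κ c q) = ap μ c (ap fa.k c q) := by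
  rw [← ap_comp, kz.κ_ν, ap_comp]

theorem ν_unit (j_μ : j ≫ μ = 𝟙 R) (c : Cell W) (s : S.sec c) :
    ap kz.ν c (kz.unit c s) = ap μ c s := by
  simp only [unit, AlgHom.comp_apply]
  rw [ν_κ, fa.aug_i j_μ]

variable {kz} in
/-- The defect of a homomorphism. -/
def Values.defect (z : kz.Values) (n : fa.gensNeg.idx) :
    kz.K.sec (Cell.whole (fa.gensNeg.face n)) :=
  (z.hom _).toAlgHom ((S.sec _).d (fa.fneg n)) - kz.unit _ ((S.sec _).d (fa.fneg n))

variable {kz} in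
theorem Values.defect_mem (z : kz.Values) (n : fa.gensNeg.idx) :
    z.defect n ∈ (kz.K.sec _).deg (fa.gensNeg.deg n + 1) :=
  Submodule.sub_mem _ ((z.hom _).map_deg (fa.d_fneg_mem n)) (kz.unit_mem _ (fa.d_fneg_mem n))

variable {kz} in
/-- The correction of the values by the contraction. -/
def Values.step (z : kz.Values) : kz.Values :=
  ⟨fun n => kz.unit _ (fa.fneg n) + kz.x n + kz.h _ (z.defect n), fun n => by
    refine Submodule.add_mem _ (Submodule.add_mem _ (kz.unit_mem _ (fa.free_neg.1 n))
      (kz.isFree.1 (Sum.inl n))) ?_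
    simpa using kz.h_mem _ (z.defect_mem n)⟩

-- An element of degree m is a polynomial over Q in generators of degree at least m, so only the
-- values on these matter.
variable {kz} in
theorem Values.hom_congr (hQ : fa.Q.IsNonpos) {z z' : kz.Values} {N : ℤ}
    (h : ∀ n, N ≤ fa.gensNeg.deg n → z.1 n = z'.1 n) {c : Cell W} {m : ℤ} (hm : N ≤ m)
    {s : S.sec c} (hs : s ∈ (S.sec c).deg m) : (z.hom c).toAlgHom s = (z'.hom c).toAlgHom s := by
  refine eq_of_mem_adjoin _ _ ?_ ((fa.free_neg.on c).mem_adjoin (hQ c) (fun n => n.1.2.le) hs)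
  rintro _ (⟨q, rfl⟩ | ⟨n, hn, rfl⟩)
  · exact (fa.free_neg.gr_base _ _ _ _ _).trans (fa.free_neg.gr_base _ _ _ _ _).symm
  · refine (fa.free_neg.gr_gen _ _ _ _ _).trans (Eq.trans ?_ (fa.free_neg.gr_gen _ _ _ _ _).symm)
    rw [resTo_eq, resTo_eq, h n.1 (hm.trans hn)]

variable {kz} in
theorem Values.defect_congr (hQ : fa.Q.IsNonpos) {z z' : kz.Values} {N : ℤ}
    (h : ∀ n, N ≤ fa.gensNeg.deg n → z.1 n = z'.1 n) {n : fa.gensNeg.idx}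
    (hn : N ≤ fa.gensNeg.deg n + 1) : z.defect n = z'.defect n := by
  unfold defect
  rw [hom_congr hQ h hn (fa.d_fneg_mem n)]

/-- The element ∂f has degree one above that of f, so the defect at f depends only on the values in
larger degrees. The fixed-point equation is therefore solved by iteration, the k-th iterate being
final in degrees at least -k. -/
theorem exists_values (hQ : fa.Q.IsNonpos) : ∃ z : kz.Values,
    ∀ n, z.1 n = kz.unit _ (fa.fneg n) + kz.x n + kz.h _ (z.defect n) := by
  let Z : ℕ → kz.Values := fun k => Values.step^[k]
    ⟨kz.x, fun n => kz.isFree.1 (Sum.inl n)⟩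
  have Z_succ : ∀ k, Z (k + 1) = (Z k).step := fun k => Function.iterate_succ_apply' _ _ _
  have stable : ∀ (k : ℕ) n, -(k : ℤ) ≤ fa.gensNeg.deg n → (Z (k + 1)).1 n = (Z k).1 n := by
    intro k
    induction k with
    | zero =>
      intro n hn
      have : fa.gensNeg.deg n < 0 := n.2
      simp only [Nat.cast_zero, neg_zero] at hn
      omega
    | succ k ih =>
      intro n hn
      rw [Z_succ (k + 1), Z_succ k]
      change _ + _ + kz.h _ (Values.defect _ n) = _ + _ + kz.h _ (Values.defect _ n)
      rw [← Z_succ k, Values.defect_congr hQ ih]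
      push_cast at hn
      omega
  have stable' : ∀ (l k : ℕ) n, -(k : ℤ) ≤ fa.gensNeg.deg n → (Z (k + l)).1 n = (Z k).1 n := by
    intro l
    induction l with
    | zero => exact fun _ _ _ => rfl
    | succ l ih =>
      intro k n hn
      rw [← add_assoc, stable _ _ (by push_cast; omega), ih k n hn]
  let z : kz.Values := ⟨fun n => (Z (-fa.gensNeg.deg n).toNat).1 n, fun n => (Z _).2 n⟩
  have hz : ∀ (k : ℕ) n, -(k : ℤ) ≤ fa.gensNeg.deg n → z.1 n = (Z k).1 n := fun k n hn => by
    obtain ⟨l, hl⟩ := Nat.exists_eq_add_of_le (show (-fa.gensNeg.deg n).toNat ≤ k by omega)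
    rw [hl, stable' l]
    omega
  refine ⟨z, fun n => ?_⟩
  have hn : fa.gensNeg.deg n < 0 := n.2
  obtain ⟨k, hk⟩ : ∃ k : ℕ, fa.gensNeg.deg n = -(k : ℤ) - 1 :=
    ⟨(-fa.gensNeg.deg n - 1).toNat, by omega⟩
  rw [hz (k + 1) n (by push_cast; omega), Z_succ, Values.defect_congr hQ (hz k) (by omega)]
  rfl

section

variable {kz} {z : kz.Values}
  (hz : ∀ n, z.1 n = kz.unit _ (fa.fneg n) + kz.x n + kz.h _ (z.defect n))

include hz

/-- The augmentation kills x and the values of the contraction, so only μ(f) survives on generators.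
-/
theorem ν_hom (j_μ : j ≫ μ = 𝟙 R) (c : Cell W) (s : S.sec c) :
    ap kz.ν c ((z.hom c).toAlgHom s) = ap μ c s := by
  have : (z.hom c).comp (apG kz.ν c) = apG μ c := (fa.free_neg.on c).hom_ext
    (fun q => (congrArg (ap kz.ν c) (fa.free_neg.gr_base _ _ _ _ _)).trans (kz.ν_κ c q))
    (fun n => by
      have h : ap kz.ν _ (z.1 n.1) = ap μ _ (fa.fneg n.1) := by
        rw [hz, map_add, map_add, kz.ν_x, kz.ν_h, add_zero, add_zero, kz.ν_unit j_μ]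
      refine (congrArg (ap kz.ν c) (fa.free_neg.gr_gen _ _ _ _ _)).trans ?_
      exact ((res_ap _ _ _).symm.trans (congrArg (R.res (Cell.le_whole n.2)) h)).trans
        (res_ap _ _ _))
  exact congrArg (fun f : GrHom _ _ => f.toAlgHom s) this

/-- By induction on the negative of the degree, the homomorphism commutes with the differential on
∂f, which makes the defect a cycle. The defect is also killed by the augmentation, so the
contraction gives ∂h(defect) = defect, and adding ∂ of μ(f) yields the image of ∂f. -/
theorem d_hom (hQ : fa.Q.IsNonpos) (j_μ : j ≫ μ = 𝟙 R) (n : fa.gensNeg.idx) :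
    (z.hom _).toAlgHom ((S.sec _).d (fa.fneg n)) = (kz.K.sec _).d (z.1 n) := by
  have key : ∀ (N : ℕ) n, -(N : ℤ) ≤ fa.gensNeg.deg n →
      (z.hom _).toAlgHom ((S.sec _).d (fa.fneg n)) = (kz.K.sec _).d (z.1 n) := by
    intro N
    induction N with
    | zero =>
      intro n hn
      have : fa.gensNeg.deg n < 0 := n.2
      simp only [Nat.cast_zero, neg_zero] at hn
      omega
    | succ N ih =>
      intro n hn
      have h1 : ∀ s ∈ (S.sec (Cell.whole (fa.gensNeg.face n))).deg (fa.gensNeg.deg n + 1),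
          (z.hom _).toAlgHom ((S.sec _).d s) = (kz.K.sec _).d ((z.hom _).toAlgHom s) := by
        intro s hs
        set c := Cell.whole (fa.gensNeg.face n)
        let D1 : GrDer (z.hom c) 1 := (S.sec c).dDer.comp (z.hom c)
        let D2 : GrDer (z.hom c) 1 := (kz.K.sec c).dDer.precomp (z.hom c)
        refine sub_eq_zero.1 ((D1.sub D2).eq_zero_of_mem_adjoin ?_
          ((fa.free_neg.on c).mem_adjoin (hQ c) (fun n => n.1.2.le) hs))
        rintro _ (⟨q, rfl⟩ | ⟨m, hm, rfl⟩)
        · refine sub_eq_zero.2 ?_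
          change (z.hom c).toAlgHom ((S.sec c).d (ap fa.k c q)) =
            (kz.K.sec c).d ((z.hom c).toAlgHom (ap fa.k c q))
          rw [← ap_d, Values.hom, fa.free_neg.gr_base, fa.free_neg.gr_base, ap_d]
        · refine sub_eq_zero.2 ?_
          change (z.hom c).toAlgHom ((S.sec c).d _) = (kz.K.sec c).d ((z.hom c).toAlgHom _)
          have h2 := ih m.1 (by
            have h3 : fa.gensNeg.deg n + 1 ≤ fa.gensNeg.deg m.1 := hm
            push_cast at hn
            omega)
          rw [Values.hom, fa.free_neg.gr_gen, resTo_eq, resTo_eq, ← res_d, ← res_d, ← fa.free_neg.res_gr]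
          exact congrArg _ h2
      have h2 : ap kz.ν _ (z.defect n) = 0 := by
        rw [Values.defect, map_sub, ν_hom hz j_μ, kz.ν_unit j_μ, sub_self]
      have h3 : (kz.K.sec _).d (z.defect n) = 0 := by
        rw [Values.defect, map_sub, ← h1 _ (fa.d_fneg_mem n), kz.d_unit, (S.sec _).d_d, map_zero,
          map_zero, sub_zero]
      have h4 := kz.homotopy _ (z.defect n)
      rw [h2, h3, map_zero, map_zero, map_zero, sub_zero, add_zero] at h4
      rw [hz, map_add, map_add, kz.d_unit, kz.d_x, h4, add_zero, Values.defect, add_sub_cancel]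
  exact key (-fa.gensNeg.deg n).toNat n (by omega)

end

/-- The structure of an `S`-algebra on the Koszul resolution. -/
theorem exists_structure (hQ : fa.Q.IsNonpos) (j_μ : j ≫ μ = 𝟙 R) : ∃ φ : S ⟶ kz.K,
    fa.k ≫ φ = kz.κ ∧ φ ≫ kz.ν = μ ∧ ∀ n : fa.gensNeg.idx, ∃ y, 
      y ∈ (kz.K.sec _).deg (fa.gensNeg.deg n + 1) ∧
      ap φ _ (fa.fneg n) = kz.unit _ (fa.fneg n) + kz.x n + kz.h _ y := by
  obtain ⟨z, hz⟩ := kz.exists_values hQ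
  obtain ⟨φ, h1, h2⟩ := fa.free_neg.exists_hom kz.κ z.1 z.2 (d_hom hz hQ j_μ)
  refine ⟨φ, h1, fa.free_neg.hom_ext ?_ fun n => ?_, fun n =>
    ⟨z.defect n, z.defect_mem n, (h2 n).trans (hz n)⟩⟩
  · rw [← Category.assoc, h1, kz.κ_ν]
  · rw [ap_comp, h2, hz, map_add, map_add, kz.ν_x, kz.ν_h, add_zero, add_zero, kz.ν_unit j_μ]

/-- The image of f is x plus an element of Q plus a value of the contraction, which is a polynomial
in the e and in those x of larger degree. So the images of the f can replace the x as generators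
over Q; S being free over Q on the f, the e remain as generators over S. -/
theorem isFree_e {φ : S ⟶ kz.K} (hφ : fa.k ≫ φ = kz.κ)
    (h : ∀ n : fa.gensNeg.idx, ∃ y, y ∈ (kz.K.sec _).deg (fa.gensNeg.deg n + 1) ∧
      ap φ _ (fa.fneg n) = kz.unit _ (fa.fneg n) + kz.x n + kz.h _ y) :
    fa.G.shift.IsFree φ kz.e := by
  choose y hy hf using h
  refine isFree_iff.2 ⟨fun n => kz.isFree.1 (Sum.inr n), fun c => ?_⟩
  have h0 := (kz.isFree.on c).reindex (fa.gensNeg.sumAt fa.G.shift c)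
  let e' : fa.gensNeg.At c ⊕ fa.G.shift.At c → kz.K.sec c :=
    Sum.elim (fun n => ap φ c (fa.gensNeg.resTo fa.fneg c n)) (fa.G.shift.resTo kz.e c)
  let a : fa.gensNeg.At c ⊕ fa.G.shift.At c → fa.Q.sec c :=
    Sum.elim (fun n => ap fa.i c (ap μ c (fa.gensNeg.resTo fa.fneg c n))) 0
  let b : fa.gensNeg.At c ⊕ fa.G.shift.At c → kz.K.sec c :=
    Sum.elim (fun n => kz.K.res (Cell.le_whole n.2) (kz.h _ (y n.1))) 0
  -- The generators e have rank 0 and are unchanged. The rank of x is the negative of its degree,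
  -- hence positive, so that corrections may involve every e and the x of larger degree.
  have h1 := h0.of_triangular (e' := e') (a := a) (b := b)
    (Sum.elim (fun n => (-fa.gensNeg.degAt c n).toNat) fun _ => 0) ?_ ?_ ?_ ?_ ?_
  · refine (fa.free_neg.on c).of_sum ?_
    have h2 : (apG fa.k c).comp (apG φ c) = apG kz.κ c := by
      rw [← hφ]
      exact GrHom.ext_fun fun q => (ap_comp _ _ _ _).symm
    rw [h2]
    have h3 : (fun n => (fa.gensNeg.sum fa.G.shift).degAt c (fa.gensNeg.sumAt fa.G.shift c n)) =
        Sum.elim (fa.gensNeg.degAt c) (fa.G.shift.degAt c) := by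
      funext n
      rcases n with n | n <;> rfl
    rw [h3] at h1
    exact h1
  · rintro (n | n)
    · exact ap_mem _ _ (resTo_mem fa.free_neg.1 c n)
    · exact resTo_mem (fun n => kz.isFree.1 (Sum.inr n)) c n
  · rintro (n | n)
    · exact ap_mem _ _ (ap_mem _ _ (resTo_mem fa.free_neg.1 c n))
    · exact Submodule.zero_mem _
  · rintro (n | n)
    · have h1 := kz.h_mem _ (hy n.1)
      rw [add_sub_cancel_right] at h1
      exact res_mem _ h1
    · exact Submodule.zero_mem _
  · rintro (n | n)
    · change ap φ c _ = _ + ap kz.κ c _ + kz.K.res _ _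
      have h2 := congrArg (kz.K.res (Cell.le_whole n.2)) (hf n.1)
      rw [res_ap, map_add, map_add, res_unit, add_comm (kz.unit _ _)] at h2
      exact h2
    · change fa.G.shift.resTo kz.e c n = _ + ap kz.κ c 0 + 0
      rw [map_zero, add_zero, add_zero]
      rfl
  · rintro (n | n)
    · have hn : fa.gensNeg.deg n.1 < 0 := n.1.2
      refine map_mem_adjoin (kz.K.res (Cell.le_whole n.2)) (kz.h_mem_adjoin _ (hy n.1)) ?_
      rintro _ (⟨q, rfl⟩ | ⟨m, rfl⟩ | ⟨m, hm, rfl⟩)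
      · rw [res_ap]
        exact Algebra.subset_adjoin (Or.inl ⟨_, rfl⟩)
      · rw [res_resTo]
        refine Algebra.subset_adjoin (Or.inr ⟨Sum.inr ⟨m.1, m.2.trans n.2⟩, ?_, rfl⟩)
        change 0 < (-fa.gensNeg.deg n.1).toNat
        omega
      · rw [res_resTo]
        refine Algebra.subset_adjoin (Or.inr ⟨Sum.inl ⟨m.1, m.2.trans n.2⟩, ?_, rfl⟩)
        have h1 : fa.gensNeg.deg n.1 + 1 - 1 < fa.gensNeg.deg m.1 := hm
        change (-fa.gensNeg.deg m.1).toNat < (-fa.gensNeg.deg n.1).toNat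
        omega
    · exact Subalgebra.zero_mem _

end FreeAnalytic.Koszul

end

/-! ### Exponentials of locally nilpotent derivations, and weights -/

section

section LocallyNilpotent

variable {A : Type u} [Ring A] [Algebra ℂ A] (D : A →ₗ[ℂ] A)

/-- The terms of the exponential series of `-D`. -/
def expTerm (n : ℕ) : A →ₗ[ℂ] A := ((-1 : ℂ) ^ n / (n.factorial : ℂ)) • D ^ n

theorem expTerm_succ (n : ℕ) (x : A) :
    ((n : ℂ) + 1) • expTerm D (n + 1) x = -D (expTerm D n x) := by
  have h : ((n : ℂ) + 1) ≠ 0 := Nat.cast_add_one_ne_zero n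
  simp only [expTerm, LinearMap.smul_apply, pow_succ' D, Module.End.mul_apply, smul_smul, map_smul]
  rw [← neg_smul]
  congr 1
  rw [Nat.factorial_succ]
  push_cast
  field_simp
  ring

/-- The Leibniz rule for divided powers: by (n + 1) Eₙ₊₁ = -D Eₙ it follows by induction, after
splitting n + 1 as the sum of the two indices in each term. -/
theorem expTerm_mul (hD : ∀ x y, D (x * y) = D x * y + x * D y) (n : ℕ) (x y : A) :
    expTerm D n (x * y) = ∑ p ∈ Finset.HasAntidiagonal.antidiagonal n, expTerm D p.1 x * expTerm D p.2 y := by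
  induction n with
  | zero => simp [expTerm]
  | succ n ih =>
    have h : ((n : ℂ) + 1) ≠ 0 := Nat.cast_add_one_ne_zero n
    refine smul_right_injective A h ?_
    change ((n : ℂ) + 1) • _ = ((n : ℂ) + 1) • _
    rw [expTerm_succ, ih, map_sum, ← Finset.sum_neg_distrib]
    have h1 : ((n : ℂ) + 1) • ∑ p ∈ Finset.HasAntidiagonal.antidiagonal (n + 1),
        expTerm D p.1 x * expTerm D p.2 y =
        ∑ p ∈ Finset.HasAntidiagonal.antidiagonal (n + 1), (((p.1 : ℂ) • expTerm D p.1 x) * expTerm D p.2 y +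
          expTerm D p.1 x * ((p.2 : ℂ) • expTerm D p.2 y)) := by
      rw [Finset.smul_sum]
      refine Finset.sum_congr rfl fun p hp => ?_
      have h2 : (p.1 : ℂ) + p.2 = n + 1 := by exact_mod_cast Finset.HasAntidiagonal.mem_antidiagonal.1 hp
      rw [smul_mul_assoc, mul_smul_comm, ← add_smul, h2]
    rw [h1, Finset.sum_add_distrib, Finset.Nat.sum_antidiagonal_succ,
      Finset.Nat.sum_antidiagonal_succ']
    simp only [Nat.cast_zero, zero_smul, zero_mul, mul_zero, zero_add, Nat.cast_add,
      Nat.cast_one, expTerm_succ]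
    rw [← Finset.sum_add_distrib]
    exact Finset.sum_congr rfl fun p _ => by rw [hD]; noncomm_ring

variable {D} in
theorem pow_apply_eq_zero_of_le {x : A} {m n : ℕ} (h : (D ^ m) x = 0) (hn : m ≤ n) : (D ^ n) x = 0 := by
  obtain ⟨k, rfl⟩ := Nat.exists_eq_add_of_le hn
  rw [add_comm, pow_add, Module.End.mul_apply, h, map_zero]

/-- The exponential of the negative of a locally nilpotent derivation is an algebra
homomorphism. -/
theorem exists_expNeg (hD : ∀ x y, D (x * y) = D x * y + x * D y) (hn : ∀ x, ∃ N : ℕ, (D ^ N) x = 0) :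
    ∃ E : A →ₐ[ℂ] A, ∀ x N, (D ^ N) x = 0 → E x = ∑ n ∈ Finset.range N, expTerm D n x := by
  choose N hN using hn
  -- The exponential series is recorded as a polynomial in an auxiliary variable, so that
  -- multiplicativity becomes a comparison of coefficients without truncation bounds. Evaluation at
  -- 1 is multiplicative although A is not commutative, since 1 is central.
  let P : A → Polynomial A := fun x =>
    ∑ n ∈ Finset.range (N x), Polynomial.monomial n (expTerm D n x)
  have P_sum : ∀ x m, (D ^ m) x = 0 →
      P x = ∑ n ∈ Finset.range m, Polynomial.monomial n (expTerm D n x) := by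
    have key : ∀ x {m k}, (D ^ m) x = 0 → m ≤ k →
        ∑ n ∈ Finset.range m, Polynomial.monomial n (expTerm D n x) =
        ∑ n ∈ Finset.range k, Polynomial.monomial n (expTerm D n x) := fun x m k h hk =>
      Finset.sum_subset (Finset.range_mono hk) fun n _ hn => by
        rw [expTerm, LinearMap.smul_apply, pow_apply_eq_zero_of_le h (by simpa using hn), smul_zero,
          map_zero]
    intro x m hm
    rcases le_total (N x) m with h | h
    · exact key x (hN x) h
    · exact (key x hm h).symm
  have coeff_P : ∀ x n, (P x).coeff n = expTerm D n x := fun x n => by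
    rw [P_sum x (max (N x) (n + 1)) (pow_apply_eq_zero_of_le (hN x) (le_max_left _ _))]
    simp only [Polynomial.finsetSum_coeff, Polynomial.coeff_monomial, Finset.sum_ite_eq',
      Finset.mem_range]
    rw [if_pos (lt_of_lt_of_le n.lt_succ_self (le_max_right _ _))]
  let ev : Polynomial A →+* A := Polynomial.eval₂RingHom' (RingHom.id A) 1 fun a => Commute.one_right a
  have ev_sum : ∀ x m, (D ^ m) x = 0 → ev (P x) = ∑ n ∈ Finset.range m, expTerm D n x := by
    intro x m hm
    rw [P_sum x m hm, map_sum]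
    refine Finset.sum_congr rfl fun n _ => ?_
    change Polynomial.eval₂ (RingHom.id A) 1 _ = _
    rw [Polynomial.eval₂_monomial]
    simp
  have one : P 1 = 1 := by
    have h1 : D 1 = 0 := by simpa using hD 1 1
    rw [P_sum 1 1 (by rw [pow_one, h1])]
    simp [expTerm]
  refine ⟨AlgHom.ofLinearMap ⟨⟨fun x => ev (P x), fun x y => ?_⟩, fun c x => ?_⟩ ?_ ?_, ev_sum⟩
  · rw [← map_add]
    exact congrArg ev (Polynomial.ext fun n => by simp only [Polynomial.coeff_add, coeff_P, map_add])
  · have h : (D ^ N x) (c • x) = 0 := by rw [map_smul, hN, smul_zero]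
    change ev (P _) = c • ev (P x)
    rw [ev_sum x _ (hN x), ev_sum _ _ h, Finset.smul_sum]
    exact Finset.sum_congr rfl fun n _ => map_smul _ _ _
  · change ev (P 1) = 1
    rw [one, map_one]
  · intro x y
    change ev (P _) = ev (P x) * ev (P y)
    rw [← map_mul]
    exact congrArg ev (Polynomial.ext fun n => by
      rw [Polynomial.coeff_mul, coeff_P, expTerm_mul D hD]
      simp only [coeff_P])

end LocallyNilpotent

namespace CDGA

section

variable {A B C : CDGA.{u}} {X : Type u} [LinearOrder X] {deg : X → ℤ} {φ : GrHom A B} {e : X → B}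

theorem IsFreeOn.nonpos (h : IsFreeOn φ deg e) (hA : ∀ n, 0 < n → A.deg n = ⊥)
    (hd : ∀ j, deg j ≤ 0) (n : ℤ) (hn : 0 < n) : B.deg n = ⊥ := by
  refine eq_bot_iff.2 fun b hb => ?_
  refine h.degree_induction (P := fun b => b ∈ (⊥ : Submodule ℂ B)) (Submodule.zero_mem _)
    (fun _ _ => Submodule.add_mem _) (fun s i _ hi a ha => ?_) hb
  have hs : Mono.mdeg deg s ≤ 0 := by
    induction s using Multiset.induction with
    | empty => simp
    | cons j s ih => exact (mdeg_le_of_mem (fun j _ => hd j) (Multiset.mem_cons_self j s)).trans (hd j)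
  rw [hA i (by omega)] at ha
  rw [(Submodule.mem_bot ℂ).1 ha, map_zero, zero_mul]
  exact Submodule.zero_mem _

/-- A derivation of a free algebra has values in a graded ideal if this holds for the coefficients
and the generators. -/
theorem IsFreeOn.der_mem (h : IsFreeOn φ deg e) {f : GrHom B C} {n : ℤ} (D : GrDer f n)
    (I : ℤ → Submodule ℂ C)
    (hl : ∀ {i m : ℤ} {x y : C}, x ∈ C.deg i → y ∈ I m → x * y ∈ I (i + m))
    (hr : ∀ {i m : ℤ} {x y : C}, x ∈ C.deg i → y ∈ I m → y * x ∈ I (m + i))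
    (hb : ∀ {i : ℤ} {a : A}, a ∈ A.deg i → D.lin (φ.toAlgHom a) ∈ I (i + n))
    (hg : ∀ j, D.lin (e j) ∈ I (deg j + n)) {m : ℤ} {b : B} (hm : b ∈ B.deg m) :
    D.lin b ∈ I (m + n) := by
  have key : ∀ {i k : ℤ} {x y : B}, x ∈ B.deg i → y ∈ B.deg k → D.lin x ∈ I (i + n) →
      D.lin y ∈ I (k + n) → D.lin (x * y) ∈ I (i + k + n) := by
    intro i k x y hx hy h1 h2
    rw [D.leibniz]
    have h3 := hr (f.map_deg hy) h1
    have h4 := hl (f.map_deg (sgn_mem n hx)) h2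
    rw [show i + n + k = i + k + n by ring] at h3
    rw [← add_assoc] at h4
    exact Submodule.add_mem _ h3 h4
  have key' : ∀ l : List X, (l.map e).prod ∈ B.deg (l.map deg).sum ∧
      D.lin (l.map e).prod ∈ I ((l.map deg).sum + n) := by
    intro l
    induction l with
    | nil =>
      refine ⟨B.one_mem, ?_⟩
      change D.lin 1 ∈ _
      rw [D.map_one]
      exact Submodule.zero_mem _
    | cons j l ih =>
      simp only [List.map_cons, List.prod_cons, List.sum_cons]
      exact ⟨B.mul_mem (h.1 j) ih.1, key (h.1 j) ih.1 (hg j) ih.2⟩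
  refine h.degree_induction (P := fun b => D.lin b ∈ I (m + n))
    (by rw [map_zero]; exact Submodule.zero_mem _)
    (fun x y hx hy => by rw [map_add]; exact Submodule.add_mem _ hx hy) (fun s i _ hi a ha => ?_) hm
  have hs : Mono.mdeg deg s = ((s.sort (· ≤ ·)).map deg).sum := by
    conv_lhs => rw [← Multiset.sort_eq s (· ≤ ·)]
    rfl
  rw [← hi, hs]
  exact key (φ.map_deg ha) (key' _).1 (hb ha) (key' _).2

end

section Weight

variable {T : CDGA.{u}} (X : ℤ → Set T)

/-- The homogeneous elements of degree `m` that are sums of products with at least `k` factors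
from `X`. -/
def weight : ℕ → ℤ → Submodule ℂ T
  | 0, m => T.deg m
  | k + 1, m => Submodule.span ℂ
      {y | ∃ a b, a + b = m ∧ ∃ x ∈ weight k a, ∃ z ∈ X b, y = x * z}

variable {X}

theorem weight_le_deg (hX : ∀ b, X b ⊆ T.deg b) (k : ℕ) (m : ℤ) : weight X k m ≤ T.deg m := by
  induction k generalizing m with
  | zero => exact le_rfl
  | succ k ih =>
    refine Submodule.span_le.2 ?_
    rintro _ ⟨a, b, rfl, x, hx, z, hz, rfl⟩
    exact T.mul_mem (ih a hx) (hX b hz)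

theorem weight_succ_le (hX : ∀ b, X b ⊆ T.deg b) (k : ℕ) (m : ℤ) :
    weight X (k + 1) m ≤ weight X k m := by
  induction k generalizing m with
  | zero => exact weight_le_deg hX 1 m
  | succ k ih =>
    refine Submodule.span_le.2 ?_
    rintro _ ⟨a, b, rfl, x, hx, z, hz, rfl⟩
    exact Submodule.subset_span ⟨a, b, rfl, x, ih a hx, z, hz, rfl⟩

theorem weight_antitone (hX : ∀ b, X b ⊆ T.deg b) (m : ℤ) : Antitone fun k => weight X k m :=
  antitone_nat_of_succ_le fun k => weight_succ_le hX k m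

theorem mul_mem_weight (k : ℕ) {i m : ℤ} {x y : T} (hx : x ∈ T.deg i) (hy : y ∈ weight X k m) :
    x * y ∈ weight X k (i + m) := by
  induction k generalizing m y with
  | zero => exact T.mul_mem hx hy
  | succ k ih =>
    refine Submodule.span_induction (p := fun y _ => x * y ∈ weight X (k + 1) (i + m)) ?_ ?_ ?_ ?_ hy
    · rintro _ ⟨a, b, rfl, x', hx', z, hz, rfl⟩
      exact Submodule.subset_span ⟨i + a, b, add_assoc _ _ _, _, ih hx', z, hz, (mul_assoc _ _ _).symm⟩
    · rw [mul_zero]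
      exact Submodule.zero_mem _
    · intro y y' _ _ h h'
      rw [mul_add]
      exact Submodule.add_mem _ h h'
    · intro c y _ h
      rw [mul_smul_comm]
      exact Submodule.smul_mem _ c h

theorem weight_mul_mem (hX : ∀ b, X b ⊆ T.deg b) (k : ℕ) {i m : ℤ} {x y : T} (hx : x ∈ T.deg i)
    (hy : y ∈ weight X k m) : y * x ∈ weight X k (m + i) := by
  rw [T.comm (weight_le_deg hX k m hy) hx, add_comm]
  rcases Int.units_eq_one_or (m * i).negOnePow with h | h
  · rw [h, one_smul]
    exact mul_mem_weight k hx hy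
  · rw [h, Units.neg_smul, one_smul]
    exact Submodule.neg_mem _ (mul_mem_weight k hx hy)

/-- Nonzero factors from X have degree at most -1, and the remaining factor has degree at most 0, so
an element of weight k lives in degrees at most -k. -/
theorem weight_eq_zero (hT : ∀ n, 0 < n → T.deg n = ⊥) (hX0 : ∀ b, 0 ≤ b → ∀ z ∈ X b, z = 0)
    (k : ℕ) {m : ℤ} (hm : -(k : ℤ) < m) {y : T} (hy : y ∈ weight X k m) : y = 0 := by
  induction k generalizing m y with
  | zero =>
    have h : y ∈ T.deg m := hy
    rw [hT m (by simpa using hm)] at h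
    exact h
  | succ k ih =>
    refine (Submodule.mem_bot ℂ).1 (Submodule.span_le.2 ?_ hy)
    rintro _ ⟨a, b, rfl, x, hx, z, hz, rfl⟩
    rcases le_or_gt 0 b with hb | hb
    · rw [hX0 b hb z hz, mul_zero]
      exact Submodule.zero_mem _
    · rw [ih (by push_cast at hm; omega) hx, zero_mul]
      exact Submodule.zero_mem _

/-- A derivation that kills `X` and raises the weight of all elements. -/
theorem der_mem_weight {D : T →ₗ[ℂ] T} (hD : ∀ x y, D (x * y) = D x * y + x * D y)
    (hDX : ∀ b, ∀ z ∈ X b, D z = 0) (h1 : ∀ {m : ℤ} {y : T}, y ∈ T.deg m → D y ∈ weight X 1 m)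
    (k : ℕ) {m : ℤ} {y : T} (hy : y ∈ weight X k m) : D y ∈ weight X (k + 1) m := by
  induction k generalizing m y with
  | zero => exact h1 hy
  | succ k ih =>
    refine (Submodule.span_le (p := (weight X (k + 1 + 1) m).comap D)).2 ?_ hy
    rintro _ ⟨a, b, rfl, x, hx, z, hz, rfl⟩
    change D (x * z) ∈ weight X (k + 1 + 1) (a + b)
    rw [hD, hDX b z hz, mul_zero, add_zero]
    exact Submodule.subset_span ⟨a, b, rfl, _, ih hx, z, hz, rfl⟩

theorem pow_mem_weight {D : T →ₗ[ℂ] T} (hD : ∀ x y, D (x * y) = D x * y + x * D y)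
    (hDX : ∀ b, ∀ z ∈ X b, D z = 0) (h1 : ∀ {m : ℤ} {y : T}, y ∈ T.deg m → D y ∈ weight X 1 m)
    {m : ℤ} {y : T} (hy : y ∈ T.deg m) (k : ℕ) : (D ^ k) y ∈ weight X k m := by
  induction k with
  | zero => exact hy
  | succ k ih =>
    rw [pow_succ', Module.End.mul_apply]
    exact der_mem_weight hD hDX h1 k ih

/-- Every application of D raises the weight by one and keeps the degree m. As soon as the weight
exceeds -m nothing is left, so 1 - m applications suffice. -/
theorem locally_nilpotent (hT : ∀ n, 0 < n → T.deg n = ⊥)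
    (hX0 : ∀ b, 0 ≤ b → ∀ z ∈ X b, z = 0) {D : T →ₗ[ℂ] T}
    (hD : ∀ x y, D (x * y) = D x * y + x * D y) (hDX : ∀ b, ∀ z ∈ X b, D z = 0)
    (h1 : ∀ {m : ℤ} {y : T}, y ∈ T.deg m → D y ∈ weight X 1 m) (y : T) :
    ∃ N : ℕ, (D ^ N) y = 0 := by
  refine homogeneous_induction (P := fun y => ∃ N : ℕ, (D ^ N) y = 0) ⟨0, rfl⟩ ?_ (fun m y hy => ?_) y
  · rintro x y ⟨N, hN⟩ ⟨M, hM⟩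
    refine ⟨max N M, ?_⟩
    rw [map_add, pow_apply_eq_zero_of_le hN (le_max_left _ _), pow_apply_eq_zero_of_le hM (le_max_right _ _),
      add_zero]
  · exact ⟨(1 - m).toNat, weight_eq_zero hT hX0 _ (by omega) (pow_mem_weight hD hDX h1 hy _)⟩

end Weight

end CDGA

end

/-! ### The connection that vanishes on the generators, and its Atiyah class -/

section

variable {W : SimplicialSystem.{u}}

namespace DGPresheaf

open CDGA Gens

/-- The zero derivation. -/
def Der.zero {F F' : DGPresheaf W} (f : F ⟶ F') (n : ℤ) : Der f n where
  app _ := 0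
  app_deg _ _ _ _ := Submodule.zero_mem _
  leibniz c i a _ b := by simp
  natural _ _ := map_zero _

/-- Postcomposition of a derivation with a morphism. -/
def Der.push {F F' F'' : DGPresheaf W} {f : F ⟶ F'} {n : ℤ} (D : Der f n) (g : F' ⟶ F'')
    {k : F ⟶ F''} (h : k = f ≫ g) : Der k n where
  app c := (ap g c).toLinearMap ∘ₗ D.app c
  app_deg c _ _ ha := ap_mem g c (D.app_deg c ha)
  leibniz c i a ha b := by
    subst h
    simp only [LinearMap.comp_apply, AlgHom.toLinearMap_apply, D.leibniz c ha, map_add, map_mul,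
      map_units_smul, ap_comp]
  natural h a := by
    simp only [LinearMap.comp_apply, AlgHom.toLinearMap_apply, res_ap, D.natural]

theorem Der.app_mul {T : DGPresheaf W} (D : Der (𝟙 T) 0) (c : Cell W) (x y : T.sec c) :
    D.app c (x * y) = D.app c x * y + x * D.app c y := by
  have h := (D.grDer c).leibniz x y
  rw [sgn_zero] at h
  exact h

theorem Der.pow_natural {T : DGPresheaf W} (D : Der (𝟙 T) 0) {c' c : Cell W} (h : c' ≤ c) (n : ℕ)
    (x : T.sec c) : T.res h ((D.app c ^ n) x) = (D.app c' ^ n) (T.res h x) := by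
  induction n generalizing x with
  | zero => rfl
  | succ n ih => rw [pow_succ, pow_succ, Module.End.mul_apply, Module.End.mul_apply, ih, D.natural]

theorem Der.pow_d {T : DGPresheaf W} (D : Der (𝟙 T) 0)
    (hd : ∀ c x, D.app c ((T.sec c).d x) = (T.sec c).d (D.app c x)) (c : Cell W) (n : ℕ)
    (x : T.sec c) : (D.app c ^ n) ((T.sec c).d x) = (T.sec c).d ((D.app c ^ n) x) := by
  induction n generalizing x with
  | zero => rfl
  | succ n ih => rw [pow_succ, Module.End.mul_apply, Module.End.mul_apply, hd, ih]

theorem Der.pow_mem {T : DGPresheaf W} (D : Der (𝟙 T) 0) (c : Cell W) (n : ℕ) {m : ℤ}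
    {x : T.sec c} (hx : x ∈ (T.sec c).deg m) : (D.app c ^ n) x ∈ (T.sec c).deg m := by
  induction n with
  | zero => exact hx
  | succ n ih =>
    rw [pow_succ', Module.End.mul_apply]
    have h := D.app_deg c ih
    rwa [add_zero] at h

/-- The exponential of the negative of a locally nilpotent derivation that commutes with the
differentials. -/
theorem exists_isExpNeg {B T : DGPresheaf W} (iB : B ⟶ T) (At : Der (𝟙 T) 0)
    (hn : ∀ c x, ∃ N : ℕ, (At.app c ^ N) x = 0)
    (hd : ∀ c x, At.app c ((T.sec c).d x) = (T.sec c).d (At.app c x)) :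
    ∃ AC : B ⟶ T, IsExpNeg iB At AC := by
  choose E hE using fun c => exists_expNeg (At.app c) (At.app_mul c) (hn c)
  have E_mem : ∀ c {m : ℤ} {x : T.sec c}, x ∈ (T.sec c).deg m → E c x ∈ (T.sec c).deg m := by
    intro c m x hx
    obtain ⟨N, hN⟩ := hn c x
    rw [hE c x N hN]
    exact Submodule.sum_mem _ fun n _ => Submodule.smul_mem _ _ (At.pow_mem c n hx)
  have E_d : ∀ c x, E c ((T.sec c).d x) = (T.sec c).d (E c x) := by
    intro c x
    obtain ⟨N, hN⟩ := hn c x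
    rw [hE c x N hN, hE c _ N (by rw [At.pow_d hd, hN, map_zero]), map_sum]
    refine Finset.sum_congr rfl fun n _ => ?_
    rw [expTerm, LinearMap.smul_apply, LinearMap.smul_apply, At.pow_d hd, map_smul]
  have E_res : ∀ {c' c : Cell W} (h : c' ≤ c) x, T.res h (E c x) = E c' (T.res h x) := by
    intro c' c h x
    obtain ⟨N, hN⟩ := hn c x
    rw [hE c x N hN, hE c' _ N (by rw [← At.pow_natural, hN, map_zero]), map_sum]
    refine Finset.sum_congr rfl fun n _ => ?_
    rw [expTerm, LinearMap.smul_apply, expTerm, LinearMap.smul_apply, map_smul, At.pow_natural]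
  refine ⟨homMk (fun c => ⟨(E c).comp (ap iB c), fun ha => E_mem c (ap_mem iB c ha)⟩)
    (fun h a => ?_) fun c a => ?_, hn, fun c b N hN => ?_⟩
  · change T.res h (E _ (ap iB _ a)) = E _ (ap iB _ _)
    rw [E_res, res_ap]
  · change E c (ap iB c _) = (T.sec c).d (E c (ap iB c a))
    rw [← E_d, ap_d]
  · exact hE c _ N hN

section

variable {S B Ω T : DGPresheaf W} {φ : S ⟶ B} {ω : S ⟶ Ω} {iB : B ⟶ T} {iΩ : Ω ⟶ T}
  {D : Der ω (-1)} {E : Gens W} {e : E.Sections B}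

/-- The connection that vanishes on the generators, and its Atiyah class. -/
theorem exists_atiyah (sq : φ ≫ iB = ω ≫ iΩ)
    (hD : ∀ c s, (Ω.sec c).d (D.app c s) + D.app c ((S.sec c).d s) = 0)
    (hB : E.IsFree φ e) (hT : E.IsFree iΩ fun n => ap iB _ (e n)) :
    ∃ (nabla : Der iB (-1)) (At : Der (𝟙 T) 0),
      (∀ c s, nabla.app c (ap φ c s) = ap iΩ c (D.app c s)) ∧ (∀ n, nabla.app _ (e n) = 0) ∧
      IsAtiyah iΩ nabla At ∧ ∀ c x, At.app c ((T.sec c).d x) = (T.sec c).d (At.app c x) := by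
  obtain ⟨nabla, hφ, he⟩ := hB.exists_der iB (D.push iΩ sq) (fun _ => 0)
    fun _ => Submodule.zero_mem _
  obtain ⟨At, hΩ, hAe⟩ := hT.exists_der (𝟙 T) (Der.zero _ 0)
    (fun n => -nabla.app _ ((B.sec _).d (e n))) fun n => by
      have h := nabla.app_deg _ ((B.sec _).d_mem (hB.1 n))
      rw [add_assoc] at h
      exact Submodule.neg_mem _ h
  have hΩ' : ∀ c w, At.app c (ap iΩ c w) = 0 := hΩ
  have hsq : ∀ c s, ap iB c (ap φ c s) = ap iΩ c (ap ω c s) := fun c s =>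
    congrArg (fun f : S ⟶ T => ap f c s) sq
  have hA : ∀ c b, At.app c (ap iB c b) =
      -((T.sec c).d (nabla.app c b) + nabla.app c ((B.sec c).d b)) := by
    intro c b
    let D1 : GrDer (apG iB c) (-1 + 1) := (nabla.grDer c).bracket (B.sec c).dDer (T.sec c).dDer
      fun b => (ap_d iB c b).symm
    have h1 : ∀ b, D1.lin b = (T.sec c).d (nabla.app c b) + nabla.app c ((B.sec c).d b) :=
      (nabla.grDer c).bracket_neg_one (B.sec c).dDer (T.sec c).dDer fun b => (ap_d iB c b).symm
    let D2 : GrDer (apG iB c) (-1 + 1) := (At.grDer c).precomp (apG iB c)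
    let D0 : GrDer (apG iB c) (-1 + 1) := ⟨0, fun _ => Submodule.zero_mem _, fun _ _ => by simp⟩
    -- Both sides are derivations along `iB`. They agree on the generators by the choice of the
    -- values there, and on S because D anticommutes with the differentials.
    have h2 : D2 = D0.sub D1 := by
      refine (hB.on c).der_ext (fun s => ?_) fun n => ?_
      · change At.app c (ap iB c (ap φ c s)) = 0 - D1.lin (ap φ c s)
        rw [h1, hsq, hΩ', ← ap_d, hφ, hφ]
        change 0 = 0 - ((T.sec c).d (ap iΩ c (D.app c s)) + ap iΩ c (D.app c ((S.sec c).d s)))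
        rw [← ap_d, ← map_add, hD, map_zero, sub_zero]
      · change At.app c (ap iB c (E.resTo e c n)) = 0 - D1.lin (E.resTo e c n)
        rw [h1, resTo_eq, ← nabla.natural, he, map_zero, map_zero, zero_add, ← res_d,
          ← nabla.natural, ← res_ap, ← At.natural, hAe, map_neg, zero_sub]
    refine (congrArg (fun D : GrDer _ _ => D.lin b) h2).trans ?_
    change 0 - D1.lin b = _
    rw [h1, zero_sub]
  refine ⟨nabla, At, hφ, he, ⟨hΩ', hA⟩, fun c x => ?_⟩
  -- The commutator of the differential with the Atiyah class is a derivation, so it may be tested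
  -- on Ω, where the class vanishes, and on e, where it vanishes because both differentials have
  -- square zero.
  let D1 : GrDer (GrHom.id (T.sec c)) (0 + 1) :=
    GrDer.bracket (f := GrHom.id (T.sec c)) (At.grDer c) (T.sec c).dDer (T.sec c).dDer fun _ => rfl
  have h1 : ∀ x, D1.lin x = (T.sec c).d (At.app c x) - At.app c ((T.sec c).d x) := fun x => by
    refine (GrDer.bracket_lin _ _ _ _ x).trans ?_
    rw [zero_mul, Int.negOnePow_zero, one_smul]
    rfl
  have h2 := (hT.on c).der_eq_zero (D := D1) (fun w => by
    change D1.lin (ap iΩ c w) = 0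
    rw [h1, ← ap_d, hΩ', hΩ', map_zero, sub_zero]) (fun n => by
    rw [h1, ← ap_resTo, ← ap_d, hA, hA, (B.sec c).d_d, map_zero, add_zero, map_neg, map_add,
      (T.sec c).d_d, zero_add, sub_self]) x
  rw [h1] at h2
  exact (sub_eq_zero.1 h2).symm

/-- The differentials of homogeneous elements. -/
def diffs (D : Der ω (-1)) (iΩ : Ω ⟶ T) (c : Cell W) (b : ℤ) : Set (T.sec c) :=
  {z | ∃ s ∈ (S.sec c).deg (b + 1), z = ap iΩ c (D.app c s)}

theorem diffs_subset (c : Cell W) (b : ℤ) : diffs D iΩ c b ⊆ (T.sec c).deg b := by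
  rintro _ ⟨s, hs, rfl⟩
  have h := D.app_deg c hs
  rw [add_neg_cancel_right] at h
  exact ap_mem _ _ h

theorem diffs_eq_zero (hS : S.IsNonpos) (c : Cell W) (b : ℤ) (hb : 0 ≤ b) :
    ∀ z ∈ diffs D iΩ c b, z = 0 := by
  rintro _ ⟨s, hs, rfl⟩
  rw [hS c _ (by omega)] at hs
  rw [(Submodule.mem_bot ℂ).1 hs, map_zero, map_zero]

/-- The Atiyah class raises the weight. -/
theorem atiyah_mem_weight {nabla : Der iB (-1)} {At : Der (𝟙 T) 0} (hB : E.IsFree φ e)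
    (hT : E.IsFree iΩ fun n => ap iB _ (e n))
    (hφ : ∀ c s, nabla.app c (ap φ c s) = ap iΩ c (D.app c s))
    (he : ∀ n, nabla.app _ (e n) = 0) (hA : IsAtiyah iΩ nabla At) (c : Cell W) {m : ℤ}
    {x : T.sec c} (hx : x ∈ (T.sec c).deg m) : At.app c x ∈ weight (diffs D iΩ c) 1 m := by
  have he' : ∀ n, nabla.app c (E.resTo e c n) = 0 := fun n => by
    rw [resTo_eq, ← nabla.natural, he, map_zero]
  have h1 : ∀ {m : ℤ} {b : B.sec c}, b ∈ (B.sec c).deg m →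
      nabla.app c b ∈ weight (diffs D iΩ c) 1 (m + -1) := by
    intro m b hb
    refine (hB.on c).der_mem (nabla.grDer c) (weight (diffs D iΩ c) 1) (mul_mem_weight 1)
      (weight_mul_mem (diffs_subset c) 1) (fun {i s} hs => ?_) (fun n => ?_) hb
    -- On S the connection is the differential itself, a single factor ds with coefficient 1, hence
    -- of weight one.
    · refine Submodule.subset_span ⟨0, i + -1, zero_add _, 1, (T.sec c).one_mem,
        ap iΩ c (D.app c s), ⟨s, ?_, rfl⟩, (hφ c s).trans (one_mul _).symm⟩
      rwa [neg_add_cancel_right]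
    · rw [Der.grDer_lin, he']
      exact Submodule.zero_mem _
  have h2 := (hT.on c).der_mem (f := GrHom.id (T.sec c)) (At.grDer c) (weight (diffs D iΩ c) 1)
    (mul_mem_weight 1) (weight_mul_mem (diffs_subset c) 1) (fun {i s} hs => ?_) (fun n => ?_) hx
  · rwa [add_zero] at h2
  · rw [Der.grDer_lin]
    exact (hA.1 c s).symm ▸ Submodule.zero_mem _
  · rw [Der.grDer_lin, ← ap_resTo, hA.2, he', map_zero, zero_add]
    have h := h1 ((B.sec c).d_mem (resTo_mem hB.1 c n))
    rw [add_assoc] at h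
    exact Submodule.neg_mem _ h

end

end DGPresheaf

namespace Gens

open CDGA DGPresheaf

variable {A B C : DGPresheaf W} {G : Gens W} {φ : A ⟶ B} {e : G.Sections B}

theorem IsFree.nonpos (h : G.IsFree φ e) (hA : A.IsNonpos) (hd : ∀ n, G.deg n ≤ 0) : B.IsNonpos :=
  fun c => (h.on c).nonpos (hA c) fun n => hd n.1

/-- A unitriangular change of generators of negative degrees. -/
theorem IsFree.of_triangular (h : G.IsFree φ e) (hd : ∀ n, G.deg n ≤ 0) {e' : G.Sections B}
    (he : ∀ n, e' n ∈ (B.sec _).deg (G.deg n))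
    (hb : ∀ n, e' n - e n ∈ Algebra.adjoin ℂ (Set.range (ap φ (Cell.whole (G.face n))) ∪
      G.resTo e _ '' {i | G.deg n < G.degAt _ i})) : G.IsFree φ e' := by
  refine isFree_iff.2 ⟨he, fun c => (h.on c).of_triangular (a := 0)
    (b := fun n => G.resTo e' c n - G.resTo e c n) (fun n => (-G.degAt c n).toNat)
    (resTo_mem he c) (fun _ => Submodule.zero_mem _)
    (fun n => Submodule.sub_mem _ (resTo_mem he c n) (resTo_mem h.1 c n)) (fun n => ?_)
    fun n => ?_⟩
  · refine Eq.trans ?_ (congrArg (fun x => G.resTo e c n + x + _) (map_zero (ap φ c)).symm)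
    abel
  · rw [resTo_eq, resTo_eq, ← map_sub]
    refine map_mem_adjoin (B.res (Cell.le_whole n.2)) (hb n.1) ?_
    rintro _ (⟨a, rfl⟩ | ⟨i, hi, rfl⟩)
    · rw [res_ap]
      exact Algebra.subset_adjoin (Or.inl ⟨_, rfl⟩)
    · rw [res_resTo]
      refine Algebra.subset_adjoin (Or.inr ⟨_, ?_, rfl⟩)
      have h1 : G.deg n.1 < G.deg i.1 := hi
      have h2 := hd i.1
      change (-G.deg i.1).toNat < (-G.deg n.1).toNat
      omega

/-- A morphism of free algebras that maps generators to generators is an isomorphism. -/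
theorem IsFree.isIso (h : G.IsFree φ e) {w : B ⟶ C}
    (h' : G.IsFree (φ ≫ w) fun n => ap w _ (e n)) : IsIso w := by
  have h1 : ∀ c, (apG w c).comp (h'.gr φ e h.1 c) = GrHom.id _ := fun c =>
    (h.on c).hom_ext (fun a => by
      change (h'.gr φ e h.1 c).toAlgHom (ap w c (ap φ c a)) = ap φ c a
      rw [← ap_comp, h'.gr_base]) fun n => by
      change (h'.gr φ e h.1 c).toAlgHom (ap w c (G.resTo e c n)) = G.resTo e c n
      rw [ap_resTo, h'.gr_gen]
  have h2 : ∀ c, (h'.gr φ e h.1 c).comp (apG w c) = GrHom.id _ := fun c =>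
    (h'.on c).hom_ext (fun a => by
      change ap w c ((h'.gr φ e h.1 c).toAlgHom (ap (φ ≫ w) c a)) = ap (φ ≫ w) c a
      rw [h'.gr_base, ap_comp]) fun n => by
      change ap w c ((h'.gr φ e h.1 c).toAlgHom (G.resTo (fun n => ap w _ (e n)) c n)) =
        G.resTo (fun n => ap w _ (e n)) c n
      rw [h'.gr_gen, ap_resTo]
  exact isIso_of_inverse w (h'.gr φ e h.1)
    (fun c a => congrArg (fun f : GrHom _ _ => f.toAlgHom a) (h1 c))
    fun c a => congrArg (fun f : GrHom _ _ => f.toAlgHom a) (h2 c)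

end Gens

end

/-! ### The character modulo weight two, and the theorem -/

section

variable {W : SimplicialSystem.{u}}

namespace DGPresheaf

open CDGA Gens

variable {S B Ω T : DGPresheaf W} {ω : S ⟶ Ω} {iB : B ⟶ T} {iΩ : Ω ⟶ T}
  {D : Der ω (-1)} {G : Gens W}

/-- The Atiyah-Chern character up to terms of weight at least `2`. -/
theorem IsExpNeg.mem_weight {At : Der (𝟙 T) 0} {AC : B ⟶ T} (h : IsExpNeg iB At AC) (c : Cell W)
    {X : ℤ → Set (T.sec c)} (hX : ∀ b, X b ⊆ (T.sec c).deg b)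
    (hAt : ∀ b, ∀ z ∈ X b, At.app c z = 0)
    (h1 : ∀ {m : ℤ} {x : T.sec c}, x ∈ (T.sec c).deg m → At.app c x ∈ weight X 1 m)
    {m : ℤ} {b : B.sec c} (hb : b ∈ (B.sec c).deg m) :
    ap AC c b - ap iB c b + At.app c (ap iB c b) ∈ weight X 2 m := by
  obtain ⟨N, hN⟩ := h.1 c (ap iB c b)
  rw [h.2 c b (N + 2) (pow_apply_eq_zero_of_le hN (Nat.le_add_right _ _)),
    Finset.sum_range_succ', Finset.sum_range_succ']
  simp only [zero_add, pow_zero, pow_one, Nat.factorial_zero, Nat.factorial_one, Nat.cast_one,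
    div_one, one_smul, Module.End.one_apply, neg_smul]
  rw [add_sub_cancel_right, neg_add_cancel_right]
  exact Submodule.sum_mem _ fun n _ => Submodule.smul_mem _ _
    (weight_antitone hX m (Nat.le_add_left 2 n)
      (pow_mem_weight (At.app_mul c) hAt h1 (ap_mem iB c hb) (n + 2)))

/-- The image of an element of weight at least `2` is a polynomial in generators of larger
degree. -/
theorem map_mem_adjoin_of_weight {R P : DGPresheaf W} {r : R ⟶ P} {z : G.Sections P} (hP : G.IsFree r z)
    (hR : R.IsNonpos) (hG : ∀ n, G.deg n ≤ 0) (f : T ⟶ P) (hT : T.IsNonpos) (c : Cell W)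
    {X : ℤ → Set (T.sec c)} (hX : ∀ b, X b ⊆ (T.sec c).deg b)
    (hX0 : ∀ b, 0 ≤ b → ∀ z ∈ X b, z = 0) {m : ℤ} {y : T.sec c} (hy : y ∈ weight X 2 m) :
    ap f c y ∈ Algebra.adjoin ℂ (Set.range (ap r c) ∪ G.resTo z c '' {i | m < G.degAt c i}) := by
  have key : ∀ {k : ℤ} {x : T.sec c}, m < k → x ∈ (T.sec c).deg k → ap f c x ∈
      Algebra.adjoin ℂ (Set.range (ap r c) ∪ G.resTo z c '' {i | m < G.degAt c i}) := by
    intro k x hk hx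
    refine Algebra.adjoin_mono (Set.union_subset_union_right _ (Set.image_mono fun i hi => ?_))
      ((hP.on c).mem_adjoin (hR c) (fun n => hG n.1) (ap_mem f c hx))
    exact lt_of_lt_of_le hk hi
  refine (Submodule.span_le (p := (Subalgebra.toSubmodule (Algebra.adjoin ℂ (Set.range (ap r c) ∪
    G.resTo z c '' {i | m < G.degAt c i}))).comap (ap f c).toLinearMap)).2 ?_ hy
  rintro _ ⟨a, b, rfl, x, hx, v, hv, rfl⟩
  change ap f c (x * v) ∈ Algebra.adjoin ℂ _
  -- Only products of two factors of negative degree survive: a differential in degree at least 0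
  -- vanishes, and so does an element of weight one in degree at least 0. Each factor then has
  -- degree strictly above the total degree.
  rcases le_or_gt 0 b with hb | hb
  · rw [hX0 b hb v hv, mul_zero, map_zero]
    exact Subalgebra.zero_mem _
  rcases le_or_gt 0 a with ha | ha
  · rw [weight_eq_zero (hT c) hX0 1 (by push_cast; omega) hx, zero_mul, map_zero]
    exact Subalgebra.zero_mem _
  rw [map_mul]
  exact Subalgebra.mul_mem _ (key (by omega) (weight_le_deg hX 1 a hx)) (key (by omega) (hX b hv))

end DGPresheaf

namespace FreeAnalytic.Koszul

open DGPresheaf CDGA Gens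

variable {R S : DGPresheaf W} {HR : HolStructure R} {j : R ⟶ S} {fa : FreeAnalytic HR j} {μ : S ⟶ R}
  (kz : fa.Koszul μ)

/-- The composite of `i` and `κ` splits `ν`, and the contraction is a homotopy on sections over
every cell; no shrinking of neighbourhoods is needed. -/
theorem isQuasiIso (j_μ : j ≫ μ = 𝟙 R) : IsQuasiIso kz.ν := by
  refine ⟨fun c b hb ⟨r, hr⟩ x hx => ⟨c.U, le_rfl, hx, kz.h c b + ap kz.κ c (ap fa.i c r), ?_⟩,
    fun c r hr x hx => ⟨c.U, le_rfl, hx, ap kz.κ c (ap fa.i c r), 0, ?_, ?_⟩⟩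
  · have h := kz.homotopy c b
    rw [hb, map_zero, add_zero, hr, ap_d, ap_d] at h
    refine (res_self c _ b).trans ?_
    rw [map_add, h, sub_add_cancel]
  · rw [← ap_d, ← ap_d, hr, map_zero, map_zero]
  · refine (res_self c _ r).trans ?_
    rw [kz.ν_κ, fa.aug_i j_μ, map_zero, add_zero]

section

variable {kz} {φ : S ⟶ kz.K} {Ω T P : DGPresheaf W} {ω : S ⟶ Ω} {iB : kz.K ⟶ T} {iΩ : Ω ⟶ T}
  {D : Der ω (-1)} {nabla : Der iB (-1)} {r : R ⟶ P} {f : T ⟶ P}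

/-- The contraction has values in the ideal generated by the e. By the Leibniz rule every term of
the connection on b e b' contains either e itself, which the augmentation kills, or ∇e = 0. -/
theorem map_connection_h (hf : iB ≫ f = kz.ν ≫ r) (he : ∀ n, nabla.app _ (kz.e n) = 0) (c : Cell W)
    (y : kz.K.sec c) : ap f c (nabla.app c (kz.h c y)) = 0 := by
  have h0 : ∀ b, ap f c (ap iB c b) = ap r c (ap kz.ν c b) := fun b =>
    congrArg (fun f : kz.K ⟶ P => ap f c b) hf
  refine (Submodule.span_le (p := LinearMap.ker ((ap f c).toLinearMap ∘ₗ nabla.app c))).2 ?_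
    (kz.h_mem_span c y)
  rintro _ ⟨n, b, b', rfl⟩
  change ap f c (nabla.app c (b * fa.G.shift.resTo kz.e c n * b')) = 0
  have h1 : ap kz.ν c (fa.G.shift.resTo kz.e c n) = 0 := by
    rw [resTo_eq, ← res_ap, kz.ν_e, map_zero]
  have h2 : nabla.app c (fa.G.shift.resTo kz.e c n) = 0 := by
    rw [resTo_eq, ← nabla.natural, he, map_zero]
  have h3 := (nabla.grDer c).leibniz (b * fa.G.shift.resTo kz.e c n) b'
  have h4 := (nabla.grDer c).leibniz b (fa.G.shift.resTo kz.e c n)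
  simp only [Der.grDer_lin, h2, mul_zero, add_zero] at h4
  have h5 : ap kz.ν c (sgn _ (-1) (fa.G.shift.resTo kz.e c n)) = 0 :=
    ((apG kz.ν c).map_sgn (-1) _).trans ((congrArg _ h1).trans (map_zero _))
  refine (congrArg (ap f c) h3).trans ?_
  simp only [Der.grDer_lin, h4, map_add, map_mul, apG_toAlgHom, h0, h1, h5, map_zero, mul_zero,
    zero_mul, add_zero]

/-- For a generator of degree 0, ∂e is t minus an element of R, on which the R-linear derivation
vanishes. For negative degree, ∂e = x = φ(f) - μ(f) - h(y): the connection on φ(f) is df, on μ(f) it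
is zero by R-linearity, and on h(y) it dies after base change. -/
theorem map_connection_d_e (hφ : fa.k ≫ φ = kz.κ)
    (hf : iB ≫ f = kz.ν ≫ r) (he : ∀ n, nabla.app _ (kz.e n) = 0)
    (hn : ∀ c s, nabla.app c (ap φ c s) = ap iΩ c (D.app c s))
    (hD : ∀ c s, D.app c (ap j c s) = 0)
    (h : ∀ n : fa.gensNeg.idx, ∃ y, y ∈ (kz.K.sec _).deg (fa.gensNeg.deg n + 1) ∧
      ap φ _ (fa.fneg n) = kz.unit _ (fa.fneg n) + kz.x n + kz.h _ y) (n : fa.G.idx) :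
    ap f _ (nabla.app _ ((kz.K.sec _).d (kz.e n))) = ap f _ (ap iΩ _ (D.app _ (fa.f n))) := by
  have hκ : ∀ c q, nabla.app c (ap kz.κ c q) = ap iΩ c (D.app c (ap fa.k c q)) := fun c q => by
    rw [← hφ, ap_comp, hn]
  have hi : ∀ c s, D.app c (ap fa.k c (ap fa.i c s)) = 0 := fun c s => by
    rw [← ap_comp, fa.i_k, hD]
  rcases eq_or_lt_of_le (fa.deg_nonpos n) with h0 | h0
  · refine congrArg (ap f _) ?_
    refine (congrArg (nabla.app _) (kz.d_e_zero ⟨n, h0⟩)).trans ((hκ _ _).trans (congrArg _ ?_))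
    let g : S.sec (Cell.whole (fa.gens0.face ⟨n, h0⟩)) := fa.f n
    have h1 : ap fa.k _ (fa.tau μ ⟨n, h0⟩).1 = g - ap fa.k _ (ap fa.i _ (fa.shiftVal μ ⟨n, h0⟩).1) :=
      (map_sub (ap fa.k _) (fa.t ⟨n, h0⟩).1 _).trans
        (congrArg (fun x : S.sec (Cell.whole (fa.gens0.face ⟨n, h0⟩)) => x - _) (fa.k_t ⟨n, h0⟩))
    refine (congrArg _ h1).trans ((map_sub _ _ _).trans ?_)
    exact (congrArg _ (hi _ _)).trans (sub_zero _)
  · obtain ⟨y, -, hy⟩ := h ⟨n, h0⟩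
    have h1 : kz.x ⟨n, h0⟩ = ap φ _ (fa.fneg ⟨n, h0⟩) - kz.unit _ (fa.fneg ⟨n, h0⟩) - kz.h _ y := by
      rw [hy]
      abel
    have h2 : ∀ c s, nabla.app c (kz.unit c s) = 0 := fun c s =>
      (hκ c _).trans ((congrArg (ap iΩ c) (hi c _)).trans (map_zero _))
    have h3 : ap f _ (nabla.app _ (kz.x ⟨n, h0⟩)) = ap f _ (ap iΩ _ (D.app _ (fa.fneg ⟨n, h0⟩))) := by
      rw [h1, map_sub, map_sub, map_sub, map_connection_h hf he, sub_zero, h2, sub_zero, hn]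
    exact (congrArg (fun x => ap f _ (nabla.app _ x)) (kz.d_e_neg ⟨n, h0⟩)).trans h3

end

end FreeAnalytic.Koszul

open DGPresheaf CDGA Gens in
theorem theorem2p2 (W : SimplicialSystem.{u}) (R S : DGPresheaf W)
    (R_sheaf : R.IsSheaf) (R_nonpos : R.IsNonpos)
    (HR : HolStructure R) (R_analytic : HR.IsComplexAnalytic)
    (S_sheaf : S.IsSheaf) (j : R ⟶ S) (μ : S ⟶ R) (j_μ : j ≫ μ = 𝟙 R)
    (S_free : FreeAnalytic HR j) :
    (∃ (Ω : DGPresheaf W) (ω : S ⟶ Ω) (D : DGPresheaf.Der ω (-1)),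
      S_free.IsDifferentialAlgebra ω D) ∧
    ∀ (Ω : DGPresheaf W) (ω : S ⟶ Ω) (D : DGPresheaf.Der ω (-1)),
      S_free.IsDifferentialAlgebra ω D →
      -- a graded free DG algebra resolution `ν : B ⟶ R` of `R` over `S`
      ∃ (B : DGPresheaf W) (φ : S ⟶ B) (ν : B ⟶ R) (E : Gens W) (e : E.Sections B),
        B.IsSheaf ∧ (∀ n, E.deg n < 0) ∧ E.IsFree φ e ∧ φ ≫ ν = μ ∧ DGPresheaf.IsQuasiIso ν ∧
        -- the Atiyah-Chern character `AC : B ⟶ B ⊗_S Ω`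
        ∃ (BΩ : DGPresheaf W) (iB : B ⟶ BΩ) (iΩ : Ω ⟶ BΩ) (_ : IsPushout φ ω iB iΩ)
          (nabla : DGPresheaf.Der iB (-1)) (At : DGPresheaf.Der (𝟙 BΩ) 0) (AC : B ⟶ BΩ),
          DGPresheaf.IsConnection (φ := φ) iΩ D e nabla ∧ DGPresheaf.IsAtiyah iΩ nabla At ∧
          DGPresheaf.IsExpNeg iB At AC ∧
          -- the induced map `Φ : B ⊗_S R ⟶ R ⊗_S Ω` is an isomorphism of DG `R`-algebras
          ∃ (BR : DGPresheaf W) (p : B ⟶ BR) (q : R ⟶ BR) (_ : IsPushout φ μ p q)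
            (RΩ : DGPresheaf W) (r : R ⟶ RΩ) (s : Ω ⟶ RΩ) (_ : IsPushout μ ω r s)
            (νΩ : BΩ ⟶ RΩ) (Φ : BR ⟶ RΩ),
            iB ≫ νΩ = ν ≫ r ∧ iΩ ≫ νΩ = s ∧ p ≫ Φ = AC ≫ νΩ ∧ q ≫ Φ = r ∧ IsIso Φ := by
  refine ⟨S_free.exists_differentialAlgebra R_analytic μ R_nonpos, fun Ω ω D hD => ?_⟩
  obtain ⟨hDj, hDd, -, hΩ⟩ := hD
  obtain ⟨kz⟩ := S_free.nonempty_koszul R_analytic R_nonpos j_μ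
  have hQ : S_free.Q.IsNonpos := S_free.Q_nonpos R_nonpos
  obtain ⟨φ, hφ, hν, hx⟩ := kz.exists_structure hQ j_μ
  have hB := kz.isFree_e hφ hx
  have hdeg : ∀ n, S_free.G.shift.deg n < 0 := fun n => by
    have h : S_free.G.deg n ≤ 0 := S_free.deg_nonpos n
    change S_free.G.deg n - 1 < 0
    omega
  have hS : S.IsNonpos := S_free.free_neg.nonpos hQ fun n => n.2.le
  obtain ⟨BΩ, iΩ, iB, hBΩ, hT⟩ := hB.exists_pushout ω
  obtain ⟨nabla, At, hn, he, hAt, hd⟩ := exists_atiyah hBΩ.flip.w hDd hB hT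
  have hBΩ0 : BΩ.IsNonpos :=
    hT.nonpos (hΩ.nonpos hS fun n => (hdeg n).le) fun n => (hdeg n).le
  have hw := fun c {m : ℤ} {x : BΩ.sec c} => atiyah_mem_weight (m := m) (x := x) hB hT hn he hAt c
  have hX : ∀ c b, ∀ z ∈ diffs D iΩ c b, At.app c z = 0 := by
    rintro c b _ ⟨s, -, rfl⟩
    exact hAt.1 c _
  obtain ⟨AC, hAC⟩ := exists_isExpNeg iB At (fun c => locally_nilpotent (hBΩ0 c)
    (diffs_eq_zero hS c) (At.app_mul c) (hX c) (hw c)) hd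
  obtain ⟨BR, q, p, hBR, hBRfree⟩ := hB.exists_pushout μ
  obtain ⟨RΩ, r, s, hRΩ, hRΩfree⟩ := hΩ.exists_pushout μ
  have h1 : φ ≫ kz.ν ≫ r = ω ≫ s := by rw [← Category.assoc, hν, hRΩ.w]
  -- The Atiyah class vanishes on the image of S, since it factors through Ω, so the exponential
  -- series stops after its first term there. This S-linearity is what lets the character induce a
  -- map on B ⊗ R.
  have h2 : φ ≫ AC = φ ≫ iB := hom_ext_ap fun c a => by
    have h3 : ap iB c (ap φ c a) = ap iΩ c (ap ω c a) :=
      congrArg (fun f : S ⟶ BΩ => ap f c a) hBΩ.flip.w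
    rw [ap_comp, ap_comp, hAC.2 c _ 1 (by rw [pow_one, h3, hAt.1])]
    simp
  let νΩ : BΩ ⟶ RΩ := hBΩ.flip.desc (kz.ν ≫ r) s h1
  have hνB : iB ≫ νΩ = kz.ν ≫ r := hBΩ.flip.inl_desc _ _ _
  have hνΩ : iΩ ≫ νΩ = s := hBΩ.flip.inr_desc _ _ _
  have h3 : φ ≫ AC ≫ νΩ = μ ≫ r := by
    rw [← Category.assoc, h2, Category.assoc, hνB, ← Category.assoc, hν]
  let Φ : BR ⟶ RΩ := hBR.flip.desc (AC ≫ νΩ) r h3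
  have hp : p ≫ Φ = AC ≫ νΩ := hBR.flip.inl_desc _ _ _
  have hq : q ≫ Φ = r := hBR.flip.inr_desc _ _ _
  -- On generators, the exponential is e - At(e) modulo weight two. After base change e vanishes and
  -- -At(e) = ∇(∂e) becomes df, while terms of weight two are polynomials in generators of larger
  -- degree. So the images of the e are a unitriangular change of the generators df.
  have hΦ : IsIso Φ := by
    refine hBRfree.isIso ?_
    rw [hq]
    refine hRΩfree.of_triangular (fun n => (hdeg n).le) (fun n => ap_mem _ _ (hBRfree.1 n))
      fun n => ?_
    have h4 := map_mem_adjoin_of_weight hRΩfree R_nonpos (fun n => (hdeg n).le) νΩ hBΩ0 _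
      (diffs_subset _) (diffs_eq_zero hS _) (hAC.mem_weight _ (diffs_subset _) (hX _) (hw _) (hB.1 n))
    have h5 : ap νΩ _ (ap iB _ (kz.e n)) = 0 := by
      rw [← ap_comp, hνB, ap_comp, kz.ν_e, map_zero]
    have h6 : ap νΩ _ (At.app _ (ap iB _ (kz.e n))) = -ap s _ (D.app _ (S_free.f n)) := by
      rw [hAt.2, he, map_zero, zero_add, map_neg,
        FreeAnalytic.Koszul.map_connection_d_e hφ hνB he hn hDj hx n, ← ap_comp, hνΩ]
      rfl
    have h7 : ap Φ _ (ap p _ (kz.e n)) = ap νΩ _ (ap AC _ (kz.e n)) := by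
      rw [← ap_comp, hp, ap_comp]
    rw [map_add, map_sub, h5, sub_zero, h6, ← h7] at h4
    rw [sub_eq_add_neg]
    exact h4
  refine ⟨kz.K, φ, kz.ν, S_free.G.shift, kz.e, kz.isSheaf, hdeg, hB, hν, kz.isQuasiIso j_μ,
    BΩ, iB, iΩ, hBΩ.flip, nabla, At, AC, ⟨hn, fun n => ?_⟩, hAt, hAC,
    BR, p, q, hBR.flip, RΩ, r, s, hRΩ, νΩ, Φ, hνB, hνΩ, hp, hq, hΦ⟩
  rw [he]
  exact Submodule.zero_mem _

end

end
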